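/- **Setting.** Let $\mathcal V$ be a complete and cocomplete closed symmetric monoidal model category with unit $\mathsf I$: the tensor product satisfies the pushout-product axiom, and for every cofibrant $K$ and every weak equivalence $Q\to\mathsf I$ with $Q$ cofibrant, $Q\otimes K\to K$ is a weak equivalence. Let $\mathcal M$ be a complete and cocomplete model $\mathcal V$-category, i.e. a $\mathcal V$-category with all tensors $K\otimes X$ and all cotensors whose underlying category is a model category, such that $\otimes\colon\mathcal V\times\mathcal M\to\mathcal M$ satisfies the pushout-product axiom and $Q\otimes X\to X$ is a weak equivalence for every cofibrant $X$ and every $Q\to \mathsf I$ as above. An object $K\in\mathcal V$ is *$\mathcal M$-flat* if $K\otimes-\colon\mathcal M\to\mathcal M$ preserves cofibrations and trivial cofibrations; a map $K\to L$ in $\mathcal V$ is *$\mathcal M$-flat* if for every (trivial) cofibration $X\to Y$ in $\mathcal M$ the map $(L\otimes X)\sqcup_{K\otimes X}(K\otimes Y)\to L\otimes Y$ is a (trivial) cofibration. Let $\mathcal C$ be a small $\mathcal V$-category. It is *locally $\mathcal M$-flat* if all $\mathcal C(c,c')$ are $\mathcal M$-flat objects, and *locally${}_*$ $\mathcal M$-flat*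 if moreover all $\mathrm{id}_c\colon\mathsf I\to\mathcal C(c,c)$ are $\mathcal M$-flat maps (and similarly with $\mathcal V$ in place of $\mathcal M$). A weight, i.e. a $\mathcal V$-functor $W\colon\mathcal C^{op}\to\mathcal V$, is *projectively cofibrant* if it has the left lifting property with respect to all $\mathcal V$-natural transformations that are pointwise trivial fibrations. The weighted colimit of $D\colon\mathcal C\to\mathcal M$ is the object $W\star_{\mathcal C}D$ of $\mathcal M$ with $\mathcal M(W\star_{\mathcal C}D,X)\cong[\mathcal C^{op},\mathcal V](W,\mathcal M(D-,X))$, $\mathcal V$-naturally in $X$. For objects $c_0,\dots,c_n$ of $\mathcal C$ write $$B(c_0,\dots,c_n)=Wc_n\otimes\mathcal C(c_{n-1},c_n)\otimes\cdots\otimes\mathcal C(c_0,c_1)\otimes Dc_0 .$$ Let $\mathcal F$ be the category whose objects are the pairs $([n],(c_0,\dots,c_n))$ with $n\ge0$ and $c_i$ objects of $\mathcal C$, and whose morphisms $([n],(c_0,\dots,c_n))\to([m],(c'_0,\dots,c'_m))$ are the monotone maps $f\colon[m]\to[n]$ with $c_{f(i)}=c'_i$ for all $i$. Composition in $\mathcal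 C$, the identities of $\mathcal C$ and the actions of $\mathcal C$ on $W$ and $D$ make $B$ a functor $\mathcal F\to\mathcal M$, and make $B_n=\coprod_{c_0,\dots,c_n}B(c_0,\dots,c_n)$ a simplicial object of $\mathcal M$. A *cosimplicial resolution* $\mathbb I$ of $\mathsf I$ is a Reedy cofibrant cosimplicial object of $\mathcal V$ with a levelwise weak equivalence to the constant cosimplicial object $\mathsf I$; the corresponding *geometric realization* of a simplicial object $X$ of $\mathcal M$ is $|X|=\int^{[n]\in\Delta}\mathbb I^n\otimes X_n$. For a small category $\mathcal I$ and a pointwise cofibrant diagram $T\colon\mathcal I\to\mathcal M$, the *homotopy colimit* is $\operatorname{hocolim}_{\mathcal I}T=\int^{([n],i)\in\Delta\times\mathcal I}N(i\downarrow\mathcal I)_n\cdot(\widetilde Ti)^n$, where $N(i\downarrow\mathcal I)_n$ is the set of chains $i\to i_0\to\cdots\to i_n$ in $\mathcal I$, $S\cdot X$ denotes a coproduct of copies of $X$ indexed by $S$, and $\widetilde T$ is a diagram of Reedy cofibrant cosimplicial objects with a natural levelwise weak equivalence to the diagram of constant cosimplicial objects $i\mapsto Ti$. Two objects are *weakly equivalent*,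 $\simeq$, if they are connected by a zigzag of weak equivalences. **Theorem.** Let $\mathcal C$ be locally${}_*$ $\mathcal M$-flat, let $W\colon\mathcal C^{op}\to\mathcal V$ be a projectively cofibrant weight and let $D\colon\mathcal C\to\mathcal M$ be a $\mathcal V$-functor with all $Dc$ cofibrant. Then $$W\star_{\mathcal C}D\;\simeq\;\Bigl|\,n\mapsto\coprod_{c_0,\dots,c_n}Wc_n\otimes\mathcal C(c_{n-1},c_n)\otimes\cdots\otimes\mathcal C(c_0,c_1)\otimes Dc_0\Bigr|$$ for every cosimplicial resolution $\mathbb I$ of $\mathsf I$ used to form the realization, and $$W\star_{\mathcal C}D\;\simeq\;\operatorname{hocolim}_{([n],(c_0,\dots,c_n))\in\mathcal F}\;Wc_n\otimes\mathcal C(c_{n-1},c_n)\otimes\cdots\otimes\mathcal C(c_0,c_1)\otimes Dc_0$$ for every choice of $\widetilde B$ used to form the homotopy colimit. Moreover all objects $\mathcal C(c_{n-1},c_n)\otimes\cdots\otimes\mathcal C(c_0,c_1)\otimes Dc_0$ and $Wc_n\otimes\mathcal C(c_{n-1},c_n)\otimes\cdots\otimes\mathcal C(c_0,c_1)\otimes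 Dc_0$ of $\mathcal M$ are cofibrant, and if $\mathcal C$ is also locally $\mathcal V$-flat, then all $Wc$ are cofibrant in $\mathcal V$, so that the objects of the diagram $B$ are homotopy tensors, i.e. tensors of a cofibrant object of $\mathcal V$ with a cofibrant object of $\mathcal M$. -/

import Mathlib

open CategoryTheory MonoidalCategory Limits HomotopicalAlgebra Opposite
open scoped MonoidalClosed

set_option linter.unusedSectionVars false

universe v u u₁ u₂

noncomputable section

namespace HWC

open MonoidalLeftAction

section EnrichedComposition

variable (V : Type u₁) [Category.{v} V] [MonoidalCategory V] [SymmetricCategory V]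

/-- Enriched composition in the classical order `E(Y, Z) ⊗ E(X, Y) ⟶ E(X, Z)`. -/
def eCompRev {E : Type u} [EnrichedCategory V E] (X Y Z : E) :
    ((Y ⟶[V] Z) ⊗ (X ⟶[V] Y)) ⟶ (X ⟶[V] Z) :=
  (β_ _ _).hom ≫ eComp V X Y Z

variable {E : Type u} [EnrichedCategory V E]

lemma eCompRev_id (X Y : E) :
    (ρ_ (X ⟶[V] Y)).inv ≫ _ ◁ eId V X ≫ eCompRev V X X Y = 𝟙 _ :=
  e_comp_id V (op Y) (op X)

lemma id_eCompRev (X Y : E) :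
    (λ_ (X ⟶[V] Y)).inv ≫ eId V Y ▷ _ ≫ eCompRev V X Y Y = 𝟙 _ :=
  e_id_comp V (op Y) (op X)

lemma eCompRev_assoc (X Y Z T : E) :
    eCompRev V Y Z T ▷ _ ≫ eCompRev V X Y T =
      (α_ _ _ _).hom ≫ _ ◁ eCompRev V X Y Z ≫ eCompRev V X Z T :=
  (e_assoc' V (op T) (op Z) (op Y) (op X)).symm

end EnrichedComposition

section Tensors

variable (V : Type u₁) [Category.{v} V] [MonoidalCategory V] [SymmetricCategory V]

/-- A choice of all tensors `K ⊗ X`. -/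
class Tensored (M : Type u₂) [Category.{v} M] [EnrichedOrdinaryCategory V M] where
  /-- the tensor `K ⊗ X` -/
  tensor : V → M → M
  /-- the universal morphism `K ⟶ M(X, K ⊗ X)` -/
  coev (K : V) (X : M) : K ⟶ (X ⟶[V] tensor K X)
  bijective (K : V) (X Y : M) (A : V) : Function.Bijective
    (fun g : A ⟶ (tensor K X ⟶[V] Y) ↦ (coev K X ⊗ₘ g) ≫ eComp V X (tensor K X) Y)

variable {M : Type u₂} [Category.{v} M] [EnrichedOrdinaryCategory V M]

section

variable {V}

lemma eCompRev_whiskerLeft (X Y : M) {Z Z' : M} (g : Z ⟶ Z') :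
    eCompRev V X Y Z ≫ eHomWhiskerLeft V X g =
      eHomWhiskerLeft V Y g ▷ _ ≫ eCompRev V X Y Z' := by
  simp [eCompRev, eComp_eHomWhiskerLeft]

lemma eCompRev_whiskerRight {X X' : M} (g : X ⟶ X') (Y Z : M) :
    eCompRev V X' Y Z ≫ eHomWhiskerRight V g Z =
      _ ◁ eHomWhiskerRight V g Y ≫ eCompRev V X Y Z := by
  simp [eCompRev, eComp_eHomWhiskerRight]

lemma eCompRev_exchange (X : M) {Y Y' : M} (g : Y ⟶ Y') (Z : M) :
    _ ◁ eHomWhiskerLeft V X g ≫ eCompRev V X Y' Z =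
      eHomWhiskerRight V g Z ▷ _ ≫ eCompRev V X Y Z := by
  simp only [eCompRev, BraidedCategory.braiding_naturality_right_assoc,
    BraidedCategory.braiding_naturality_left_assoc]
  congr 1
  simp only [eHomWhiskerLeft, eHomWhiskerRight, comp_whiskerRight,
    MonoidalCategory.whiskerLeft_comp, Category.assoc]
  rw [← e_assoc']
  simp

lemma tensorHom_comp_right {K L A B D : V} (φ : K ⟶ A) (ψ : L ⟶ B) (χ : B ⟶ D) :
    (φ ⊗ₘ (ψ ≫ χ)) = (φ ⊗ₘ ψ) ≫ A ◁ χ := by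
  simp [MonoidalCategory.tensorHom_def]

lemma tensorHom_comp_left {K L A B D : V} (φ : K ⟶ A) (ψ : L ⟶ B) (χ : A ⟶ D) :
    ((φ ≫ χ) ⊗ₘ ψ) = (φ ⊗ₘ ψ) ≫ χ ▷ B := by
  simp [MonoidalCategory.tensorHom_def']

lemma eCompRev_left_comp {K L : V} {X Y Z Z' : M} (φ : K ⟶ (Y ⟶[V] Z)) (g : Z ⟶ Z')
    (ψ : L ⟶ (X ⟶[V] Y)) :
    (φ ≫ eHomWhiskerLeft V Y g ⊗ₘ ψ) ≫ eCompRev V X Y Z' =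
      ((φ ⊗ₘ ψ) ≫ eCompRev V X Y Z) ≫ eHomWhiskerLeft V X g := by
  rw [Category.assoc, eCompRev_whiskerLeft]
  simp [MonoidalCategory.tensorHom_def, ← whisker_exchange_assoc]

lemma eCompRev_middle {K L : V} {X Y Y' Z : M} (φ : K ⟶ (Y' ⟶[V] Z)) (g : Y ⟶ Y')
    (ψ : L ⟶ (X ⟶[V] Y)) :
    (φ ≫ eHomWhiskerRight V g Z ⊗ₘ ψ) ≫ eCompRev V X Y Z =
      (φ ⊗ₘ (ψ ≫ eHomWhiskerLeft V X g)) ≫ eCompRev V X Y' Z := by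
  simp only [MonoidalCategory.tensorHom_def, comp_whiskerRight, MonoidalCategory.whiskerLeft_comp,
    Category.assoc, eCompRev_exchange]
  rw [whisker_exchange_assoc]

lemma eCompRev_right_comp {K L : V} {X X' Y Z : M} (φ : K ⟶ (Y ⟶[V] Z)) (g : X ⟶ X')
    (ψ : L ⟶ (X' ⟶[V] Y)) :
    (φ ⊗ₘ (ψ ≫ eHomWhiskerRight V g Y)) ≫ eCompRev V X Y Z =
      ((φ ⊗ₘ ψ) ≫ eCompRev V X' Y Z) ≫ eHomWhiskerRight V g Z := by
  rw [Category.assoc, eCompRev_whiskerRight]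
  simp [MonoidalCategory.tensorHom_def]

lemma eHomEquiv_comp_whiskerLeft {X Y Z : M} (f : X ⟶ Y) (g : Y ⟶ Z) :
    eHomEquiv V (f ≫ g) = eHomEquiv V f ≫ eHomWhiskerLeft V X g := by
  rw [eHomEquiv_comp, eHomWhiskerLeft, rightUnitor_inv_naturality_assoc, tensorHom_def_assoc,
    unitors_inv_equal]

lemma eHomEquiv_comp_whiskerRight {X Y Z : M} (f : X ⟶ Y) (g : Y ⟶ Z) :
    eHomEquiv V (f ≫ g) = eHomEquiv V g ≫ eHomWhiskerRight V f Z := by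
  rw [eHomEquiv_comp, eHomWhiskerRight, leftUnitor_inv_naturality_assoc, tensorHom_def'_assoc]

lemma whiskerRight_eHomEquiv_eCompRev {X Y Z : M} (f : X ⟶ Y) :
    _ ◁ eHomEquiv V f ≫ eCompRev V X Y Z = (ρ_ _).hom ≫ eHomWhiskerRight V f Z := by
  simp [eCompRev, eHomWhiskerRight]

lemma eHomEquiv_whiskerRight_eCompRev {X Y Z : M} (g : Y ⟶ Z) :
    eHomEquiv V g ▷ _ ≫ eCompRev V X Y Z = (λ_ _).hom ≫ eHomWhiskerLeft V X g := by
  simp [eCompRev, eHomWhiskerLeft]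

end

namespace Tensored

variable [Tensored V M]

variable {V}

lemma bijective_rev (K : V) (X Y : M) (A : V) : Function.Bijective
    (fun g : A ⟶ (tensor K X ⟶[V] Y) ↦ (g ⊗ₘ coev K X) ≫ eCompRev V X (tensor K X) Y) := by
  have h : (fun g : A ⟶ (tensor K X ⟶[V] Y) ↦ (g ⊗ₘ coev K X) ≫ eCompRev V X (tensor K X) Y) =
      (fun φ : K ⊗ A ⟶ (X ⟶[V] Y) ↦ (β_ A K).hom ≫ φ) ∘
      (fun g : A ⟶ (tensor K X ⟶[V] Y) ↦ (coev K X ⊗ₘ g) ≫ eComp V X (tensor K X) Y) := by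
    funext g
    simp [eCompRev]
  rw [h]
  refine Function.Bijective.comp ⟨fun a b hab ↦ ?_, fun b ↦ ⟨(β_ A K).inv ≫ b, by simp⟩⟩
    (bijective K X Y A)
  simpa using hab

/-- The morphism `K ⟶ M(X, Y)` corresponding to a morphism `K ⊗ X ⟶ Y`. -/
def hat {K : V} {X Y : M} (f : tensor K X ⟶ Y) : K ⟶ (X ⟶[V] Y) :=
  coev K X ≫ eHomWhiskerLeft V X f

lemma hat_bijective (K : V) (X Y : M) :
    Function.Bijective (hat : (tensor K X ⟶ Y) → (K ⟶ (X ⟶[V] Y))) := by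
  have h : (hat : (tensor K X ⟶ Y) → (K ⟶ (X ⟶[V] Y))) =
      (fun φ : K ⊗ 𝟙_ V ⟶ (X ⟶[V] Y) ↦ (ρ_ K).inv ≫ φ) ∘
      (fun g : 𝟙_ V ⟶ (tensor K X ⟶[V] Y) ↦ (coev K X ⊗ₘ g) ≫ eComp V X (tensor K X) Y) ∘
      (eHomEquiv V) := by
    funext g
    simp only [hat, eHomWhiskerLeft, Function.comp, MonoidalCategory.tensorHom_def, Category.assoc,
      rightUnitor_inv_naturality_assoc]
  rw [h]
  refine Function.Bijective.comp ⟨fun a b hab ↦ ?_, fun b ↦ ⟨(ρ_ K).hom ≫ b, by simp⟩⟩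
    (Function.Bijective.comp (bijective K X Y _) (Equiv.bijective _))
  simpa using hab

/-- The morphism `K ⊗ X ⟶ Y` corresponding to a morphism `K ⟶ M(X, Y)`. -/
def unhat {K : V} {X Y : M} (φ : K ⟶ (X ⟶[V] Y)) : tensor K X ⟶ Y :=
  (Equiv.ofBijective _ (hat_bijective K X Y)).symm φ

@[simp]
lemma hat_unhat {K : V} {X Y : M} (φ : K ⟶ (X ⟶[V] Y)) : hat (unhat φ) = φ :=
  (Equiv.ofBijective _ (hat_bijective K X Y)).apply_symm_apply φ

lemma hat_injective {K : V} {X Y : M} {f g : tensor K X ⟶ Y} (h : hat f = hat g) : f = g :=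
  (hat_bijective K X Y).1 h

@[simp]
lemma hat_id (K : V) (X : M) : hat (𝟙 (tensor K X)) = coev K X := by simp [hat]

lemma hat_comp {K : V} {X Y Z : M} (f : tensor K X ⟶ Y) (g : Y ⟶ Z) :
    hat (f ≫ g) = hat f ≫ eHomWhiskerLeft V X g := by simp [hat]

/-- Functoriality of `K ⊗ X` in `K`. -/
def mapLeft {K L : V} (u : K ⟶ L) (X : M) : tensor K X ⟶ tensor L X := unhat (u ≫ coev L X)

/-- Functoriality of `K ⊗ X` in `X`. -/
def mapRight (K : V) {X Y : M} (f : X ⟶ Y) : tensor K X ⟶ tensor K Y :=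
  unhat (coev K Y ≫ eHomWhiskerRight V f _)

/-- The morphism `(K ⊗ L) ⊗ X ⟶ K ⊗ (L ⊗ X)`. -/
def assocHom (K L : V) (X : M) : tensor (K ⊗ L) X ⟶ tensor K (tensor L X) :=
  unhat ((coev K (tensor L X) ⊗ₘ coev L X) ≫ eCompRev V _ _ _)

/-- The morphism `K ⊗ (L ⊗ X) ⟶ (K ⊗ L) ⊗ X`. -/
def assocInv (K L : V) (X : M) : tensor K (tensor L X) ⟶ tensor (K ⊗ L) X :=
  unhat ((Equiv.ofBijective _ (bijective_rev L X (tensor (K ⊗ L) X) K)).symm (coev (K ⊗ L) X))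

lemma hat_mapLeft {K L : V} (u : K ⟶ L) {X Y : M} (f : tensor L X ⟶ Y) :
    hat (mapLeft u X ≫ f) = u ≫ hat f := by
  rw [hat_comp, mapLeft, hat_unhat, Category.assoc, hat]

lemma hat_mapRight (K : V) {X X' Y : M} (v : X ⟶ X') (f : tensor K X' ⟶ Y) :
    hat (mapRight K v ≫ f) = hat f ≫ eHomWhiskerRight V v Y := by
  rw [hat_comp, mapRight, hat_unhat, Category.assoc, hat, Category.assoc, eHom_whisker_exchange]

lemma hat_mapLeft' {K L : V} (u : K ⟶ L) (X : M) : hat (mapLeft u X) = u ≫ coev L X :=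
  hat_unhat _

lemma hat_mapRight' (K : V) {X X' : M} (v : X ⟶ X') :
    hat (mapRight K v) = coev K X' ≫ eHomWhiskerRight V v _ :=
  hat_unhat _

lemma hat_assocHom' (K L : V) (X : M) :
    hat (assocHom K L X) = (coev K (tensor L X) ⊗ₘ coev L X) ≫ eCompRev V _ _ _ :=
  hat_unhat _

lemma hat_assocHom (K L : V) {X Y : M} (f : tensor K (tensor L X) ⟶ Y) :
    hat (assocHom K L X ≫ f) = (hat f ⊗ₘ coev L X) ≫ eCompRev V _ _ _ := by
  rw [hat_comp, assocHom, hat_unhat, hat, eCompRev_left_comp]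

lemma hat_assocInv (K L : V) (X : M) :
    (hat (assocInv K L X) ⊗ₘ coev L X) ≫ eCompRev V _ _ _ = coev (K ⊗ L) X := by
  rw [assocInv, hat_unhat]
  exact (Equiv.ofBijective _ (bijective_rev L X (tensor (K ⊗ L) X) K)).apply_symm_apply _

/-- The associativity isomorphism of tensors. -/
def assocIso (K L : V) (X : M) : tensor (K ⊗ L) X ≅ tensor K (tensor L X) where
  hom := assocHom K L X
  inv := assocInv K L X
  hom_inv_id := hat_injective (by rw [hat_assocHom, hat_assocInv, hat_id])
  inv_hom_id := by
    apply hat_injective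
    apply (bijective_rev L X _ K).1
    dsimp only
    rw [hat_comp, hat_id, eCompRev_left_comp, hat_assocInv]
    exact hat_unhat _

/-- The unit isomorphism of tensors. -/
def unitIso (X : M) : tensor (𝟙_ V) X ≅ X where
  hom := unhat (eId V X)
  inv := (eHomEquiv V).symm (coev (𝟙_ V) X)
  hom_inv_id := hat_injective (by
    rw [hat_comp, hat_unhat, hat_id, ← eHomEquiv_id, ← eHomEquiv_comp_whiskerLeft]
    simp)
  inv_hom_id := by
    apply (eHomEquiv V).injective
    rw [eHomEquiv_comp_whiskerLeft, Equiv.apply_symm_apply, eHomEquiv_id]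
    exact hat_unhat _

/-- Tensors form an action of `V` on `M`. -/
instance (priority := low) monoidalLeftAction : MonoidalLeftAction V M where
  actionObj := tensor
  actionHomLeft u X := mapLeft u X
  actionHomRight K _ _ f := mapRight K f
  actionAssocIso := assocIso
  actionUnitIso := unitIso
  actionHom_def _ _ := rfl
  actionHomRight_id K X := hat_injective (by simp [mapRight])
  id_actionHomLeft K X := hat_injective (by simp [mapLeft])
  actionHom_comp f₁ f₂ g₁ g₂ := hat_injective (by
    simp only [Category.assoc, hat_mapLeft, hat_mapRight, hat_mapRight', eHomWhiskerRight_comp])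
  actionAssocIso_hom_naturality f g h := hat_injective (by
    simp only [assocIso, Category.assoc, hat_mapLeft, hat_mapRight, hat_mapRight', hat_assocHom,
      hat_assocHom']
    rw [← Category.assoc f, eCompRev_middle, ← hat, hat_mapLeft, hat_mapRight',
      ← Category.assoc g, eCompRev_right_comp, ← tensorHom_comp_tensorHom]
    simp only [Category.assoc])
  actionUnitIso_hom_naturality f := hat_injective (by
    rw [hat_comp, hat_mapRight]
    simp only [unitIso, hat_unhat]
    rw [← eHomEquiv_id, ← eHomEquiv_id, ← eHomEquiv_comp_whiskerLeft,
      ← eHomEquiv_comp_whiskerRight, Category.comp_id, Category.id_comp])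
  whiskerLeft_actionHomLeft K L L' f X := by
    rw [← Category.assoc, Iso.eq_comp_inv]
    apply hat_injective
    simp only [assocIso, hat_mapLeft, hat_mapRight', hat_assocHom, hat_assocHom']
    rw [eCompRev_middle, ← hat, hat_mapLeft', ← Category.assoc, ← id_tensorHom,
      tensorHom_comp_tensorHom, Category.id_comp]
  whiskerRight_actionHomLeft {K K'} L f X := by
    rw [← Category.assoc, Iso.eq_comp_inv]
    apply hat_injective
    simp only [assocIso, hat_mapLeft, hat_mapLeft', hat_assocHom, hat_assocHom']
    rw [← Category.assoc, ← tensorHom_id, tensorHom_comp_tensorHom, Category.id_comp]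
  associator_actionHom K₁ K₂ K₃ X := hat_injective (by
    simp only [assocIso, hat_mapLeft, hat_mapRight', hat_assocHom, hat_assocHom']
    rw [eCompRev_middle, ← hat, hat_assocHom', tensorHom_comp_right, Category.assoc,
      tensorHom_comp_left, Category.assoc, eCompRev_assoc, associator_naturality_assoc])
  leftUnitor_actionHom K X := hat_injective (by
    simp only [assocIso, unitIso, hat_mapLeft', hat_assocHom, hat_unhat]
    rw [MonoidalCategory.tensorHom_def', Category.assoc, Eq.comm, ← Iso.inv_comp_eq,
      ← leftUnitor_inv_naturality_assoc, id_eCompRev, Category.comp_id])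
  rightUnitor_actionHom K X := hat_injective (by
    simp only [assocIso, unitIso, hat_mapLeft', hat_mapRight', hat_assocHom]
    rw [eCompRev_middle, ← hat, hat_unhat, MonoidalCategory.tensorHom_def, Category.assoc,
      Eq.comm, ← Iso.inv_comp_eq, ← rightUnitor_inv_naturality_assoc, eCompRev_id, Category.comp_id])

end Tensored

end Tensors
section ActionLemmas

variable {V : Type u₁} [Category.{v} V] [MonoidalCategory V]
  {M : Type u₂} [Category.{v} M] [MonoidalLeftAction V M]

lemma leftUnitor_inv_act (K : V) (X : M) :
    (λ_ K).inv ⊵ₗ X = (λₗ[V] (K ⊙ₗ X)).inv ≫ (αₗ _ _ _).inv := by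
  rw [Iso.eq_comp_inv, ← cancel_mono (λₗ[V] (K ⊙ₗ X)).hom, Category.assoc,
    ← leftUnitor_actionHom, inv_hom_actionHomLeft, Iso.inv_hom_id]

lemma rightUnitor_inv_act (K : V) (X : M) :
    (ρ_ K).inv ⊵ₗ X = K ⊴ₗ (λₗ[V] X).inv ≫ (αₗ _ _ _).inv := by
  rw [Iso.eq_comp_inv, ← cancel_mono (K ⊴ₗ (λₗ[V] X).hom), Category.assoc,
    ← rightUnitor_actionHom, inv_hom_actionHomLeft, actionHomRight_inv_hom]

lemma act_right_unit {I' K L : V} {X : M} (u : 𝟙_ V ⟶ I') (m : K ⊗ I' ⟶ L) (n : K ⟶ L)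
    (h : (ρ_ K).inv ≫ K ◁ u ≫ m = n) :
    K ⊴ₗ ((λₗ[V] X).inv ≫ u ⊵ₗ X) ≫ (αₗ _ _ _).inv ≫ m ⊵ₗ X = n ⊵ₗ X := by
  rw [← h]
  simp only [actionHomRight_comp, comp_actionHomLeft, whiskerLeft_actionHomLeft,
    Category.assoc, rightUnitor_inv_act, Iso.inv_hom_id_assoc]

lemma act_left_unit {I' K L : V} {X Y : M} (u : 𝟙_ V ⟶ I') (m : I' ⊗ K ⟶ L) (n : K ⟶ L)
    (h : (λ_ K).inv ≫ u ▷ K ≫ m = n) (φ : X ⟶ K ⊙ₗ Y) :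
    ((λₗ[V] X).inv ≫ u ⊵ₗ X) ≫ I' ⊴ₗ φ ≫ (αₗ _ _ _).inv ≫ m ⊵ₗ Y = φ ≫ n ⊵ₗ Y := by
  rw [← h, Category.assoc, ← action_exchange_assoc, actionUnitIso_inv_naturality_assoc]
  simp [leftUnitor_inv_act]

lemma act_assoc {A B C AB BC ABC : V} {X Y Z : M} (ab : A ⊗ B ⟶ AB) (bc : B ⊗ C ⟶ BC)
    (ab_c : AB ⊗ C ⟶ ABC) (a_bc : A ⊗ BC ⟶ ABC)
    (h : ab ▷ C ≫ ab_c = (α_ _ _ _).hom ≫ A ◁ bc ≫ a_bc) (φ : X ⟶ B ⊙ₗ Y) (ψ : Y ⟶ C ⊙ₗ Z) :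
    (A ⊴ₗ φ ≫ (αₗ _ _ _).inv ≫ ab ⊵ₗ Y) ≫ AB ⊴ₗ ψ ≫ (αₗ _ _ _).inv ≫ ab_c ⊵ₗ Z =
      A ⊴ₗ (φ ≫ B ⊴ₗ ψ ≫ (αₗ _ _ _).inv ≫ bc ⊵ₗ Z) ≫ (αₗ _ _ _).inv ≫ a_bc ⊵ₗ Z := by
  have h' := congrArg (fun t ↦ t ⊵ₗ Z) h
  simp only [comp_actionHomLeft, whiskerLeft_actionHomLeft, Category.assoc] at h'
  simp only [Category.assoc, ← action_exchange_assoc, actionHomRight_comp, actionHomLeft_action,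
    tensor_actionHomRight, Iso.hom_inv_id_assoc, Iso.inv_hom_id_assoc, h']
  have h'' : (αₗ A B (C ⊙ₗ Z)).inv ≫ (αₗ (A ⊗ B) C Z).inv ≫ (α_ A B C).hom ⊵ₗ Z ≫
      (αₗ A (B ⊗ C) Z).hom = A ⊴ₗ (αₗ B C Z).inv := by
    rw [← cancel_mono (A ⊴ₗ (αₗ B C Z).hom)]
    simp only [Category.assoc, associator_actionHom, actionHomRight_inv_hom,
      Iso.inv_hom_id_assoc, Iso.inv_hom_id]
  rw [← h'']
  simp only [Category.assoc]

lemma act_natural {A B N : V} {X Y Z : M} (φ : X ⟶ B ⊙ₗ Y) (m : A ⊗ B ⟶ N) (χ : Y ⟶ Z) :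
    (A ⊴ₗ φ ≫ (αₗ _ _ _).inv ≫ m ⊵ₗ Y) ≫ N ⊴ₗ χ =
      A ⊴ₗ (φ ≫ B ⊴ₗ χ) ≫ (αₗ _ _ _).inv ≫ m ⊵ₗ Z := by
  simp only [Category.assoc, ← action_exchange, tensor_actionHomRight_assoc, actionHomRight_comp,
    Iso.inv_hom_id_assoc]

lemma act_unit_natural {X Y : M} {B : V} (u : 𝟙_ V ⟶ B) (χ : X ⟶ Y) :
    ((λₗ[V] X).inv ≫ u ⊵ₗ X) ≫ B ⊴ₗ χ = χ ≫ (λₗ[V] Y).inv ≫ u ⊵ₗ Y := by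
  rw [Category.assoc, ← action_exchange, actionUnitIso_inv_naturality_assoc]

end ActionLemmas

section Chains

variable {V : Type u₁} [Category.{v} V] [MonoidalCategory V] [SymmetricCategory V]
  {C : Type u} [EnrichedCategory V C]

section Weight

variable [MonoidalClosed V]

/-- The action `W c' ⊗ C(c, c') ⟶ W c` of `C` on a weight `W : Cᵒᵖ ⟶ V`. -/
def weightAct (W : EnrichedFunctor V Cᵒᵖ V) (c c' : C) :
    W.obj (op c') ⊗ (c ⟶[V] c') ⟶ W.obj (op c) :=
  MonoidalClosed.uncurry (W.map (op c') (op c))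

lemma weightAct_id (W : EnrichedFunctor V Cᵒᵖ V) (c : C) :
    W.obj (op c) ◁ eId V c ≫ weightAct W c c = (ρ_ _).hom := by
  have h : eId V c ≫ W.map (op c) (op c) = MonoidalClosed.curry (ρ_ (W.obj (op c))).hom :=
    W.map_id (op c)
  rw [weightAct, ← MonoidalClosed.uncurry_natural_left]
  exact (congrArg MonoidalClosed.uncurry h).trans (MonoidalClosed.uncurry_curry _)

lemma uncurry_tensorHom_comp {A B X K L : V} (f : K ⟶ (ihom A).obj B) (g : L ⟶ (ihom B).obj X) :
    MonoidalClosed.uncurry ((f ⊗ₘ g) ≫ MonoidalClosed.comp A B X) =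
      (α_ _ _ _).inv ≫ MonoidalClosed.uncurry f ▷ L ≫ MonoidalClosed.uncurry g := by
  rw [MonoidalClosed.uncurry_natural_left, MonoidalClosed.comp_eq, MonoidalClosed.uncurry_curry,
    MonoidalClosed.compTranspose_eq]
  simp only [MonoidalClosed.uncurry_eq, MonoidalCategory.tensorHom_def,
    MonoidalCategory.whiskerLeft_comp, Category.assoc, comp_whiskerRight]
  rw [associator_inv_naturality_right_assoc, associator_inv_naturality_middle_assoc]
  simp only [← whisker_exchange_assoc]

lemma weightAct_comp (W : EnrichedFunctor V Cᵒᵖ V) (c c' c'' : C) :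
    W.obj (op c'') ◁ eCompRev V c c' c'' ≫ weightAct W c c'' =
      (α_ _ _ _).inv ≫ weightAct W c' c'' ▷ _ ≫ weightAct W c c' := by
  have h : eCompRev V c c' c'' ≫ W.map (op c'') (op c) =
      (W.map (op c'') (op c') ⊗ₘ W.map (op c') (op c)) ≫ MonoidalClosed.comp _ _ _ :=
    W.map_comp (op c'') (op c') (op c)
  rw [weightAct, ← MonoidalClosed.uncurry_natural_left]
  exact (congrArg MonoidalClosed.uncurry h).trans (uncurry_tensorHom_comp _ _)

end Weight

variable {M : Type u₂} [Category.{v} M] [EnrichedOrdinaryCategory V M] [Tensored V M]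

open Tensored

section Diagram

variable (D : EnrichedFunctor V C M)

/-- The action `C(c, c') ⊗ D c ⟶ D c'` of `C` on a diagram `D : C ⟶ M`. -/
def diagramAct (c c' : C) : (c ⟶[V] c') ⊙ₗ D.obj c ⟶ D.obj c' :=
  unhat (D.map c c')

lemma diagramAct_id (c : C) :
    (λₗ[V] (D.obj c)).inv ≫ eId V c ⊵ₗ D.obj c ≫ diagramAct D c c = 𝟙 _ := by
  rw [Iso.inv_comp_eq]
  apply hat_injective
  refine (hat_mapLeft _ _).trans ?_
  rw [diagramAct, hat_unhat, D.map_id, Category.comp_id]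
  exact (hat_unhat _).symm

lemma diagramAct_comp (c c' c'' : C) :
    eCompRev V c c' c'' ⊵ₗ D.obj c ≫ diagramAct D c c'' =
      (αₗ _ _ _).hom ≫ _ ⊴ₗ diagramAct D c c' ≫ diagramAct D c' c'' := by
  apply hat_injective
  refine (hat_mapLeft _ _).trans (Eq.trans ?_ (hat_assocHom _ _ _).symm)
  have h : hat (mapRight (c' ⟶[V] c'') (diagramAct D c c') ≫ diagramAct D c' c'') =
    hat (diagramAct D c' c'') ≫ eHomWhiskerRight V (diagramAct D c c') _ := hat_mapRight _ _ _
  refine Eq.trans ?_ (congrArg (fun t ↦ (t ⊗ₘ coev _ _) ≫ eCompRev V _ _ _) h.symm)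
  refine Eq.trans ?_ (eCompRev_middle _ _ _).symm
  change _ = (_ ⊗ₘ hat _) ≫ _
  rw [diagramAct, diagramAct, diagramAct, hat_unhat, hat_unhat, hat_unhat,
    eCompRev, Category.assoc, D.map_comp, eCompRev]
  simp

/-- The iterated tensor `C(c_{n-1}, c_n) ⊗ ⋯ ⊗ C(c_0, c_1) ⊗ D c_0`. -/
@[reducible]
def chainObj (c : ℕ → C) : ℕ → M
  | 0 => D.obj (c 0)
  | n + 1 => (c n ⟶[V] c (n + 1)) ⊙ₗ chainObj c n

/-- Composing the last factors, from `c_i` to `c_j`, of the iterated tensor (inserting an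
identity if `i = j`). -/
def chainCut (c : ℕ → C) {i j : ℕ} (h : i ≤ j) :
    chainObj D c j ⟶ (c i ⟶[V] c j) ⊙ₗ chainObj D c i :=
  Nat.leRec (motive := fun j _ ↦ (chainObj D c j ⟶ (c i ⟶[V] c j) ⊙ₗ chainObj D c i))
    ((λₗ[V] _).inv ≫ eId V (c i) ⊵ₗ _)
    (fun j _ φ ↦ (c j ⟶[V] c (j + 1)) ⊴ₗ φ ≫ (αₗ _ _ _).inv ≫ eCompRev V _ _ _ ⊵ₗ _) h

lemma chainCut_self (c : ℕ → C) (i : ℕ) :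
    chainCut D c (le_refl i) = (λₗ[V] _).inv ≫ eId V (c i) ⊵ₗ _ :=
  Nat.leRec_self _ _

lemma chainCut_succ (c : ℕ → C) {i j : ℕ} (h : i ≤ j) (h' : i ≤ j + 1) :
    chainCut D c h' = (c j ⟶[V] c (j + 1)) ⊴ₗ chainCut D c h ≫ (αₗ _ _ _).inv ≫
      eCompRev V _ _ _ ⊵ₗ _ :=
  Nat.leRec_succ _ _ h

lemma chainCut_succ_self (c : ℕ → C) (k : ℕ) (h : k ≤ k + 1) :
    chainCut D c h = 𝟙 (chainObj D c (k + 1)) := by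
  rw [chainCut_succ D c le_rfl, chainCut_self, act_right_unit _ _ _ (eCompRev_id V _ _),
    MonoidalLeftAction.id_actionHomLeft]

lemma chainCut_comp (c : ℕ → C) {i j k : ℕ} (h : i ≤ j) (h' : j ≤ k) :
    chainCut D c h' ≫ (c j ⟶[V] c k) ⊴ₗ chainCut D c h ≫ (αₗ _ _ _).inv ≫
      eCompRev V _ _ _ ⊵ₗ _ = chainCut D c (h.trans h') := by
  induction k, h' using Nat.le_induction with
  | base =>
    rw [chainCut_self, act_left_unit _ _ _ (id_eCompRev V _ _),
      MonoidalLeftAction.id_actionHomLeft, Category.comp_id]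
  | succ k h' ih =>
    rw [chainCut_succ D c h', chainCut_succ D c (h.trans h'), ← ih]
    exact act_assoc _ _ _ _ (eCompRev_assoc V _ _ _ _) _ _

/-- The action of the iterated tensor `C(c_{n-1}, c_n) ⊗ ⋯ ⊗ C(c_0, c_1)` on the diagram. -/
def chainAct (c : ℕ → C) : (n : ℕ) → (chainObj D c n ⟶ D.obj (c n))
  | 0 => 𝟙 _
  | n + 1 => (c n ⟶[V] c (n + 1)) ⊴ₗ chainAct c n ≫ diagramAct D _ _

lemma chainCut_chainAct (c : ℕ → C) {i j : ℕ} (h : i ≤ j) :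
    chainCut D c h ≫ (c i ⟶[V] c j) ⊴ₗ chainAct D c i ≫ diagramAct D _ _ = chainAct D c j := by
  induction j, h using Nat.le_induction with
  | base =>
    rw [chainCut_self, ← Category.assoc, act_unit_natural, Category.assoc, Category.assoc,
      diagramAct_id, Category.comp_id]
  | succ j h ih =>
    rw [chainCut_succ D c h, chainAct, ← ih, ← Category.assoc, act_natural, Category.assoc,
      Category.assoc, diagramAct_comp]
    simp only [MonoidalLeftAction.actionHomRight_comp, Category.assoc, Iso.inv_hom_id_assoc]

/-- The morphism of iterated tensors induced by a monotone map `f`: it acts on the diagram with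
the factors below `f 0`, composes the factors between `f i` and `f (i + 1)` for all `i < k`, and
inserts identities where `f i = f (i + 1)`. -/
def chainMap (c : ℕ → C) {f : ℕ → ℕ} (hf : Monotone f) :
    (k : ℕ) → (chainObj D c (f k) ⟶ chainObj D (fun i ↦ c (f i)) k)
  | 0 => chainAct D c (f 0)
  | k + 1 => chainCut D c (hf k.le_succ) ≫ (c (f k) ⟶[V] c (f (k + 1))) ⊴ₗ chainMap c hf k

lemma chainMap_id (c : ℕ → C) (k : ℕ) : chainMap D c monotone_id k = 𝟙 (chainObj D c k) := by
  induction k with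
  | zero => rfl
  | succ k ih =>
    rw [chainMap, ih]
    exact (congrArg₂ _ (chainCut_succ_self D c k _) (MonoidalLeftAction.actionHomRight_id _ _)).trans
      (Category.id_comp _)

lemma chainMap_chainCut (c : ℕ → C) {f : ℕ → ℕ} (hf : Monotone f) {i j : ℕ} (h : i ≤ j) :
    chainMap D c hf j ≫ chainCut D (fun i ↦ c (f i)) h =
      chainCut D c (hf h) ≫ (c (f i) ⟶[V] c (f j)) ⊴ₗ chainMap D c hf i := by
  induction j, h using Nat.le_induction with
  | base =>
    rw [chainCut_self, chainCut_self, act_unit_natural]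
  | succ j h ih =>
    rw [chainCut_succ D _ h, chainMap, ← chainCut_comp D c (hf h) (hf j.le_succ), Category.assoc,
      ← MonoidalLeftAction.actionHomRight_comp_assoc, ih, Category.assoc, act_natural]

lemma chainMap_chainAct (c : ℕ → C) {f : ℕ → ℕ} (hf : Monotone f) (k : ℕ) :
    chainMap D c hf k ≫ chainAct D (fun i ↦ c (f i)) k = chainAct D c (f k) := by
  induction k with
  | zero => exact Category.comp_id _
  | succ k ih =>
    rw [chainMap, chainAct, ← chainCut_chainAct D c (hf k.le_succ), ← ih]
    simp

lemma chainMap_comp (c : ℕ → C) {f g : ℕ → ℕ} (hf : Monotone f) (hg : Monotone g) (k : ℕ) :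
    chainMap D c hf (g k) ≫ chainMap D (fun i ↦ c (f i)) hg k =
      chainMap D c (hf.comp hg) k := by
  induction k with
  | zero => exact chainMap_chainAct D c hf _
  | succ k ih =>
    have h := chainMap_chainCut D c hf (hg k.le_succ)
    refine (Category.assoc _ _ _).symm.trans ?_
    refine (congrArg (· ≫ _ ⊴ₗ chainMap D (fun i ↦ c (f i)) hg k) h).trans ?_
    rw [chainMap, ← ih]
    simp

end Diagram

section Bar

variable [MonoidalClosed V] (W : EnrichedFunctor V Cᵒᵖ V) (D : EnrichedFunctor V C M)

/-- The object `W c_n ⊗ C(c_{n-1}, c_n) ⊗ ⋯ ⊗ C(c_0, c_1) ⊗ D c_0`. -/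
abbrev barObj (c : ℕ → C) (n : ℕ) : M := W.obj (op (c n)) ⊙ₗ chainObj D c n

/-- Acting on the weight with the factors above `c_i`. -/
def barCut (c : ℕ → C) {i j : ℕ} (h : i ≤ j) : barObj W D c j ⟶ barObj W D c i :=
  W.obj (op (c j)) ⊴ₗ chainCut D c h ≫ (αₗ _ _ _).inv ≫ weightAct W _ _ ⊵ₗ _

lemma barCut_self (c : ℕ → C) (i : ℕ) : barCut W D c (le_refl i) = 𝟙 _ := by
  rw [barCut, chainCut_self, act_right_unit _ _ (𝟙 _) (by simp [weightAct_id]),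
    MonoidalLeftAction.id_actionHomLeft]

lemma barCut_comp (c : ℕ → C) {i j k : ℕ} (h : i ≤ j) (h' : j ≤ k) :
    barCut W D c h' ≫ barCut W D c h = barCut W D c (h.trans h') := by
  rw [barCut, barCut, barCut, ← chainCut_comp D c h h']
  exact act_assoc _ _ _ _ (by rw [weightAct_comp]; simp) _ _

lemma barCut_natural (c : ℕ → C) {f : ℕ → ℕ} (hf : Monotone f) {i j : ℕ} (h : i ≤ j) :
    barCut W D c (hf h) ≫ W.obj (op (c (f i))) ⊴ₗ chainMap D c hf i =
      W.obj (op (c (f j))) ⊴ₗ chainMap D c hf j ≫ barCut W D (fun i ↦ c (f i)) h := by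
  rw [barCut, act_natural, ← chainMap_chainCut, barCut,
    MonoidalLeftAction.actionHomRight_comp, Category.assoc]

/-- The morphism `barObj W D c n ⟶ barObj W D (fun i ↦ c (f i)) m` induced by a monotone map `f` with
`f m ≤ n`. -/
def barMap (c : ℕ → C) {f : ℕ → ℕ} (hf : Monotone f) {m n : ℕ} (h : f m ≤ n) :
    barObj W D c n ⟶ barObj W D (fun i ↦ c (f i)) m :=
  barCut W D c h ≫ W.obj (op (c (f m))) ⊴ₗ chainMap D c hf m

lemma barMap_id (c : ℕ → C) (n : ℕ) : barMap W D c monotone_id (le_refl n) = 𝟙 _ := by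
  rw [barMap, chainMap_id, barCut_self]
  exact (Category.id_comp _).trans (MonoidalLeftAction.actionHomRight_id _ _)

lemma barMap_comp (c : ℕ → C) {f g : ℕ → ℕ} (hf : Monotone f) (hg : Monotone g) {l m n : ℕ}
    (h : f m ≤ n) (h' : g l ≤ m) (h'' : f (g l) ≤ n) :
    barMap W D c hf h ≫ barMap W D (fun i ↦ c (f i)) hg h' =
      barMap W D c (hf.comp hg) h'' := by
  have e := barCut_natural W D c hf h'
  simp only [barMap, Category.assoc]
  rw [← reassoc_of% e, ← MonoidalLeftAction.actionHomRight_comp, chainMap_comp,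
    ← Category.assoc, barCut_comp]
  rfl

lemma chainCut_eqToHom (c : ℕ → C) {k a b : ℕ} (ha : a = k) (hb : b = k + 1) (h : a ≤ b) {Y : M}
    (e : (c a ⟶[V] c b) ⊙ₗ chainObj D c a = Y) (e' : chainObj D c b = Y) :
    chainCut D c h ≫ eqToHom e = eqToHom e' := by
  subst ha hb e
  simp [chainCut_succ_self]

lemma chainObj_congr {c c' : ℕ → C} {k : ℕ} (h : ∀ i ≤ k, c i = c' i) :
    chainObj D c k = chainObj D c' k := by
  induction k with
  | zero => exact congrArg D.obj (h 0 le_rfl)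
  | succ k ih =>
    have e := ih (fun i hi ↦ h i (hi.trans k.le_succ))
    simp only [chainObj, e, h k k.le_succ, h (k + 1) le_rfl]

lemma chainMap_eqToHom (c : ℕ → C) {f : ℕ → ℕ} (hf : Monotone f) {k : ℕ} (h : ∀ i ≤ k, f i = i)
    (e : chainObj D c (f k) = chainObj D (fun i ↦ c (f i)) k) :
    chainMap D c hf k = eqToHom e := by
  induction k with
  | zero =>
    have aux : ∀ (a : ℕ) (ha : a = 0) (e : chainObj D c a = D.obj (c a)),
        chainAct D c a = eqToHom e := by
      rintro a rfl e
      rfl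
    exact aux _ (h 0 le_rfl) _
  | succ k ih =>
    have e' : chainObj D c (f k) = chainObj D (fun i ↦ c (f i)) k := by
      rw [h k k.le_succ]
      exact chainObj_congr D fun i hi ↦ by rw [h i (hi.trans k.le_succ)]
    rw [chainMap, ih (fun i hi ↦ h i (hi.trans k.le_succ)) e']
    have aux : ∀ {K : V} {X Y : M} (e : X = Y),
        K ⊴ₗ eqToHom e = eqToHom (congrArg (fun Z ↦ K ⊙ₗ Z) e) := by
      rintro K X _ rfl
      simp
    rw [aux]
    exact chainCut_eqToHom D c (h k k.le_succ) (h (k + 1) le_rfl) _ _ _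

/-- `barMap` with a specified sequence `c'` equal to `c ∘ f`. -/
def barMapOfEq {c c' : ℕ → C} {f : ℕ → ℕ} (hf : Monotone f) {m n : ℕ} (h : f m ≤ n)
    (e : c' = fun i ↦ c (f i)) : barObj W D c n ⟶ barObj W D c' m :=
  barMap W D c hf h ≫ eqToHom (by rw [e])

lemma barMapOfEq_id {c : ℕ → C} {f : ℕ → ℕ} (hf : Monotone f) {n : ℕ} (h : f n ≤ n)
    (e : c = fun i ↦ c (f i)) (hid : ∀ i ≤ n, f i = i) : barMapOfEq W D hf h e = 𝟙 _ := by
  have e₁ : chainObj D c (f n) = chainObj D (fun i ↦ c (f i)) n := by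
    rw [hid n le_rfl, ← e]
  have aux : ∀ {K : V} {X Y : M} (e : X = Y),
      K ⊴ₗ eqToHom e = eqToHom (congrArg (fun Z ↦ K ⊙ₗ Z) e) := by
    rintro K X _ rfl
    simp
  have aux' : ∀ (a : ℕ) (ha : a = n) (h : a ≤ n),
      barCut W D c h = eqToHom (by rw [ha]) := by
    rintro a rfl h
    exact barCut_self W D c a
  rw [barMapOfEq, barMap, chainMap_eqToHom D c hf hid e₁, aux, aux' _ (hid n le_rfl)]
  simp

lemma barMapOfEq_comp {c c' c'' : ℕ → C} {f g k : ℕ → ℕ} (hf : Monotone f) (hg : Monotone g)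
    (hk : Monotone k) {l m n : ℕ} (h : f m ≤ n) (h' : g l ≤ m) (h'' : k l ≤ n)
    (e : c' = fun i ↦ c (f i)) (e' : c'' = fun i ↦ c' (g i)) (e'' : c'' = fun i ↦ c (k i))
    (hkfg : k = fun i ↦ f (g i)) :
    barMapOfEq W D hf h e ≫ barMapOfEq W D hg h' e' = barMapOfEq W D hk h'' e'' := by
  subst hkfg e e'
  simp only [barMapOfEq, eqToHom_refl, Category.comp_id]
  exact barMap_comp W D c hf hg h h' h''

/-- Extend a finite sequence `c_0, …, c_n` to an infinite one by repeating `c_n`. -/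
def extend {X : Type*} {n : ℕ} (c : Fin (n + 1) → X) (k : ℕ) : X :=
  c ⟨min k n, by omega⟩

/-- The extension of a monotone map `[m] ⟶ [n]` to `ℕ`, constant from `m` on. -/
def extendMap {m n : ℕ} (φ : Fin (m + 1) →o Fin (n + 1)) (k : ℕ) : ℕ :=
  (extend φ k : Fin (n + 1))

lemma extendMap_monotone {m n : ℕ} (φ : Fin (m + 1) →o Fin (n + 1)) : Monotone (extendMap φ) :=
  fun _ _ h ↦ φ.monotone (Fin.mk_le_mk.2 (min_le_min_right _ h))

lemma extendMap_le {m n : ℕ} (φ : Fin (m + 1) →o Fin (n + 1)) (k : ℕ) : extendMap φ k ≤ n :=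
  Nat.le_of_lt_succ (extend φ k).2

lemma extend_extendMap {X : Type*} {m n : ℕ} (φ : Fin (m + 1) →o Fin (n + 1))
    (c : Fin (n + 1) → X) (k : ℕ) : extend c (extendMap φ k) = extend (fun i ↦ c (φ i)) k := by
  have h := extendMap_le φ k
  simp only [extend]
  congr 1
  apply Fin.ext
  simp only [min_eq_left h]
  rfl

variable (C) in
/-- The functor `[n] ↦ C^{n+1}` of finite families of objects. The objects of its category of
elements are the pairs `([n], (c_0, …, c_n))`, and its morphisms
`([n], (c_0, …, c_n)) ⟶ ([m], (c'_0, …, c'_m))` are the monotone maps `f : [m] ⟶ [n]` with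
`c_{f i} = c'_i` for all `i`. -/
def families : SimplexCategoryᵒᵖ ⥤ Type u where
  obj n := Fin (n.unop.len + 1) → C
  map f := ↾fun c i ↦ c (f.unop.toOrderHom i)

lemma extendMap_comp {l m n : ℕ} (φ : Fin (m + 1) →o Fin (n + 1)) (ψ : Fin (l + 1) →o Fin (m + 1))
    (k : ℕ) : extendMap (φ.comp ψ) k = extendMap φ (extendMap ψ k) :=
  congrArg Fin.val (extend_extendMap ψ φ k).symm

lemma extendMap_id {n k : ℕ} (hk : k ≤ n) : extendMap (OrderHom.id (α := Fin (n + 1))) k = k :=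
  min_eq_left hk

lemma extend_elements_map {x y : (families C).Elements} (f : x ⟶ y) :
    extend (n := y.1.unop.len) y.2 =
      fun k ↦ extend (n := x.1.unop.len) x.2 (extendMap f.1.unop.toOrderHom k) := by
  funext k
  exact (congrArg (fun c ↦ extend (n := y.1.unop.len) c k) f.2.symm).trans
    (extend_extendMap f.1.unop.toOrderHom x.2 k).symm

/-- The diagram `([n], (c_0, …, c_n)) ↦ W c_n ⊗ C(c_{n-1}, c_n) ⊗ ⋯ ⊗ C(c_0, c_1) ⊗ D c_0`. -/
def barDiagram : (families C).Elements ⥤ M where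
  obj x := barObj W D (extend (n := x.1.unop.len) x.2) x.1.unop.len
  map {_ _} f := barMapOfEq W D (extendMap_monotone f.1.unop.toOrderHom) (extendMap_le _ _)
    (extend_elements_map f)
  map_id _ := barMapOfEq_id W D _ _ _ (fun _ hi ↦ extendMap_id hi)
  map_comp f g := (barMapOfEq_comp W D _ _ _ _ _ _ _ _ _
    (funext fun k ↦ extendMap_comp f.1.unop.toOrderHom g.1.unop.toOrderHom k)).symm

lemma sigma_ι_congr {ι : Type*} (Y : ι → M) [HasCoproduct Y] {X : M} {i j : ι} (h : i = j)
    (f : X ⟶ Y i) (g : X ⟶ Y j) (e : f ≫ eqToHom (by rw [h]) = g) :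
    f ≫ Sigma.ι Y i = g ≫ Sigma.ι Y j := by
  subst h e
  simp

lemma elements_eqToHom_val {J : Type*} [Category J] {P : J ⥤ Type u} {x y : P.Elements}
    (h : x = y) : (eqToHom h).1 = eqToHom (by rw [h]) := by
  subst h
  rfl

/-- For a diagram `T` on the category of elements of `P`, the diagram
`n ↦ ∐_{c ∈ P n} T (n, c)`. -/
def fiberwiseCoproduct {J : Type*} [Category J] {P : J ⥤ Type u} [HasCoproducts.{u} M]
    (T : P.Elements ⥤ M) : J ⥤ M where
  obj n := ∐ fun c : P.obj n ↦ T.obj (P.elementsMk n c)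
  map {m n} f := Sigma.desc fun c ↦
    T.map (CategoryOfElements.homMk (P.elementsMk m c) (P.elementsMk n (P.map f c)) f rfl) ≫
      Sigma.ι (fun c : P.obj n ↦ T.obj (P.elementsMk n c)) (P.map f c)
  map_id n := by
    refine Sigma.hom_ext _ _ fun c ↦ ?_
    rw [Sigma.ι_desc, Category.comp_id]
    have h : P.map (𝟙 n) c = c := by simp
    refine (sigma_ι_congr (fun c : P.obj n ↦ T.obj (P.elementsMk n c)) h _ (𝟙 _) ?_).trans
      (Category.id_comp _)
    rw [← eqToHom_map T (by rw [h]), ← T.map_comp, ← T.map_id]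
    congr 1
    apply CategoryOfElements.ext
    exact (congrArg (_ ≫ ·) (elements_eqToHom_val _)).trans (by simp)
  map_comp {l m n} f g := by
    refine Sigma.hom_ext _ _ fun c ↦ ?_
    rw [Sigma.ι_desc, Sigma.ι_desc_assoc, Category.assoc, Sigma.ι_desc, ← Category.assoc,
      ← T.map_comp]
    have h : P.map (f ≫ g) c = P.map g (P.map f c) := by simp
    refine sigma_ι_congr (fun c : P.obj n ↦ T.obj (P.elementsMk n c)) h _ _ ?_
    rw [← eqToHom_map T (by rw [h]), ← T.map_comp]
    congr 1
    apply CategoryOfElements.ext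
    exact (congrArg (_ ≫ ·) (elements_eqToHom_val _)).trans (by simp)

/-- The simplicial object
`n ↦ ∐_{c_0, …, c_n} W c_n ⊗ C(c_{n-1}, c_n) ⊗ ⋯ ⊗ C(c_0, c_1) ⊗ D c_0`. -/
def barSimplicial [HasCoproducts.{u} M] : SimplexCategoryᵒᵖ ⥤ M :=
  fiberwiseCoproduct (barDiagram W D)

end Bar

end Chains

section ModelCategories

variable {A B E : Type*} [Category* A] [Category* B] [Category* E]
  [ModelCategory A] [ModelCategory B] [ModelCategory E]

/-- The pushout-product axiom for a bifunctor `F : A ⥤ B ⥤ E` of model categories. -/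
def PushoutProductAxiom (F : A ⥤ B ⥤ E) : Prop :=
  ∀ ⦃K L : A⦄ ⦃X Y : B⦄ (i : K ⟶ L) (j : X ⟶ Y) (sq : F.PushoutObjObj i j),
    Cofibration i → Cofibration j → Cofibration sq.ι ∧
      (WeakEquivalence i ∨ WeakEquivalence j → WeakEquivalence sq.ι)

/-- Flatness of the object `K` with respect to a bifunctor (for instance a tensor product)
`F : A ⥤ B ⥤ E`: the functor `F (K, -)` preserves cofibrations and trivial cofibrations. -/
def IsFlat (F : A ⥤ B ⥤ E) (K : A) : Prop :=
  ∀ ⦃X Y : B⦄ (j : X ⟶ Y), Cofibration j → Cofibration ((F.obj K).map j) ∧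
    (WeakEquivalence j → WeakEquivalence ((F.obj K).map j))

/-- Flatness of the morphism `i` with respect to a bifunctor (for instance a tensor product)
`F : A ⥤ B ⥤ E`: for `j` a (trivial) cofibration, the induced morphism from the pushout to the
bottom right corner of the square of the values of `F` on `i` and `j` is a (trivial)
cofibration. -/
def IsFlatMap (F : A ⥤ B ⥤ E) {K L : A} (i : K ⟶ L) : Prop :=
  ∀ ⦃X Y : B⦄ (j : X ⟶ Y) (sq : F.PushoutObjObj i j), Cofibration j → Cofibration sq.ι ∧
    (WeakEquivalence j → WeakEquivalence sq.ι)

/-- Two objects are weakly equivalent if they are connected by a zigzag of weak equivalences. -/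
def WeaklyEquivalent : A → A → Prop :=
  Relation.EqvGen fun X Y ↦ ∃ f : X ⟶ Y, WeakEquivalence f

variable [HasColimits E]

/-- The indexing category of the `n`-th latching object of a cosimplicial object: the
non-invertible injections `[k] ⟶ [n]`. -/
abbrev LatchingIndex (n : SimplexCategory) :=
  ObjectProperty.FullSubcategory (fun f : Over n ↦ Mono f.hom ∧ ¬ IsIso f.hom)

/-- The restriction of a cosimplicial object `X` to the indexing category of the `n`-th latching
object. -/
abbrev latchingDiagram (X : SimplexCategory ⥤ E) (n : SimplexCategory) : LatchingIndex n ⥤ E :=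
  ObjectProperty.ι _ ⋙ Over.forget n ⋙ X

end ModelCategories

section Resolutions

variable {E : Type u} [Category.{v} E] [ModelCategory E]

/-- A cosimplicial object is Reedy cofibrant if all its latching morphisms
`colim_{[k] ↪ [n], k < n} X [k] ⟶ X [n]` are cofibrations. -/
def IsReedyCofibrant [HasColimits E] (X : SimplexCategory ⥤ E) : Prop :=
  haveI : HasColimitsOfSize.{0, 0} E := hasColimitsOfSizeShrink.{0, 0, v, v} E
  ∀ n : SimplexCategory, Cofibration (colimit.desc (latchingDiagram X n)
    { pt := X.obj n
      ι := { app f := X.map f.obj.hom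
             naturality f g h := by
               simp [← Functor.map_comp] } })

variable [HasColimits E]

/-- A cosimplicial resolution of `X`, i.e. a Reedy cofibrant replacement of the constant
cosimplicial object with value `X`. -/
structure CosimplicialResolution (X : E) where
  /-- the cosimplicial object -/
  obj : SimplexCategory ⥤ E
  /-- the augmentation -/
  aug : obj ⟶ (Functor.const SimplexCategory).obj X
  isReedyCofibrant : IsReedyCofibrant obj
  weakEquivalence (n : SimplexCategory) : WeakEquivalence (aug.app n)

/-- A pointwise Reedy cofibrant replacement of the diagram of constant cosimplicial objects
on the values of a diagram `T`. -/
structure DiagramResolution {I : Type*} [Category* I] (T : I ⥤ E) where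
  /-- the diagram of cosimplicial objects -/
  obj : I ⥤ (SimplexCategory ⥤ E)
  /-- the augmentation -/
  aug : obj ⟶ T ⋙ Functor.const SimplexCategory
  isReedyCofibrant (i : I) : IsReedyCofibrant (obj.obj i)
  weakEquivalence (i : I) (n : SimplexCategory) : WeakEquivalence ((aug.app i).app n)

end Resolutions

section HomotopyColimits

universe w t

/-- The functor `(n, i) ↦ N(i ↓ I)_n = {i ⟶ i_0 ⟶ ⋯ ⟶ i_n}`. -/
def underChains (I : Type t) [Category.{w} I] : (SimplexCategory × I)ᵒᵖ ⥤ Type (max t w) :=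
  (prodOpEquiv SimplexCategory).functor ⋙
    Functor.uncurry.obj ((Under.mapFunctor I ⋙ nerveFunctor).flip)

/-- The homotopy colimit `∫^{(n, i)} N(i ↓ I)_n · (T' i)^n` of a diagram `T`, formed with a
given pointwise Reedy cofibrant replacement `T'` of the constant cosimplicial objects on `T`. -/
def hocolim {I : Type t} [Category.{w} I] {E : Type u} [Category.{v} E] [ModelCategory E]
    [HasColimits E] [HasColimitsOfSize.{max t w, max t w} E] {T : I ⥤ E}
    (T' : DiagramResolution T) : E :=
  coend (underChains I ⋙ sigmaConst.flip ⋙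
    (Functor.whiskeringLeft _ _ _).obj (Functor.uncurry.obj T'.obj.flip))

end HomotopyColimits

section EnrichedModelCategories

variable (V : Type u₁) [Category.{v} V] [MonoidalCategory V] [SymmetricCategory V]

/-- The axioms of a monoidal model category (with symmetric monoidal product). -/
class MonoidalModelCategory [ModelCategory V] : Prop where
  pushoutProduct : PushoutProductAxiom (curriedTensor V)
  unit {Q : V} (q : Q ⟶ 𝟙_ V) (K : V) :
    IsCofibrant Q → WeakEquivalence q → IsCofibrant K → WeakEquivalence (q ▷ K)

variable (M : Type u₂) [Category.{v} M] [EnrichedOrdinaryCategory V M] [Tensored V M]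

/-- The bifunctor `(K, X) ↦ K ⊗ X` from `V × M` to `M`. -/
abbrev tensorBifunctor : V ⥤ M ⥤ M := curriedAction V M

/-- The axioms of a model `V`-category: `M` has all cotensors `Z = Y ^ K` (with universal
morphism `K ⟶ M(Z, Y)`), tensors satisfy the pushout-product axiom and the unit axiom. -/
class ModelEnrichedCategory [ModelCategory V] [ModelCategory M] : Prop where
  hasCotensors (K : V) (Y : M) : ∃ (Z : M) (ev : K ⟶ (Z ⟶[V] Y)), ∀ (X : M) (A : V),
    Function.Bijective (fun g : A ⟶ (X ⟶[V] Z) ↦ (g ⊗ₘ ev) ≫ eComp V X Z Y)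
  pushoutProduct : PushoutProductAxiom (tensorBifunctor V M)
  unit {Q : V} (q : Q ⟶ 𝟙_ V) (X : M) :
    IsCofibrant Q → WeakEquivalence q → IsCofibrant X → WeakEquivalence (q ⊵ₗ X)

variable {V M}

/-- The geometric realization `∫^n I^n ⊗ X_n` of a simplicial object `X`, formed with a
cosimplicial object `I` of `V`. -/
def realization [HasColimits M] (I : SimplexCategory ⥤ V) (X : SimplexCategoryᵒᵖ ⥤ M) : M :=
  haveI : HasColimitsOfSize.{0, 0} M := hasColimitsOfSizeShrink.{0, 0, v, v} M
  coend (X ⋙ (tensorBifunctor V M).flip ⋙ (Functor.whiskeringLeft _ _ _).obj I)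

/-- `C` is locally flat: all objects `C(c, c')` are flat with respect to the bifunctor `F`. -/
def LocallyFlat {A B : Type*} [Category* A] [Category* B] [ModelCategory A] [ModelCategory B]
    (C : Type u) [EnrichedCategory V C] (F : V ⥤ A ⥤ B) : Prop :=
  ∀ c c' : C, IsFlat F (c ⟶[V] c')

/-- `C` is locally flat and all unit morphisms `id_c : 𝟙 ⟶ C(c, c)` are flat with respect to
the bifunctor `F`. -/
def LocallyPointedFlat {A B : Type*} [Category* A] [Category* B] [ModelCategory A]
    [ModelCategory B] (C : Type u) [EnrichedCategory V C] (F : V ⥤ A ⥤ B) : Prop :=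
  LocallyFlat C F ∧ ∀ c : C, IsFlatMap F (eId V c)

section Weights

variable [MonoidalClosed V] {C : Type u} [EnrichedCategory V C]

/-- Morphisms of weights, i.e. `V`-natural transformations. -/
structure WeightHom (W W' : EnrichedFunctor V Cᵒᵖ V) where
  /-- the components -/
  app (c : C) : W.obj (op c) ⟶ W'.obj (op c)
  naturality (c c' : C) :
    weightAct W c c' ≫ app c = app c' ▷ (c ⟶[V] c') ≫ weightAct W' c c'

/-- Projectively cofibrant weights: those with the left lifting property with respect to all
pointwise trivial fibrations of weights. -/
def IsProjectivelyCofibrant [ModelCategory V] (W : EnrichedFunctor V Cᵒᵖ V) : Prop :=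
  ∀ ⦃E B : EnrichedFunctor V Cᵒᵖ V⦄ (p : WeightHom E B),
    (∀ c, Fibration (p.app c) ∧ WeakEquivalence (p.app c)) →
      ∀ f : WeightHom W B, ∃ g : WeightHom W E, ∀ c, g.app c ≫ p.app c = f.app c

/-- The object `P`, together with the `V`-natural family `W c ⟶ M(D c, P)`, is the colimit of
`D` weighted by `W`: it represents the `V`-functor `X ↦ [Cᵒᵖ, V](W, M(D -, X))`, i.e. morphisms
`A ⟶ M(P, X)` correspond to `V`-natural families `A ⊗ W c ⟶ M(D c, X)`. -/
structure WeightedColimit (W : EnrichedFunctor V Cᵒᵖ V) (D : EnrichedFunctor V C M) where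
  /-- the weighted colimit `W ⋆ D` -/
  pt : M
  /-- the universal family -/
  ι (c : C) : W.obj (op c) ⟶ (D.obj c ⟶[V] pt)
  naturality (c c' : C) : weightAct W c c' ≫ ι c =
    (ι c' ⊗ₘ D.map c c') ≫ eCompRev V (D.obj c) (D.obj c') pt
  existsUnique {X : M} {A : V} (φ : ∀ c, A ⊗ W.obj (op c) ⟶ (D.obj c ⟶[V] X)) :
    (∀ c c', A ◁ weightAct W c c' ≫ φ c = (α_ _ _ _).inv ≫ (φ c' ⊗ₘ D.map c c') ≫
      eCompRev V (D.obj c) (D.obj c') X) →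
    ∃! g : A ⟶ (pt ⟶[V] X), ∀ c, φ c = (g ⊗ₘ ι c) ≫ eCompRev V (D.obj c) pt X

end Weights

end EnrichedModelCategories

end HWC

end

noncomputable section

namespace HWC

open MonoidalLeftAction

section Lifting

variable {E : Type*} [Category* E] [ModelCategory E]

lemma cofibration_of_hasLiftingProperty {X Y : E} (i : X ⟶ Y)
    (h : ∀ ⦃Z B : E⦄ (p : Z ⟶ B), Fibration p → WeakEquivalence p → HasLiftingProperty i p) :
    Cofibration i := by
  rw [cofibration_iff, ← trivialFibrations_llp]
  intro Z B p hp
  rw [mem_trivialFibrations_iff] at hp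
  exact h p hp.1 hp.2

lemma trivialCofibration_of_hasLiftingProperty {X Y : E} (i : X ⟶ Y)
    (h : ∀ ⦃Z B : E⦄ (p : Z ⟶ B), Fibration p → HasLiftingProperty i p) :
    Cofibration i ∧ WeakEquivalence i := by
  rw [← mem_trivialCofibrations_iff, ← fibrations_llp]
  intro Z B p hp
  exact h p ⟨hp⟩

lemma trivialFibration_of_hasLiftingProperty {X Y : E} (p : X ⟶ Y)
    (h : ∀ ⦃A B : E⦄ (i : A ⟶ B), Cofibration i → HasLiftingProperty i p) :
    Fibration p ∧ WeakEquivalence p := by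
  rw [← mem_trivialFibrations_iff, ← cofibrations_rlp]
  intro A B i hi
  exact h i ⟨hi⟩

/-- Two cofibrations and a fibration, one of which is a weak equivalence. -/
structure Admissible {A B E : Type*} [Category* A] [Category* B] [Category* E]
    [ModelCategory A] [ModelCategory B] [ModelCategory E] {K L : A} {X Y : B} {Z T : E}
    (j : K ⟶ L) (f : X ⟶ Y) (p : Z ⟶ T) : Prop where
  left : Cofibration j
  right : Cofibration f
  fib : Fibration p
  weq : WeakEquivalence j ∨ WeakEquivalence f ∨ WeakEquivalence p

lemma hasLiftingProperty_of_weakEquivalence {X Y Z T : E} (i : X ⟶ Y) (p : Z ⟶ T)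
    [Cofibration i] [Fibration p] (h : WeakEquivalence i ∨ WeakEquivalence p) :
    HasLiftingProperty i p := by
  rcases h with h | h <;> infer_instance

end Lifting

section Bifunctors

variable {A B E : Type*} [Category* A] [Category* B] [Category* E]

/-- The lifting property of the pushout-product of `j` and `f` against `p`. -/
def Lift₃ (F : A ⥤ B ⥤ E) {K L : A} {X Y : B} {Z T : E} (j : K ⟶ L) (f : X ⟶ Y)
    (p : Z ⟶ T) : Prop :=
  ∀ (a : (F.obj K).obj Y ⟶ Z) (b : (F.obj L).obj X ⟶ Z) (g : (F.obj L).obj Y ⟶ T),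
    (F.obj K).map f ≫ a = (F.map j).app X ≫ b →
    a ≫ p = (F.map j).app Y ≫ g → b ≫ p = (F.obj L).map f ≫ g → ∃ h : (F.obj L).obj Y ⟶ Z,
      (F.map j).app Y ≫ h = a ∧ (F.obj L).map f ≫ h = b ∧ h ≫ p = g

lemma lift₃_of_hasLiftingProperty {F : A ⥤ B ⥤ E} {K L : A} {X Y : B} {Z T : E} {j : K ⟶ L}
    {f : X ⟶ Y} {p : Z ⟶ T} (sq : F.PushoutObjObj j f) (H : HasLiftingProperty sq.ι p) :
    Lift₃ F j f p := by
  intro a b g e₁ e₂ e₃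
  have hsq : CommSq (sq.isPushout.desc b a e₁.symm) sq.ι p g := ⟨sq.hom_ext
    (by rw [IsPushout.inl_desc_assoc, sq.inl_ι_assoc, e₃])
    (by rw [IsPushout.inr_desc_assoc, sq.inr_ι_assoc, e₂])⟩
  refine ⟨hsq.lift, ?_, ?_, hsq.fac_right⟩
  · rw [← sq.inr_ι, Category.assoc, hsq.fac_left, IsPushout.inr_desc]
  · rw [← sq.inl_ι, Category.assoc, hsq.fac_left, IsPushout.inl_desc]

lemma PushoutProductAxiom.lift₃ [ModelCategory A] [ModelCategory B] [ModelCategory E]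
    {F : A ⥤ B ⥤ E} (H : PushoutProductAxiom F) {K L : A} {X Y : B} {Z T : E} {j : K ⟶ L}
    {f : X ⟶ Y} {p : Z ⟶ T} (h : Admissible j f p) : Lift₃ F j f p := by
  let sq := Functor.PushoutObjObj.ofHasPushout F j f
  have h' := H j f sq h.left h.right
  have := h'.1
  have := h.fib
  have w := h.weq
  rw [← or_assoc] at w
  exact lift₃_of_hasLiftingProperty sq
    (hasLiftingProperty_of_weakEquivalence _ _ (w.imp_left h'.2))

end Bifunctors

section Actions

variable {V : Type*} [Category* V] [MonoidalCategory V]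
  {M : Type*} [Category* M] [MonoidalLeftAction V M]

/-- The lifting property of the pushout-product of `j` and `f` against `p`. -/
def ActLift {K L : V} {X Y E B : M} (j : K ⟶ L) (f : X ⟶ Y) (p : E ⟶ B) : Prop :=
  ∀ (a : K ⊙ₗ Y ⟶ E) (b : L ⊙ₗ X ⟶ E) (g : L ⊙ₗ Y ⟶ B), K ⊴ₗ f ≫ a = j ⊵ₗ X ≫ b →
    a ≫ p = j ⊵ₗ Y ≫ g → b ≫ p = L ⊴ₗ f ≫ g → ∃ h : L ⊙ₗ Y ⟶ E,
      j ⊵ₗ Y ≫ h = a ∧ L ⊴ₗ f ≫ h = b ∧ h ≫ p = g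

lemma actLift_of_lift₃ {K L : V} {X Y E B : M} {j : K ⟶ L} {f : X ⟶ Y} {p : E ⟶ B}
    (h : Lift₃ (curriedAction V M) j f p) : ActLift j f p := h

end Actions

section Adjunctions

variable {V : Type u₁} [Category.{v} V] [MonoidalCategory V] [SymmetricCategory V]
  {M : Type u₂} [Category.{v} M] [EnrichedOrdinaryCategory V M] [Tensored V M]

open Tensored

/-- Morphisms `K ⊗ X ⟶ Y` are the same as morphisms `K ⟶ M(X, Y)`. -/
def hatEquiv (K : V) (X Y : M) : (K ⊙ₗ X ⟶ Y) ≃ (K ⟶ (X ⟶[V] Y)) :=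
  Equiv.ofBijective _ (hat_bijective K X Y)

lemma hatEquiv_mapLeft {K L : V} (u : K ⟶ L) {X Y : M} (f : L ⊙ₗ X ⟶ Y) :
    hatEquiv K X Y (u ⊵ₗ X ≫ f) = u ≫ hatEquiv L X Y f :=
  hat_mapLeft u f

lemma hatEquiv_mapRight (K : V) {X X' Y : M} (w : X ⟶ X') (f : K ⊙ₗ X' ⟶ Y) :
    hatEquiv K X Y (K ⊴ₗ w ≫ f) = hatEquiv K X' Y f ≫ eHomWhiskerRight V w Y :=
  hat_mapRight K w f

lemma hatEquiv_comp {K : V} {X Y Z : M} (f : K ⊙ₗ X ⟶ Y) (g : Y ⟶ Z) :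
    hatEquiv K X Z (f ≫ g) = hatEquiv K X Y f ≫ eHomWhiskerLeft V X g :=
  hat_comp f g

lemma hatEquiv_symm_mapLeft {K L : V} (u : K ⟶ L) {X Y : M} (φ : L ⟶ (X ⟶[V] Y)) :
    (hatEquiv K X Y).symm (u ≫ φ) = u ⊵ₗ X ≫ (hatEquiv L X Y).symm φ := by
  rw [Equiv.symm_apply_eq, hatEquiv_mapLeft, Equiv.apply_symm_apply]

lemma hatEquiv_symm_mapRight (K : V) {X X' Y : M} (w : X ⟶ X') (φ : K ⟶ (X' ⟶[V] Y)) :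
    (hatEquiv K X Y).symm (φ ≫ eHomWhiskerRight V w Y) = K ⊴ₗ w ≫ (hatEquiv K X' Y).symm φ := by
  rw [Equiv.symm_apply_eq, hatEquiv_mapRight, Equiv.apply_symm_apply]

lemma hatEquiv_symm_comp {K : V} {X Y Z : M} (φ : K ⟶ (X ⟶[V] Y)) (g : Y ⟶ Z) :
    (hatEquiv K X Z).symm (φ ≫ eHomWhiskerLeft V X g) = (hatEquiv K X Y).symm φ ≫ g := by
  rw [Equiv.symm_apply_eq, hatEquiv_comp, Equiv.apply_symm_apply]

instance isLeftAdjoint_actionRight (X : M) : ((curriedAction V M).flip.obj X).IsLeftAdjoint :=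
  (Adjunction.adjunctionOfEquivRight (F := (curriedAction V M).flip.obj X)
    (G_obj := fun Y ↦ (X ⟶[V] Y)) (fun K Y ↦ hatEquiv K X Y)
    (fun _ _ _ u f ↦ hatEquiv_mapLeft u f)).isLeftAdjoint

section Cotensors

variable [ModelCategory V] [ModelCategory M] [ModelEnrichedCategory V M]

/-- The cotensor of `Y` and `K`. -/
def cotensor (K : V) (Y : M) : M :=
  (ModelEnrichedCategory.hasCotensors (V := V) (M := M) K Y).choose

/-- The universal morphism `K ⟶ M(Y ^ K, Y)`. -/
def cotensorEv (K : V) (Y : M) : K ⟶ (cotensor K Y ⟶[V] Y) :=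
  (ModelEnrichedCategory.hasCotensors (V := V) (M := M) K Y).choose_spec.choose

lemma cotensorEv_bijective (K : V) (X Y : M) (A : V) : Function.Bijective
    (fun g : A ⟶ (X ⟶[V] cotensor K Y) ↦ (g ⊗ₘ cotensorEv K Y) ≫ eComp V X (cotensor K Y) Y) :=
  (ModelEnrichedCategory.hasCotensors (V := V) (M := M) K Y).choose_spec.choose_spec X A

/-- Morphisms `X ⟶ Y ^ K` are the same as morphisms `K ⊗ X ⟶ Y`. -/
def cotensorEquiv (K : V) (X Y : M) : (X ⟶ cotensor K Y) ≃ (K ⊙ₗ X ⟶ Y) :=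
  (eHomEquiv V).trans ((Equiv.ofBijective _ (cotensorEv_bijective K X Y (𝟙_ V))).trans
      (((λ_ K).homFromEquiv).trans (hatEquiv K X Y).symm))

lemma cotensorEquiv_comp (K : V) {X' X Y : M} (w : X' ⟶ X) (f : X ⟶ cotensor K Y) :
    cotensorEquiv K X' Y (w ≫ f) = K ⊴ₗ w ≫ cotensorEquiv K X Y f := by
  change (hatEquiv K X' Y).symm ((λ_ K).inv ≫ _) = K ⊴ₗ w ≫ (hatEquiv K X Y).symm ((λ_ K).inv ≫ _)
  rw [← hatEquiv_symm_mapRight]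
  simp only [Equiv.ofBijective_apply, eHomEquiv_comp_whiskerRight, Category.assoc]
  congr 2
  rw [tensorHom_comp_left, Category.assoc, ← eComp_eHomWhiskerRight]

lemma cotensorEquiv_symm_comp (K : V) {X' X Y : M} (w : X' ⟶ X) (f : K ⊙ₗ X ⟶ Y) :
    (cotensorEquiv K X' Y).symm (K ⊴ₗ w ≫ f) = w ≫ (cotensorEquiv K X Y).symm f := by
  rw [Equiv.symm_apply_eq, cotensorEquiv_comp, Equiv.apply_symm_apply]

instance isLeftAdjoint_actionLeft (K : V) : ((curriedAction V M).obj K).IsLeftAdjoint :=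
  (Adjunction.adjunctionOfEquivRight (F := (curriedAction V M).obj K)
    (G_obj := cotensor K) (fun X Y ↦ (cotensorEquiv K X Y).symm)
    (fun _ _ _ w f ↦ cotensorEquiv_symm_comp K w f)).isLeftAdjoint

end Cotensors

end Adjunctions

section WeightConstructions

variable {V : Type u₁} [Category.{v} V] [MonoidalCategory V] [SymmetricCategory V]
  [MonoidalClosed V] {C : Type u} [EnrichedCategory V C]

/-- The weight with given right action of `C`. -/
abbrev weightMk (obj : C → V) (act : ∀ c c' : C, obj c' ⊗ (c ⟶[V] c') ⟶ obj c)
    (act_id : ∀ c, obj c ◁ eId V c ≫ act c c = (ρ_ _).hom)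
    (act_comp : ∀ c c' c'', obj c'' ◁ eCompRev V c c' c'' ≫ act c c'' =
      (α_ _ _ _).inv ≫ act c' c'' ▷ _ ≫ act c c') : EnrichedFunctor V Cᵒᵖ V where
  obj c := obj c.unop
  map x y := MonoidalClosed.curry (act y.unop x.unop)
  map_id x := by
    change eId V x.unop ≫ MonoidalClosed.curry _ = MonoidalClosed.curry (ρ_ (obj x.unop)).hom
    rw [← MonoidalClosed.curry_natural_left, act_id]
  map_comp x y z := by
    change eCompRev V z.unop y.unop x.unop ≫ MonoidalClosed.curry _ =
      (MonoidalClosed.curry _ ⊗ₘ MonoidalClosed.curry _) ≫ MonoidalClosed.comp _ _ _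
    apply MonoidalClosed.uncurry_injective
    rw [uncurry_tensorHom_comp, ← MonoidalClosed.curry_natural_left, act_comp]
    simp only [MonoidalClosed.uncurry_curry]

lemma weightAct_weightMk (obj : C → V) (act : ∀ c c' : C, obj c' ⊗ (c ⟶[V] c') ⟶ obj c)
    (act_id : ∀ c, obj c ◁ eId V c ≫ act c c = (ρ_ _).hom)
    (act_comp : ∀ c c' c'', obj c'' ◁ eCompRev V c c' c'' ≫ act c c'' =
      (α_ _ _ _).inv ≫ act c' c'' ▷ _ ≫ act c c') (c c' : C) :
    weightAct (weightMk obj act act_id act_comp) c c' = act c c' :=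
  MonoidalClosed.uncurry_curry _

/-- The representable weight `C(-, a)`. -/
abbrev representable (a : C) : EnrichedFunctor V Cᵒᵖ V :=
  weightMk (fun c ↦ (c ⟶[V] a)) (fun c c' ↦ eCompRev V c c' a)
    (fun c ↦ by rw [← cancel_epi (ρ_ _).inv, eCompRev_id, Iso.inv_hom_id])
    (fun c c' c'' ↦ by rw [eCompRev_assoc, Iso.inv_hom_id_assoc])

lemma weightAct_representable (a c c' : C) :
    weightAct (representable (V := V) a) c c' = eCompRev V c c' a :=
  weightAct_weightMk _ _ _ _ _ _

/-- The pullback of two morphisms of weights. -/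
abbrev pullbackWeight [HasPullbacks V] {W₁ W₂ W₃ : EnrichedFunctor V Cᵒᵖ V} (f : WeightHom W₁ W₃)
    (g : WeightHom W₂ W₃) : EnrichedFunctor V Cᵒᵖ V :=
  weightMk (fun c ↦ pullback (f.app c) (g.app c))
    (fun c c' ↦ pullback.lift (pullback.fst _ _ ▷ _ ≫ weightAct W₁ c c')
      (pullback.snd _ _ ▷ _ ≫ weightAct W₂ c c') (by
        rw [Category.assoc, Category.assoc, f.naturality, g.naturality, ← comp_whiskerRight_assoc,
          pullback.condition, comp_whiskerRight_assoc]))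
    (fun c ↦ by
      apply pullback.hom_ext
      · rw [Category.assoc, pullback.lift_fst, whisker_exchange_assoc, weightAct_id,
          rightUnitor_naturality]
      · rw [Category.assoc, pullback.lift_snd, whisker_exchange_assoc, weightAct_id,
          rightUnitor_naturality])
    (fun c c' c'' ↦ by
      apply pullback.hom_ext
      · simp only [Category.assoc, pullback.lift_fst]
        rw [whisker_exchange_assoc, weightAct_comp, ← comp_whiskerRight_assoc, pullback.lift_fst]
        simp
      · simp only [Category.assoc, pullback.lift_snd]
        rw [whisker_exchange_assoc, weightAct_comp, ← comp_whiskerRight_assoc, pullback.lift_snd]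
        simp)

lemma weightAct_pullbackWeight_fst [HasPullbacks V] {W₁ W₂ W₃ : EnrichedFunctor V Cᵒᵖ V}
    (f : WeightHom W₁ W₃) (g : WeightHom W₂ W₃) (c c' : C) :
    weightAct (pullbackWeight f g) c c' ≫ pullback.fst (f.app c) (g.app c) =
      pullback.fst (f.app c') (g.app c') ▷ _ ≫ weightAct W₁ c c' := by
  rw [weightAct_weightMk]
  exact pullback.lift_fst _ _ _

lemma weightAct_pullbackWeight_snd [HasPullbacks V] {W₁ W₂ W₃ : EnrichedFunctor V Cᵒᵖ V}
    (f : WeightHom W₁ W₃) (g : WeightHom W₂ W₃) (c c' : C) :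
    weightAct (pullbackWeight f g) c c' ≫ pullback.snd (f.app c) (g.app c) =
      pullback.snd (f.app c') (g.app c') ▷ _ ≫ weightAct W₂ c c' := by
  rw [weightAct_weightMk]
  exact pullback.lift_snd _ _ _

/-- The morphism to a pullback of weights with given components. -/
def WeightHom.lift [HasPullbacks V] {W W₁ W₂ W₃ : EnrichedFunctor V Cᵒᵖ V} {f : WeightHom W₁ W₃}
    {g : WeightHom W₂ W₃} (h : WeightHom W W₁) (k : WeightHom W W₂)
    (w : ∀ c, h.app c ≫ f.app c = k.app c ≫ g.app c) : WeightHom W (pullbackWeight f g) where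
  app c := pullback.lift (h.app c) (k.app c) (w c)
  naturality c c' := by
    apply pullback.hom_ext
    · rw [Category.assoc, Category.assoc, pullback.lift_fst, weightAct_pullbackWeight_fst,
        h.naturality, ← comp_whiskerRight_assoc, pullback.lift_fst]
    · rw [Category.assoc, Category.assoc, pullback.lift_snd, weightAct_pullbackWeight_snd,
        k.naturality, ← comp_whiskerRight_assoc, pullback.lift_snd]

lemma WeightHom.lift_fst [HasPullbacks V] {W W₁ W₂ W₃ : EnrichedFunctor V Cᵒᵖ V}
    {f : WeightHom W₁ W₃} {g : WeightHom W₂ W₃} (h : WeightHom W W₁) (k : WeightHom W W₂)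
    (w : ∀ c, h.app c ≫ f.app c = k.app c ≫ g.app c) (c : C) :
    (WeightHom.lift h k w).app c ≫ pullback.fst (f.app c) (g.app c) = h.app c :=
  pullback.lift_fst _ _ _

lemma WeightHom.lift_snd [HasPullbacks V] {W W₁ W₂ W₃ : EnrichedFunctor V Cᵒᵖ V}
    {f : WeightHom W₁ W₃} {g : WeightHom W₂ W₃} (h : WeightHom W W₁) (k : WeightHom W W₂)
    (w : ∀ c, h.app c ≫ f.app c = k.app c ≫ g.app c) (c : C) :
    (WeightHom.lift h k w).app c ≫ pullback.snd (f.app c) (g.app c) = k.app c :=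
  pullback.lift_snd _ _ _

/-- Evaluation `[A, N] ⊗ A ⟶ N`. -/
def evRight (A N : V) : (ihom A).obj N ⊗ A ⟶ N := (β_ _ _).hom ≫ (ihom.ev A).app N

/-- The morphism `Z ⟶ [A, N]` corresponding to `Z ⊗ A ⟶ N`. -/
def curryRight {Z A N : V} (f : Z ⊗ A ⟶ N) : Z ⟶ (ihom A).obj N :=
  MonoidalClosed.curry ((β_ _ _).hom ≫ f)

@[simp]
lemma curryRight_evRight {Z A N : V} (f : Z ⊗ A ⟶ N) : curryRight f ▷ A ≫ evRight A N = f := by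
  rw [evRight, BraidedCategory.braiding_naturality_left_assoc, curryRight,
    ← MonoidalClosed.uncurry_eq, MonoidalClosed.uncurry_curry, SymmetricCategory.symmetry_assoc]

@[simp]
lemma curryRight_evRight_assoc {Z A N N' : V} (f : Z ⊗ A ⟶ N) (g : N ⟶ N') :
    curryRight f ▷ A ≫ evRight A N ≫ g = f ≫ g := by
  rw [← Category.assoc, curryRight_evRight]

lemma hom_ext_evRight {Z A N : V} {f g : Z ⟶ (ihom A).obj N}
    (h : f ▷ A ≫ evRight A N = g ▷ A ≫ evRight A N) : f = g := by
  apply MonoidalClosed.uncurry_injective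
  rwa [evRight, BraidedCategory.braiding_naturality_left_assoc,
    BraidedCategory.braiding_naturality_left_assoc, cancel_epi, ← MonoidalClosed.uncurry_eq,
    ← MonoidalClosed.uncurry_eq] at h

/-- The weight `c ↦ [C(a, c), N]`, the value at `N` of the right adjoint of evaluation at `a`. -/
abbrev coinducedWeight (a : C) (N : V) : EnrichedFunctor V Cᵒᵖ V :=
  weightMk (fun c ↦ (ihom (a ⟶[V] c)).obj N)
    (fun c c' ↦ curryRight ((α_ _ _ _).hom ≫ _ ◁ eCompRev V a c c' ≫ evRight _ N))
    (fun c ↦ by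
      have h := id_eCompRev V a c
      rw [Iso.inv_comp_eq, Category.comp_id] at h
      apply hom_ext_evRight
      rw [comp_whiskerRight_assoc, curryRight_evRight, associator_naturality_middle_assoc,
        ← MonoidalCategory.whiskerLeft_comp_assoc, h, triangle_assoc])
    (fun c c' c'' ↦ by
      have h := eCompRev_assoc V a c c' c''
      apply hom_ext_evRight
      simp only [comp_whiskerRight, Category.assoc, curryRight_evRight]
      rw [associator_naturality_middle_assoc, ← MonoidalCategory.whiskerLeft_comp_assoc, h,
        associator_naturality_left_assoc, ← whisker_exchange_assoc, curryRight_evRight]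
      simp)

/-- The morphism of weights `W ⟶ [C(a, -), N]` corresponding to `W a ⟶ N`. -/
def coinducedHom (W : EnrichedFunctor V Cᵒᵖ V) (a : C) {N : V} (f : W.obj (op a) ⟶ N) :
    WeightHom W (coinducedWeight a N) where
  app c := curryRight (weightAct W a c ≫ f)
  naturality c c' := by
    rw [weightAct_weightMk]
    apply hom_ext_evRight
    simp only [comp_whiskerRight, Category.assoc, curryRight_evRight]
    rw [associator_naturality_left_assoc, ← whisker_exchange_assoc, curryRight_evRight,
      reassoc_of% (weightAct_comp W a c c'), Iso.hom_inv_id_assoc]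

/-- The morphism of weights `[C(a, -), N] ⟶ [C(a, -), N']` induced by a morphism `N ⟶ N'`. -/
def coinducedMap (a : C) {N N' : V} (p : N ⟶ N') :
    WeightHom (coinducedWeight (V := V) a N) (coinducedWeight a N') where
  app c := curryRight (evRight _ N ≫ p)
  naturality c c' := by
    rw [weightAct_weightMk, weightAct_weightMk]
    apply hom_ext_evRight
    simp only [comp_whiskerRight, Category.assoc, curryRight_evRight]
    rw [curryRight_evRight_assoc, associator_naturality_left_assoc, ← whisker_exchange_assoc,
      curryRight_evRight]
    simp

/-- Projectively cofibrant weights over locally flat categories are pointwise cofibrant. -/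
lemma isCofibrant_of_isProjectivelyCofibrant [ModelCategory V]
    (hC : LocallyFlat C (curriedTensor V)) {W : EnrichedFunctor V Cᵒᵖ V}
    (hW : IsProjectivelyCofibrant W) (a : C) : IsCofibrant (W.obj (op a)) := by
  rw [isCofibrant_iff]
  refine cofibration_of_hasLiftingProperty _ fun Z B p hp hp' ↦ ⟨fun {t b} hsq ↦ ?_⟩
  obtain ⟨g, hg⟩ := hW (coinducedMap (C := C) a p) (fun c ↦
    trivialFibration_of_hasLiftingProperty _ fun K L i hi ↦ ⟨fun {t' b'} hsq' ↦ by
      have : Cofibration ((a ⟶[V] c) ◁ i) := (hC a c i hi).1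
      have e := congrArg (fun t ↦ (β_ _ _).hom ≫ t ▷ _ ≫ evRight _ B) hsq'.w
      simp only [comp_whiskerRight, Category.assoc, coinducedMap, curryRight_evRight] at e
      have hsq₂ : CommSq ((β_ _ _).hom ≫ t' ▷ _ ≫ evRight _ Z) ((a ⟶[V] c) ◁ i) p
          ((β_ _ _).hom ≫ b' ▷ _ ≫ evRight _ B) := ⟨by simpa using e⟩
      refine ⟨⟨curryRight ((β_ _ _).hom ≫ hsq₂.lift), hom_ext_evRight ?_, hom_ext_evRight ?_⟩⟩
      · rw [comp_whiskerRight, Category.assoc, curryRight_evRight,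
          BraidedCategory.braiding_naturality_left_assoc, hsq₂.fac_left,
          SymmetricCategory.symmetry_assoc]
      · rw [comp_whiskerRight, Category.assoc, coinducedMap, curryRight_evRight,
          curryRight_evRight_assoc, Category.assoc, hsq₂.fac_right,
          SymmetricCategory.symmetry_assoc]⟩) (coinducedHom W a b)
  refine ⟨⟨(ρ_ _).inv ≫ W.obj (op a) ◁ eId V a ≫ (g.app a) ▷ _ ≫ evRight _ Z,
    initialIsInitial.hom_ext _ _, ?_⟩⟩
  have h := congrArg (fun t ↦ t ▷ _ ≫ evRight _ B) (hg a)
  simp only [comp_whiskerRight, Category.assoc] at h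
  rw [coinducedHom, coinducedMap, curryRight_evRight, curryRight_evRight] at h
  simp only [Category.assoc]
  rw [h, reassoc_of% (weightAct_id W a), Iso.inv_hom_id_assoc]

end WeightConstructions

section Diagrams

variable {V : Type u₁} [Category.{v} V] [MonoidalCategory V] [SymmetricCategory V]
  {C : Type u} [EnrichedCategory V C]
  {M : Type u₂} [Category.{v} M] [EnrichedOrdinaryCategory V M] [Tensored V M]

open Tensored

/-- The diagram with given left action of `C`. -/
abbrev diagramMk (obj : C → M) (act : ∀ c c' : C, (c ⟶[V] c') ⊙ₗ obj c ⟶ obj c')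
    (act_id : ∀ c, (λₗ[V] (obj c)).inv ≫ eId V c ⊵ₗ obj c ≫ act c c = 𝟙 _)
    (act_comp : ∀ c c' c'', eCompRev V c c' c'' ⊵ₗ obj c ≫ act c c'' =
      (αₗ _ _ _).hom ≫ _ ⊴ₗ act c c' ≫ act c' c'') : EnrichedFunctor V C M where
  obj := obj
  map c c' := hatEquiv _ _ _ (act c c')
  map_id c := by
    rw [← hatEquiv_mapLeft]
    have h := act_id c
    rw [Iso.inv_comp_eq, Category.comp_id] at h
    rw [h]
    exact hat_unhat _
  map_comp c c' c'' := by
    have e : eComp V c c' c'' = (β_ _ _).hom ≫ eCompRev V c c' c'' := by simp [eCompRev]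
    rw [e, Category.assoc, ← hatEquiv_mapLeft, act_comp]
    refine (congrArg ((β_ _ _).hom ≫ ·) (hat_assocHom _ _ _)).trans ?_
    refine (congrArg (fun t ↦ _ ≫ (t ⊗ₘ _) ≫ _) (hat_mapRight _ _ _)).trans ?_
    refine (congrArg (fun t ↦ _ ≫ t) (eCompRev_middle _ _ _)).trans ?_
    change (β_ _ _).hom ≫ (hatEquiv _ _ _ _ ⊗ₘ hatEquiv _ _ _ _) ≫ _ = _
    simp [eCompRev]

lemma diagramAct_diagramMk (obj : C → M) (act : ∀ c c' : C, (c ⟶[V] c') ⊙ₗ obj c ⟶ obj c')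
    (act_id : ∀ c, (λₗ[V] (obj c)).inv ≫ eId V c ⊵ₗ obj c ≫ act c c = 𝟙 _)
    (act_comp : ∀ c c' c'', eCompRev V c c' c'' ⊵ₗ obj c ≫ act c c'' =
      (αₗ _ _ _).hom ≫ _ ⊴ₗ act c c' ≫ act c' c'') (c c' : C) :
    diagramAct (diagramMk obj act act_id act_comp) c c' = act c c' :=
  (hatEquiv _ _ _).symm_apply_apply _

/-- Morphisms of diagrams, i.e. `V`-natural transformations. -/
structure DiagramHom (D D' : EnrichedFunctor V C M) where
  /-- the components -/
  app (c : C) : D.obj c ⟶ D'.obj c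
  naturality (c c' : C) :
    diagramAct D c c' ≫ app c' = (c ⟶[V] c') ⊴ₗ app c ≫ diagramAct D' c c'

/-- The free diagram `c ↦ C(a, c) ⊗ X`. -/
abbrev freeDiagram (a : C) (X : M) : EnrichedFunctor V C M :=
  diagramMk (fun c ↦ (a ⟶[V] c) ⊙ₗ X) (fun c c' ↦ (αₗ _ _ _).inv ≫ eCompRev V a c c' ⊵ₗ X)
    (fun c ↦ by
      have := act_left_unit _ _ _ (id_eCompRev V a c) (𝟙 ((a ⟶[V] c) ⊙ₗ X))
      simpa using this)
    (fun c c' c'' ↦ by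
      have := act_assoc _ _ _ _ (eCompRev_assoc V a c c' c'') (𝟙 (_ ⊙ₗ ((a ⟶[V] c) ⊙ₗ X)))
        (𝟙 _)
      rw [← Iso.inv_comp_eq]
      simpa using this)

lemma diagramAct_freeDiagram (a c c' : C) (X : M) :
    diagramAct (freeDiagram (V := V) a X) c c' = (αₗ _ _ _).inv ≫ eCompRev V a c c' ⊵ₗ X :=
  diagramAct_diagramMk _ _ _ _ _ _

/-- The morphism of free diagrams induced by a morphism. -/
def freeDiagramMap (a : C) {X Y : M} (f : X ⟶ Y) :
    DiagramHom (freeDiagram (V := V) a X) (freeDiagram a Y) where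
  app c := (a ⟶[V] c) ⊴ₗ f
  naturality c c' := by
    rw [diagramAct_freeDiagram, diagramAct_freeDiagram, Category.assoc, Iso.inv_comp_eq,
      ← action_exchange, tensor_actionHomRight]
    simp

end Diagrams

section Balanced

variable {V : Type u₁} [Category.{v} V] [MonoidalCategory V] [SymmetricCategory V]
  [MonoidalClosed V] {C : Type u} [EnrichedCategory V C]
  {M : Type u₂} [Category.{v} M] [EnrichedOrdinaryCategory V M] [Tensored V M]

open Tensored

lemma hatEquiv_diagramAct (D : EnrichedFunctor V C M) (c c' : C) :
    hatEquiv _ _ _ (diagramAct D c c') = D.map c c' :=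
  hat_unhat _

/-- The weight `c ↦ M(D c, E)`. -/
abbrev homWeight (D : EnrichedFunctor V C M) (E : M) : EnrichedFunctor V Cᵒᵖ V :=
  weightMk (fun c ↦ (D.obj c ⟶[V] E)) (fun c c' ↦ _ ◁ D.map c c' ≫ eCompRev V _ _ _)
    (fun c ↦ by
      rw [← MonoidalCategory.whiskerLeft_comp_assoc, D.map_id, ← cancel_epi (ρ_ _).inv,
        eCompRev_id, Iso.inv_hom_id])
    (fun c c' c'' ↦ by
      have h : eCompRev V c c' c'' ≫ D.map c c'' =
          (D.map c' c'' ⊗ₘ D.map c c') ≫ eCompRev V _ _ _ := by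
        rw [eCompRev, Category.assoc, D.map_comp, eCompRev]
        simp
      rw [← MonoidalCategory.whiskerLeft_comp_assoc, h, comp_whiskerRight_assoc,
        ← whisker_exchange_assoc, eCompRev_assoc, MonoidalCategory.tensorHom_def]
      simp)

lemma weightAct_homWeight (D : EnrichedFunctor V C M) (E : M) (c c' : C) :
    weightAct (homWeight D E) c c' = _ ◁ D.map c c' ≫ eCompRev V _ _ _ :=
  weightAct_weightMk _ _ _ _ _ _

/-- The functoriality of `c ↦ M(D c, E)` in `E`. -/
def homWeightMap (D : EnrichedFunctor V C M) {E B : M} (p : E ⟶ B) :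
    WeightHom (homWeight D E) (homWeight D B) where
  app c := eHomWhiskerLeft V _ p
  naturality c c' := by
    rw [weightAct_homWeight, weightAct_homWeight, Category.assoc, eCompRev_whiskerLeft,
      whisker_exchange_assoc]

lemma DiagramHom.map_whiskerLeft {D D' : EnrichedFunctor V C M} (f : DiagramHom D D') (c c' : C) :
    D.map c c' ≫ eHomWhiskerLeft V _ (f.app c') = D'.map c c' ≫ eHomWhiskerRight V (f.app c) _ := by
  rw [← hatEquiv_diagramAct, ← hatEquiv_diagramAct, ← hatEquiv_comp, f.naturality,
    hatEquiv_mapRight]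

/-- The functoriality of `c ↦ M(D c, E)` in `D`. -/
def homWeightPrecomp {D D' : EnrichedFunctor V C M} (f : DiagramHom D D') (E : M) :
    WeightHom (homWeight D' E) (homWeight D E) where
  app c := eHomWhiskerRight V (f.app c) E
  naturality c c' := by
    rw [weightAct_homWeight, weightAct_homWeight, Category.assoc, eCompRev_whiskerRight,
      ← MonoidalCategory.whiskerLeft_comp_assoc, ← f.map_whiskerLeft, ← whisker_exchange_assoc,
      ← eCompRev_exchange]
    simp

/-- Balanced families `W c ⊗ D c ⟶ E`. -/
structure Balanced (W : EnrichedFunctor V Cᵒᵖ V) (D : EnrichedFunctor V C M) (E : M) where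
  /-- the components -/
  app (c : C) : W.obj (op c) ⊙ₗ D.obj c ⟶ E
  balanced (c c' : C) : weightAct W c c' ⊵ₗ D.obj c ≫ app c =
    (αₗ _ _ _).hom ≫ W.obj (op c') ⊴ₗ diagramAct D c c' ≫ app c'

namespace Balanced

variable {W : EnrichedFunctor V Cᵒᵖ V} {D D' : EnrichedFunctor V C M} {E B : M}

@[ext]
lemma ext {φ ψ : Balanced W D E} (h : ∀ c, φ.app c = ψ.app c) : φ = ψ := by
  cases φ; cases ψ; congr; exact funext h

/-- Postcomposition of a balanced family. -/
@[simps] def postcomp (φ : Balanced W D E) (p : E ⟶ B) : Balanced W D B where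
  app c := φ.app c ≫ p
  balanced c c' := by simp [reassoc_of% φ.balanced c c']

/-- Precomposition of a balanced family with a morphism of diagrams. -/
@[simps] def precomp (f : DiagramHom D D') (φ : Balanced W D' E) : Balanced W D E where
  app c := W.obj (op c) ⊴ₗ f.app c ≫ φ.app c
  balanced c c' := by
    rw [← action_exchange_assoc, φ.balanced, ← actionHomRight_comp_assoc, f.naturality]
    simp

lemma hat_balanced (W : EnrichedFunctor V Cᵒᵖ V) (D : EnrichedFunctor V C M) (E : M) (c c' : C)
    (f : W.obj (op c) ⊙ₗ D.obj c ⟶ E) (f' : W.obj (op c') ⊙ₗ D.obj c' ⟶ E) :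
    weightAct W c c' ⊵ₗ D.obj c ≫ f =
      (αₗ _ _ _).hom ≫ W.obj (op c') ⊴ₗ diagramAct D c c' ≫ f' ↔
    weightAct W c c' ≫ hatEquiv _ _ _ f = (hatEquiv _ _ _ f' ⊗ₘ D.map c c') ≫ eCompRev V _ _ _ := by
  rw [← hatEquiv_diagramAct D, ← (hatEquiv _ _ _).apply_eq_iff_eq, hatEquiv_mapLeft]
  refine Eq.congr_right ((hat_assocHom _ _ _).trans ?_)
  refine (congrArg (fun t ↦ (t ⊗ₘ _) ≫ _) (hat_mapRight _ _ _)).trans ?_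
  exact eCompRev_middle _ _ _

/-- Balanced families are morphisms of weights to `c ↦ M(D c, E)`. -/
def toHom (φ : Balanced W D E) : WeightHom W (homWeight D E) where
  app c := hatEquiv _ _ _ (φ.app c)
  naturality c c' := by
    rw [weightAct_homWeight, (hat_balanced W D E c c' _ _).1 (φ.balanced c c'),
      MonoidalCategory.tensorHom_def, Category.assoc]

/-- The balanced family corresponding to a morphism of weights to `c ↦ M(D c, E)`. -/
def ofHom (ψ : WeightHom W (homWeight D E)) : Balanced W D E where
  app c := (hatEquiv _ _ _).symm (ψ.app c)
  balanced c c' := by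
    have h := ψ.naturality c c'
    rw [weightAct_homWeight, ← Category.assoc, ← MonoidalCategory.tensorHom_def] at h
    rw [hat_balanced, Equiv.apply_symm_apply, Equiv.apply_symm_apply]
    exact h

/-- The balanced family `W c ⊗ C(a, c) ⊗ X ⟶ E` corresponding to a morphism `W a ⊗ X ⟶ E`. -/
@[simps] def ofFree (a : C) {X : M} (g : W.obj (op a) ⊙ₗ X ⟶ E) :
    Balanced W (freeDiagram a X) E where
  app c := (αₗ _ _ _).inv ≫ weightAct W a c ⊵ₗ X ≫ g
  balanced c c' := by
    rw [diagramAct_freeDiagram, ← Iso.inv_comp_eq]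
    have := act_assoc _ _ _ _ (show weightAct W c c' ▷ _ ≫ weightAct W a c =
      (α_ _ _ _).hom ≫ _ ◁ eCompRev V a c c' ≫ weightAct W a c' by rw [weightAct_comp]; simp)
      (𝟙 ((c ⟶[V] c') ⊙ₗ (a ⟶[V] c) ⊙ₗ X)) (𝟙 ((a ⟶[V] c) ⊙ₗ X))
    simp only [actionHomRight_id, Category.id_comp, Category.assoc] at this
    exact (by simpa only [Category.assoc] using this =≫ g)

/-- A balanced family on a free diagram is determined by the morphism `W a ⊗ X ⟶ E`. -/
lemma app_eq_ofFree (a : C) {X : M} (φ : Balanced W (freeDiagram a X) E) (c : C) :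
    φ.app c = (αₗ _ _ _).inv ≫ weightAct W a c ⊵ₗ X ≫
      W.obj (op a) ⊴ₗ ((λₗ[V] X).inv ≫ eId V a ⊵ₗ X) ≫ φ.app a := by
  have h := φ.balanced a c
  rw [diagramAct_freeDiagram] at h
  have e : weightAct W a c ⊵ₗ X ≫ W.obj (op a) ⊴ₗ ((λₗ[V] X).inv ≫ eId V a ⊵ₗ X) =
      _ ⊴ₗ ((λₗ[V] X).inv ≫ eId V a ⊵ₗ X) ≫ weightAct W a c ⊵ₗ _ :=
    (action_exchange _ _).symm
  rw [reassoc_of% e, h, tensor_actionHomRight]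
  have e' := act_right_unit (X := X) _ _ _ (eCompRev_id V a c)
  simp only [Category.assoc, Iso.inv_hom_id_assoc]
  rw [← actionHomRight_comp_assoc, e', id_actionHomLeft, actionHomRight_id, Category.id_comp]

end Balanced

variable [ModelCategory V] [ModelCategory M] [ModelEnrichedCategory V M]

/-- Lifting of balanced families on a projectively cofibrant weight. -/
lemma Balanced.exists_lift {W : EnrichedFunctor V Cᵒᵖ V} (hW : IsProjectivelyCofibrant W)
    {D D' : EnrichedFunctor V C M} (f : DiagramHom D D') (hf : ∀ c, Cofibration (f.app c))
    {E B : M} (p : E ⟶ B) (hp : Fibration p)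
    (w : (∀ c, WeakEquivalence (f.app c)) ∨ WeakEquivalence p)
    (φ : Balanced W D E) (ψ : Balanced W D' B) (h : φ.postcomp p = ψ.precomp f) :
    ∃ χ : Balanced W D' E, χ.precomp f = φ ∧ χ.postcomp p = ψ := by
  have hw (c : C) : (homWeightPrecomp f E).app c ≫ (homWeightMap D p).app c =
      (homWeightMap D' p).app c ≫ (homWeightPrecomp f B).app c := by
    simp [homWeightPrecomp, homWeightMap, eHom_whisker_exchange]
  let π : WeightHom (homWeight D' E) (pullbackWeight (homWeightMap D p) (homWeightPrecomp f B)) :=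
    WeightHom.lift (homWeightPrecomp f E) (homWeightMap D' p) hw
  have hπ (c : C) : Fibration (π.app c) ∧ WeakEquivalence (π.app c) := by
    refine trivialFibration_of_hasLiftingProperty _ fun K L j hj ↦ ⟨fun {t b} hsq ↦ ?_⟩
    have := hf c
    have H : ActLift j (f.app c) p := actLift_of_lift₃
      (ModelEnrichedCategory.pushoutProduct.lift₃ ⟨hj, hf c, hp, by tauto⟩)
    let b₁ : L ⟶ (D.obj c ⟶[V] E) :=
      b ≫ pullback.fst ((homWeightMap D p).app c) ((homWeightPrecomp f B).app c)
    let b₂ : L ⟶ (D'.obj c ⟶[V] B) :=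
      b ≫ pullback.snd ((homWeightMap D p).app c) ((homWeightPrecomp f B).app c)
    have hb : b₁ ≫ eHomWhiskerLeft V _ p = b₂ ≫ eHomWhiskerRight V (f.app c) B :=
      (Category.assoc _ _ _).trans ((b ≫= pullback.condition).trans (Category.assoc _ _ _).symm)
    have hπ₁ := WeightHom.lift_fst (homWeightPrecomp f E) (homWeightMap D' p) hw c
    have hπ₂ := WeightHom.lift_snd (homWeightPrecomp f E) (homWeightMap D' p) hw c
    have e₁ : t ≫ eHomWhiskerRight V (f.app c) E = j ≫ b₁ :=
      (t ≫= hπ₁.symm).trans (by rw [← Category.assoc, hsq.w, Category.assoc])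
    have e₂ : t ≫ eHomWhiskerLeft V _ p = j ≫ b₂ :=
      (t ≫= hπ₂.symm).trans (by rw [← Category.assoc, hsq.w, Category.assoc])
    obtain ⟨l, hl₁, hl₂, hl₃⟩ := H ((hatEquiv _ _ _).symm t)
      ((hatEquiv _ _ _).symm b₁) ((hatEquiv _ _ _).symm b₂)
      (by rw [← hatEquiv_symm_mapRight, ← hatEquiv_symm_mapLeft, e₁])
      (by rw [← hatEquiv_symm_comp, ← hatEquiv_symm_mapLeft, e₂])
      (by rw [← hatEquiv_symm_comp, ← hatEquiv_symm_mapRight, hb])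
    refine ⟨⟨hatEquiv _ _ _ l, ?_, ?_⟩⟩
    · rw [← hatEquiv_mapLeft, hl₁, Equiv.apply_symm_apply]
    · apply pullback.hom_ext
      · refine (Category.assoc _ _ _).trans ((_ ≫= hπ₁).trans ?_)
        exact (hatEquiv_mapRight _ _ _).symm.trans (by rw [hl₂, Equiv.apply_symm_apply])
      · refine (Category.assoc _ _ _).trans ((_ ≫= hπ₂).trans ?_)
        exact (hatEquiv_comp _ _).symm.trans (by rw [hl₃, Equiv.apply_symm_apply])
  have h' (c : C) := congrArg (fun t ↦ t.app c) h
  simp only [Balanced.postcomp_app, Balanced.precomp_app] at h'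
  have hφψ (c : C) : φ.toHom.app c ≫ (homWeightMap D p).app c =
      ψ.toHom.app c ≫ (homWeightPrecomp f B).app c := by
    refine (hatEquiv_comp _ _).symm.trans (Eq.trans ?_ (hatEquiv_mapRight _ _ _))
    rw [h']
  obtain ⟨g, hg⟩ := hW π hπ (WeightHom.lift φ.toHom ψ.toHom hφψ)
  have hπ₁ := WeightHom.lift_fst (homWeightPrecomp f E) (homWeightMap D' p) hw
  have hπ₂ := WeightHom.lift_snd (homWeightPrecomp f E) (homWeightMap D' p) hw
  refine ⟨Balanced.ofHom g, Balanced.ext fun c ↦ ?_, Balanced.ext fun c ↦ ?_⟩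
  · refine (hatEquiv_symm_mapRight _ _ _).symm.trans ((Equiv.symm_apply_eq _).2 ?_)
    refine (_ ≫= (hπ₁ c).symm).trans ?_
    rw [← Category.assoc, hg, WeightHom.lift_fst]
    rfl
  · refine (hatEquiv_symm_comp _ _).symm.trans ((Equiv.symm_apply_eq _).2 ?_)
    refine (_ ≫= (hπ₂ c).symm).trans ?_
    rw [← Category.assoc, hg, WeightHom.lift_snd]
    rfl

/-- The values of projectively cofibrant weights over locally flat categories are flat with respect
to cofibrations. -/
lemma cofibration_weight_tensor {W : EnrichedFunctor V Cᵒᵖ V} (hW : IsProjectivelyCofibrant W)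
    (hC : LocallyFlat C (tensorBifunctor V M)) (a : C) {X Y : M} (f : X ⟶ Y) [hf : Cofibration f] :
    Cofibration (W.obj (op a) ⊴ₗ f) := by
  refine cofibration_of_hasLiftingProperty _ fun Z B p hp hp' ↦ ⟨fun {t b} hsq ↦ ?_⟩
  obtain ⟨χ, h₁, h₂⟩ := Balanced.exists_lift hW (freeDiagramMap a f) (fun c ↦ (hC a c f hf).1) p hp
    (Or.inr hp') (.ofFree a t) (.ofFree a b) (Balanced.ext fun c ↦ by
      simp only [Balanced.postcomp_app, Balanced.precomp_app, Balanced.ofFree_app, freeDiagramMap,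
        Category.assoc, hsq.w]
      rw [← action_exchange_assoc, tensor_actionHomRight]
      simp)
  have key {Z' X' : M} (t' : W.obj (op a) ⊙ₗ X' ⟶ Z') :
      W.obj (op a) ⊴ₗ ((λₗ[V] X').inv ≫ eId V a ⊵ₗ X') ≫ (Balanced.ofFree a t').app a = t' := by
    have := act_right_unit (X := X') (eId V a) (weightAct W a a) (𝟙 _) (by simp [weightAct_id])
    rw [Balanced.ofFree_app, reassoc_of% this, id_actionHomLeft, Category.id_comp]
  refine ⟨⟨W.obj (op a) ⊴ₗ ((λₗ[V] Y).inv ≫ eId V a ⊵ₗ Y) ≫ χ.app a, ?_, ?_⟩⟩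
  · rw [← key t, ← h₁, ← actionHomRight_comp_assoc, ← act_unit_natural]
    simp [freeDiagramMap]
  · rw [← key b, ← h₂]
    simp

end Balanced

section Sing

universe t w

variable {J : Type t} [Category.{w} J] {M : Type u₂} [Category.{v} M]

/-- The presheaf `j ↦ (A j ⟶ E)`. -/
abbrev singObj (A : J ⥤ M) (E : M) : Jᵒᵖ ⥤ Type v := A.op ⋙ yoneda.obj E

/-- Functoriality of `singObj` in the second variable. -/
abbrev singPostcomp (A : J ⥤ M) {E B : M} (p : E ⟶ B) : singObj A E ⟶ singObj A B :=
  Functor.whiskerLeft A.op (yoneda.map p)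

/-- Functoriality of `singObj` in the first variable. -/
abbrev singPrecomp {A A' : J ⥤ M} (f : A ⟶ A') (E : M) : singObj A' E ⟶ singObj A E :=
  Functor.whiskerRight (NatTrans.op f) (yoneda.obj E)

lemma singPrecomp_singPostcomp {A A' : J ⥤ M} (f : A ⟶ A') {E B : M} (p : E ⟶ B) :
    singPrecomp f E ≫ singPostcomp A p = singPostcomp A' p ≫ singPrecomp f B := by
  ext j g
  exact Category.assoc _ _ _

/-- The functor `singObj A`. -/
abbrev sing (A : J ⥤ M) : M ⥤ Jᵒᵖ ⥤ Type v := yoneda ⋙ (Functor.whiskeringLeft _ _ _).obj A.op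

variable [HasCoproducts.{v} M]

/-- The bifunctor `K j · A j'`. -/
abbrev copowerBifunctor (A : J ⥤ M) (K : Jᵒᵖ ⥤ Type v) : Jᵒᵖ ⥤ J ⥤ M :=
  K ⋙ sigmaConst.flip ⋙ (Functor.whiskeringLeft _ _ _).obj A

variable [HasColimitsOfSize.{max t w, max t w} M]

/-- The universal morphism from `A j`, for an element of `K j`. -/
def copowerι (A : J ⥤ M) (K : Jᵒᵖ ⥤ Type v) (j : J) (k : K.obj (op j)) :
    A.obj j ⟶ coend (copowerBifunctor A K) :=
  Sigma.ι (fun _ : K.obj (op j) ↦ A.obj j) k ≫ coend.ι (copowerBifunctor A K) j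

lemma copowerι_naturality (A : J ⥤ M) (K : Jᵒᵖ ⥤ Type v) {i j : J} (f : i ⟶ j)
    (k : K.obj (op j)) :
    A.map f ≫ copowerι A K j k = copowerι A K i (K.map f.op k) := by
  have h := Sigma.ι (fun _ : K.obj (op j) ↦ A.obj i) k ≫=
    coend.condition (copowerBifunctor A K) f
  have e₁ : Sigma.ι (fun _ : K.obj (op j) ↦ A.obj i) k ≫
      ((copowerBifunctor A K).map f.op).app i =
      Sigma.ι (fun _ : K.obj (op i) ↦ A.obj i) (K.map f.op k) :=
    (Sigma.ι_comp_map' _ _ _).trans (Category.id_comp _)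
  have e₂ : Sigma.ι (fun _ : K.obj (op j) ↦ A.obj i) k ≫
      ((copowerBifunctor A K).obj (op j)).map f =
      A.map f ≫ Sigma.ι (fun _ : K.obj (op j) ↦ A.obj j) k :=
    Sigma.ι_map (fun _ : K.obj (op j) ↦ A.map f) k
  exact (Category.assoc _ _ _).symm.trans ((e₂.symm =≫ _).trans ((Category.assoc _ _ _).trans
    (h.symm.trans ((Category.assoc _ _ _).symm.trans (e₁ =≫ _)))))

/-- Morphisms from the coend `∫ K j · A j` are morphisms of presheaves `K ⟶ singObj A E`. -/
def copowerEquiv (A : J ⥤ M) (K : Jᵒᵖ ⥤ Type v) (E : M) :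
    (coend (copowerBifunctor A K) ⟶ E) ≃ (K ⟶ singObj A E) where
  toFun g :=
    { app j := ↾fun k ↦ copowerι A K j.unop k ≫ g
      naturality i j f := by
        ext k
        exact ((Category.assoc _ _ _).symm.trans (copowerι_naturality A K f.unop k =≫ g)).symm }
  invFun φ := coend.desc (fun j ↦ Sigma.desc fun k ↦ φ.app (op j) k) (by
    intro i j f
    refine Sigma.hom_ext _ _ fun k ↦ ?_
    have e₁ : Sigma.ι (fun _ : K.obj (op j) ↦ A.obj i) k ≫
        ((copowerBifunctor A K).map f.op).app i =
        Sigma.ι (fun _ : K.obj (op i) ↦ A.obj i) (K.map f.op k) :=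
      (Sigma.ι_comp_map' _ _ _).trans (Category.id_comp _)
    have e₂ : Sigma.ι (fun _ : K.obj (op j) ↦ A.obj i) k ≫
        ((copowerBifunctor A K).obj (op j)).map f =
        A.map f ≫ Sigma.ι (fun _ : K.obj (op j) ↦ A.obj j) k :=
      Sigma.ι_map (fun _ : K.obj (op j) ↦ A.map f) k
    refine (Category.assoc _ _ _).symm.trans ((e₁ =≫ _).trans (Eq.trans ?_
      ((e₂ =≫ _).symm.trans (Category.assoc _ _ _))))
    refine (Sigma.ι_desc _ _).trans (Eq.trans ?_ (Category.assoc _ _ _).symm)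
    refine Eq.trans ?_ (A.map f ≫= (Sigma.ι_desc (fun k ↦ φ.app (op j) k) k).symm)
    exact (ConcreteCategory.congr_hom (φ.naturality f.op) k))
  left_inv g := by
    refine coend.hom_ext fun j ↦ Sigma.hom_ext _ _ fun k ↦ ?_
    rw [coend.ι_desc]
    exact (Sigma.ι_desc _ _).trans (Category.assoc _ _ _)
  right_inv φ := by
    ext j k
    change (_ ≫ _) ≫ _ = _
    rw [Category.assoc, coend.ι_desc]
    exact Sigma.ι_desc _ _

lemma copowerEquiv_comp (A : J ⥤ M) (K : Jᵒᵖ ⥤ Type v) {E B : M}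
    (g : coend (copowerBifunctor A K) ⟶ E) (p : E ⟶ B) :
    copowerEquiv A K B (g ≫ p) = copowerEquiv A K E g ≫ singPostcomp A p := by
  ext j k
  exact (Category.assoc _ _ _).symm

instance isRightAdjoint_sing (A : J ⥤ M) : (sing A).IsRightAdjoint :=
  (Adjunction.adjunctionOfEquivLeft (G := sing A) (F_obj := fun K ↦ coend (copowerBifunctor A K))
    (fun K E ↦ copowerEquiv A K E) (fun K _ _ p g ↦ copowerEquiv_comp A K g p)).isRightAdjoint

end Sing

section BoundaryGluing

open Simplicial SSet

variable {Y : SSet.{v}} {n : ℕ}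

lemma not_surjective_of_len_lt {k : SimplexCategory} (φ : k ⟶ ⦋n⦌) (hk : k.len < n) :
    ¬ Function.Surjective φ.toOrderHom := by
  intro h
  have := SimplexCategory.epi_iff_surjective.2 h
  exact absurd (SimplexCategory.len_le_of_epi φ) (not_le.2 hk)

lemma image_len_lt {k : SimplexCategory} (φ : k ⟶ ⦋n⦌) (h : ¬ Function.Surjective φ.toOrderHom) :
    (image φ).len < n := by
  refine lt_of_le_of_ne (SimplexCategory.len_le_of_mono (image.ι φ)) fun e ↦ h ?_
  have : IsIso (image.ι φ) := (SimplexCategory.isIso_iff_of_mono _).2 e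
  rw [← SimplexCategory.epi_iff_surjective, ← image.fac φ]
  infer_instance

lemma boundary_glue_aux (y : ∀ (k : SimplexCategory) (_ : k ⟶ ⦋n⦌), k.len < n → Y.obj (op k))
    (hy : ∀ (k l : SimplexCategory) (ψ : l ⟶ k) (φ : k ⟶ ⦋n⦌) (hk : k.len < n) (hl : l.len < n),
      Y.map ψ.op (y k φ hk) = y l (ψ ≫ φ) hl)
    {k j : SimplexCategory} (φ : k ⟶ ⦋n⦌) (h : (image φ).len < n) (a : k ⟶ j) (b : j ⟶ ⦋n⦌)
    (hj : j.len < n) (hab : a ≫ b = φ) :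
    Y.map a.op (y j b hj) = Y.map (factorThruImage φ).op (y _ (image.ι φ) h) := by
  have h₁ : (image a).len < n := (SimplexCategory.len_le_of_mono (image.ι a)).trans_lt hj
  have h₂ : (image (image.ι a ≫ b)).len < n :=
    (SimplexCategory.len_le_of_epi (factorThruImage (image.ι a ≫ b))).trans_lt h₁
  have e : (factorThruImage a ≫ factorThruImage (image.ι a ≫ b)) ≫ image.ι (image.ι a ≫ b) = φ := by
    rw [Category.assoc, image.fac, image.fac_assoc, hab]
  have e₁ := image.isoStrongEpiMono_hom_comp_ι _ _ e
  have e₂ : factorThruImage φ ≫ (image.isoStrongEpiMono _ _ e).inv =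
      factorThruImage a ≫ factorThruImage (image.ι a ≫ b) := by
    rw [← cancel_mono (image.ι (image.ι a ≫ b)), Category.assoc, e,
      image.isoStrongEpiMono_inv_comp_mono, image.fac]
  have e₃ := image.isoStrongEpiMono_inv_comp_mono _ _ e
  rw [← image.fac a, op_comp, Functor.map_comp, ConcreteCategory.comp_apply, hy _ _ _ _ _ h₁]
  have : y (image a) (image.ι a ≫ b) h₁ =
      Y.map (factorThruImage (image.ι a ≫ b)).op (y _ (image.ι (image.ι a ≫ b)) h₂) := by
    rw [hy _ _ _ _ _ h₁, image.fac]
  have h₃ : y _ (image.ι φ) h = Y.map (image.isoStrongEpiMono _ _ e).inv.op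
      (y _ (image.ι (image.ι a ≫ b)) h₂) := by
    rw [hy _ _ _ _ _ h, e₃]
  rw [this, h₃, ← ConcreteCategory.comp_apply, ← ConcreteCategory.comp_apply, ← Functor.map_comp,
    ← Functor.map_comp, ← op_comp, ← op_comp, e₂]

/-- The morphism from the boundary of `Δ[n]` given by a compatible family of simplices indexed by
the morphisms `[k] ⟶ [n]` with `k < n`. -/
def boundaryDesc (y : ∀ (k : SimplexCategory) (_ : k ⟶ ⦋n⦌), k.len < n → Y.obj (op k))
    (hy : ∀ (k l : SimplexCategory) (ψ : l ⟶ k) (φ : k ⟶ ⦋n⦌) (hk : k.len < n) (hl : l.len < n),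
      Y.map ψ.op (y k φ hk) = y l (ψ ≫ φ) hl) : (∂Δ[n] : SSet.{v}) ⟶ Y where
  app k := ↾fun s ↦ Y.map (factorThruImage (stdSimplex.objEquiv s.1)).op
    (y _ (image.ι _) (image_len_lt _ s.2))
  naturality k l ψ := by
    ext s
    have := boundary_glue_aux y hy (ψ.unop ≫ stdSimplex.objEquiv s.1)
      (image_len_lt _ (((∂Δ[n] : SSet.{v}).map ψ s).2))
      (ψ.unop ≫ factorThruImage (stdSimplex.objEquiv s.1)) (image.ι _)
      (image_len_lt _ s.2) (by rw [Category.assoc, image.fac])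
    refine this.symm.trans ?_
    rw [op_comp, Functor.map_comp]
    rfl

lemma boundaryDesc_app (y : ∀ (k : SimplexCategory) (_ : k ⟶ ⦋n⦌), k.len < n → Y.obj (op k))
    (hy : ∀ (k l : SimplexCategory) (ψ : l ⟶ k) (φ : k ⟶ ⦋n⦌) (hk : k.len < n) (hl : l.len < n),
      Y.map ψ.op (y k φ hk) = y l (ψ ≫ φ) hl) {k : SimplexCategory} (φ : k ⟶ ⦋n⦌)
    (hk : k.len < n) :
    (boundaryDesc y hy).app (op k) ⟨stdSimplex.objEquiv.symm φ, not_surjective_of_len_lt φ hk⟩ =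
      y k φ hk :=
  (boundary_glue_aux y hy φ _ (𝟙 k) φ hk (Category.id_comp _)).symm.trans (by simp)

end BoundaryGluing

open Simplicial SSet in
lemma app_objEquiv_symm {X : SSet.{v}} {n : SimplexCategory} (b : stdSimplex.{v}.obj n ⟶ X)
    {k : SimplexCategory} (φ : k ⟶ n) :
    b.app (op k) (stdSimplex.objEquiv.symm φ) = X.map φ.op (SSet.yonedaEquiv b) := by
  obtain ⟨x, rfl⟩ := SSet.yonedaEquiv.symm.surjective b
  rw [Equiv.apply_symm_apply]
  exact SSet.yonedaEquiv_symm_app_objEquiv_symm x φ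

section Reedy

open Simplicial SSet

variable {M : Type u₂} [Category.{v} M] [ModelCategory M] [HasColimits M]

lemma IsReedyCofibrant.hasLiftingProperty_boundary {X : SimplexCategory ⥤ M}
    (hX : IsReedyCofibrant X) {E B : M} (p : E ⟶ B) [Fibration p] [WeakEquivalence p] (n : ℕ) :
    HasLiftingProperty (boundary.{v} n).ι (singPostcomp X p) where
  sq_hasLift {t b} hsq := by
    have : HasColimitsOfSize.{0, 0} M := hasColimitsOfSizeShrink.{0, 0, v, v} M
    have ns (f : LatchingIndex ⦋n⦌) : ¬ Function.Surjective f.obj.hom.toOrderHom := by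
      intro h
      have := f.property.1
      have := SimplexCategory.epi_iff_surjective.2 h
      exact f.property.2 (isIso_of_mono_of_epi _)
    let c : Cocone (latchingDiagram X ⦋n⦌) :=
      { pt := E
        ι := { app f := t.app (op f.obj.left) ⟨stdSimplex.objEquiv.symm f.obj.hom, ns f⟩
               naturality f g h := by
                have := ConcreteCategory.congr_hom (t.naturality h.hom.left.op)
                  ⟨stdSimplex.objEquiv.symm g.obj.hom, ns g⟩
                refine this.symm.trans (Eq.trans ?_ (Category.comp_id _).symm)
                refine congrArg (t.app (op f.obj.left)) (Subtype.ext ?_)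
                exact congrArg stdSimplex.objEquiv.symm (Over.w h.hom) } }
    have hc := hX ⦋n⦌
    have hsq' : CommSq (colimit.desc _ c) (colimit.desc (latchingDiagram X ⦋n⦌)
      { pt := X.obj ⦋n⦌
        ι := { app f := X.map f.obj.hom
               naturality f g h := by
                simp [← Functor.map_comp] } }) p (SSet.yonedaEquiv b) := by
      constructor
      refine colimit.hom_ext fun f ↦ ?_
      rw [colimit.ι_desc_assoc, colimit.ι_desc_assoc]
      exact (ConcreteCategory.congr_hom (congr_app hsq.w (op f.obj.left))
        ⟨stdSimplex.objEquiv.symm f.obj.hom, ns f⟩).trans (app_objEquiv_symm b f.obj.hom)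
    refine ⟨⟨SSet.yonedaEquiv.symm hsq'.lift, ?_, ?_⟩⟩
    · ext k ⟨s, hs⟩
      obtain ⟨φ, rfl⟩ := stdSimplex.objEquiv.symm.surjective s
      refine (SSet.yonedaEquiv_symm_app_objEquiv_symm (X := singObj X E)
        hsq'.lift φ).trans ?_
      change X.map φ ≫ hsq'.lift = _
      have hφ : (image φ).len < n := image_len_lt φ hs
      let f : LatchingIndex ⦋n⦌ := ⟨Over.mk (image.ι φ), inferInstanceAs (Mono (image.ι φ)),
        fun h : IsIso (image.ι φ) ↦ hφ.ne (SimplexCategory.len_eq_of_isIso (image.ι φ))⟩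
      have e : X.map (image.ι φ) ≫ hsq'.lift =
          t.app (op (image φ)) ⟨stdSimplex.objEquiv.symm (image.ι φ), ns f⟩ := by
        have := colimit.ι (latchingDiagram X ⦋n⦌) f ≫= hsq'.fac_left
        rwa [colimit.ι_desc_assoc, colimit.ι_desc] at this
      have e' : X.map φ ≫ hsq'.lift = X.map (factorThruImage φ) ≫
          t.app (op (image φ)) ⟨stdSimplex.objEquiv.symm (image.ι φ), ns f⟩ := by
        rw [← e, ← Functor.map_comp_assoc, image.fac]
      refine e'.trans ?_
      refine (ConcreteCategory.congr_hom (t.naturality (factorThruImage φ).op)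
        ⟨stdSimplex.objEquiv.symm (image.ι φ), ns f⟩).symm.trans ?_
      refine congrArg (t.app k) (Subtype.ext ?_)
      exact congrArg stdSimplex.objEquiv.symm (image.fac φ)
    · apply SSet.yonedaEquiv.injective
      refine (SSet.yonedaEquiv_comp _ _).trans ?_
      rw [Equiv.apply_symm_apply]
      exact hsq'.fac_right

end Reedy

section Leibniz

open Simplicial SSet

variable (M : Type u₂) [Category.{v} M]

/-- The bifunctor `(A, E) ↦ singObj A E`, for cosimplicial objects `A`. -/
abbrev singBifunctor : (SimplexCategory ⥤ M)ᵒᵖ ⥤ M ⥤ SSet.{v} where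
  obj A := sing A.unop
  map f := { app E := singPrecomp f.unop E
             naturality _ _ p := (singPrecomp_singPostcomp f.unop p).symm }

variable [HasColimits M]

instance hasColimitsOfSize_zero : HasColimitsOfSize.{0, 0} M :=
  hasColimitsOfSizeShrink.{0, 0, v, v} M

/-- The bifunctor `(A, S) ↦ A ⊗ S = ∫ S_n · A^n`, for cosimplicial objects `A` and simplicial
sets `S`. -/
def copower : (SimplexCategory ⥤ M) ⥤ SSet.{v} ⥤ M where
  obj A := (sing A).leftAdjoint
  map {A A'} f := (conjugateEquiv (.ofIsRightAdjoint (sing A')) (.ofIsRightAdjoint (sing A))).symm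
    ((singBifunctor M).map f.op)
  map_id A := by
    rw [op_id, (singBifunctor M).map_id]
    exact conjugateEquiv_symm_id _
  map_comp f g := by
    rw [op_comp, (singBifunctor M).map_comp]
    exact (conjugateEquiv_symm_comp _ _ _ _ _).symm

/-- The adjunction between `copower` and `singBifunctor`. -/
def copowerAdjunction : copower M ⊣₂ singBifunctor M where
  adj A := .ofIsRightAdjoint (sing A)
  unit_whiskerRight_map {A A'} f := by
    ext S : 2
    exact (unit_conjugateEquiv_symm (.ofIsRightAdjoint (sing A')) (.ofIsRightAdjoint (sing A))
      ((singBifunctor M).map f.op) S).symm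

instance isLeftAdjoint_copower (A : SimplexCategory ⥤ M) : ((copower M).obj A).IsLeftAdjoint :=
  ((copowerAdjunction M).adj A).isLeftAdjoint

variable {M}

/-- The isomorphism `A^n ≅ A ⊗ Δ[n]`. -/
def copowerStdSimplex (A : SimplexCategory ⥤ M) (n : SimplexCategory) :
    A.obj n ≅ ((copower M).obj A).obj (stdSimplex.{v}.obj n) where
  hom := SSet.yonedaEquiv ((copowerAdjunction M).homEquiv (𝟙 _))
  inv := (copowerAdjunction M).homEquiv.symm (SSet.yonedaEquiv.symm (𝟙 (A.obj n)))
  hom_inv_id := by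
    have h : ((copowerAdjunction M).homEquiv (𝟙 _)) ≫ singPostcomp A
      ((copowerAdjunction M).homEquiv.symm (SSet.yonedaEquiv.symm (𝟙 (A.obj n)))) = _ :=
      ((copowerAdjunction M).homEquiv_naturality_three _ _).symm
    rw [Category.id_comp, Equiv.apply_symm_apply] at h
    have h' := (SSet.yonedaEquiv_comp _ _).symm.trans (congrArg SSet.yonedaEquiv h)
    rw [Equiv.apply_symm_apply] at h'
    exact h'
  inv_hom_id := by
    apply (copowerAdjunction M).homEquiv.injective
    rw [(copowerAdjunction M).homEquiv_naturality_three, Equiv.apply_symm_apply]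
    apply SSet.yonedaEquiv.injective
    refine (SSet.yonedaEquiv_comp _ _).trans ?_
    rw [Equiv.apply_symm_apply]
    exact Category.id_comp _

lemma copowerStdSimplex_hom_natural {A A' : SimplexCategory ⥤ M} (f : A ⟶ A')
    (n : SimplexCategory) :
    (copowerStdSimplex A n).hom ≫ ((copower M).map f).app _ =
      f.app n ≫ (copowerStdSimplex A' n).hom := by
  have h := (copowerAdjunction M).homEquiv_naturality_one (X₂ := stdSimplex.{v}.obj n) f (𝟙 _)
  have h' : (copowerAdjunction M).homEquiv (𝟙 (((copower M).obj A).obj (stdSimplex.{v}.obj n))) ≫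
    singPostcomp A (((copower M).map f).app _) = _ :=
    ((copowerAdjunction M).homEquiv_naturality_three _ _).symm
  rw [Category.id_comp] at h'
  rw [Category.comp_id] at h
  exact (SSet.yonedaEquiv_comp _ _).symm.trans
    ((congrArg SSet.yonedaEquiv (h'.trans h)).trans (SSet.yonedaEquiv_comp _ _))

lemma copowerStdSimplex_hom_map (A : SimplexCategory ⥤ M) {m n : SimplexCategory} (φ : m ⟶ n) :
    (copowerStdSimplex A m).hom ≫ ((copower M).obj A).map (stdSimplex.{v}.map φ) =
      A.map φ ≫ (copowerStdSimplex A n).hom := by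
  have h' : (copowerAdjunction M).homEquiv (𝟙 (((copower M).obj A).obj (stdSimplex.{v}.obj m))) ≫
    singPostcomp A (((copower M).obj A).map (stdSimplex.{v}.map φ)) = _ :=
    ((copowerAdjunction M).homEquiv_naturality_three _ _).symm
  have h := (copowerAdjunction M).homEquiv_naturality_two (X₁ := A) (stdSimplex.{v}.map φ) (𝟙 _)
  rw [Category.id_comp] at h'
  rw [Category.comp_id] at h
  refine (SSet.yonedaEquiv_comp _ _).symm.trans ((congrArg SSet.yonedaEquiv (h'.trans h)).trans ?_)
  exact (SSet.yonedaEquiv_naturality _ _).symm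

variable [ModelCategory M]

/-- The pullback-hom `singObj A' E ⟶ singObj A E ×_{singObj A B} singObj A' B`. -/
abbrev singLeibniz {A A' : SimplexCategory ⥤ M} (f : A ⟶ A') {E B : M} (p : E ⟶ B) :=
  Functor.PullbackObjObj.ofHasPullback (singBifunctor M) f p

/-- Relative Reedy cofibrations of cosimplicial objects. -/
def IsRelativeCofibration {A A' : SimplexCategory ⥤ M} (f : A ⟶ A') : Prop :=
  ∀ ⦃E B : M⦄ (p : E ⟶ B), Fibration p → WeakEquivalence p →
    modelCategoryQuillen.I.rlp (singLeibniz f p).π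

/-- Relative trivial Reedy cofibrations of cosimplicial objects. -/
def IsRelativeTrivialCofibration {A A' : SimplexCategory ⥤ M} (f : A ⟶ A') : Prop :=
  ∀ ⦃E B : M⦄ (p : E ⟶ B), Fibration p → modelCategoryQuillen.I.rlp (singLeibniz f p).π

lemma hasLiftingProperty_of_boundary {Y Y' : SSet.{v}} {q : Y ⟶ Y'}
    (h : modelCategoryQuillen.I.rlp q) {S T : SSet.{v}} (i : S ⟶ T) [Mono i] :
    HasLiftingProperty i q := by
  rw [← rlp_monomorphisms] at h
  exact h i (MorphismProperty.monomorphisms.infer_property i)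

lemma hasLiftingProperty_of_hasDimensionLT {Y Y' : SSet.{v}} {q : Y ⟶ Y'} {n : ℕ}
    (h : ∀ k < n, HasLiftingProperty (boundary.{v} k).ι q) (T : SSet.{v}) [T.HasDimensionLT n] :
    HasLiftingProperty (Subcomplex.ι (⊥ : T.Subcomplex)) q := by
  let I' : MorphismProperty SSet.{v} := .ofHoms (fun k : Fin n ↦ (boundary.{v} k.1).ι)
  have hq : I'.rlp q := by
    rintro _ _ _ ⟨k⟩
    exact h k.1 k.2
  have hc (c : (relativeCellComplex T).Cells) : I' (boundary.{v} c.j).ι :=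
    MorphismProperty.ofHoms.mk (f := fun k : Fin n ↦ (boundary.{v} k.1).ι)
      ⟨c.j, dim_lt_of_nonDegenerate T ⟨c.k.simplex, c.k.nonDegenerate⟩ n⟩
  exact MorphismProperty.transfiniteCompositionsOfShape_pushouts_coproducts_le_llp_rlp.{v} I' ℕ _
    ⟨(relativeCellComplex T).transfiniteCompositionOfShape' hc⟩ _ hq

lemma IsRelativeCofibration.hasLiftingProperty_map_app {A A' : SimplexCategory ⥤ M} (f : A ⟶ A')
    {E B : M} (p : E ⟶ B) (S : SSet.{v})
    (h : HasLiftingProperty (Subcomplex.ι (⊥ : S.Subcomplex)) (singLeibniz f p).π) :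
    HasLiftingProperty (((copower M).map f).app S) p :=
  ((copowerAdjunction M).hasLiftingProperty_iff (Functor.PushoutObjObj.ofIsInitialRight
    (copower M) f _ Subcomplex.isInitialBot) (singLeibniz f p)).2 h

/-- Relative Reedy cofibrations that are levelwise weak equivalences are trivial. -/
lemma IsRelativeCofibration.isRelativeTrivialCofibration {A A' : SimplexCategory ⥤ M} {f : A ⟶ A'}
    (hf : IsRelativeCofibration f) (w : ∀ n, WeakEquivalence (f.app n)) :
    IsRelativeTrivialCofibration f := by
  suffices H : ∀ (n : ℕ) ⦃E B : M⦄ (p : E ⟶ B), Fibration p →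
      HasLiftingProperty (boundary.{v} n).ι (singLeibniz f p).π by
    rintro E B p hp _ _ _ ⟨n⟩
    exact H n p hp
  intro n
  induction n using Nat.strong_induction_on with
  | _ n ih =>
    intro E B p hp
    let sq := Functor.PushoutObjObj.ofHasPushout (copower M) f (boundary.{v} n).ι
    refine ((copowerAdjunction M).hasLiftingProperty_iff sq (singLeibniz f p)).1 ?_
    have h₁ : Cofibration sq.ι := cofibration_of_hasLiftingProperty _ fun Z B p hp hp' ↦
      ((copowerAdjunction M).hasLiftingProperty_iff sq (singLeibniz f p)).2
        (hf p hp hp' _ (modelCategoryQuillen.boundary_ι_mem_I n))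
    have h₂ := trivialCofibration_of_hasLiftingProperty
      (((copower M).map f).app (boundary.{v} n : SSet.{v}))
      fun Z B p hp ↦ IsRelativeCofibration.hasLiftingProperty_map_app f p _
        (hasLiftingProperty_of_hasDimensionLT (n := n) (fun k hk ↦ ih k hk p hp) _)
    have h₃ : WeakEquivalence sq.inr := by
      have := h₂.1
      have := h₂.2
      have : trivialCofibrations M sq.inr := MorphismProperty.of_isPushout sq.isPushout.flip
        (mem_trivialCofibrations _)
      exact ((mem_trivialCofibrations_iff _).1 this).2
    have h₄ : WeakEquivalence (((copower M).map f).app (stdSimplex.{v}.obj ⦋n⦌)) := by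
      have e := copowerStdSimplex_hom_natural f ⦋n⦌
      have := w ⦋n⦌
      rw [← weakEquivalence_precomp_iff (copowerStdSimplex A ⦋n⦌).hom, e]
      infer_instance
    have h₅ : WeakEquivalence sq.ι := by
      rw [← sq.inr_ι] at h₄
      exact (weakEquivalence_precomp_iff _ _).1 h₄
    infer_instance

end Leibniz

section Kan

open Simplicial SSet

variable {M : Type u₂} [Category.{v} M] [HasColimits M] [ModelCategory M]

/-- Monomorphisms of simplicial sets with the left lifting property with respect to all
`singPostcomp A p` with `p` a fibration. -/
def IsAcyclicFor (A : SimplexCategory ⥤ M) {S T : SSet.{v}} (i : S ⟶ T) : Prop :=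
  ∀ ⦃E B : M⦄ (p : E ⟶ B), Fibration p → HasLiftingProperty i (singPostcomp A p)

/-- Cosimplicial objects for which `singObj A` sends trivial fibrations to trivial Kan
fibrations. -/
def IsCofibrantCosimplicial (A : SimplexCategory ⥤ M) : Prop :=
  ∀ ⦃E B : M⦄ (p : E ⟶ B), Fibration p → WeakEquivalence p →
    modelCategoryQuillen.I.rlp (singPostcomp A p)

lemma IsReedyCofibrant.isCofibrantCosimplicial {A : SimplexCategory ⥤ M}
    (hA : IsReedyCofibrant A) : IsCofibrantCosimplicial A := by
  rintro E B p hp hp' _ _ _ ⟨n⟩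
  exact hA.hasLiftingProperty_boundary p n

variable {A : SimplexCategory ⥤ M}

lemma hasLiftingProperty_copower_map_iff {S T : SSet.{v}} (i : S ⟶ T) {E B : M} (p : E ⟶ B) :
    HasLiftingProperty (((copower M).obj A).map i) p ↔ HasLiftingProperty i (singPostcomp A p) :=
  ((copowerAdjunction M).adj A).hasLiftingProperty_iff i p

lemma IsCofibrantCosimplicial.cofibration_map (hA : IsCofibrantCosimplicial A) {S T : SSet.{v}}
    (i : S ⟶ T) [Mono i] : Cofibration (((copower M).obj A).map i) :=
  cofibration_of_hasLiftingProperty _ fun _ _ p hp hp' ↦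
    (hasLiftingProperty_copower_map_iff i p).2 (hasLiftingProperty_of_boundary (hA p hp hp') i)

lemma IsCofibrantCosimplicial.isAcyclicFor_iff (hA : IsCofibrantCosimplicial A) {S T : SSet.{v}}
    (i : S ⟶ T) [Mono i] : IsAcyclicFor A i ↔ WeakEquivalence (((copower M).obj A).map i) := by
  refine ⟨fun h ↦ (trivialCofibration_of_hasLiftingProperty _ fun _ _ p hp ↦
    (hasLiftingProperty_copower_map_iff i p).2 (h p hp)).2, fun h E B p hp ↦ ?_⟩
  have := hA.cofibration_map i
  rw [← hasLiftingProperty_copower_map_iff]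
  infer_instance

lemma IsAcyclicFor.comp {S T U : SSet.{v}} {i : S ⟶ T} {j : T ⟶ U} (hi : IsAcyclicFor A i)
    (hj : IsAcyclicFor A j) : IsAcyclicFor A (i ≫ j) := fun E B p hp ↦ by
  have := hi p hp
  have := hj p hp
  infer_instance

lemma IsAcyclicFor.of_isPushout {S T S' T' : SSet.{v}} {i : S ⟶ T} {f : S ⟶ S'} {g : T ⟶ T'}
    {i' : S' ⟶ T'} (h : IsPushout f i i' g) (hi : IsAcyclicFor A i) : IsAcyclicFor A i' :=
  fun E B p hp ↦ by
    have := hi p hp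
    exact h.hasLiftingProperty (singPostcomp A p)

lemma IsCofibrantCosimplicial.isAcyclicFor_of_comp (hA : IsCofibrantCosimplicial A)
    {S T U : SSet.{v}} {i : S ⟶ T} {j : T ⟶ U} [Mono i] [Mono j] (hi : IsAcyclicFor A i)
    (hij : IsAcyclicFor A (i ≫ j)) : IsAcyclicFor A j := by
  rw [hA.isAcyclicFor_iff] at hi hij ⊢
  rw [Functor.map_comp] at hij
  exact (weakEquivalence_precomp_iff _ _).1 hij

lemma IsCofibrantCosimplicial.isAcyclicFor_stdSimplex (hA : IsCofibrantCosimplicial A)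
    (w : ∀ ⦃m n : SimplexCategory⦄ (φ : m ⟶ n), WeakEquivalence (A.map φ))
    {S T : SSet.{v}} {m n : SimplexCategory} (e : stdSimplex.{v}.obj m ≅ S)
    (e' : stdSimplex.{v}.obj n ≅ T) (i : S ⟶ T) [Mono i] : IsAcyclicFor A i := by
  rw [hA.isAcyclicFor_iff]
  let φ : m ⟶ n := stdSimplex.objEquiv (SSet.yonedaEquiv (e.hom ≫ i ≫ e'.inv))
  have hφ : e.hom ≫ i = stdSimplex.{v}.map φ ≫ e'.hom := by
    rw [← Iso.comp_inv_eq, Category.assoc]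
    apply SSet.yonedaEquiv.injective
    rw [SSet.yonedaEquiv_map]
    exact (Equiv.symm_apply_apply _ _).symm
  have hw : WeakEquivalence (((copower M).obj A).map (stdSimplex.{v}.map φ)) := by
    have := w φ
    rw [← weakEquivalence_precomp_iff (copowerStdSimplex A m).hom, copowerStdSimplex_hom_map]
    infer_instance
  rw [← weakEquivalence_precomp_iff (((copower M).obj A).map e.hom), ← Functor.map_comp, hφ,
    Functor.map_comp]
  infer_instance

/-- A face of a standard simplex is a standard simplex. -/
lemma exists_iso_face {n : ℕ} (S : Finset (Fin (n + 1))) (hS : S.Nonempty) :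
    ∃ m : ℕ, Nonempty (stdSimplex.{v}.obj ⦋m⦌ ≅ (stdSimplex.face S : SSet.{v})) := by
  obtain ⟨m, hm⟩ := Nat.exists_eq_succ_of_ne_zero (Finset.card_pos.2 hS).ne'
  exact ⟨m, ⟨stdSimplex.isoOfRepresentableBy
    (stdSimplex.faceRepresentableBy S m (S.orderIsoOfFin hm))⟩⟩

/-- The union of the faces `R ∩ T` of `Δ[n]` for `T` in a list. -/
def unionFaces {n : ℕ} (R : Finset (Fin (n + 1))) (l : List (Finset (Fin (n + 1)))) :
    (Δ[n] : SSet.{v}).Subcomplex :=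
  l.foldr (fun T U ↦ stdSimplex.face (R ⊓ T) ⊔ U) ⊥

lemma face_inter_unionFaces {n : ℕ} (S R : Finset (Fin (n + 1)))
    (l : List (Finset (Fin (n + 1)))) :
    stdSimplex.face.{v} S ⊓ unionFaces R l = unionFaces (S ⊓ R) l := by
  induction l with
  | nil => simp [unionFaces]
  | cons T l ih =>
    change _ ⊓ (_ ⊔ unionFaces R l) = _ ⊔ unionFaces (S ⊓ R) l
    rw [← ih, inf_assoc, show stdSimplex.face.{v} (S ⊓ (R ⊓ T)) = stdSimplex.face S ⊓ stdSimplex.face (R ⊓ T)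
      from (stdSimplex.face_inter_face _ _).symm]
    ext m x
    exact and_or_left

lemma face_singleton_le {n : ℕ} {k : Fin (n + 1)} {S : Finset (Fin (n + 1))} (hS : k ∈ S) :
    stdSimplex.face.{v} {k} ≤ stdSimplex.face S := by
  rw [stdSimplex.face_le_face_iff]
  simpa using hS

lemma IsCofibrantCosimplicial.isAcyclicFor_union (hA : IsCofibrantCosimplicial A)
    (w : ∀ ⦃m n : SimplexCategory⦄ (φ : m ⟶ n), WeakEquivalence (A.map φ)) {n : ℕ}
    (k : Fin (n + 1)) (l : List (Finset (Fin (n + 1)))) : ∀ (R S : Finset (Fin (n + 1)))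
    (_ : k ∈ R) (_ : k ∈ S) (_ : ∀ T ∈ l, k ∈ T) (U : (Δ[n] : SSet.{v}).Subcomplex)
    (_ : U = stdSimplex.face S ⊔ unionFaces R l) (h : stdSimplex.face {k} ≤ U),
    IsAcyclicFor A (Subcomplex.homOfLE h) := by
  have base (S T : Finset (Fin (n + 1))) (hS : k ∈ S) (hT : k ∈ T)
      (h : stdSimplex.face.{v} S ≤ stdSimplex.face T) :
      IsAcyclicFor A (Subcomplex.homOfLE h) := by
    obtain ⟨a, ⟨e⟩⟩ := exists_iso_face.{v} S ⟨k, hS⟩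
    obtain ⟨b, ⟨e'⟩⟩ := exists_iso_face.{v} T ⟨k, hT⟩
    exact hA.isAcyclicFor_stdSimplex w e e' _
  induction l with
  | nil =>
    intro R S _ hS _ U hU h
    have : U = stdSimplex.face S := hU.trans (sup_bot_eq _)
    subst this
    exact base {k} S (by simp) hS h
  | cons T l ih =>
    intro R S hR hS hl U hU h
    have hT : k ∈ T := hl T (by simp)
    have hl' : ∀ T' ∈ l, k ∈ T' := fun T' h ↦ hl T' (by simp [h])
    let W : (Δ[n] : SSet.{v}).Subcomplex := unionFaces R (T :: l)
    have hkW : stdSimplex.face {k} ≤ W :=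
      (face_singleton_le (Finset.mem_inter.2 ⟨hR, hT⟩)).trans
        (le_sup_left : _ ≤ stdSimplex.face (R ⊓ T) ⊔ unionFaces R l)
    have sq : Lattice.BicartSq (stdSimplex.face S ⊓ W) (stdSimplex.face S) W U :=
      { sup_eq := hU.symm
        inf_eq := rfl }
    have hk : stdSimplex.face {k} ≤ stdSimplex.face S ⊓ W := le_inf (face_singleton_le hS) hkW
    have h₁ : IsAcyclicFor A (Subcomplex.homOfLE hk) :=
      ih (S ⊓ R) (S ⊓ (R ⊓ T)) (by simp_all) (by simp_all) hl' _
        ((face_inter_unionFaces S R (T :: l)).trans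
          (by rw [← inf_assoc]; rfl)) hk
    have h₂ : IsAcyclicFor A (Subcomplex.homOfLE (face_singleton_le.{v} hS)) :=
      base {k} S (by simp) hS _
    have h₃ : IsAcyclicFor A (Subcomplex.homOfLE hkW) :=
      ih R (R ⊓ T) hR (by simp_all) hl' _ rfl hkW
    have h₄ : IsAcyclicFor A (Subcomplex.homOfLE sq.le₁₂) :=
      hA.isAcyclicFor_of_comp h₁ h₂
    exact h₃.comp (h₄.of_isPushout (Subcomplex.BicartSq.isPushout sq).flip)

lemma IsCofibrantCosimplicial.fibration_singPostcomp (hA : IsCofibrantCosimplicial A)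
    (w : ∀ ⦃m n : SimplexCategory⦄ (φ : m ⟶ n), WeakEquivalence (A.map φ)) {E B : M} (p : E ⟶ B)
    [hp : Fibration p] : modelCategoryQuillen.J.rlp (singPostcomp A p) := by
  intro _ _ i hi
  simp only [modelCategoryQuillen.J, MorphismProperty.iSup_iff] at hi
  obtain ⟨n, ⟨k⟩⟩ := hi
  obtain ⟨j, hj⟩ := exists_ne k
  let l := ((Finset.univ.filter (· ≠ k)).toList.map fun j ↦ ({j}ᶜ : Finset (Fin (n + 2))))
  have hU : horn.{v} (n + 1) k = stdSimplex.face {j}ᶜ ⊔ unionFaces ⊤ l := by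
    have H (l : List (Finset (Fin (n + 2)))) (U : (Δ[n + 1] : SSet.{v}).Subcomplex) :
        unionFaces ⊤ l ≤ U ↔ ∀ T ∈ l, stdSimplex.face T ≤ U := by
      induction l with
      | nil => simp [unionFaces]
      | cons T l ih =>
        rw [List.forall_mem_cons, ← ih, ← sup_le_iff]
        nth_rw 2 [← top_inf_eq T]
        rfl
    refine le_antisymm ?_ (sup_le (face_le_horn _ _ hj) ((H _ _).2 ?_))
    · rw [horn_eq_iSup, iSup_le_iff]
      rintro ⟨j', hj'⟩
      refine le_trans ?_ le_sup_right
      exact (H _ _).1 le_rfl _ (List.mem_map.2 ⟨j', by simpa using hj', rfl⟩)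
    · intro T hT
      obtain ⟨j', hj', rfl⟩ := List.mem_map.1 hT
      exact face_le_horn _ _ (by simpa using hj')
  have hk : stdSimplex.face.{v} {k} ≤ horn (n + 1) k :=
    (face_singleton_le (by simpa using hj.symm)).trans (face_le_horn j k hj)
  have h₁ := hA.isAcyclicFor_union w k l ⊤ {j}ᶜ (by simp) (by simpa using hj.symm)
    (fun T hT ↦ by
      obtain ⟨j', hj', rfl⟩ := List.mem_map.1 hT
      simp only [Finset.mem_toList, Finset.mem_filter] at hj'
      simpa using hj'.2.symm) _ hU hk
  obtain ⟨a, ⟨e⟩⟩ := exists_iso_face.{v} {k} ⟨k, by simp⟩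
  exact hA.isAcyclicFor_of_comp h₁
    (hA.isAcyclicFor_stdSimplex w (n := ⦋n + 1⦌) e (Iso.refl _) _) p hp

end Kan

section Cylinder

open Simplicial SSet

/-- The inclusion of an end of the cylinder. -/
def cylInc (k : Fin 2) (S : SSet.{v}) : S ⟶ Δ[1] ⊗ S :=
  CartesianMonoidalCategory.lift (SSet.const (stdSimplex.obj₀Equiv.symm k)) (𝟙 S)

lemma cylInc_natural (k : Fin 2) {S T : SSet.{v}} (f : S ⟶ T) :
    cylInc k S ≫ Δ[1] ◁ f = f ≫ cylInc k T := by
  ext : 1 <;> simp [cylInc]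

/-- All the simplices of a subcomplex of `Δ[1]` are constant. -/
def ConstSimplices (K : (Δ[1] : SSet.{v}).Subcomplex) : Prop :=
  ∀ (n : SimplexCategory) (x : (Δ[1] : SSet.{v}).obj (op n)), x ∈ K.obj (op n) →
    ∀ i j, (stdSimplex.objEquiv x).toOrderHom i = (stdSimplex.objEquiv x).toOrderHom j

lemma constSimplices_horn (k : Fin 2) : ConstSimplices (horn.{v} 1 k) := by
  intro n x hx i j
  by_contra h
  refine hx (Set.eq_univ_of_univ_subset fun l _ ↦ Or.inl ?_)
  have : ∀ a b k : Fin 2, a ≠ b → a = k ∨ b = k := by decide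
  rcases this _ _ l h with h | h
  exacts [⟨i, h⟩, ⟨j, h⟩]

/-- The morphism defined on `K ⊗ S` by morphisms `b k` on `S` for every vertex `k`, for a
subcomplex `K` of `Δ[1]` whose simplices are constant. -/
def constDesc {K : (Δ[1] : SSet.{v}).Subcomplex} (hK : ConstSimplices K)
    {S X : SSet.{v}} (b : Fin 2 → (S ⟶ X)) : (K : SSet.{v}) ⊗ S ⟶ X where
  app n := ↾fun x ↦ (b ((stdSimplex.objEquiv x.1.1).toOrderHom 0)).app n x.2
  naturality m n f := by
    ext ⟨⟨x, hx⟩, s⟩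
    have h : (stdSimplex.objEquiv ((Δ[1] : SSet.{v}).map f x)).toOrderHom 0 =
      (stdSimplex.objEquiv x).toOrderHom 0 := hK _ x hx _ _
    change (b ((stdSimplex.objEquiv ((Δ[1] : SSet.{v}).map f x)).toOrderHom 0)).app n (S.map f s) =
      X.map f ((b ((stdSimplex.objEquiv x).toOrderHom 0)).app m s)
    rw [h]
    exact ConcreteCategory.congr_hom ((b _).naturality f) s

/-- A vertex of a subcomplex. -/
def IsVertex (K : (Δ[1] : SSet.{v}).Subcomplex) (k : Fin 2) : Prop :=
  stdSimplex.obj₀Equiv.symm k ∈ K.obj (op ⦋0⦌)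

lemma mem_of_isVertex {K : (Δ[1] : SSet.{v}).Subcomplex} {k : Fin 2} (hk : IsVertex K k)
    (n : SimplexCategory) : (Δ[1] : SSet.{v}).map (n.const ⦋0⦌ 0).op
      (stdSimplex.obj₀Equiv.symm k) ∈ K.obj (op n) :=
  K.map _ hk

/-- The inclusion of an end, with values in `K ⊗ S`. -/
def subInc {K : (Δ[1] : SSet.{v}).Subcomplex} {k : Fin 2} (hk : IsVertex K k) (S : SSet.{v}) :
    S ⟶ (K : SSet.{v}) ⊗ S where
  app n := ↾fun s ↦ ⟨⟨_, mem_of_isVertex hk n.unop⟩, s⟩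
  naturality m n f := by
    ext s
    refine Prod.ext (Subtype.ext ?_) rfl
    exact (ConcreteCategory.congr_hom (((SSet.const (stdSimplex.obj₀Equiv.symm k) :
      S ⟶ Δ[1])).naturality f) s)

lemma subInc_ι {K : (Δ[1] : SSet.{v}).Subcomplex} {k : Fin 2} (hk : IsVertex K k) (S : SSet.{v}) :
    subInc hk S ≫ K.ι ▷ S = cylInc k S := rfl

lemma subInc_constDesc {K : (Δ[1] : SSet.{v}).Subcomplex} (hK : ConstSimplices K) {k : Fin 2}
    (hk : IsVertex K k) {S X : SSet.{v}} (b : Fin 2 → (S ⟶ X)) :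
    subInc hk S ≫ constDesc hK b = b k := by
  ext n s
  rfl

lemma hom_ext_of_constSimplices {K : (Δ[1] : SSet.{v}).Subcomplex} (hK : ConstSimplices K)
    {S X : SSet.{v}} {f g : (K : SSet.{v}) ⊗ S ⟶ X}
    (h : ∀ (k : Fin 2) (hk : IsVertex K k), subInc hk S ≫ f = subInc hk S ≫ g) : f = g := by
  ext n ⟨⟨x, hx⟩, s⟩
  let k := (stdSimplex.objEquiv x).toOrderHom 0
  have hk : IsVertex K k := by
    have h₁ : (Δ[1] : SSet.{v}).map (SimplexCategory.const ⦋0⦌ n.unop 0).op x ∈ K.obj (op ⦋0⦌) :=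
      K.map (SimplexCategory.const ⦋0⦌ n.unop 0).op hx
    have h₂ : stdSimplex.obj₀Equiv.symm k =
        (Δ[1] : SSet.{v}).map (SimplexCategory.const ⦋0⦌ n.unop 0).op x := by
      rw [Equiv.symm_apply_eq]
      rfl
    change stdSimplex.obj₀Equiv.symm k ∈ _
    rw [h₂]
    exact h₁
  have e : x = (Δ[1] : SSet.{v}).map (n.unop.const ⦋0⦌ 0).op (stdSimplex.obj₀Equiv.symm k) := by
    apply stdSimplex.objEquiv.injective
    ext i : 3
    exact hK _ x hx i 0
  have := ConcreteCategory.congr_hom (NatTrans.congr_app (h k hk) n) s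
  have e' : (⟨⟨x, hx⟩, s⟩ : ((K : SSet.{v}) ⊗ S).obj n) = (subInc hk S).app n s :=
    Prod.ext (Subtype.ext e) rfl
  rw [e']
  exact this

lemma exists_cylinder_lift {K : (Δ[1] : SSet.{v}).Subcomplex} (hK : ConstSimplices K)
    {S T X Y : SSet.{v}} {i : S ⟶ T} {q : X ⟶ Y} (H : Lift₃ (curriedTensor SSet.{v}) K.ι i q)
    (a : Δ[1] ⊗ S ⟶ X) (b : Fin 2 → (T ⟶ X)) (c : Δ[1] ⊗ T ⟶ Y)
    (e₁ : ∀ k, IsVertex K k → cylInc k S ≫ a = i ≫ b k)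
    (e₂ : ∀ k, IsVertex K k → b k ≫ q = cylInc k T ≫ c) (e₃ : a ≫ q = Δ[1] ◁ i ≫ c) :
    ∃ h : Δ[1] ⊗ T ⟶ X, Δ[1] ◁ i ≫ h = a ∧ (∀ k, IsVertex K k → cylInc k T ≫ h = b k) ∧
      h ≫ q = c := by
  obtain ⟨h, h₁, h₂, h₃⟩ := H (constDesc hK b) a c
    (hom_ext_of_constSimplices hK fun k hk ↦ by
      change subInc hk S ≫ (K : SSet.{v}) ◁ i ≫ constDesc hK b = subInc hk S ≫ K.ι ▷ S ≫ a
      rw [← Category.assoc _ _ a, subInc_ι, e₁ k hk, ← subInc_constDesc hK hk b]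
      rfl)
    (hom_ext_of_constSimplices hK fun k hk ↦ by
      change subInc hk T ≫ _ = subInc hk T ≫ K.ι ▷ T ≫ c
      rw [← Category.assoc _ _ c, subInc_ι, ← e₂ k hk, ← Category.assoc, subInc_constDesc])
    e₃
  refine ⟨h, h₂, fun k hk ↦ ?_, h₃⟩
  rw [← subInc_ι hk, Category.assoc]
  exact (subInc hk T ≫= h₁).trans (subInc_constDesc hK hk b)

lemma lift₃_of_fibration (k : Fin 2) (n : ℕ) {X Y : SSet.{v}} {q : X ⟶ Y}
    (hq : modelCategoryQuillen.J.rlp q) :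
    Lift₃ (curriedTensor SSet.{v}) (horn.{v} 1 k).ι (boundary.{v} n).ι q := by
  refine lift₃_of_hasLiftingProperty (Subcomplex.unionProd.pushoutObjObj _ _) ?_
  have h := anodyneExtensions_pushoutObjObjι'
    (Subcomplex.unionProd.pushoutObjObj (horn.{v} 1 k) (boundary.{v} n))
    (anodyneExtensions.horn_ι k)
  rw [anodyneExtensions_eq_llp_rlp] at h
  exact h q hq

lemma isVertex_horn_iff (k l : Fin 2) : IsVertex (horn.{v} 1 k) l ↔ l = k := by
  have h : ∀ k l : Fin 2, l = k ↔ ∃ i : Fin 2, ¬ (l = i ∨ i = k) := by decide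
  rw [h]
  change ¬ (_ = _) ↔ _
  rw [Set.eq_univ_iff_forall, not_forall]
  refine exists_congr fun i ↦ not_congr (or_congr ⟨?_, fun h ↦ ⟨0, h⟩⟩ Iff.rfl)
  rintro ⟨_, h⟩
  exact h

end Cylinder

section CylinderObject

open Simplicial SSet

variable {M : Type u₂} [Category.{v} M] [HasColimits M]

/-- The cosimplicial object `n ↦ A ⊗ (Δ[1] × Δ[n])`. -/
def cylinder (A : SimplexCategory ⥤ M) : SimplexCategory ⥤ M :=
  SSet.stdSimplex.{v} ⋙ tensorLeft Δ[1] ⋙ (copower M).obj A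

/-- The ends of the cylinder. -/
def cylinderEnd (A : SimplexCategory ⥤ M) (k : Fin 2) : A ⟶ cylinder A where
  app n := (copowerStdSimplex A n).hom ≫ ((copower M).obj A).map (cylInc k _)
  naturality m n φ := by
    have h := copowerStdSimplex_hom_map A φ
    have h' := congrArg ((copower M).obj A).map (cylInc_natural k (SSet.stdSimplex.{v}.map φ))
    rw [Functor.map_comp, Functor.map_comp] at h'
    exact (Category.assoc _ _ _).symm.trans ((h.symm =≫ _).trans ((Category.assoc _ _ _).trans
      ((_ ≫= h'.symm).trans (Category.assoc _ _ _).symm)))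

/-- Morphisms from the levels of the cylinder. -/
def cylinderEquiv (A : SimplexCategory ⥤ M) (n : SimplexCategory) (E : M) :
    ((cylinder A).obj n ⟶ E) ≃ (Δ[1] ⊗ SSet.stdSimplex.{v}.obj n ⟶ singObj A E) :=
  (copowerAdjunction M).homEquiv

lemma cylinderEquiv_comp (A : SimplexCategory ⥤ M) (n : SimplexCategory) {E B : M}
    (g : (cylinder A).obj n ⟶ E) (p : E ⟶ B) :
    cylinderEquiv A n B (g ≫ p) = cylinderEquiv A n E g ≫ singPostcomp A p :=
  (copowerAdjunction M).homEquiv_naturality_three _ _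

lemma cylinderEquiv_map (A : SimplexCategory ⥤ M) {m n : SimplexCategory} (φ : m ⟶ n) {E : M}
    (g : (cylinder A).obj n ⟶ E) :
    cylinderEquiv A m E ((cylinder A).map φ ≫ g) =
      Δ[1] ◁ SSet.stdSimplex.{v}.map φ ≫ cylinderEquiv A n E g :=
  (copowerAdjunction M).homEquiv_naturality_two _ _

lemma yonedaEquiv_cylInc_cylinderEquiv (A : SimplexCategory ⥤ M) (n : SimplexCategory) {E : M}
    (k : Fin 2) (g : (cylinder A).obj n ⟶ E) :
    SSet.yonedaEquiv (cylInc k (SSet.stdSimplex.{v}.obj n) ≫ cylinderEquiv A n E g) =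
      (cylinderEnd A k).app n ≫ g := by
  have h := (copowerAdjunction M).homEquiv_naturality_two (X₁ := A)
    (cylInc k (SSet.stdSimplex.{v}.obj n)) g
  have h' := (copowerAdjunction M).homEquiv_naturality_three (X₁ := A)
    (((copower M).obj A).map (cylInc k (SSet.stdSimplex.{v}.obj n)) ≫
      (show ((copower M).obj A).obj (Δ[1] ⊗ SSet.stdSimplex.{v}.obj n) ⟶ E from g))
    (𝟙 (((copower M).obj A).obj (SSet.stdSimplex.{v}.obj n)))
  rw [Category.id_comp] at h'
  refine (congrArg SSet.yonedaEquiv (h.symm.trans h')).trans ((SSet.yonedaEquiv_comp _ _).trans ?_)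
  exact (Category.assoc _ _ _).symm

/-- Morphisms to `singObj (cylinder A) E` are homotopies. -/
def singCylinder (A : SimplexCategory ⥤ M) {S : SSet.{v}} {E : M}
    (φ : S ⟶ singObj (cylinder A) E) : Δ[1] ⊗ S ⟶ singObj A E :=
  MonoidalClosed.uncurry (φ ≫
    { app n := ↾fun g : (cylinder A).obj n.unop ⟶ E ↦
        SSet.yonedaEquiv (MonoidalClosed.curry (cylinderEquiv A n.unop E g))
      naturality m n f := by
        ext g
        have h := cylinderEquiv_map A f.unop g
        exact (congrArg (fun x ↦ SSet.yonedaEquiv (MonoidalClosed.curry x)) h).trans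
          ((congrArg SSet.yonedaEquiv (MonoidalClosed.curry_natural_left _ _)).trans
            (SSet.yonedaEquiv_naturality _ _).symm) })

lemma singCylinder_yonedaEquiv_symm (A : SimplexCategory ⥤ M) (n : SimplexCategory) {E : M}
    (g : (cylinder A).obj n ⟶ E) :
    singCylinder A ((SSet.yonedaEquiv (X := singObj (cylinder A) E)).symm g) =
      cylinderEquiv A n E g := by
  rw [singCylinder]
  apply MonoidalClosed.curry_injective
  rw [MonoidalClosed.curry_uncurry]
  apply SSet.yonedaEquiv.injective
  rw [SSet.yonedaEquiv_comp, Equiv.apply_symm_apply]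
  rfl

lemma singCylinder_bijective (A : SimplexCategory ⥤ M) (n : SimplexCategory) (E : M) :
    Function.Bijective (singCylinder A : (SSet.stdSimplex.{v}.obj n ⟶ singObj (cylinder A) E) → _) := by
  have : (singCylinder A : (SSet.stdSimplex.{v}.obj n ⟶ singObj (cylinder A) E) → _) =
      cylinderEquiv A n E ∘ SSet.yonedaEquiv := by
    funext g
    obtain ⟨g, rfl⟩ := SSet.yonedaEquiv.symm.surjective g
    rw [singCylinder_yonedaEquiv_symm]
    simp
  rw [this]
  exact (cylinderEquiv A n E).bijective.comp SSet.yonedaEquiv.bijective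

lemma singCylinder_comp_left (A : SimplexCategory ⥤ M) {S T : SSet.{v}} {E : M} (f : S ⟶ T)
    (φ : T ⟶ singObj (cylinder A) E) :
    singCylinder A (f ≫ φ) = Δ[1] ◁ f ≫ singCylinder A φ := by
  simp only [singCylinder, Category.assoc]
  exact MonoidalClosed.uncurry_natural_left _ _

lemma hom_ext_of_stdSimplex {S X : SSet.{v}} {f g : S ⟶ X}
    (h : ∀ (n : SimplexCategory) (s : SSet.stdSimplex.{v}.obj n ⟶ S), s ≫ f = s ≫ g) : f = g := by
  ext n s
  have := congrArg SSet.yonedaEquiv (h n.unop (SSet.yonedaEquiv.symm s))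
  rwa [SSet.yonedaEquiv_comp, SSet.yonedaEquiv_comp, Equiv.apply_symm_apply] at this

lemma hom_ext_of_tensor_stdSimplex {K S X : SSet.{v}} {f g : K ⊗ S ⟶ X}
    (h : ∀ (n : SimplexCategory) (s : SSet.stdSimplex.{v}.obj n ⟶ S), K ◁ s ≫ f = K ◁ s ≫ g) :
    f = g := by
  apply MonoidalClosed.curry_injective
  refine hom_ext_of_stdSimplex fun n s ↦ ?_
  rw [← MonoidalClosed.curry_natural_left, h, MonoidalClosed.curry_natural_left]

lemma singCylinder_injective (A : SimplexCategory ⥤ M) {S : SSet.{v}} {E : M} :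
    Function.Injective (singCylinder A : (S ⟶ singObj (cylinder A) E) → _) := by
  intro f g h
  refine hom_ext_of_stdSimplex fun n s ↦ (singCylinder_bijective A n E).injective ?_
  rw [singCylinder_comp_left, singCylinder_comp_left, h]

lemma singCylinder_postcomp (A : SimplexCategory ⥤ M) {S : SSet.{v}} {E B : M}
    (φ : S ⟶ singObj (cylinder A) E) (p : E ⟶ B) :
    singCylinder A (φ ≫ singPostcomp _ p) = singCylinder A φ ≫ singPostcomp A p := by
  refine hom_ext_of_tensor_stdSimplex fun n s ↦ ?_
  rw [← singCylinder_comp_left, ← Category.assoc, ← Category.assoc, ← singCylinder_comp_left]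
  obtain ⟨g, hg⟩ := SSet.yonedaEquiv.symm.surjective (s ≫ φ)
  have h := cylinderEquiv_comp A n g p
  rw [← hg, singCylinder_yonedaEquiv_symm, ← h, ← singCylinder_yonedaEquiv_symm]
  congr 1
  apply SSet.yonedaEquiv.injective
  rw [SSet.yonedaEquiv_comp, Equiv.apply_symm_apply, Equiv.apply_symm_apply]
  rfl

lemma cylInc_singCylinder (A : SimplexCategory ⥤ M) {S : SSet.{v}} {E : M} (k : Fin 2)
    (φ : S ⟶ singObj (cylinder A) E) :
    cylInc k S ≫ singCylinder A φ = φ ≫ singPrecomp (cylinderEnd A k) E := by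
  refine hom_ext_of_stdSimplex fun n s ↦ ?_
  rw [← Category.assoc, ← cylInc_natural, Category.assoc, ← singCylinder_comp_left,
    ← Category.assoc s]
  obtain ⟨g, hg⟩ := SSet.yonedaEquiv.symm.surjective (s ≫ φ)
  rw [← hg, singCylinder_yonedaEquiv_symm]
  apply SSet.yonedaEquiv.injective
  rw [yonedaEquiv_cylInc_cylinderEquiv, SSet.yonedaEquiv_comp, Equiv.apply_symm_apply]
  rfl

lemma exists_lift_singCylinder (A : SimplexCategory ⥤ M) {K : (Δ[1] : SSet.{v}).Subcomplex}
    (hK : ConstSimplices K) {E B : M} {p : E ⟶ B} {n : ℕ}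
    (H : Lift₃ (curriedTensor SSet.{v}) K.ι (boundary.{v} n).ι (singPostcomp A p))
    (a : (∂Δ[n] : SSet.{v}) ⟶ singObj (cylinder A) E)
    (b : Fin 2 → (Δ[n] ⟶ singObj A E)) (c : Δ[n] ⟶ singObj (cylinder A) B)
    (e₁ : ∀ k, IsVertex K k → a ≫ singPrecomp (cylinderEnd A k) E = (boundary n).ι ≫ b k)
    (e₂ : ∀ k, IsVertex K k → b k ≫ singPostcomp A p = c ≫ singPrecomp (cylinderEnd A k) B)
    (e₃ : a ≫ singPostcomp _ p = (boundary n).ι ≫ c) :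
    ∃ h : Δ[n] ⟶ singObj (cylinder A) E, (boundary n).ι ≫ h = a ∧
      (∀ k, IsVertex K k → h ≫ singPrecomp (cylinderEnd A k) E = b k) ∧
      h ≫ singPostcomp _ p = c := by
  obtain ⟨h', h₁, h₂, h₃⟩ := exists_cylinder_lift hK H (singCylinder A a) b (singCylinder A c)
    (fun k hk ↦ by rw [cylInc_singCylinder, e₁ k hk])
    (fun k hk ↦ by rw [cylInc_singCylinder, e₂ k hk])
    (by rw [← singCylinder_postcomp, e₃, singCylinder_comp_left])
  obtain ⟨h, rfl⟩ := (singCylinder_bijective A ⦋n⦌ E).surjective h'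
  refine ⟨h, singCylinder_injective A ?_, fun k hk ↦ ?_, singCylinder_injective A ?_⟩
  · rw [singCylinder_comp_left, h₁]
  · rw [← cylInc_singCylinder, h₂ k hk]
  · rw [singCylinder_postcomp, h₃]

end CylinderObject

section Leibniz

open Simplicial SSet

variable {M : Type u₂} [Category.{v} M] [HasColimits M] [ModelCategory M]
  {A A' : SimplexCategory ⥤ M} {f : A ⟶ A'} {E B : M} {p : E ⟶ B}

lemma exists_lift_of_singLeibniz (hf : modelCategoryQuillen.I.rlp (singLeibniz f p).π)
    {S T : SSet.{v}} (i : S ⟶ T) [Mono i] (a : S ⟶ singObj A' E) (b : T ⟶ singObj A E)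
    (c : T ⟶ singObj A' B) (e₁ : a ≫ singPrecomp f E = i ≫ b)
    (e₂ : b ≫ singPostcomp A p = c ≫ singPrecomp f B) (e₃ : a ≫ singPostcomp A' p = i ≫ c) :
    ∃ h : T ⟶ singObj A' E, i ≫ h = a ∧ h ≫ singPrecomp f E = b ∧ h ≫ singPostcomp A' p = c := by
  have := hasLiftingProperty_of_boundary hf i
  let sq := singLeibniz f p
  have hsq : CommSq a i sq.π (sq.isPullback.lift b c e₂) := ⟨sq.isPullback.hom_ext
    (by rw [Category.assoc, Category.assoc, sq.π_fst, IsPullback.lift_fst]; exact e₁)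
    (by rw [Category.assoc, Category.assoc, sq.π_snd, IsPullback.lift_snd]; exact e₃)⟩
  refine ⟨hsq.lift, hsq.fac_left, ?_, ?_⟩
  · have := hsq.fac_right =≫ sq.fst
    rwa [IsPullback.lift_fst, Category.assoc, sq.π_fst] at this
  · have := hsq.fac_right =≫ sq.snd
    rwa [IsPullback.lift_snd, Category.assoc, sq.π_snd] at this

lemma rlp_singLeibniz_π (H : ∀ (n : ℕ) (a : (∂Δ[n] : SSet.{v}) ⟶ singObj A' E)
    (b : Δ[n] ⟶ singObj A E) (c : Δ[n] ⟶ singObj A' B),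
    a ≫ singPrecomp f E = (boundary n).ι ≫ b →
    b ≫ singPostcomp A p = c ≫ singPrecomp f B →
    a ≫ singPostcomp A' p = (boundary n).ι ≫ c →
    ∃ h : Δ[n] ⟶ singObj A' E, (boundary n).ι ≫ h = a ∧ h ≫ singPrecomp f E = b ∧
      h ≫ singPostcomp A' p = c) : modelCategoryQuillen.I.rlp (singLeibniz f p).π := by
  rintro _ _ _ ⟨n⟩
  let sq := singLeibniz f p
  refine ⟨fun {a d} hsq ↦ ?_⟩
  have h := hsq.w
  obtain ⟨h, h₁, h₂, h₃⟩ := H n a (d ≫ sq.fst) (d ≫ sq.snd)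
    (by have := h =≫ sq.fst
        rwa [Category.assoc, Category.assoc, sq.π_fst] at this)
    (by rw [Category.assoc, Category.assoc]
        exact d ≫= sq.isPullback.w)
    (by have := h =≫ sq.snd
        rwa [Category.assoc, Category.assoc, sq.π_snd] at this)
  exact ⟨⟨h, h₁, sq.isPullback.hom_ext (by rw [Category.assoc, sq.π_fst]; exact h₂)
    (by rw [Category.assoc, sq.π_snd]; exact h₃)⟩⟩

lemma IsCofibrantCosimplicial.isRelativeTrivialCofibration_cylinderEnd
    (hA : IsCofibrantCosimplicial A)
    (w : ∀ ⦃m n : SimplexCategory⦄ (φ : m ⟶ n), WeakEquivalence (A.map φ)) (k : Fin 2) :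
    IsRelativeTrivialCofibration (cylinderEnd A k) := by
  refine fun E B p hp ↦ rlp_singLeibniz_π fun n a b c e₁ e₂ e₃ ↦ ?_
  obtain ⟨h, h₁, h₂, h₃⟩ := exists_lift_singCylinder A (constSimplices_horn k)
    (lift₃_of_fibration _ n (hA.fibration_singPostcomp w p)) a (fun _ ↦ b) c
    (fun l hl ↦ by rwa [(isVertex_horn_iff k l).1 hl])
    (fun l hl ↦ by rwa [(isVertex_horn_iff k l).1 hl]) e₃
  exact ⟨h, h₁, h₂ k ((isVertex_horn_iff k k).2 rfl), h₃⟩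

end Leibniz

section Sections

variable {P : SimplexCategoryᵒᵖ ⥤ Type v} {M : Type u₂} [Category.{v} M]

/-- The simplex underlying an element of a simplicial set. -/
abbrev dimObj (x : P.Elements) : SimplexCategory := x.1.unop

/-- For a diagram `A` of cosimplicial objects on the category of elements of `P`, the natural
families of morphisms `(A x)^n ⟶ E`, for `x ∈ P_n`. -/
@[ext]
structure Sec (A : P.Elements ⥤ SimplexCategory ⥤ M) (E : M) where
  /-- the components -/
  app (x : P.Elements) : (A.obj x).obj (dimObj x) ⟶ E
  naturality {x y : P.Elements} (e : x ⟶ y) :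
    (A.map e).app (dimObj y) ≫ app y = (A.obj x).map e.1.unop ≫ app x

namespace Sec

variable {A A' A'' : P.Elements ⥤ SimplexCategory ⥤ M} {E B : M}

/-- Composition with a morphism. -/
@[simps]
def postcomp (φ : Sec A E) (p : E ⟶ B) : Sec A B where
  app x := φ.app x ≫ p
  naturality e := by rw [← Category.assoc, φ.naturality, Category.assoc]

/-- Composition with a morphism of diagrams. -/
@[simps]
def precomp (f : A ⟶ A') (φ : Sec A' E) : Sec A E where
  app x := (f.app x).app _ ≫ φ.app x
  naturality {x y} e := by
    have h := NatTrans.congr_app (f.naturality e) (dimObj y)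
    rw [NatTrans.comp_app, NatTrans.comp_app] at h
    rw [← Category.assoc, h, Category.assoc, φ.naturality, ← Category.assoc, ← Category.assoc,
      (f.app x).naturality]

end Sec

/-- The bifunctor whose coend corepresents `Sec A`. -/
abbrev elementsBifunctor (A : P.Elements ⥤ SimplexCategory ⥤ M) :
    P.Elementsᵒᵖ ⥤ P.Elements ⥤ M :=
  (CategoryOfElements.π P).op ⋙ unopUnop _ ⋙ A.flip

variable [HasColimits M]

/-- The object corepresenting `Sec A`. -/
abbrev elementsCoend (A : P.Elements ⥤ SimplexCategory ⥤ M) : M :=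
  coend (elementsBifunctor A)

/-- The universal property of `elementsCoend A`. -/
def elementsCoendEquiv (A : P.Elements ⥤ SimplexCategory ⥤ M) (E : M) :
    (elementsCoend A ⟶ E) ≃ Sec A E where
  toFun g :=
    { app x := coend.ι (elementsBifunctor A) x ≫ g
      naturality {x y} e := by
        have h := coend.condition (elementsBifunctor A) e
        exact (Category.assoc _ _ _).symm.trans ((h.symm =≫ g).trans (Category.assoc _ _ _)) }
  invFun φ := coend.desc φ.app fun x y e ↦ (φ.naturality e).symm
  left_inv g := coend.hom_ext fun x ↦ coend.ι_desc _ _ _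
  right_inv φ := by
    ext x
    exact coend.ι_desc _ _ _

lemma elementsCoendEquiv_comp (A : P.Elements ⥤ SimplexCategory ⥤ M) {E B : M}
    (g : elementsCoend A ⟶ E) (p : E ⟶ B) :
    elementsCoendEquiv A B (g ≫ p) = (elementsCoendEquiv A E g).postcomp p := by
  ext x
  exact (Category.assoc _ _ _).symm

/-- Functoriality of `elementsCoend`. -/
def elementsCoendMap {A A' : P.Elements ⥤ SimplexCategory ⥤ M} (f : A ⟶ A') :
    elementsCoend A ⟶ elementsCoend A' :=
  (elementsCoendEquiv A _).symm (Sec.precomp f (elementsCoendEquiv A' _ (𝟙 _)))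

lemma elementsCoendEquiv_map_comp {A A' : P.Elements ⥤ SimplexCategory ⥤ M} (f : A ⟶ A') {E : M}
    (g : elementsCoend A' ⟶ E) :
    elementsCoendEquiv A E (elementsCoendMap f ≫ g) =
      Sec.precomp f (elementsCoendEquiv A' E g) := by
  rw [elementsCoendEquiv_comp, elementsCoendMap, Equiv.apply_symm_apply]
  ext x
  have h : coend.ι (elementsBifunctor A') x ≫ 𝟙 _ = coend.ι (elementsBifunctor A') x :=
    Category.comp_id _
  exact ((_ ≫= h) =≫ g).trans (Category.assoc _ _ _)

/-- The lifting property for sections. -/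
def SecLift {A A' : P.Elements ⥤ SimplexCategory ⥤ M} (f : A ⟶ A') {E B : M} (p : E ⟶ B) : Prop :=
  ∀ (φ : Sec A E) (ψ : Sec A' B), φ.postcomp p = ψ.precomp f →
    ∃ χ : Sec A' E, χ.precomp f = φ ∧ χ.postcomp p = ψ

lemma hasLiftingProperty_elementsCoendMap {A A' : P.Elements ⥤ SimplexCategory ⥤ M} {f : A ⟶ A'}
    {E B : M} {p : E ⟶ B} (h : SecLift f p) : HasLiftingProperty (elementsCoendMap f) p := by
  refine ⟨fun {a b} sq ↦ ?_⟩
  obtain ⟨χ, h₁, h₂⟩ := h (elementsCoendEquiv _ _ a) (elementsCoendEquiv _ _ b) (by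
    rw [← elementsCoendEquiv_comp, ← elementsCoendEquiv_map_comp, sq.w])
  refine ⟨⟨(elementsCoendEquiv _ _).symm χ, (elementsCoendEquiv _ _).injective ?_,
    (elementsCoendEquiv _ _).injective ?_⟩⟩
  · rw [elementsCoendEquiv_map_comp, Equiv.apply_symm_apply, h₁]
  · rw [elementsCoendEquiv_comp, Equiv.apply_symm_apply, h₂]

end Sections

section Families

/-- Construction of a compatible family by induction on a degree. -/
lemma exists_compatible_family {X : Type*} (deg : X → ℕ) (T : X → Type*)
    (Rel : ∀ x y : X, T x → T y → Prop)
    (step : ∀ (x : X) (s : ∀ y, deg y < deg x → T y),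
      (∀ y z hy hz, Rel y z (s y hy) (s z hz)) →
      ∃ t : T x, ∀ y hy, Rel x y t (s y hy) ∧ Rel y x (s y hy) t)
    (same : ∀ (n : ℕ) (s : ∀ y, deg y < n → T y) (t : ∀ y, deg y = n → T y),
      (∀ x y hx hy, Rel x y (t x hx) (s y hy) ∧ Rel y x (s y hy) (t x hx)) →
      ∀ x y hx hy, Rel x y (t x hx) (t y hy)) :
    ∃ s : ∀ x, T x, ∀ x y, Rel x y (s x) (s y) := by
  classical
  let PF (n : ℕ) := { s : ∀ y, deg y < n → T y // ∀ y z hy hz, Rel y z (s y hy) (s z hz) }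
  have ext (n : ℕ) (s : PF n) : ∃ s' : PF (n + 1), ∀ y (hy : deg y < n) (hy' : deg y < n + 1),
      s'.1 y hy' = s.1 y hy := by
    have H (x : X) (hx : deg x = n) : ∃ t : T x, ∀ y (hy : deg y < n),
        Rel x y t (s.1 y hy) ∧ Rel y x (s.1 y hy) t := by
      subst hx
      exact step x s.1 s.2
    choose t ht using H
    have ht' := same n s.1 t fun x y hx hy ↦ ht x hx y hy
    let s' : ∀ y, deg y < n + 1 → T y := fun y hy ↦
      if h : deg y < n then s.1 y h else t y (by omega)
    have h₁ (y) (hy : deg y < n) (hy' : deg y < n + 1) : s' y hy' = s.1 y hy := dif_pos hy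
    have h₂ (y) (hy : deg y = n) (hy' : deg y < n + 1) : s' y hy' = t y hy :=
      dif_neg (by omega)
    refine ⟨⟨s', fun y z hy hz ↦ ?_⟩, h₁⟩
    obtain hy' | hy' := Nat.lt_succ_iff_lt_or_eq.1 hy <;>
      obtain hz' | hz' := Nat.lt_succ_iff_lt_or_eq.1 hz
    · rw [h₁ y hy' hy, h₁ z hz' hz]
      exact s.2 _ _ _ _
    · rw [h₁ y hy' hy, h₂ z hz' hz]
      exact (ht z hz' y hy').2
    · rw [h₂ y hy' hy, h₁ z hz' hz]
      exact (ht y hy' z hz').1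
    · rw [h₂ y hy' hy, h₂ z hz' hz]
      exact ht' _ _ _ _
  choose next hnext using ext
  let F : ∀ n, PF n := fun n ↦ Nat.rec ⟨fun _ h ↦ absurd h (Nat.not_lt_zero _),
    fun _ _ h ↦ absurd h (Nat.not_lt_zero _)⟩ next n
  have hF (m n : ℕ) (h : m ≤ n) (y) (hy : deg y < m) (hy' : deg y < n) :
      (F n).1 y hy' = (F m).1 y hy := by
    induction n, h using Nat.le_induction with
    | base => rfl
    | succ n h ih => exact (hnext n (F n) y (hy.trans_le h) hy').trans (ih _)
  refine ⟨fun x ↦ (F (deg x + 1)).1 x (Nat.lt_succ_self _), fun x y ↦ ?_⟩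
  have hx := hF (deg x + 1) (max (deg x) (deg y) + 1) (by omega) x (by omega) (by omega)
  have hy := hF (deg y + 1) (max (deg x) (deg y) + 1) (by omega) y (by omega) (by omega)
  dsimp only
  rw [← hx, ← hy]
  exact (F (max (deg x) (deg y) + 1)).2 x y (by omega) (by omega)

variable {P : SimplexCategoryᵒᵖ ⥤ Type v} {M : Type u₂} [Category.{v} M]
  {A A' : P.Elements ⥤ SimplexCategory ⥤ M} {E B : M}

/-- The naturality condition of sections for a single morphism. -/
def SecRel (A : P.Elements ⥤ SimplexCategory ⥤ M) {x y : P.Elements} (e : x ⟶ y)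
    (a : (A.obj x).obj (dimObj x) ⟶ E) (b : (A.obj y).obj (dimObj y) ⟶ E) : Prop :=
  (A.map e).app (dimObj y) ≫ b = (A.obj x).map e.1.unop ≫ a

lemma SecRel.id (x : P.Elements) (a : (A.obj x).obj (dimObj x) ⟶ E) : SecRel A (𝟙 x) a a := by
  simp [SecRel]

lemma map_comp_app_unop {x y z : P.Elements} (e : x ⟶ y) (e' : y ⟶ z) :
    (A.obj x).map (e ≫ e').1.unop = (A.obj x).map e'.1.unop ≫ (A.obj x).map e.1.unop :=
  (A.obj x).map_comp _ _

lemma SecRel.comp {x y z : P.Elements} {e : x ⟶ y} {e' : y ⟶ z}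
    {a : (A.obj x).obj (dimObj x) ⟶ E} {b : (A.obj y).obj (dimObj y) ⟶ E}
    {c : (A.obj z).obj (dimObj z) ⟶ E} (h : SecRel A e a b) (h' : SecRel A e' b c) :
    SecRel A (e ≫ e') a c := by
  simp only [SecRel] at h h' ⊢
  rw [A.map_comp, NatTrans.comp_app, Category.assoc, h', ← NatTrans.naturality_assoc, h,
    map_comp_app_unop, Category.assoc]

lemma SecRel.of_comp {x y z : P.Elements} {e : x ⟶ y} {e' : y ⟶ z}
    {a : (A.obj x).obj (dimObj x) ⟶ E} {b : (A.obj y).obj (dimObj y) ⟶ E}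
    {c : (A.obj z).obj (dimObj z) ⟶ E} [IsIso (A.map e)] (h : SecRel A e a b)
    (h' : SecRel A (e ≫ e') a c) : SecRel A e' b c := by
  simp only [SecRel] at h h' ⊢
  rw [A.map_comp, NatTrans.comp_app, Category.assoc, map_comp_app_unop, Category.assoc,
    ← h, NatTrans.naturality_assoc] at h'
  exact (cancel_epi ((A.map e).app (dimObj z))).1 h'

lemma SecRel.exists_of_isIso {x y : P.Elements} (e : x ⟶ y) [IsIso (A.map e)]
    (a : (A.obj x).obj (dimObj x) ⟶ E) : ∃ b, SecRel A e a b :=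
  ⟨inv ((A.map e).app (dimObj y)) ≫ (A.obj x).map e.1.unop ≫ a, by simp [SecRel]⟩

/-- The morphism to the element obtained by restriction. -/
abbrev restrHom (x : P.Elements) {n : SimplexCategory} (φ : n ⟶ dimObj x) :
    x ⟶ P.elementsMk (op n) (P.map φ.op x.2) :=
  CategoryOfElements.homMk x (P.elementsMk (op n) (P.map φ.op x.2)) φ.op rfl

/-- Any morphism in the category of elements factors through the image. -/
lemma exists_factorization {x y : P.Elements} (e : x ⟶ y) :
    ∃ (z : P.Elements) (m : x ⟶ z) (q : z ⟶ y), m ≫ q = e ∧ Mono m.1.unop ∧ Epi q.1.unop := by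
  refine ⟨_, restrHom x (image.ι e.1.unop), CategoryOfElements.homMk _ y
    (factorThruImage e.1.unop).op ?_, ?_, ?_, ?_⟩
  · refine Eq.trans ?_ e.2
    change P.map _ (P.map _ x.2) = _
    rw [← CategoryTheory.comp_apply, ← P.map_comp, ← op_comp, image.fac]
    rfl
  · ext
    exact congrArg Quiver.Hom.op (image.fac e.1.unop)
  · exact inferInstanceAs (Mono (image.ι e.1.unop))
  · exact inferInstanceAs (Epi (factorThruImage e.1.unop))

lemma eq_eqToHom_of_isIso {x y : P.Elements} (e : x ⟶ y) (he : IsIso e.1.unop) :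
    ∃ h : x = y, e = eqToHom h := by
  obtain ⟨⟨a⟩, s⟩ := x
  obtain ⟨⟨b⟩, t⟩ := y
  have hab : a = b := SimplexCategory.ext
    (le_antisymm (SimplexCategory.len_le_of_epi e.1.unop) (SimplexCategory.len_le_of_mono e.1.unop))
  subst hab
  have h₁ : e.1 = 𝟙 _ := congrArg Quiver.Hom.op (SimplexCategory.eq_id_of_isIso e.1.unop)
  have h₂ : s = t := by
    have := e.2
    rw [h₁, P.map_id] at this
    exact this
  subst h₂
  exact ⟨rfl, CategoryOfElements.ext _ _ _ h₁⟩

lemma eq_eqToHom_of_factorization {x y z : P.Elements} (hxy : (dimObj x).len = (dimObj y).len)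
    (m : x ⟶ z) (q : z ⟶ y) (hm : Mono m.1.unop) (hq : Epi q.1.unop)
    (h : (dimObj z).len = (dimObj x).len) : ∃ hxy : x = y, m ≫ q = eqToHom hxy := by
  obtain ⟨rfl, rfl⟩ := eq_eqToHom_of_isIso m ((SimplexCategory.isIso_iff_of_mono _).2 h)
  obtain ⟨rfl, rfl⟩ := eq_eqToHom_of_isIso q ((SimplexCategory.isIso_iff_of_epi _).2 hxy.symm)
  exact ⟨rfl, by simp⟩

/-- Sections can be lifted by induction. -/
lemma secLift_of_step {f : A ⟶ A'} {p : E ⟶ B}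
    (step : ∀ (φ : Sec A E) (ψ : Sec A' B), φ.postcomp p = ψ.precomp f → ∀ (x : P.Elements)
      (s : ∀ y : P.Elements, (dimObj y).len < (dimObj x).len →
        ((A'.obj y).obj (dimObj y) ⟶ E)),
      (∀ y hy, (f.app y).app _ ≫ s y hy = φ.app y ∧ s y hy ≫ p = ψ.app y) →
      (∀ y z hy hz (e : y ⟶ z), SecRel A' e (s y hy) (s z hz)) →
      ∃ t : (A'.obj x).obj (dimObj x) ⟶ E, (f.app x).app _ ≫ t = φ.app x ∧ t ≫ p = ψ.app x ∧
        (∀ y hy (e : x ⟶ y), SecRel A' e t (s y hy)) ∧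
        (∀ y hy (e : y ⟶ x), SecRel A' e (s y hy) t)) :
    SecLift f p := by
  intro φ ψ h
  obtain ⟨s, hs⟩ := exists_compatible_family (fun x : P.Elements ↦ (dimObj x).len)
    (fun x ↦ { t : (A'.obj x).obj (dimObj x) ⟶ E // (f.app x).app _ ≫ t = φ.app x ∧ t ≫ p = ψ.app x })
    (fun x y a b ↦ ∀ e : x ⟶ y, SecRel A' e a.1 b.1) (by
      intro x s hs
      obtain ⟨t, h₁, h₂, h₃, h₄⟩ := step φ ψ h x (fun y hy ↦ (s y hy).1) (fun y hy ↦ (s y hy).2)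
        (fun y z hy hz e ↦ hs y z hy hz e)
      exact ⟨⟨t, h₁, h₂⟩, fun y hy ↦ ⟨h₃ y hy, h₄ y hy⟩⟩) (by
      intro n s t hst x y hx hy e
      obtain ⟨z, m, q, rfl, hm, hq⟩ := exists_factorization e
      have hz : (dimObj z).len ≤ (dimObj x).len := SimplexCategory.len_le_of_mono m.1.unop
      obtain hz | hz := hz.lt_or_eq
      · exact ((hst x z hx (hx ▸ hz)).1 m).comp ((hst y z hy (hx ▸ hz)).2 q)
      · obtain ⟨rfl, h⟩ := eq_eqToHom_of_factorization (hx.trans hy.symm) m q hm hq hz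
        rw [h]
        exact SecRel.id _ _)
  refine ⟨⟨fun x ↦ (s x).1, fun e ↦ hs _ _ e⟩, ?_, ?_⟩
  · ext x
    exact (s x).2.1
  · ext x
    exact (s x).2.2

end Families

section NondegenerateLifting

open Simplicial SSet

variable {P : SSet.{v}} {M : Type u₂} [Category.{v} M] [HasColimits M] [ModelCategory M]
  {A A' : P.Elements ⥤ SimplexCategory ⥤ M} {E B : M}

lemma SecRel.precomp {f : A ⟶ A'} {x y : P.Elements} {e : x ⟶ y}
    {a : (A'.obj x).obj (dimObj x) ⟶ E} {b : (A'.obj y).obj (dimObj y) ⟶ E}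
    (h : SecRel A' e a b) : SecRel A e ((f.app x).app _ ≫ a) ((f.app y).app _ ≫ b) := by
  have h' := NatTrans.congr_app (f.naturality e) (dimObj y)
  rw [NatTrans.comp_app, NatTrans.comp_app] at h'
  simp only [SecRel] at h ⊢
  rw [← Category.assoc, h', Category.assoc, h, ← Category.assoc, ← Category.assoc,
    (f.app x).naturality]

lemma SecRel.postcomp {x y : P.Elements} {e : x ⟶ y} {a : (A.obj x).obj (dimObj x) ⟶ E}
    {b : (A.obj y).obj (dimObj y) ⟶ E} (h : SecRel A e a b) (p : E ⟶ B) :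
    SecRel A e (a ≫ p) (b ≫ p) := by
  simp only [SecRel] at h ⊢
  rw [← Category.assoc, h, Category.assoc]

lemma SecRel.unique {x y : P.Elements} {e : x ⟶ y} {a : (A.obj x).obj (dimObj x) ⟶ E}
    {b b' : (A.obj y).obj (dimObj y) ⟶ E} [IsIso (A.map e)] (h : SecRel A e a b)
    (h' : SecRel A e a b') : b = b' :=
  (cancel_epi ((A.map e).app (dimObj y))).1 (h.trans h'.symm)

/-- Every morphism of elements to a degenerate simplex comes from a nondegenerate one. -/
lemma exists_nonDegenerate_hom (x : P.Elements) :
    ∃ (z : P.Elements) (e : z ⟶ x), Epi e.1.unop ∧ z.2 ∈ P.nonDegenerate (dimObj z).len := by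
  obtain ⟨m, f, hf, y, hy⟩ := P.exists_nonDegenerate (n := (dimObj x).len) x.2
  exact ⟨P.elementsMk (op ⦋m⦌) y.1, CategoryOfElements.homMk _ x f.op hy.symm, hf, y.2⟩

lemma nonDegenerate_hom_unique {x z w : P.Elements} (e : z ⟶ x) (e' : w ⟶ x) (he : Epi e.1.unop)
    (he' : Epi e'.1.unop) (hz : z.2 ∈ P.nonDegenerate (dimObj z).len)
    (hw : w.2 ∈ P.nonDegenerate (dimObj w).len) : ∃ h : z = w, e = eqToHom h ≫ e' := by
  obtain ⟨⟨a⟩, s⟩ := z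
  obtain ⟨⟨b⟩, t⟩ := w
  have hab : a = b := SimplexCategory.ext
    (P.unique_nonDegenerate_dim (n := (dimObj x).len) x.2 e.1.unop ⟨s, hz⟩ e.2.symm
      e'.1.unop ⟨t, hw⟩ e'.2.symm)
  subst hab
  have hst : s = t := congrArg Subtype.val
    (P.unique_nonDegenerate_simplex (n := (dimObj x).len) x.2 e.1.unop ⟨s, hz⟩ e.2.symm
      e'.1.unop ⟨t, hw⟩ e'.2.symm)
  subst hst
  refine ⟨rfl, ?_⟩
  have := P.unique_nonDegenerate_map (n := (dimObj x).len) x.2 e.1.unop ⟨s, hz⟩ e.2.symm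
      e'.1.unop ⟨s, hw⟩ e'.2.symm
  exact (CategoryOfElements.ext _ _ _ (congrArg Quiver.Hom.op this)).trans (Category.id_comp _).symm

lemma boundary_hom_ext {n : ℕ} {Y : SSet.{v}} {f g : (∂Δ[n] : SSet.{v}) ⟶ Y}
    (h : ∀ (k : SimplexCategory) (φ : k ⟶ ⦋n⦌) (hk : k.len < n),
      f.app (op k) ⟨stdSimplex.objEquiv.symm φ, not_surjective_of_len_lt φ hk⟩ =
        g.app (op k) ⟨stdSimplex.objEquiv.symm φ, not_surjective_of_len_lt φ hk⟩) : f = g := by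
  ext m s
  let φ := stdSimplex.objEquiv s.1
  have hk := image_len_lt _ s.2
  have hs : s = (∂Δ[n] : SSet.{v}).map (factorThruImage φ).op
      ⟨stdSimplex.objEquiv.symm (image.ι φ), not_surjective_of_len_lt _ hk⟩ := by
    apply Subtype.ext
    apply stdSimplex.objEquiv.injective
    exact (image.fac φ).symm
  rw [hs]
  exact (ConcreteCategory.congr_hom (f.naturality _) _).trans
    ((congrArg _ (h _ _ hk)).trans (ConcreteCategory.congr_hom (g.naturality _) _).symm)

/-- Sections lift along levelwise relative cofibrations of diagrams which invert degeneracies. -/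
lemma secLift_of_isIso_degeneracies {f : A ⟶ A'} {p : E ⟶ B}
    (hA : ∀ ⦃x y : P.Elements⦄ (e : x ⟶ y), Epi e.1.unop → IsIso (A.map e))
    (hA' : ∀ ⦃x y : P.Elements⦄ (e : x ⟶ y), Epi e.1.unop → IsIso (A'.map e))
    (hf : ∀ x, modelCategoryQuillen.I.rlp (singLeibniz (f.app x) p).π) : SecLift f p := by
  refine secLift_of_step fun φ ψ hφψ x s hs hs' ↦ ?_
  by_cases hx : x.2 ∈ P.nonDegenerate (dimObj x).len
  · let b : Δ[(dimObj x).len] ⟶ singObj (A.obj x) E :=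
      SSet.yonedaEquiv.symm (show (singObj (A.obj x) E).obj _ from φ.app x)
    let c : Δ[(dimObj x).len] ⟶ singObj (A'.obj x) B :=
      SSet.yonedaEquiv.symm (show (singObj (A'.obj x) B).obj _ from ψ.app x)
    let a : (∂Δ[(dimObj x).len] : SSet.{v}) ⟶ singObj (A'.obj x) E := boundaryDesc
      (fun k θ hk ↦ (A'.map (restrHom x θ)).app k ≫ s (P.elementsMk (op k) (P.map θ.op x.2)) hk)
      (fun k l θ θ' hk hl ↦ by
        let u : P.Elements := P.elementsMk (op k) (P.map θ'.op x.2)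
        let w : P.Elements := P.elementsMk (op l) (P.map (θ ≫ θ').op x.2)
        let e : u ⟶ w := CategoryOfElements.homMk u w θ.op (by
          change P.map _ (P.map _ x.2) = P.map _ x.2
          rw [op_comp, P.map_comp]
          rfl)
        have he : restrHom x (θ ≫ θ') = restrHom x θ' ≫ e := rfl
        have h := hs' u w hk hl e
        change (A'.obj x).map θ ≫ (A'.map (restrHom x θ')).app k ≫ s u hk =
          (A'.map (restrHom x (θ ≫ θ'))).app l ≫ s w hl
        rw [he, A'.map_comp, NatTrans.comp_app, Category.assoc]
        exact ((Category.assoc _ _ _).symm.trans (((A'.map (restrHom x θ')).naturality θ =≫ _).trans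
          (Category.assoc _ _ _))).trans (_ ≫= h.symm))
    have hb (k) (θ : k ⟶ dimObj x) : b.app (op k) (stdSimplex.objEquiv.symm θ) =
        (A.obj x).map θ ≫ φ.app x :=
      (app_objEquiv_symm _ _).trans
        (congrArg ((singObj (A.obj x) E).map θ.op) (SSet.yonedaEquiv.apply_symm_apply _))
    have hc (k) (θ : k ⟶ dimObj x) : c.app (op k) (stdSimplex.objEquiv.symm θ) =
        (A'.obj x).map θ ≫ ψ.app x :=
      (app_objEquiv_symm _ _).trans
        (congrArg ((singObj (A'.obj x) B).map θ.op) (SSet.yonedaEquiv.apply_symm_apply _))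
    have hfx {k} (θ : k ⟶ dimObj x) := NatTrans.congr_app (f.naturality (restrHom x θ)) k
    simp only [NatTrans.comp_app] at hfx
    obtain ⟨h, h₁, h₂, h₃⟩ := exists_lift_of_singLeibniz (hf x) (boundary _).ι a b c
      (boundary_hom_ext fun k θ hk ↦ by
        refine (congrArg ((f.app x).app k ≫ ·) (boundaryDesc_app _ _ θ hk)).trans
          (Eq.trans ?_ (hb k θ).symm)
        rw [← Category.assoc, ← hfx, Category.assoc, (hs _ hk).1]
        exact φ.naturality (restrHom x θ))
      (by
        apply SSet.yonedaEquiv.injective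
        refine (SSet.yonedaEquiv_comp _ _).trans (Eq.trans ?_ (SSet.yonedaEquiv_comp _ _).symm)
        exact (congrArg (· ≫ p) (SSet.yonedaEquiv.apply_symm_apply _)).trans
          ((congrArg (fun ξ : Sec A B ↦ ξ.app x) hφψ).trans
            (congrArg ((f.app x).app _ ≫ ·) (SSet.yonedaEquiv.apply_symm_apply _)).symm))
      (boundary_hom_ext fun k θ hk ↦ by
        refine (congrArg (· ≫ p) (boundaryDesc_app _ _ θ hk)).trans
          (Eq.trans ?_ (hc k θ).symm)
        dsimp only
        rw [Category.assoc, (hs _ hk).2]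
        exact ψ.naturality (restrHom x θ))
    refine ⟨SSet.yonedaEquiv h, ?_, ?_, fun y hy e ↦ ?_, fun y hy e ↦ ?_⟩
    · exact (SSet.yonedaEquiv_comp _ _).symm.trans ((congrArg SSet.yonedaEquiv h₂).trans
        (SSet.yonedaEquiv.apply_symm_apply _))
    · exact (SSet.yonedaEquiv_comp _ _).symm.trans ((congrArg SSet.yonedaEquiv h₃).trans
        (SSet.yonedaEquiv.apply_symm_apply _))
    · obtain ⟨⟨k⟩, t⟩ := y
      obtain ⟨θ, hθ⟩ := e
      change x.1 ⟶ op k at θ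
      change P.map θ x.2 = t at hθ
      subst hθ
      have H := ConcreteCategory.congr_hom (NatTrans.congr_app h₁ (op k))
        ⟨stdSimplex.objEquiv.symm θ.unop, not_surjective_of_len_lt θ.unop hy⟩
      exact (boundaryDesc_app _ _ θ.unop hy).symm.trans (H.symm.trans (app_objEquiv_symm h θ.unop))
    · have := P.mono_of_nonDegenerate (n := (dimObj x).len) ⟨x.2, hx⟩ e.1.unop y.2 e.2
      exact absurd (SimplexCategory.len_le_of_mono e.1.unop) (not_le.2 hy)
  · obtain ⟨z, e, he, hz⟩ := exists_nonDegenerate_hom x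
    have := hA e he
    have := hA' e he
    have hzx : (dimObj z).len < (dimObj x).len := by
      refine lt_of_le_of_ne (SimplexCategory.len_le_of_epi e.1.unop) fun h ↦ hx ?_
      obtain ⟨rfl, -⟩ := eq_eqToHom_of_isIso e ((SimplexCategory.isIso_iff_of_epi _).2 h.symm)
      exact hz
    obtain ⟨t, ht⟩ := SecRel.exists_of_isIso (A := A') e (s z hzx)
    refine ⟨t, ?_, ?_, fun y hy e' ↦ ht.of_comp (hs' z y hzx hy _), fun y hy e' ↦ ?_⟩
    · have h := ht.precomp (f := f)
      rw [(hs z hzx).1] at h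
      exact h.unique (φ.naturality e)
    · have h := ht.postcomp p
      rw [(hs z hzx).2] at h
      exact h.unique (ψ.naturality e)
    · obtain ⟨u, m, q, rfl, hm, hq⟩ := exists_factorization e'
      have hu : (dimObj u).len < (dimObj x).len :=
        (SimplexCategory.len_le_of_mono m.1.unop).trans_lt hy
      refine (hs' y u hy hu m).comp ?_
      obtain ⟨w, r, hr, hw⟩ := exists_nonDegenerate_hom u
      have hqr : Epi (r ≫ q).1.unop := epi_comp q.1.unop r.1.unop
      obtain ⟨rfl, h⟩ := nonDegenerate_hom_unique e (r ≫ q) he hqr hz hw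
      rw [eqToHom_refl, Category.id_comp] at h
      have := hA' r hr
      exact (hs' _ _ hzx hu r).of_comp (h ▸ ht)

end NondegenerateLifting

section Realization

variable {V : Type u₁} [Category.{v} V] [MonoidalCategory V] [SymmetricCategory V]
  [MonoidalClosed V] [HasLimits V] [HasColimits V] [ModelCategory V] [MonoidalModelCategory V]
  {M : Type u₂} [Category.{v} M] [EnrichedOrdinaryCategory V M] [Tensored V M] [HasLimits M]
  [HasColimits M] [ModelCategory M] [ModelEnrichedCategory V M]

/-- The diagram of cosimplicial objects `I ⊗ T x`. -/
abbrev tensorDiagram {J : Type*} [Category* J] (I : SimplexCategory ⥤ V) (T : J ⥤ M) :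
    J ⥤ SimplexCategory ⥤ M :=
  T ⋙ (tensorBifunctor V M).flip ⋙ (Functor.whiskeringLeft _ _ _).obj I

lemma hom_ext_actionLeft_sigma {ι : Type v} (K : V) (Y : ι → M) {E : M} {f g : K ⊙ₗ (∐ Y) ⟶ E}
    (h : ∀ i, K ⊴ₗ Sigma.ι Y i ≫ f = K ⊴ₗ Sigma.ι Y i ≫ g) : f = g := by
  apply (cotensorEquiv K (∐ Y) E).symm.injective
  refine Sigma.hom_ext _ _ fun i ↦ ?_
  rw [← cotensorEquiv_symm_comp, ← cotensorEquiv_symm_comp, h]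

lemma exists_desc_actionLeft_sigma {ι : Type v} (K : V) (Y : ι → M) {E : M}
    (φ : ∀ i, K ⊙ₗ Y i ⟶ E) : ∃ f : K ⊙ₗ (∐ Y) ⟶ E, ∀ i, K ⊴ₗ Sigma.ι Y i ≫ f = φ i := by
  refine ⟨cotensorEquiv K _ _ (Sigma.desc fun i ↦ (cotensorEquiv K _ _).symm (φ i)), fun i ↦ ?_⟩
  apply (cotensorEquiv K _ E).symm.injective
  rw [cotensorEquiv_symm_comp, Equiv.symm_apply_apply, Sigma.ι_desc]

variable {P : SimplexCategoryᵒᵖ ⥤ Type v}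

/-- The realization of the fiberwise coproduct as an object corepresenting sections. -/
lemma exists_iso_realization (I : SimplexCategory ⥤ V) (T : P.Elements ⥤ M) :
    Nonempty (elementsCoend (tensorDiagram I T) ≅ realization I (fiberwiseCoproduct T)) := by
  have : HasColimitsOfSize.{0, 0} M := hasColimitsOfSizeShrink.{0, 0, v, v} M
  let X := fiberwiseCoproduct T
  let H := X ⋙ (tensorBifunctor V M).flip ⋙ (Functor.whiskeringLeft _ _ _).obj I
  let inc (x : P.Elements) : T.obj x ⟶ X.obj x.1 :=
    Sigma.ι (fun c : P.obj x.1 ↦ T.obj (P.elementsMk x.1 c)) (show P.obj x.1 from x.2)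
  have hinc {x y : P.Elements} (e : x ⟶ y) : T.map e ≫ inc y = inc x ≫ X.map e.1 := by
    obtain ⟨k, t⟩ := y
    obtain ⟨θ, hθ⟩ := e
    change x.1 ⟶ k at θ
    change P.map θ x.2 = t at hθ
    subst hθ
    exact (Sigma.ι_desc (f := fun c : P.obj x.1 ↦ T.obj (P.elementsMk x.1 c))
      (fun c ↦ T.map (CategoryOfElements.homMk (P.elementsMk x.1 c) (P.elementsMk k (P.map θ c)) θ rfl) ≫
        Sigma.ι (fun c : P.obj k ↦ T.obj (P.elementsMk k c)) (P.map θ c))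
      (show P.obj x.1 from x.2)).symm
  let κ (n : SimplexCategory) : I.obj n ⊙ₗ X.obj (op n) ⟶ coend H := coend.ι H n
  have cond {E : M} (g : coend H ⟶ E) : ∀ {x y : P.Elements} (e : x ⟶ y),
      I.obj (dimObj y) ⊴ₗ T.map e ≫ (I.obj (dimObj y) ⊴ₗ inc y ≫ κ y.1.unop) ≫ g =
      I.map e.1.unop ⊵ₗ T.obj x ≫ (I.obj (dimObj x) ⊴ₗ inc x ≫ κ x.1.unop) ≫ g := by
    intro x y e
    have h := coend.condition H e.1.unop
    have h' : I.obj (dimObj y) ⊴ₗ X.map e.1 ≫ κ y.1.unop =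
      I.map e.1.unop ⊵ₗ X.obj x.1 ≫ κ x.1.unop := h
    have h₁ : I.obj (dimObj y) ⊴ₗ T.map e ≫ I.obj (dimObj y) ⊴ₗ inc y =
        I.obj (dimObj y) ⊴ₗ inc x ≫ I.obj (dimObj y) ⊴ₗ X.map e.1 := by
      rw [← MonoidalLeftAction.actionHomRight_comp, hinc, MonoidalLeftAction.actionHomRight_comp]
    have h₂ : I.obj (dimObj y) ⊴ₗ inc x ≫ I.map e.1.unop ⊵ₗ X.obj x.1 =
        I.map e.1.unop ⊵ₗ T.obj x ≫ I.obj (dimObj x) ⊴ₗ inc x :=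
      MonoidalLeftAction.action_exchange _ _
    simp only [Category.assoc]
    rw [reassoc_of% h₁, reassoc_of% h', reassoc_of% h₂]
  let S (E : M) (g : coend H ⟶ E) : Sec (tensorDiagram I T) E :=
    { app x := (I.obj (dimObj x) ⊴ₗ inc x ≫ κ x.1.unop) ≫ g
      naturality e := cond g e }
  let F := (elementsCoendEquiv (tensorDiagram I T) _).symm (S _ (𝟙 _))
  have hF {E : M} (g : coend H ⟶ E) : elementsCoendEquiv _ _ (F ≫ g) = S E g := by
    rw [elementsCoendEquiv_comp, Equiv.apply_symm_apply]
    ext x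
    exact (Category.assoc _ _ _).trans (congrArg _ (Category.id_comp g))
  have isIso : IsIso F := by
    apply isIso_of_coyoneda_map_bijective
    intro E
    have hS : Function.Bijective (S E) := by
      refine ⟨fun g g' h ↦ coend.hom_ext fun n ↦ ?_, fun φ ↦ ?_⟩
      · refine hom_ext_actionLeft_sigma (I.obj n) _ fun c ↦ ?_
        have := congrArg (fun s : Sec (tensorDiagram I T) E ↦ s.app (P.elementsMk (op n) c)) h
        exact (Category.assoc _ _ _).symm.trans (this.trans (Category.assoc _ _ _))
      · choose t ht using fun n : SimplexCategory ↦ exists_desc_actionLeft_sigma (I.obj n)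
          (fun c : P.obj (op n) ↦ T.obj (P.elementsMk (op n) c))
          (fun c ↦ φ.app (P.elementsMk (op n) c))
        have hcond ⦃m n : SimplexCategory⦄ (f : m ⟶ n) :
            (H.map f.op).app m ≫ t m = (H.obj (op n)).map f ≫ t n := by
          refine hom_ext_actionLeft_sigma (I.obj m) _ fun c ↦ ?_
          have h := φ.naturality (restrHom (P.elementsMk (op n) c) f)
          have h₁ : I.obj m ⊴ₗ inc (P.elementsMk (op n) c) ≫ I.obj m ⊴ₗ X.map f.op =
              I.obj m ⊴ₗ T.map (restrHom (P.elementsMk (op n) c) f) ≫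
                I.obj m ⊴ₗ inc (P.elementsMk (op m) (P.map f.op c)) := by
            rw [← MonoidalLeftAction.actionHomRight_comp, ← MonoidalLeftAction.actionHomRight_comp,
              hinc]
            rfl
          refine (Category.assoc _ _ _).symm.trans ((h₁ =≫ _).trans ((Category.assoc _ _ _).trans
            ((_ ≫= ht m _).trans (h.trans ?_))))
          refine (_ ≫= (ht n c).symm).trans ?_
          refine (Category.assoc _ _ _).symm.trans (Eq.trans ?_ (Category.assoc _ _ _))
          exact (MonoidalLeftAction.action_exchange _ _ =≫ _).symm
        have hκ (n : SimplexCategory) : κ n ≫ coend.desc t hcond = t n :=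
          coend.ι_desc (F := H) t hcond n
        refine ⟨coend.desc t hcond, ?_⟩
        ext x
        exact (Category.assoc _ _ _).trans ((_ ≫= hκ (dimObj x)).trans (ht (dimObj x) x.2))
    refine ⟨fun g g' h ↦ hS.1 ?_, fun g ↦ ?_⟩
    · rw [← hF, ← hF]
      exact congrArg _ h
    · obtain ⟨g', hg'⟩ := hS.2 (elementsCoendEquiv _ _ g)
      exact ⟨g', (elementsCoendEquiv _ _).injective ((hF g').trans hg')⟩
  exact ⟨@asIso _ _ _ _ F isIso⟩

end Realization

section HomotopyColimit

variable {J : Type v} [Category.{0} J] {M : Type u₂} [Category.{v} M]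

/-- The chain underlying an element of the nerve. -/
abbrev nerveChain (ξ : Functor.Elements (nerve J : SSet.{v})) :
    ComposableArrows J ξ.1.unop.len := ξ.2

variable (J) in
/-- The functor sending a chain `j_0 ⟶ ⋯ ⟶ j_n` to `j_0`. -/
def firstVertex : Functor.Elements (nerve J : SSet.{v}) ⥤ J where
  obj ξ := (nerveChain ξ).obj 0
  map {ξ ζ} e := (nerveChain ξ).map (homOfLE (Fin.zero_le (e.1.unop.toOrderHom 0))) ≫
    eqToHom (congrArg (fun η : ComposableArrows J ζ.1.unop.len ↦ η.obj 0) e.2)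
  map_id ξ := (congrArg (· ≫ eqToHom rfl) ((nerveChain ξ).map_id 0)).trans (Category.comp_id _)
  map_comp {x y z} e e' := by
    obtain ⟨⟨k⟩, t⟩ := y
    obtain ⟨θ, hθ⟩ := e
    change x.1 ⟶ op k at θ
    change (nerve J : SSet.{v}).map θ x.2 = t at hθ
    subst hθ
    obtain ⟨⟨l⟩, t⟩ := z
    obtain ⟨θ', hθ⟩ := e'
    change op k ⟶ op l at θ'
    change (nerve J : SSet.{v}).map θ' ((nerve J : SSet.{v}).map θ x.2) = t at hθ
    subst hθ
    refine (Category.comp_id _).trans (Eq.trans ?_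
      (congrArg₂ (· ≫ ·) (Category.comp_id _).symm (Category.comp_id _).symm))
    exact (nerveChain x).map_comp _ _

lemma isIso_firstVertex_map {x y : Functor.Elements (nerve J : SSet.{v})} (e : x ⟶ y)
    (he : Epi e.1.unop) : IsIso ((firstVertex J).map e) := by
  have h : e.1.unop.toOrderHom 0 = 0 := by
    obtain ⟨a, ha⟩ := SimplexCategory.epi_iff_surjective.1 he 0
    exact Fin.le_zero_iff.1 ((e.1.unop.toOrderHom.monotone (Fin.zero_le a)).trans ha.le)
  let i : (0 : Fin (x.1.unop.len + 1)) ≅ e.1.unop.toOrderHom 0 :=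
    ⟨homOfLE (Fin.zero_le _), homOfLE h.le, Subsingleton.elim _ _, Subsingleton.elim _ _⟩
  have hi : IsIso ((nerveChain x).mapIso i).hom := inferInstance
  exact @IsIso.comp_isIso _ _ _ _ _ _ _ hi (eqToIso
    (congrArg (fun η : ComposableArrows J y.1.unop.len ↦ η.obj 0) e.2)).isIso_hom

lemma firstVertex_map_restrHom (x : Functor.Elements (nerve J : SSet.{v})) {n : SimplexCategory}
    (φ : n ⟶ dimObj x) : (firstVertex J).map (restrHom x φ) =
      (nerveChain x).map (homOfLE (Fin.zero_le (φ.toOrderHom 0))) :=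
  Category.comp_id _

/-- The chain `c_0 ⟶ ⋯ ⟶ c_n` as a chain of objects under `c_0`. -/
abbrev underChain {n : ℕ} (c : ComposableArrows J n) : ComposableArrows (Under (c.obj 0)) n where
  obj k := Under.mk (c.map (homOfLE (Fin.zero_le k)))
  map {k l} g := Under.homMk (c.map g) ((c.map_comp _ _).symm)
  map_id k := by ext; exact c.map_id k
  map_comp g h := by ext; exact c.map_comp g h

lemma under_eqToHom_right {i : J} {X Y : Under i} (h : X = Y) :
    (eqToHom h).right = eqToHom (congrArg (fun Z : Under i ↦ Z.right) h) := by
  subst h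
  rfl

lemma underChain_map {i : J} {n : ℕ} (η : ComposableArrows (Under i) n) :
    underChain (η ⋙ Under.forget i) ⋙ Under.map (η.obj 0).hom = η := by
  refine CategoryTheory.Functor.ext (fun k ↦ congrArg Under.mk (Under.w (η.map _))) fun k l g ↦ ?_
  ext
  change (η.map g).right = _
  rw [Under.comp_right, Under.comp_right]
  refine Eq.trans ?_ (congrArg₂ (fun a b ↦ a ≫ (η.map g).right ≫ b)
    (under_eqToHom_right (congrArg Under.mk (Under.w (η.map _)))).symm
    (under_eqToHom_right (congrArg Under.mk (Under.w (η.map _))).symm).symm)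
  exact ((Category.id_comp _).trans (Category.comp_id _)).symm

variable [HasColimits M]

/-- The homotopy colimit corepresents sections on the nerve. -/
lemma exists_iso_hocolim [ModelCategory M] {T : J ⥤ M} (T' : DiagramResolution T) :
    Nonempty (elementsCoend (firstVertex J ⋙ T'.obj) ≅ hocolim T') := by
  let A := Functor.uncurry.obj T'.obj.flip
  let K : (SimplexCategory × J)ᵒᵖ ⥤ Type v := underChains J
  let H (E : M) : (hocolim T' ⟶ E) ≃ (K ⟶ singObj A E) := copowerEquiv A K E
  have hA {m n : SimplexCategory} {i j : J} (φ : m ⟶ n) (f : i ⟶ j) :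
      A.map ((φ, f) : (m, i) ⟶ (n, j)) = (T'.obj.obj i).map φ ≫ (T'.obj.map f).app n := rfl
  let app {E : M} (g : K ⟶ singObj A E) (n : SimplexCategory) (i : J)
    (η : ComposableArrows (Under i) n.len) : (T'.obj.obj i).obj n ⟶ E := g.app (op (n, i)) η
  have hg₁ {E : M} (g : K ⟶ singObj A E) {m n : SimplexCategory} {i : J} (φ : m ⟶ n)
      (η : ComposableArrows (Under i) n.len) :
      app g m i (η.whiskerLeft (SimplexCategory.toCat.map φ).toFunctor) =
        (T'.obj.obj i).map φ ≫ app g n i η := by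
    have h : app g m i (η.whiskerLeft (SimplexCategory.toCat.map φ).toFunctor ⋙ Under.map (𝟙 i)) =
        A.map ((φ, 𝟙 i) : (m, i) ⟶ (n, i)) ≫ app g n i η := ConcreteCategory.congr_hom (g.naturality
      (Quiver.Hom.op ((φ, 𝟙 i) : (m, i) ⟶ (n, i)))) η
    rw [hA, T'.obj.map_id] at h
    have e : Under.map (𝟙 i) = 𝟭 _ := Under.mapId_eq i
    rw [e] at h
    exact h.trans (congrArg (· ≫ app g n i η) (Category.comp_id _))
  have hg₂ {E : M} (g : K ⟶ singObj A E) {n : SimplexCategory} {i j : J} (f : i ⟶ j)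
      (η : ComposableArrows (Under j) n.len) :
      app g n i (η ⋙ Under.map f) = (T'.obj.map f).app n ≫ app g n j η := by
    have h : app g n i (η ⋙ Under.map f) =
        A.map ((𝟙 n, f) : (n, i) ⟶ (n, j)) ≫ app g n j η := ConcreteCategory.congr_hom (g.naturality
      (Quiver.Hom.op ((𝟙 n, f) : (n, i) ⟶ (n, j)))) η
    rw [hA, CategoryTheory.Functor.map_id] at h
    exact h.trans (congrArg (· ≫ app g n j η) (Category.id_comp _))
  let S {E : M} (g : K ⟶ singObj A E) : Sec (firstVertex J ⋙ T'.obj) E :=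
    { app x := app g (dimObj x) _ (underChain (nerveChain x))
      naturality {x y} e := by
        obtain ⟨⟨k⟩, t⟩ := y
        obtain ⟨θ, hθ⟩ := e
        change x.1 ⟶ op k at θ
        change (nerve J : SSet.{v}).map θ x.2 = t at hθ
        subst hθ
        let η : ComposableArrows (Under ((nerveChain x).obj 0)) k.len :=
          (underChain (nerveChain x)).whiskerLeft (SimplexCategory.toCat.map θ.unop).toFunctor
        refine Eq.trans (congrArg (fun f ↦ (T'.obj.map f).app k ≫
          app g k _ (underChain (η ⋙ Under.forget _))) (Category.comp_id _)) ?_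
        refine (hg₂ g (η.obj 0).hom (underChain (η ⋙ Under.forget _))).symm.trans ?_
        exact (congrArg (app g k _) (underChain_map η)).trans
          (hg₁ g θ.unop (underChain (nerveChain x))) }
  have hS (E : M) : Function.Bijective (S (E := E)) := by
    refine ⟨fun g g' h ↦ ?_, fun χ ↦ ?_⟩
    · have hη (n : SimplexCategory) (i : J) (η : ComposableArrows (Under i) n.len) :
          app g n i η = app g' n i η := by
        let c : ComposableArrows J n.len := η ⋙ Under.forget _
        have h' : app g n _ (underChain c) = app g' n _ (underChain c) :=
          congrArg (fun s : Sec (firstVertex J ⋙ T'.obj) E ↦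
            s.app (Functor.elementsMk (nerve J : SSet.{v}) (op n) c)) h
        have h₁ (g : K ⟶ singObj A E) : app g n i η =
            (T'.obj.map (η.obj 0).hom).app n ≫ app g n _ (underChain c) :=
          (congrArg (app g n i) (underChain_map η)).symm.trans (hg₂ g (η.obj 0).hom (underChain c))
        exact (h₁ g).trans ((_ ≫= h').trans (h₁ g').symm)
      ext ⟨⟨n, i⟩⟩ η
      exact hη n i η
    · let G (n : SimplexCategory) (i : J) (η : ComposableArrows (Under i) n.len) :
          (T'.obj.obj i).obj n ⟶ E :=
        (T'.obj.map (η.obj 0).hom).app n ≫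
          χ.app (Functor.elementsMk (nerve J : SSet.{v}) (op n) (η ⋙ Under.forget _))
      refine ⟨{ app x := ↾fun η ↦ G x.unop.1 x.unop.2 η
                naturality := ?_ }, ?_⟩
      · rintro ⟨n, j⟩ ⟨m, i⟩ ⟨φ, f⟩
        change m ⟶ n at φ
        change i ⟶ j at f
        ext η
        change ComposableArrows (Under j) n.len at η
        change G m i (η.whiskerLeft (SimplexCategory.toCat.map φ).toFunctor ⋙ Under.map f) =
          A.map ((φ, f) : (m, i) ⟶ (n, j)) ≫ G n j η
        let x := Functor.elementsMk (nerve J : SSet.{v}) (op n) (η ⋙ Under.forget _)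
        let g : (η.obj 0).right ⟶ (η.obj (φ.toOrderHom 0)).right :=
          (η.map (homOfLE (Fin.zero_le (φ.toOrderHom 0)))).right
        let y := Functor.elementsMk (nerve J : SSet.{v}) (op m)
          ((SimplexCategory.toCat.map φ).toFunctor ⋙ η ⋙ Under.forget _)
        let a : (T'.obj.obj (η.obj (φ.toOrderHom 0)).right).obj m ⟶ E := χ.app y
        let b : (T'.obj.obj (η.obj 0).right).obj n ⟶ E := χ.app x
        have h : (T'.obj.map g).app m ≫ a = (T'.obj.obj (η.obj 0).right).map φ ≫ b :=
          (congrArg (fun f ↦ (T'.obj.map f).app m ≫ χ.app y) (Category.comp_id g)).symm.trans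
            (χ.naturality (restrHom x φ))
        have hw : f ≫ (η.obj (φ.toOrderHom 0)).hom = (f ≫ (η.obj 0).hom) ≫ g :=
          (f ≫= (Under.w (η.map (homOfLE (Fin.zero_le (φ.toOrderHom 0))))).symm).trans
            (Category.assoc _ _ _).symm
        have h₁ : G m i (η.whiskerLeft (SimplexCategory.toCat.map φ).toFunctor ⋙ Under.map f) =
            (T'.obj.map (f ≫ (η.obj (φ.toOrderHom 0)).hom)).app m ≫ a := rfl
        have h₂ : G n j η = (T'.obj.map (η.obj 0).hom).app n ≫ b := rfl
        rw [h₁, h₂, hA, hw, T'.obj.map_comp, T'.obj.map_comp, NatTrans.comp_app, NatTrans.comp_app,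
          Category.assoc, Category.assoc, h, Category.assoc, NatTrans.naturality_assoc,
          NatTrans.naturality_assoc]
      · ext x
        refine (congrArg (fun f ↦ (T'.obj.map f).app _ ≫ χ.app x)
          ((nerveChain x).map_id 0)).trans ?_
        exact (NatTrans.congr_app (T'.obj.map_id _) (dimObj x) =≫ χ.app x).trans
          (Category.id_comp _)
  let F := (elementsCoendEquiv (firstVertex J ⋙ T'.obj) (hocolim T')).symm (S (H _ (𝟙 _)))
  have hF {E : M} (g : hocolim T' ⟶ E) : elementsCoendEquiv _ _ (F ≫ g) = S (H E g) := by
    rw [elementsCoendEquiv_comp, Equiv.apply_symm_apply]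
    ext x
    have h := copowerEquiv_comp A K (𝟙 (hocolim T')) g
    have h' : H E g = H _ (𝟙 _) ≫ singPostcomp A g := (congrArg (H E) (Category.id_comp g)).symm.trans h
    rw [h']
    rfl
  have isIso : IsIso F := by
    apply isIso_of_coyoneda_map_bijective
    intro E
    have hb := (hS E).comp (H E).bijective
    refine ⟨fun g g' h ↦ hb.1 ?_, fun g ↦ ?_⟩
    · exact (hF g).symm.trans ((congrArg _ h).trans (hF g'))
    · obtain ⟨g', hg'⟩ := hb.2 (elementsCoendEquiv _ _ g)
      exact ⟨g', (elementsCoendEquiv _ _).injective ((hF g').trans hg')⟩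
  exact ⟨@asIso _ _ _ _ F isIso⟩

end HomotopyColimit

section Append

variable {C : Type u}

/-- Append an object to a finite sequence. -/
def appendFun {n : ℕ} (c : Fin (n + 1) → C) (b : C) (i : Fin (n + 1 + 1)) : C :=
  if h : i.1 ≤ n then c ⟨i.1, Nat.lt_succ_of_le h⟩ else b

lemma appendFun_of_le {n : ℕ} (c : Fin (n + 1) → C) (b : C) (i : Fin (n + 1 + 1)) (h : i.1 ≤ n) :
    appendFun c b i = c ⟨i.1, Nat.lt_succ_of_le h⟩ := dif_pos h

lemma appendFun_of_lt {n : ℕ} (c : Fin (n + 1) → C) (b : C) (i : Fin (n + 1 + 1)) (h : n < i.1) :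
    appendFun c b i = b := dif_neg (by omega)

/-- Extend a monotone map `[m] ⟶ [n]` to `[m + 1] ⟶ [n + 1]`, preserving the last element. -/
def appendMap {m n : ℕ} (φ : Fin (m + 1) →o Fin (n + 1)) : Fin (m + 1 + 1) →o Fin (n + 1 + 1) where
  toFun i := if h : i.1 ≤ m then (φ ⟨i.1, Nat.lt_succ_of_le h⟩).castSucc else Fin.last _
  monotone' i j hij := by
    have hij' : i.1 ≤ j.1 := hij
    dsimp only
    split_ifs with h₁ h₂ h₂
    · exact φ.monotone hij
    · exact Fin.le_last _
    · omega
    · exact le_rfl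

lemma appendMap_of_le {m n : ℕ} (φ : Fin (m + 1) →o Fin (n + 1)) (i : Fin (m + 1 + 1))
    (h : i.1 ≤ m) : appendMap φ i = (φ ⟨i.1, Nat.lt_succ_of_le h⟩).castSucc := dif_pos h

lemma appendMap_of_lt {m n : ℕ} (φ : Fin (m + 1) →o Fin (n + 1)) (i : Fin (m + 1 + 1))
    (h : m < i.1) : appendMap φ i = Fin.last _ := dif_neg (by omega)

lemma appendFun_appendMap {m n : ℕ} (φ : Fin (m + 1) →o Fin (n + 1)) (c : Fin (n + 1) → C) (b : C)
    (i : Fin (m + 1 + 1)) : appendFun c b (appendMap φ i) = appendFun (fun j ↦ c (φ j)) b i := by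
  obtain h | h := le_or_gt i.1 m
  · rw [appendMap_of_le _ _ h, appendFun_of_le _ _ _ h, appendFun_of_le]
    · rfl
    · exact Nat.le_of_lt_succ (φ ⟨i.1, Nat.lt_succ_of_le h⟩).2
  · rw [appendMap_of_lt _ _ h, appendFun_of_lt _ _ _ h, appendFun_of_lt]
    simp

lemma appendMap_id (n : ℕ) : appendMap (OrderHom.id (α := Fin (n + 1))) = OrderHom.id := by
  ext i
  obtain h | h := le_or_gt i.1 n
  · rw [appendMap_of_le _ _ h]
    rfl
  · rw [appendMap_of_lt _ _ h]
    simp only [Fin.val_last, OrderHom.id_coe, id_eq]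
    omega

lemma appendMap_comp {l m n : ℕ} (φ : Fin (m + 1) →o Fin (n + 1)) (ψ : Fin (l + 1) →o Fin (m + 1)) :
    appendMap (φ.comp ψ) = (appendMap φ).comp (appendMap ψ) := by
  ext i
  obtain h | h := le_or_gt i.1 l
  · have e : ((appendMap φ).comp (appendMap ψ)) i = appendMap φ (appendMap ψ i) := rfl
    rw [appendMap_of_le _ _ h, e, appendMap_of_le _ _ h, appendMap_of_le]
    · rfl
    · exact Nat.le_of_lt_succ (ψ ⟨i.1, Nat.lt_succ_of_le h⟩).2
  · have e : ((appendMap φ).comp (appendMap ψ)) i = appendMap φ (appendMap ψ i) := rfl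
    rw [appendMap_of_lt _ _ h, e, appendMap_of_lt _ _ h, appendMap_of_lt]
    simp

lemma extend_appendFun_of_le {n k : ℕ} (c : Fin (n + 1) → C) (b : C) (hk : k ≤ n) :
    extend (appendFun c b) k = extend c k := by
  have h₁ : min k (n + 1) = k := by omega
  have h₂ : min k n = k := by omega
  rw [extend, appendFun_of_le _ _ _ (by change min k (n + 1) ≤ n; omega)]
  simp only [extend, h₁, h₂]

lemma extend_appendFun_last {n : ℕ} (c : Fin (n + 1) → C) (b : C) :
    extend (appendFun c b) (n + 1) = b :=
  appendFun_of_lt _ _ _ (by simp)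

lemma extend_eq_extend_appendFun {n : ℕ} (c : Fin (n + 1) → C) (b : C) :
    extend c = fun k ↦ extend (appendFun c b) (min k n) := by
  funext k
  rw [extend_appendFun_of_le c b (min_le_right _ _)]
  simp [extend]

lemma extendMap_appendMap_of_le {m n k : ℕ} (φ : Fin (m + 1) →o Fin (n + 1)) (hk : k ≤ m) :
    extendMap (appendMap φ) k = extendMap φ k := by
  have h₁ : min k (m + 1) = k := by omega
  have h₂ : min k m = k := by omega
  simp only [extendMap, extend, h₁, h₂]
  rw [appendMap_of_le _ _ hk]
  rfl

lemma extendMap_appendMap_last {m n : ℕ} (φ : Fin (m + 1) →o Fin (n + 1)) :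
    extendMap (appendMap φ) (m + 1) = n + 1 := by
  rw [extendMap, extend, appendMap_of_lt _ _ (by simp)]
  rfl

/-- Appending `b` to a sequence, as an endofunctor of the category of finite sequences. -/
def appendFunctor (b : C) : (families C).Elements ⥤ (families C).Elements where
  obj x := (families C).elementsMk (op (SimplexCategory.mk (x.1.unop.len + 1))) (appendFun x.2 b)
  map {x y} f := CategoryOfElements.homMk _ _
    (Quiver.Hom.op (SimplexCategory.mkHom (appendMap f.1.unop.toOrderHom))) (by
      refine (funext fun i ↦ appendFun_appendMap _ _ _ i).trans ?_
      exact congrArg (fun c ↦ appendFun (n := y.1.unop.len) c b) f.2)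
  map_id x := CategoryOfElements.ext _ _ _ (congrArg Quiver.Hom.op
    (SimplexCategory.Hom.ext _ _ (appendMap_id _)))
  map_comp f g := CategoryOfElements.ext _ _ _ (congrArg Quiver.Hom.op
    (SimplexCategory.Hom.ext _ _ (appendMap_comp _ _)))

/-- The sequence underlying an element. -/
abbrev seq (x : (families C).Elements) : ℕ → C := extend (n := x.1.unop.len) x.2

/-- The last object of a sequence. -/
abbrev lastObj (x : (families C).Elements) : C := seq x x.1.unop.len

/-- The morphism omitting the last object. -/
def appendProj (b : C) (x : (families C).Elements) : (appendFunctor b).obj x ⟶ x :=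
  CategoryOfElements.homMk _ _
    (Quiver.Hom.op (SimplexCategory.mkHom (Fin.castSuccOrderEmb (n := x.1.unop.len + 1)).toOrderHom)) (by
      funext i
      exact appendFun_of_le (n := x.1.unop.len) x.2 b i.castSucc (Nat.le_of_lt_succ i.2))

lemma appendProj_naturality (b : C) {x y : (families C).Elements} (f : x ⟶ y) :
    (appendFunctor b).map f ≫ appendProj b y = appendProj b x ≫ f := by
  refine CategoryOfElements.ext _ _ _ (congrArg Quiver.Hom.op (SimplexCategory.Hom.ext _ _ ?_))
  ext i
  exact congrArg Fin.val (appendMap_of_le f.1.unop.toOrderHom i.castSucc (Nat.le_of_lt_succ i.2))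

/-- The sequence with one object. -/
abbrev singleSeq (b : C) : (families C).Elements :=
  (families C).elementsMk (op (SimplexCategory.mk 0)) (fun _ ↦ b)

/-- The morphism keeping only the last object. -/
def appendLast (b : C) (x : (families C).Elements) : (appendFunctor b).obj x ⟶ singleSeq b :=
  CategoryOfElements.homMk _ _ (Quiver.Hom.op (SimplexCategory.const _
    (SimplexCategory.mk (x.1.unop.len + 1)) (Fin.last _))) (by
      funext i
      exact appendFun_of_lt (n := x.1.unop.len) x.2 b (Fin.last _) (by simp))

lemma appendLast_naturality (b : C) {x y : (families C).Elements} (f : x ⟶ y) :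
    (appendFunctor b).map f ≫ appendLast b y = appendLast b x := by
  refine CategoryOfElements.ext _ _ _ (congrArg Quiver.Hom.op (SimplexCategory.Hom.ext _ _ ?_))
  ext i
  exact congrArg Fin.val (appendMap_of_lt f.1.unop.toOrderHom (Fin.last _) (by simp))

/-- The monotone map `[n + 1] ⟶ [n]` repeating the last value. -/
def lastDegeneracy (n : ℕ) : Fin (n + 1 + 1) →o Fin (n + 1) where
  toFun i := ⟨min i.1 n, by omega⟩
  monotone' _ _ h := Fin.mk_le_mk.2 (min_le_min_right _ h)

/-- The morphism repeating the last object. -/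
def appendRepeat (x : (families C).Elements) : x ⟶ (appendFunctor (lastObj x)).obj x :=
  CategoryOfElements.homMk _ _ (Quiver.Hom.op (SimplexCategory.mkHom
    (lastDegeneracy x.1.unop.len))) (by
      funext i
      change x.2 ⟨min i.1 _, _⟩ = appendFun (n := x.1.unop.len) x.2 _ i
      obtain h | h := le_or_gt i.1 x.1.unop.len
      · exact (congrArg x.2 (Fin.ext (min_eq_left h))).trans
          (appendFun_of_le (n := x.1.unop.len) x.2 _ i h).symm
      · exact (congrArg x.2 (Fin.ext ((min_eq_right h.le).trans (min_self _).symm))).trans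
          (appendFun_of_lt (n := x.1.unop.len) x.2 _ i h).symm)

end Append

section AppendBar

variable {V : Type u₁} [Category.{v} V] [MonoidalCategory V] [SymmetricCategory V]
  [MonoidalClosed V] {C : Type u} [EnrichedCategory V C]
  {M : Type u₂} [Category.{v} M] [EnrichedOrdinaryCategory V M] [Tensored V M]
  (W : EnrichedFunctor V Cᵒᵖ V) (D : EnrichedFunctor V C M)

lemma actionHomRight_eqToHom {K : V} {X Y : M} (e : X = Y) :
    K ⊴ₗ eqToHom e = eqToHom (congrArg (fun Z ↦ K ⊙ₗ Z) e) := by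
  subst e
  simp

lemma barObj_congr {c c' : ℕ → C} {n : ℕ} (h : ∀ i ≤ n, c i = c' i) :
    barObj W D c n = barObj W D c' n := by
  rw [barObj, barObj, h n le_rfl, chainObj_congr D h]

lemma barMapOfEq_eqToHom {c c' : ℕ → C} {f : ℕ → ℕ} (hf : Monotone f) {n : ℕ} (h : f n ≤ n)
    (e : c' = fun i ↦ c (f i)) (hid : ∀ i ≤ n, f i = i) (e' : barObj W D c n = barObj W D c' n) :
    barMapOfEq W D hf h e = eqToHom e' := by
  have e₁ : chainObj D c (f n) = chainObj D (fun i ↦ c (f i)) n := by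
    rw [hid n le_rfl]
    exact chainObj_congr D fun i hi ↦ by rw [hid i hi]
  have aux' : ∀ (a : ℕ) (ha : a = n) (h : a ≤ n), barCut W D c h = eqToHom (by rw [ha]) := by
    rintro a rfl h
    exact barCut_self W D c a
  rw [barMapOfEq, barMap, chainMap_eqToHom D c hf hid e₁, actionHomRight_eqToHom,
    aux' _ (hid n le_rfl)]
  simp

lemma barObj_append (c : ℕ → C) (n : ℕ) {b : C} (hb : c (n + 1) = b) {c' : ℕ → C}
    (hc : ∀ i ≤ n, c i = c' i) :
    barObj W D c (n + 1) = W.obj (op b) ⊙ₗ barObj (representable b) D c' n := by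
  subst hb
  rw [← barObj_congr (representable (c (n + 1))) D hc]

lemma barCut_chainCut (c : ℕ → C) {i k N : ℕ} (hk : k = N) (hik : i ≤ k) (hkN : k ≤ N)
    (hiN : i ≤ N) {Y : M} (ψ : chainObj D c i ⟶ Y)
    (e : W.obj (op (c N)) ⊙ₗ ((c i ⟶[V] c N) ⊙ₗ Y) = W.obj (op (c k)) ⊙ₗ ((c i ⟶[V] c k) ⊙ₗ Y)) :
    barCut W D c hkN ≫ W.obj (op (c k)) ⊴ₗ (chainCut D c hik ≫ (c i ⟶[V] c k) ⊴ₗ ψ) =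
      W.obj (op (c N)) ⊴ₗ (chainCut D c hiN ≫ (c i ⟶[V] c N) ⊴ₗ ψ) ≫ eqToHom e := by
  subst hk
  rw [barCut_self]
  simp

lemma barMap_representable (c : ℕ → C) {f : ℕ → ℕ} (hf : Monotone f) {m n : ℕ} (h : f m ≤ n) :
    barMap (representable (c (n + 1))) D c hf h =
      chainCut D c (h.trans n.le_succ) ≫ (c (f m) ⟶[V] c (n + 1)) ⊴ₗ chainMap D c hf m := by
  rw [barMap, barCut, weightAct_representable, chainCut_succ D c h]

lemma barMapOfEq_append (c d : ℕ → C) {f : ℕ → ℕ} (hf : Monotone f) {m n : ℕ}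
    (h : f m ≤ n) (hmn : f (m + 1) = n + 1) (e : d = fun i ↦ c (f i)) {b : C} (hb : c (n + 1) = b)
    (hb' : d (m + 1) = b) :
    barMapOfEq W D hf hmn.le e ≫ eqToHom (barObj_append W D d m hb' (fun _ _ ↦ rfl)) =
      eqToHom (barObj_append W D c n hb (fun _ _ ↦ rfl)) ≫
        W.obj (op b) ⊴ₗ barMapOfEq (representable b) D hf h e := by
  subst e hb
  have key := barCut_chainCut W D c hmn (hf m.le_succ) hmn.le (h.trans n.le_succ)
    (chainMap D c hf m) (by rw [hmn])
  simp only [barMapOfEq, eqToHom_refl, Category.comp_id, Category.id_comp]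
  rw [barMap_representable]
  refine (congrArg (· ≫ eqToHom _) key).trans ?_
  simp

lemma seq_append_last (b : C) (x : (families C).Elements) :
    seq ((appendFunctor b).obj x) (x.1.unop.len + 1) = b :=
  extend_appendFun_last (n := x.1.unop.len) _ _

lemma seq_append_of_le (b : C) (x : (families C).Elements) (i : ℕ) (hi : i ≤ x.1.unop.len) :
    seq ((appendFunctor b).obj x) i = seq x i :=
  extend_appendFun_of_le (n := x.1.unop.len) _ _ hi

lemma seq_eq_seq_append (b : C) (x : (families C).Elements) :
    seq x = fun k ↦ seq ((appendFunctor b).obj x) (min k x.1.unop.len) :=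
  extend_eq_extend_appendFun (n := x.1.unop.len) _ _

/-- The bar construction of an extended sequence. -/
def appendIso (b : C) (x : (families C).Elements) :
    (barDiagram W D).obj ((appendFunctor b).obj x) ≅
      W.obj (op b) ⊙ₗ (barDiagram (representable b) D).obj x :=
  eqToIso (barObj_append W D (seq ((appendFunctor b).obj x)) x.1.unop.len (seq_append_last b x)
    (seq_append_of_le b x))

lemma monotone_min (n : ℕ) : Monotone fun k ↦ min k n := fun _ _ h ↦ min_le_min_right _ h

lemma appendIso_hom (b : C) (x : (families C).Elements) :
    (appendIso W D b x).hom =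
      eqToHom (barObj_append W D _ _ (seq_append_last b x) (fun _ _ ↦ rfl)) ≫
        W.obj (op b) ⊴ₗ barMapOfEq (representable b) D (monotone_min x.1.unop.len)
          (min_le_left _ _) (seq_eq_seq_append b x) := by
  rw [barMapOfEq_eqToHom (representable b) D (monotone_min x.1.unop.len)
    (min_le_left _ _) (seq_eq_seq_append b x) (fun i hi ↦ min_eq_left hi)
    (barObj_congr _ D (seq_append_of_le b x)), actionHomRight_eqToHom, eqToHom_trans]
  rfl

lemma appendIso_hom_naturality (b : C) {x y : (families C).Elements} (f : x ⟶ y) :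
    (barDiagram W D).map ((appendFunctor b).map f) ≫ (appendIso W D b y).hom =
      (appendIso W D b x).hom ≫ W.obj (op b) ⊴ₗ (barDiagram (representable b) D).map f := by
  let φ := f.1.unop.toOrderHom
  have h : extendMap (appendMap φ) y.1.unop.len ≤ x.1.unop.len := by
    rw [extendMap_appendMap_of_le φ le_rfl]
    exact extendMap_le _ _
  have e := extend_elements_map ((appendFunctor b).map f)
  have h₁ := barMapOfEq_append W D (seq ((appendFunctor b).obj x)) (seq ((appendFunctor b).obj y))
    (extendMap_monotone (appendMap φ)) h (extendMap_appendMap_last φ) e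
    (seq_append_last b x) (seq_append_last b y)
  rw [appendIso_hom, appendIso_hom]
  refine (Category.assoc _ _ _).symm.trans ((h₁ =≫ _).trans ?_)
  refine (Category.assoc _ _ _).trans (Eq.trans (_ ≫= ?_) (Category.assoc _ _ _).symm)
  refine (MonoidalLeftAction.actionHomRight_comp _ _ _).symm.trans (Eq.trans
    (congrArg (fun t ↦ W.obj (op b) ⊴ₗ t) ?_) (MonoidalLeftAction.actionHomRight_comp _ _ _))
  have e' : seq y = fun k ↦ seq ((appendFunctor b).obj x) (extendMap φ k) := by
    refine (extend_elements_map f).trans (funext fun k ↦ ?_)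
    exact (seq_append_of_le b x _ (extendMap_le φ k)).symm
  refine (barMapOfEq_comp _ D _ _ (extendMap_monotone φ) _ _ (extendMap_le _ _) _ _ e' ?_).trans
    (barMapOfEq_comp _ D _ _ (extendMap_monotone φ) _ _ (extendMap_le _ _) _
      (extend_elements_map f) e' ?_).symm
  · funext k
    rw [extendMap_appendMap_of_le φ (min_le_right _ _)]
    simp [extendMap, extend]
  · funext k
    exact (min_eq_left (extendMap_le φ k)).symm

lemma eqToHom_weightAct (b : C) {a a' : C} (ha : a = a') {X X' : M} (hX : X = X')
    (e : (a ⟶[V] b) ⊙ₗ X = (a' ⟶[V] b) ⊙ₗ X')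
    (e' : W.obj (op a) ⊙ₗ X = W.obj (op a') ⊙ₗ X') :
    W.obj (op b) ⊴ₗ eqToHom e ≫ (αₗ _ _ _).inv ≫ weightAct W a' b ⊵ₗ X' =
      ((αₗ _ _ _).inv ≫ weightAct W a b ⊵ₗ X) ≫ eqToHom e' := by
  subst ha hX
  simp

lemma barCut_succ (c : ℕ → C) (n : ℕ) (h : n ≤ n + 1) :
    barCut W D c h = (αₗ _ _ _).inv ≫ weightAct W (c n) (c (n + 1)) ⊵ₗ chainObj D c n := by
  rw [barCut, chainCut_succ_self]
  exact (MonoidalLeftAction.actionHomRight_id _ _ =≫ _).trans (Category.id_comp _)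

lemma barMapOfEq_proj {c c' : ℕ → C} {n : ℕ} {b : C} (hb : c (n + 1) = b)
    (hc : ∀ i ≤ n, c i = c' i) {f : ℕ → ℕ} (hf : Monotone f) (h : f n ≤ n + 1)
    (e : c' = fun i ↦ c (f i)) (hid : ∀ i ≤ n, f i = i) :
    barMapOfEq W D hf h e = eqToHom (barObj_append W D c n hb hc) ≫
      (αₗ _ _ _).inv ≫ weightAct W (c' n) b ⊵ₗ chainObj D c' n := by
  subst hb
  have h₁ := barMapOfEq_comp W D monotone_id hf hf n.le_succ (hid n le_rfl).le h rfl e e rfl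
  have h₂ : barMapOfEq W D (c := c) monotone_id n.le_succ rfl = barCut W D c n.le_succ := by
    rw [barMapOfEq, barMap, chainMap_id]
    refine (Category.comp_id _).trans ?_
    exact (_ ≫= MonoidalLeftAction.actionHomRight_id _ _).trans (Category.comp_id _)
  rw [← h₁, h₂, barCut_succ, barMapOfEq_eqToHom W D hf _ e hid (barObj_congr W D hc),
    ← eqToHom_weightAct W _ (hc n le_rfl) (chainObj_congr D hc)
      (barObj_congr (representable (c (n + 1))) D hc),
    actionHomRight_eqToHom]

lemma barDiagram_map_appendProj (b : C) (x : (families C).Elements) :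
    (barDiagram W D).map (appendProj b x) = (appendIso W D b x).hom ≫
      (αₗ _ _ _).inv ≫ weightAct W (lastObj x) b ⊵ₗ chainObj D (seq x) x.1.unop.len :=
  barMapOfEq_proj W D (seq_append_last b x) (seq_append_of_le b x) _ _
    (extend_elements_map (appendProj b x))
    (fun _ hi ↦ min_eq_left hi)

lemma eqToHom_diagramAct {a a' b b' : C} (ha : a = a') (hb : b = b') {X X' : M} (hX : X = X')
    {φ : X ⟶ D.obj a} {φ' : X' ⟶ D.obj a'} (h : eqToHom hX ≫ φ' = φ ≫ eqToHom (by rw [ha]))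
    (e : (a ⟶[V] b) ⊙ₗ X = (a' ⟶[V] b') ⊙ₗ X') :
    eqToHom e ≫ (a' ⟶[V] b') ⊴ₗ φ' ≫ diagramAct D a' b' =
      ((a ⟶[V] b) ⊴ₗ φ ≫ diagramAct D a b) ≫ eqToHom (by rw [hb]) := by
  subst ha hb hX
  simp only [eqToHom_refl, Category.id_comp, Category.comp_id] at h ⊢
  rw [h]

lemma eqToHom_chainAct {c c' : ℕ → C} {n : ℕ} (h : ∀ i ≤ n, c i = c' i) :
    eqToHom (chainObj_congr D h) ≫ chainAct D c' n =
      chainAct D c n ≫ eqToHom (by rw [h n le_rfl]) := by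
  induction n with
  | zero => exact (Category.comp_id _).trans (Category.id_comp _).symm
  | succ n ih =>
    exact eqToHom_diagramAct D (h n n.le_succ) (h (n + 1) le_rfl)
      (chainObj_congr D fun i hi ↦ h i (hi.trans n.le_succ))
      (ih fun i hi ↦ h i (hi.trans n.le_succ)) _

lemma barCut_chainAct (c : ℕ → C) {k N : ℕ} (hk : k = N) (hkN : k ≤ N)
    (e : W.obj (op (c N)) ⊙ₗ D.obj (c N) = W.obj (op (c k)) ⊙ₗ D.obj (c k)) :
    barCut W D c hkN ≫ W.obj (op (c k)) ⊴ₗ chainAct D c k =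
      W.obj (op (c N)) ⊴ₗ chainAct D c N ≫ eqToHom e := by
  subst hk
  rw [barCut_self]
  simp

lemma barMapOfEq_last {c c' d : ℕ → C} {n : ℕ} {b : C} (hb : c (n + 1) = b)
    (hc : ∀ i ≤ n, c i = c' i) {f : ℕ → ℕ} (hf : Monotone f) (h : f 0 ≤ n + 1)
    (e : d = fun i ↦ c (f i)) (h0 : f 0 = n + 1) (hd : d 0 = b) :
    barMapOfEq W D hf h e = eqToHom (barObj_append W D c n hb hc) ≫
      W.obj (op b) ⊴ₗ ((c' n ⟶[V] b) ⊴ₗ chainAct D c' n ≫ diagramAct D (c' n) b) ≫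
        eqToHom (by rw [barObj, chainObj, hd]) := by
  subst hb e
  have h₁ := eqToHom_diagramAct D (hc n le_rfl) (rfl : c (n + 1) = _) (chainObj_congr D hc)
    (eqToHom_chainAct D hc) (barObj_congr (representable (c (n + 1))) D hc)
  rw [eqToHom_refl, Category.comp_id] at h₁
  have h₂ : eqToHom (barObj_append W D c n rfl hc) = W.obj (op (c (n + 1))) ⊴ₗ
    eqToHom (barObj_congr (representable (c (n + 1))) D hc) := (actionHomRight_eqToHom _).symm
  rw [h₂, ← MonoidalLeftAction.actionHomRight_comp_assoc, h₁]
  refine (Category.comp_id _).trans ?_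
  exact barCut_chainAct W D c h0 h _

lemma chainCut_eqToHom_self (c : ℕ → C) {i n : ℕ} (hi : i = n) (h : i ≤ n) {Y : M}
    (hY : chainObj D c i = Y) (e : (c n ⟶[V] c n) ⊙ₗ chainObj D c n = (c i ⟶[V] c n) ⊙ₗ Y) :
    chainCut D c h ≫ (c i ⟶[V] c n) ⊴ₗ eqToHom hY =
      ((λₗ[V] _).inv ≫ eId V (c n) ⊵ₗ chainObj D c n) ≫ eqToHom e := by
  subst hi hY
  rw [chainCut_self]
  simp

lemma barMapOfEq_repeat {c c' : ℕ → C} {n : ℕ} (hb : c (n + 1) = c' n)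
    (hc : ∀ i ≤ n, c i = c' i) {f : ℕ → ℕ} (hf : Monotone f) (h : f (n + 1) ≤ n)
    (e : c = fun i ↦ c' (f i)) (hid : ∀ i ≤ n, f i = i) (h' : f (n + 1) = n) :
    barMapOfEq W D hf h e ≫ eqToHom (barObj_append W D c n hb hc) =
      W.obj (op (c' n)) ⊴ₗ ((λₗ[V] _).inv ≫ eId V (c' n) ⊵ₗ chainObj D c' n) := by
  subst e
  have h₁ := barCut_chainCut W D c' h' (hf n.le_succ) h (hid n le_rfl).le
    (chainMap D c' hf n) (by rw [h'])
  have e₁ : chainObj D c' (f n) = chainObj D (fun i ↦ c' (f i)) n := by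
    rw [hid n le_rfl]
    exact (chainObj_congr D hc).symm
  have e₂ : (c' n ⟶[V] c' n) ⊙ₗ chainObj D c' n =
      (c' (f n) ⟶[V] c' n) ⊙ₗ chainObj D (fun i ↦ c' (f i)) n := by
    rw [← e₁, hid n le_rfl]
  rw [chainMap_eqToHom D c' hf hid e₁, chainCut_eqToHom_self D c' (hid n le_rfl) _ e₁ e₂] at h₁
  rw [barMapOfEq, eqToHom_refl, Category.comp_id, barMap, chainMap,
    chainMap_eqToHom D c' hf hid e₁]
  refine (h₁ =≫ _).trans ?_
  rw [MonoidalLeftAction.actionHomRight_comp, actionHomRight_eqToHom]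
  simp

/-- The total action on the bar construction of a representable weight. -/
def barAct (b : C) (x : (families C).Elements) :
    (barDiagram (representable b) D).obj x ⟶ D.obj b :=
  (lastObj x ⟶[V] b) ⊴ₗ chainAct D (seq x) x.1.unop.len ≫ diagramAct D (lastObj x) b

lemma barDiagram_map_appendLast (b : C) (x : (families C).Elements) :
    (barDiagram W D).map (appendLast b x) = (appendIso W D b x).hom ≫
      W.obj (op b) ⊴ₗ barAct D b x :=
  (barMapOfEq_last W D (seq_append_last b x) (seq_append_of_le b x) _ _
    (extend_elements_map (appendLast b x)) rfl rfl).trans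
    (_ ≫= Category.comp_id _)

lemma barDiagram_map_appendRepeat (x : (families C).Elements) :
    (barDiagram W D).map (appendRepeat x) ≫ (appendIso W D (lastObj x) x).hom =
      W.obj (op (lastObj x)) ⊴ₗ ((λₗ[V] _).inv ≫
        eId V (lastObj x) ⊵ₗ chainObj D (seq x) x.1.unop.len) :=
  barMapOfEq_repeat W D (seq_append_last _ x) (seq_append_of_le _ x) _ _
    (extend_elements_map (appendRepeat x))
    (fun i hi ↦ by
      change min (min i (x.1.unop.len + 1)) x.1.unop.len = i
      omega)
    (by
      change min (min (x.1.unop.len + 1) (x.1.unop.len + 1)) x.1.unop.len = x.1.unop.len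
      omega)

lemma barDiagram_map_barAct (b : C) {x y : (families C).Elements} (f : x ⟶ y) :
    (barDiagram (representable b) D).map f ≫ barAct D b y = barAct D b x := by
  let B := barDiagram (representable (V := V) b) D
  have h₁ : B.map (appendLast b x) = B.map ((appendFunctor b).map f) ≫ B.map (appendLast b y) := by
    rw [← B.map_comp, appendLast_naturality]
  have h₂ : (appendIso (representable (V := V) b) D b x).hom ≫ (b ⟶[V] b) ⊴ₗ barAct D b x =
      (appendIso (representable (V := V) b) D b x).hom ≫
        (b ⟶[V] b) ⊴ₗ (B.map f ≫ barAct D b y) := by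
    refine (barDiagram_map_appendLast _ D b x).symm.trans (h₁.trans
      ((_ ≫= barDiagram_map_appendLast _ D b y).trans ?_))
    refine (Category.assoc _ _ _).symm.trans ((appendIso_hom_naturality _ D b f =≫ _).trans ?_)
    refine (Category.assoc _ _ _).trans (_ ≫= ?_)
    exact (MonoidalLeftAction.actionHomRight_comp _ _ _).symm
  have h := (cancel_epi _).1 h₂
  have key {X : M} (g : X ⟶ D.obj b) : ((λₗ[V] X).inv ≫ eId V b ⊵ₗ X) ≫
      (b ⟶[V] b) ⊴ₗ g ≫ diagramAct D b b = g := by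
    rw [← Category.assoc, act_unit_natural, Category.assoc, Category.assoc, diagramAct_id,
      Category.comp_id]
  rw [← key (barAct D b x), ← key (_ ≫ barAct D b y)]
  exact congrArg (fun t ↦ ((λₗ[V] _).inv ≫ eId V b ⊵ₗ _) ≫ t ≫ diagramAct D b b) h.symm

end AppendBar

section Chains

variable {V : Type u₁} [Category.{v} V] [MonoidalCategory V] [SymmetricCategory V]
  {C : Type v} [EnrichedCategory V C]
  {M : Type u₂} [Category.{v} M] [EnrichedOrdinaryCategory V M] [Tensored V M]

variable (C) in
/-- Finite sequences of objects with a given last object. -/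
inductive Chain : C → Type v
  | nil (a : C) : Chain a
  | cons {b : C} (x : Chain b) (b' : C) : Chain b'

namespace Chain

/-- The iterated tensor of a sequence. -/
@[reducible]
def ch (D : EnrichedFunctor V C M) : {b : C} → Chain C b → M
  | _, nil a => D.obj a
  | _, cons (b := b) x b' => (b ⟶[V] b') ⊙ₗ ch D x

/-- The ways of obtaining a sequence by repeating an entry of another one. -/
inductive Deg : {b : C} → Chain C b → Chain C b → Type v
  | here {b : C} (x : Chain C b) : Deg x (x.cons b)
  | cons {b : C} {y x : Chain C b} (d : Deg y x) (b' : C) : Deg (y.cons b') (x.cons b')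

/-- The insertion of a unit. -/
def degMap (D : EnrichedFunctor V C M) : {b : C} → {y x : Chain C b} → Deg y x → (ch D y ⟶ ch D x)
  | _, _, _, .here (b := b) x => (λₗ[V] (ch D x)).inv ≫ eId V b ⊵ₗ ch D x
  | _, _, _, .cons (b := b) d b' => (b ⟶[V] b') ⊴ₗ degMap D d

/-- Commutative squares of degeneracies. -/
inductive Sq : {b : C} → {w y y' x : Chain C b} → Deg w y → Deg y x → Deg w y' → Deg y' x → Prop
  | here {b : C} {y x : Chain C b} (d : Deg y x) : Sq (.here y) (.cons d b) d (.here x)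
  | cons {b : C} {w y y' x : Chain C b} {e : Deg w y} {d : Deg y x} {e' : Deg w y'} {d' : Deg y' x}
      (h : Sq e d e' d') (b' : C) : Sq (.cons e b') (.cons d b') (.cons e' b') (.cons d' b')

end Chain

variable [MonoidalClosed V] [HasLimits V] [HasColimits V] [ModelCategory V] [MonoidalModelCategory V]
  [HasLimits M] [HasColimits M] [ModelCategory M] [ModelEnrichedCategory V M]

/-- The lifting property of `j`, with respect to `p`, against all cofibrations. -/
def CofibrationLift {K L : V} (k : K ⟶ L) {E B : M} (p : E ⟶ B) : Prop :=
  ∀ {X Y : M} (f : X ⟶ Y), Cofibration f → ActLift k f p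

lemma CofibrationLift.exists_lift {K L : V} {k : K ⟶ L} {E B : M} {p : E ⟶ B}
    (hk : CofibrationLift k p) {X : M} (hX : IsCofibrant X) (a : K ⊙ₗ X ⟶ E) (g : L ⊙ₗ X ⟶ B)
    (h : a ≫ p = k ⊵ₗ X ≫ g) : ∃ t : L ⊙ₗ X ⟶ E, k ⊵ₗ X ≫ t = a ∧ t ≫ p = g := by
  have ext {N : V} {Z : M} (f g : N ⊙ₗ (⊥_ M) ⟶ Z) : f = g :=
    (cotensorEquiv N (⊥_ M) Z).symm.injective (initial.hom_ext _ _)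
  rw [isCofibrant_iff] at hX
  obtain ⟨t, h₁, -, h₂⟩ := hk (initial.to X) hX a (cotensorEquiv L _ _ (initial.to _)) g (ext _ _) h
    (ext _ _)
  exact ⟨t, h₁, h₂⟩

lemma CofibrationLift.whiskerRight {K L : V} {k : K ⟶ L} {E B : M} {p : E ⟶ B}
    (hk : CofibrationLift k p) {N : V} (hN : IsFlat (tensorBifunctor V M) N) :
    CofibrationLift (k ▷ N) p := by
  intro X Y f hf a b g e₁ e₂ e₃
  have ex {A : M} (f : X ⟶ A) (Z : V) : Z ⊴ₗ N ⊴ₗ f ≫ (αₗ Z N A).inv =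
      (αₗ Z N X).inv ≫ (Z ⊗ N) ⊴ₗ f := by simp
  have ex' (A : M) : k ⊵ₗ (N ⊙ₗ A) ≫ (αₗ L N A).inv = (αₗ K N A).inv ≫ (k ▷ N) ⊵ₗ A := by simp
  obtain ⟨t, h₁, h₂, h₃⟩ := hk (N ⊴ₗ f) (hN f hf).1 ((αₗ _ _ _).inv ≫ a) ((αₗ _ _ _).inv ≫ b)
    ((αₗ _ _ _).inv ≫ g) (by rw [reassoc_of% ex, reassoc_of% ex', e₁])
    (by rw [reassoc_of% ex', Category.assoc, e₂]) (by rw [reassoc_of% ex, Category.assoc, e₃])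
  refine ⟨(αₗ _ _ _).hom ≫ t, ?_, ?_, ?_⟩
  · rw [Iso.eq_inv_comp] at h₁
    rw [← h₁]
    simp
  · rw [Iso.eq_inv_comp] at h₂
    rw [← h₂]
    simp
  · rw [Category.assoc, h₃, Iso.hom_inv_id_assoc]

lemma hom_ext_act_pushout {K : V} {X Y Z E : M} {f : X ⟶ Y} {g : X ⟶ Z}
    {φ ψ : K ⊙ₗ pushout f g ⟶ E} (h : K ⊴ₗ pushout.inl f g ≫ φ = K ⊴ₗ pushout.inl f g ≫ ψ)
    (h' : K ⊴ₗ pushout.inr f g ≫ φ = K ⊴ₗ pushout.inr f g ≫ ψ) : φ = ψ := by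
  apply (cotensorEquiv K _ E).symm.injective
  apply pushout.hom_ext
  · rw [← cotensorEquiv_symm_comp, ← cotensorEquiv_symm_comp, h]
  · rw [← cotensorEquiv_symm_comp, ← cotensorEquiv_symm_comp, h']

lemma exists_desc_act_pushout {K : V} {X Y Z E : M} {f : X ⟶ Y} {g : X ⟶ Z}
    (φ : K ⊙ₗ Y ⟶ E) (ψ : K ⊙ₗ Z ⟶ E) (h : K ⊴ₗ f ≫ φ = K ⊴ₗ g ≫ ψ) :
    ∃ χ : K ⊙ₗ pushout f g ⟶ E, K ⊴ₗ pushout.inl f g ≫ χ = φ ∧ K ⊴ₗ pushout.inr f g ≫ χ = ψ := by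
  refine ⟨cotensorEquiv K _ E (pushout.desc ((cotensorEquiv K _ E).symm φ)
    ((cotensorEquiv K _ E).symm ψ) ?_), ?_, ?_⟩
  · rw [← cotensorEquiv_symm_comp, ← cotensorEquiv_symm_comp, h]
  · rw [← cotensorEquiv_comp, pushout.inl_desc, Equiv.apply_symm_apply]
  · rw [← cotensorEquiv_comp, pushout.inr_desc, Equiv.apply_symm_apply]

lemma hom_ext_pushout_act {K L N : V} {X E : M} {f : K ⟶ L} {g : K ⟶ N}
    {φ ψ : pushout f g ⊙ₗ X ⟶ E} (h : pushout.inl f g ⊵ₗ X ≫ φ = pushout.inl f g ⊵ₗ X ≫ ψ)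
    (h' : pushout.inr f g ⊵ₗ X ≫ φ = pushout.inr f g ⊵ₗ X ≫ ψ) : φ = ψ := by
  apply (hatEquiv _ X E).injective
  apply pushout.hom_ext
  · rw [← hatEquiv_mapLeft, ← hatEquiv_mapLeft, h]
  · rw [← hatEquiv_mapLeft, ← hatEquiv_mapLeft, h']

lemma exists_desc_pushout_act {K L N : V} {X E : M} {f : K ⟶ L} {g : K ⟶ N}
    (φ : L ⊙ₗ X ⟶ E) (ψ : N ⊙ₗ X ⟶ E) (h : f ⊵ₗ X ≫ φ = g ⊵ₗ X ≫ ψ) :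
    ∃ χ : pushout f g ⊙ₗ X ⟶ E,
      pushout.inl f g ⊵ₗ X ≫ χ = φ ∧ pushout.inr f g ⊵ₗ X ≫ χ = ψ := by
  refine ⟨(hatEquiv _ X E).symm (pushout.desc (hatEquiv _ X E φ) (hatEquiv _ X E ψ) ?_), ?_, ?_⟩
  · rw [← hatEquiv_mapLeft, ← hatEquiv_mapLeft, h]
  · rw [← hatEquiv_symm_mapLeft, pushout.inl_desc, Equiv.symm_apply_apply]
  · rw [← hatEquiv_symm_mapLeft, pushout.inr_desc, Equiv.symm_apply_apply]

/-- The morphism `X ⟶ N ⊗ X` induced by a morphism from the unit. -/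
abbrev unitInsert {N : V} (u : 𝟙_ V ⟶ N) (X : M) : X ⟶ N ⊙ₗ X := (λₗ[V] X).inv ≫ u ⊵ₗ X

/-- The morphism `K ⟶ K ⊗ N` induced by a morphism from the unit. -/
abbrev unitInsertRight {N : V} (u : 𝟙_ V ⟶ N) (K : V) : K ⟶ K ⊗ N := (ρ_ K).inv ≫ K ◁ u

lemma unitInsertRight_act {N : V} (u : 𝟙_ V ⟶ N) (K : V) (X : M) :
    unitInsertRight u K ⊵ₗ X = K ⊴ₗ unitInsert u X ≫ (αₗ _ _ _).inv := by
  have h := act_right_unit (X := X) u (𝟙 (K ⊗ N)) (unitInsertRight u K) (by simp)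
  rw [← h]
  simp

/-- The pushout-product of `k` and `u`. -/
abbrev pushoutTensor {K L N : V} (k : K ⟶ L) (u : 𝟙_ V ⟶ N) :
    pushout (unitInsertRight u K) k ⟶ L ⊗ N :=
  pushout.desc (k ▷ N) (unitInsertRight u L) (by
    rw [Category.assoc, whisker_exchange, rightUnitor_inv_naturality_assoc])

lemma CofibrationLift.pushoutTensor {K L : V} {k : K ⟶ L} {E B : M} {p : E ⟶ B}
    (hk : CofibrationLift k p) {N : V} {u : 𝟙_ V ⟶ N}
    (hu : IsFlatMap (tensorBifunctor V M) u) : CofibrationLift (pushoutTensor k u) p := by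
  intro X Y f hf a b g e₁ e₂ e₃
  have hsq : IsPushout (u ⊵ₗ X) (𝟙_ V ⊴ₗ f) (pushout.inl (unitInsert u X) f)
      ((λₗ[V] Y).hom ≫ pushout.inr _ _) := by
    refine IsPushout.of_iso (IsPushout.of_hasPushout (unitInsert u X) f) (λₗ[V] X).symm
      (Iso.refl _) (λₗ[V] Y).symm (Iso.refl _) ?_ ?_ ?_ ?_
    · exact Category.comp_id _
    · exact (MonoidalLeftAction.actionUnitIso_inv_naturality (C := V) f).symm
    · exact (Category.comp_id _).trans (Category.id_comp _).symm
    · exact (Category.comp_id _).trans (Iso.inv_hom_id_assoc _ _).symm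
  have hsq' : u ⊵ₗ X ≫ N ⊴ₗ f = 𝟙_ V ⊴ₗ f ≫ u ⊵ₗ Y := (MonoidalLeftAction.action_exchange _ _).symm
  let sq : (tensorBifunctor V M).PushoutObjObj u f :=
    { pt := pushout (unitInsert u X) f
      inl := pushout.inl _ _
      inr := (λₗ[V] Y).hom ≫ pushout.inr _ _
      isPushout := hsq
      ι := hsq.desc (N ⊴ₗ f) (u ⊵ₗ Y) hsq'
      inl_ι := hsq.inl_desc _ _ hsq'
      inr_ι := hsq.inr_desc _ _ hsq' }
  have hι := (hu f sq hf).1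
  let ι : pushout (unitInsert u X) f ⟶ N ⊙ₗ Y := sq.ι
  have hl : pushout.inl _ _ ≫ ι = N ⊴ₗ f := sq.inl_ι
  have hr : pushout.inr _ _ ≫ ι = unitInsert u Y := by
    have h : ((λₗ[V] Y).hom ≫ pushout.inr _ _) ≫ ι = u ⊵ₗ Y := sq.inr_ι
    rw [Category.assoc, ← Iso.eq_inv_comp] at h
    exact h
  have kl : pushout.inl _ _ ≫ HWC.pushoutTensor k u = k ▷ N := pushout.inl_desc _ _ _
  have kr : pushout.inr _ _ ≫ HWC.pushoutTensor k u = unitInsertRight u L := pushout.inr_desc _ _ _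
  have fac (A : M) : unitInsertRight u L ⊵ₗ A ≫ (αₗ _ _ _).hom = L ⊴ₗ unitInsert u A := by
    rw [unitInsertRight_act, Category.assoc, Iso.inv_hom_id, Category.comp_id]
  have exf (Z : V) : Z ⊴ₗ N ⊴ₗ f ≫ (αₗ Z N Y).inv = (αₗ Z N X).inv ≫ (Z ⊗ N) ⊴ₗ f := by simp
  have exk (A : M) : k ⊵ₗ (N ⊙ₗ A) ≫ (αₗ L N A).inv = (αₗ K N A).inv ≫ (k ▷ N) ⊵ₗ A := by simp
  have c₁ : (pushout.inl _ _) ⊵ₗ X ≫ HWC.pushoutTensor k u ⊵ₗ X = (k ▷ N) ⊵ₗ X := by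
    rw [← MonoidalLeftAction.comp_actionHomLeft, kl]
  have c₁' : (pushout.inl _ _) ⊵ₗ Y ≫ HWC.pushoutTensor k u ⊵ₗ Y = (k ▷ N) ⊵ₗ Y := by
    rw [← MonoidalLeftAction.comp_actionHomLeft, kl]
  have c₂ (A : M) : (pushout.inr _ _) ⊵ₗ A ≫ HWC.pushoutTensor k u ⊵ₗ A =
      L ⊴ₗ unitInsert u A ≫ (αₗ _ _ _).inv := by
    rw [← MonoidalLeftAction.comp_actionHomLeft, kr, unitInsertRight_act]
  have hL {Z : V} : Z ⊴ₗ pushout.inl _ _ ≫ Z ⊴ₗ ι = Z ⊴ₗ N ⊴ₗ f := by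
    rw [← MonoidalLeftAction.actionHomRight_comp, hl]
  have hR {Z : V} : Z ⊴ₗ pushout.inr _ _ ≫ Z ⊴ₗ ι = Z ⊴ₗ unitInsert u Y := by
    rw [← MonoidalLeftAction.actionHomRight_comp, hr]
  obtain ⟨b₂, hb₁, hb₂⟩ := exists_desc_act_pushout (f := unitInsert u X) (g := f)
    ((αₗ L N X).inv ≫ b) ((pushout.inr (unitInsertRight u K) k) ⊵ₗ Y ≫ a) (by
      rw [action_exchange_assoc, e₁, reassoc_of% (c₂ X)])
  obtain ⟨t, h₁, h₂, h₃⟩ := hk ι hι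
    ((αₗ K N Y).inv ≫ (pushout.inl (unitInsertRight u K) k) ⊵ₗ Y ≫ a) b₂ ((αₗ L N Y).inv ≫ g) (by
      apply hom_ext_act_pushout
      · rw [reassoc_of% hL, reassoc_of% exf K, action_exchange_assoc, e₁, reassoc_of% c₁,
          action_exchange_assoc, hb₁, reassoc_of% exk]
      · rw [reassoc_of% hR, action_exchange_assoc, hb₂, ← comp_actionHomLeft_assoc,
          ← pushout.condition, comp_actionHomLeft_assoc, unitInsertRight_act, Category.assoc]) (by
      rw [Category.assoc, Category.assoc, e₂, reassoc_of% c₁', reassoc_of% exk]) (by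
      apply hom_ext_act_pushout
      · rw [reassoc_of% hb₁, e₃, reassoc_of% hL, reassoc_of% exf L]
      · rw [reassoc_of% hb₂, e₂, reassoc_of% hR, reassoc_of% (c₂ Y)])
  refine ⟨(αₗ L N Y).hom ≫ t, hom_ext_pushout_act ?_ ?_, ?_, ?_⟩
  · rw [reassoc_of% c₁', ← cancel_epi (αₗ K N Y).inv, ← reassoc_of% exk, Iso.inv_hom_id_assoc, h₁]
  · rw [reassoc_of% (c₂ Y), Iso.inv_hom_id_assoc, ← reassoc_of% (hR (Z := L)), h₂, hb₂]
  · rw [← cancel_epi (αₗ L N X).inv, ← reassoc_of% exf L, Iso.inv_hom_id_assoc,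
      ← reassoc_of% (hL (Z := L)), h₂, hb₁]
  · rw [Category.assoc, h₃, Iso.hom_inv_id_assoc]

lemma Chain.exists_lift (hC : LocallyPointedFlat C (tensorBifunctor V M))
    (D : EnrichedFunctor V C M) (hD : ∀ c, IsCofibrant (D.obj c)) {E B : M} (p : E ⟶ B) {b : C}
    (x : Chain C b) : ∀ {K L : V} (k : K ⟶ L), CofibrationLift k p →
    ∀ (a : K ⊙ₗ ch D x ⟶ E) (g : L ⊙ₗ ch D x ⟶ B) (s : ∀ y, Deg y x → (L ⊙ₗ ch D y ⟶ E)),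
    a ≫ p = k ⊵ₗ _ ≫ g → (∀ y d, k ⊵ₗ _ ≫ s y d = K ⊴ₗ degMap D d ≫ a) →
    (∀ y d, s y d ≫ p = L ⊴ₗ degMap D d ≫ g) →
    (∀ w y y' (e : Deg w y) (d : Deg y x) (e' : Deg w y') (d' : Deg y' x), Sq e d e' d' →
      L ⊴ₗ degMap D e ≫ s y d = L ⊴ₗ degMap D e' ≫ s y' d') →
    ∃ t : L ⊙ₗ ch D x ⟶ E, k ⊵ₗ _ ≫ t = a ∧ t ≫ p = g ∧ ∀ y d, L ⊴ₗ degMap D d ≫ t = s y d := by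
  induction x with
  | nil c =>
    intro K L k hk a g s h₁ h₂ h₃ h₄
    obtain ⟨t, ht, ht'⟩ := hk.exists_lift (hD c) a g h₁
    exact ⟨t, ht, ht', fun y d ↦ nomatch d⟩
  | @cons b x b' ih =>
    intro K L k hk a g s h₁ h₂ h₃ h₄
    by_cases hb : b = b'
    · subst hb
      let N := (b ⟶[V] b)
      have exf {Z : V} {A A' : M} (f : A ⟶ A') :
          (Z ⊗ N) ⊴ₗ f ≫ (αₗ Z N A').hom = (αₗ Z N A).hom ≫ Z ⊴ₗ N ⊴ₗ f := by simp
      have exk (A : M) : (k ▷ N) ⊵ₗ A ≫ (αₗ L N A).hom = (αₗ K N A).hom ≫ k ⊵ₗ (N ⊙ₗ A) := by simp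
      have fac (Z : V) (A : M) : unitInsertRight (eId V b) Z ⊵ₗ A ≫ (αₗ _ _ _).hom =
          Z ⊴ₗ unitInsert (eId V b) A := by
        rw [unitInsertRight_act, Category.assoc, Iso.inv_hom_id, Category.comp_id]
      have c₁ (A : M) : (pushout.inl _ _) ⊵ₗ A ≫ HWC.pushoutTensor k (eId V b) ⊵ₗ A =
          (k ▷ N) ⊵ₗ A := by
        rw [← MonoidalLeftAction.comp_actionHomLeft, pushout.inl_desc]
      have c₂ (A : M) : (pushout.inr _ _) ⊵ₗ A ≫ HWC.pushoutTensor k (eId V b) ⊵ₗ A =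
          unitInsertRight (eId V b) L ⊵ₗ A := by
        rw [← MonoidalLeftAction.comp_actionHomLeft, pushout.inr_desc]
      obtain ⟨a₁, ha₁, ha₂⟩ := exists_desc_pushout_act (f := unitInsertRight (eId V b) K) (g := k)
        ((αₗ K N (ch D x)).hom ≫ a) (s x (.here x)) (by
          rw [reassoc_of% fac, h₂]
          rfl)
      obtain ⟨t, ht₁, ht₂, ht₃⟩ := ih (HWC.pushoutTensor k (eId V b)) (hk.pushoutTensor (hC.2 b)) a₁
        ((αₗ L N (ch D x)).hom ≫ g) (fun y d ↦ (αₗ L N (ch D y)).hom ≫ s _ (d.cons b))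
        (hom_ext_pushout_act
          (by rw [reassoc_of% ha₁, h₁, reassoc_of% c₁, reassoc_of% exk])
          (by
            rw [reassoc_of% ha₂, h₃, reassoc_of% c₂, reassoc_of% fac]
            rfl))
        (fun y d ↦ hom_ext_pushout_act
          (by
            rw [reassoc_of% c₁, reassoc_of% exk, ← action_exchange_assoc, ha₁,
              reassoc_of% (exf (Z := K) (degMap D d))]
            exact _ ≫= h₂ _ (d.cons b))
          (by
            rw [reassoc_of% c₂, reassoc_of% fac, ← action_exchange_assoc, ha₂]
            exact h₄ _ _ _ _ _ _ _ (.here d)))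
        (fun y d ↦ by
          rw [Category.assoc, h₃, reassoc_of% (exf (Z := L) (degMap D d))]
          rfl)
        (fun w y y' e d e' d' h ↦ by
          rw [reassoc_of% (exf (Z := L) (degMap D e)), reassoc_of% (exf (Z := L) (degMap D e'))]
          exact congrArg _ (h₄ _ _ _ _ _ _ _ (.cons h b)))
      refine ⟨(αₗ L N (ch D x)).inv ≫ t, ?_, ?_, fun y d ↦ ?_⟩
      · have h := (pushout.inl _ _) ⊵ₗ (ch D x) ≫= ht₁
        rw [reassoc_of% c₁, ha₁] at h
        rw [← cancel_epi (αₗ K N (ch D x)).hom, ← h, ← reassoc_of% exk, Iso.hom_inv_id_assoc]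
      · rw [Category.assoc, ht₂, Iso.inv_hom_id_assoc]
      · cases d with
        | here =>
          have h := (pushout.inr _ _) ⊵ₗ (ch D x) ≫= ht₁
          rw [reassoc_of% c₂, ha₂, unitInsertRight_act, Category.assoc] at h
          exact h
        | cons d =>
          rw [← cancel_epi (αₗ L N (ch D _)).hom, ← ht₃]
          have h := reassoc_of% (exf (Z := L) (degMap D d))
          refine (h _).symm.trans ?_
          rw [Iso.hom_inv_id_assoc]
    · let N := (b ⟶[V] b')
      have exf {Z : V} {A A' : M} (f : A ⟶ A') :
          (Z ⊗ N) ⊴ₗ f ≫ (αₗ Z N A').hom = (αₗ Z N A).hom ≫ Z ⊴ₗ N ⊴ₗ f := by simp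
      have exk (A : M) : (k ▷ N) ⊵ₗ A ≫ (αₗ L N A).hom = (αₗ K N A).hom ≫ k ⊵ₗ (N ⊙ₗ A) := by simp
      obtain ⟨t, ht₁, ht₂, ht₃⟩ := ih (k ▷ N) (hk.whiskerRight (hC.1 b b'))
        ((αₗ K N (ch D x)).hom ≫ a) ((αₗ L N (ch D x)).hom ≫ g)
        (fun y d ↦ (αₗ L N (ch D y)).hom ≫ s _ (d.cons b'))
        (by rw [Category.assoc, h₁, reassoc_of% exk])
        (fun y d ↦ by
          rw [reassoc_of% exk, reassoc_of% (exf (Z := K) (degMap D d))]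
          exact _ ≫= h₂ _ (d.cons b'))
        (fun y d ↦ by
          rw [Category.assoc, h₃, reassoc_of% (exf (Z := L) (degMap D d))]
          rfl)
        (fun w y y' e d e' d' h ↦ by
          rw [reassoc_of% (exf (Z := L) (degMap D e)), reassoc_of% (exf (Z := L) (degMap D e'))]
          exact congrArg _ (h₄ _ _ _ _ _ _ _ (.cons h b')))
      refine ⟨(αₗ L N (ch D x)).inv ≫ t, ?_, ?_, fun y d ↦ ?_⟩
      · rw [← cancel_epi (αₗ K N (ch D x)).hom, ← ht₁, ← reassoc_of% exk, Iso.hom_inv_id_assoc]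
      · rw [Category.assoc, ht₂, Iso.inv_hom_id_assoc]
      · cases d with
        | here => exact absurd rfl hb
        | cons d =>
          rw [← cancel_epi (αₗ L N (ch D _)).hom, ← ht₃]
          have h := reassoc_of% (exf (Z := L) (degMap D d))
          refine (h _).symm.trans ?_
          rw [Iso.hom_inv_id_assoc]

end Chains

section ChainElements

variable {C : Type v}

/-- The morphism repeating the last object, for a given last object. -/
def repeatHom {b : C} (x : (families C).Elements) (h : lastObj x = b) :
    x ⟶ (appendFunctor b).obj x := by
  subst h
  exact appendRepeat x

lemma repeatHom_toOrderHom {b : C} (x : (families C).Elements) (h : lastObj x = b) :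
    (repeatHom x h).1.unop.toOrderHom = lastDegeneracy x.1.unop.len := by
  subst h
  rfl

lemma elements_hom_ext {x y : (families C).Elements} {f g : x ⟶ y}
    (h : f.1.unop.toOrderHom = g.1.unop.toOrderHom) : f = g :=
  CategoryOfElements.ext _ _ _ (Quiver.Hom.unop_inj (SimplexCategory.Hom.ext _ _ h))

lemma repeatHom_naturality {b : C} {x y : (families C).Elements} (f : x ⟶ y)
    (hx : lastObj x = b) (hy : lastObj y = b)
    (hf : f.1.unop.toOrderHom (Fin.last _) = Fin.last _) :
    repeatHom x hx ≫ (appendFunctor b).map f = f ≫ repeatHom y hy := by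
  apply elements_hom_ext
  ext i
  change ((repeatHom x hx).1.unop.toOrderHom (appendMap f.1.unop.toOrderHom i)).1 =
    (f.1.unop.toOrderHom ((repeatHom y hy).1.unop.toOrderHom i)).1
  rw [repeatHom_toOrderHom, repeatHom_toOrderHom]
  change min (appendMap f.1.unop.toOrderHom i).1 x.1.unop.len =
    (f.1.unop.toOrderHom ⟨min i.1 y.1.unop.len, _⟩).1
  obtain h | h := le_or_gt i.1 y.1.unop.len
  · rw [appendMap_of_le _ _ h]
    simp only [min_eq_left h]
    exact min_eq_left (Nat.le_of_lt_succ (f.1.unop.toOrderHom _).2)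
  · rw [appendMap_of_lt _ _ h]
    simp only [min_eq_right h.le]
    refine (min_eq_right (Nat.le_succ _)).trans ?_
    exact congrArg Fin.val hf.symm

namespace Chain

/-- The element of `families C` underlying a chain. -/
@[reducible]
def el : {b : C} → Chain C b → (families C).Elements
  | _, nil a => singleSeq a
  | _, cons x b' => (appendFunctor b').obj (el x)

lemma lastObj_el : {b : C} → (x : Chain C b) → lastObj (el x) = b
  | _, nil a => rfl
  | _, cons x b' => seq_append_last b' (el x)

/-- The morphism underlying a degeneracy. -/
def degHom : {b : C} → {y x : Chain C b} → Deg y x → (el y ⟶ el x)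
  | _, _, _, .here x => repeatHom (el x) (lastObj_el x)
  | _, _, _, .cons d b' => (appendFunctor b').map (degHom d)

lemma degHom_last {b : C} {y x : Chain C b} (d : Deg y x) :
    (degHom d).1.unop.toOrderHom (Fin.last _) = Fin.last _ := by
  cases d with
  | here =>
    rw [degHom, repeatHom_toOrderHom]
    exact Fin.ext (min_eq_right (Nat.le_succ _))
  | cons d => exact appendMap_of_lt _ _ (Nat.lt_succ_self _)

lemma degHom_len {b : C} {y x : Chain C b} (d : Deg y x) :
    (el x).1.unop.len = (el y).1.unop.len + 1 := by
  induction d with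
  | here => rfl
  | cons d b' ih => exact congrArg (· + 1) ih

lemma Sq.degHom_comp {b : C} {w y y' x : Chain C b} {e : Deg w y} {d : Deg y x} {e' : Deg w y'}
    {d' : Deg y' x} (h : Sq e d e' d') : degHom e ≫ degHom d = degHom e' ≫ degHom d' := by
  induction h with
  | here d => exact repeatHom_naturality _ _ _ (degHom_last d)
  | cons h b' ih =>
    exact ((appendFunctor b').map_comp _ _).symm.trans
      ((congrArg (appendFunctor b').map ih).trans ((appendFunctor b').map_comp _ _))

lemma exists_eq_el (x : (families C).Elements) : ∃ (b : C) (z : Chain C b), x = el z := by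
  obtain ⟨⟨n⟩, c⟩ := x
  induction n using SimplexCategory.rec with | _ n
  induction n with
  | zero =>
    refine ⟨c 0, .nil _, ?_⟩
    refine Sigma.ext rfl (heq_of_eq (funext fun i ↦ ?_))
    exact congrArg c (Subsingleton.elim (α := Fin 1) _ _)
  | succ n ih =>
    obtain ⟨b, z, hz⟩ := ih (fun i : Fin (n + 1) ↦ c i.castSucc)
    refine ⟨c (Fin.last _), z.cons _, ?_⟩
    rw [el, ← hz]
    refine Sigma.ext rfl (heq_of_eq (funext fun i ↦ ?_))
    obtain h | h := le_or_gt i.1 n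
    · exact (appendFun_of_le (n := n) (fun i : Fin (n + 1) ↦ c i.castSucc) _ i h).symm
    · refine Eq.trans ?_ (appendFun_of_lt (n := n) (fun i : Fin (n + 1) ↦ c i.castSucc) _ i h).symm
      refine congrArg c (Fin.ext ?_)
      have h₁ := i.2
      change i.1 < n + 1 + 1 at h₁
      change i.1 = n + 1
      omega

lemma exists_eq_comp_degHom {b : C} (x : Chain C b) :
    ∀ (y : (families C).Elements) (e : y ⟶ el x), y.1.unop.len < (el x).1.unop.len →
      ∃ (w : Chain C b) (d : Deg w x) (f : y ⟶ el w), e = f ≫ degHom d := by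
  induction x with
  | nil a => intro y e h; exact absurd h (Nat.not_lt_zero _)
  | @cons b x b' ih =>
    intro y e h
    let n := (el x).1.unop.len
    let m := y.1.unop.len
    replace h : m < n + 1 := h
    let φ : Fin (n + 1 + 1) →o Fin (m + 1) := e.1.unop.toOrderHom
    have hφ (i : Fin (n + 1 + 1)) : y.2 (φ i) = appendFun (n := n) (el x).2 b' i := congrFun e.2 i
    have hφ₁ (i : Fin (n + 1)) : y.2 (φ i.castSucc) = (el x).2 i :=
      (hφ _).trans (appendFun_of_le (n := n) _ _ _ (Nat.le_of_lt_succ i.2))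
    have hφ₂ : y.2 (φ (Fin.last _)) = b' :=
      (hφ _).trans (appendFun_of_lt (n := n) _ _ _ (Nat.lt_succ_self _))
    have hmono : (φ (Fin.last n).castSucc).1 ≤ (φ (Fin.last _)).1 := φ.monotone (Fin.le_last _)
    obtain hlt | heq := hmono.lt_or_eq
    · let k := (φ (Fin.last n).castSucc).1
      have hk : k < m := hlt.trans_le (Nat.le_of_lt_succ (φ (Fin.last _)).2)
      let y' : (families C).Elements := (families C).elementsMk (op (SimplexCategory.mk k))
        (fun i : Fin (k + 1) ↦ y.2 ⟨i.1, by have := i.2; omega⟩)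
      let ψ : Fin (n + 1) →o Fin (k + 1) :=
        { toFun := fun i ↦ ⟨(φ i.castSucc).1, Nat.lt_succ_of_le (φ.monotone
            (show i.castSucc ≤ (Fin.last n).castSucc from Fin.le_last i))⟩
          monotone' := fun i j hij ↦ φ.monotone (show i.castSucc ≤ j.castSucc from hij) }
      let e' : y' ⟶ el x := CategoryOfElements.homMk _ _
        (Quiver.Hom.op (SimplexCategory.mkHom ψ)) (funext fun i ↦ hφ₁ i)
      obtain ⟨w, d, f, hf⟩ := ih y' e' (show k < n by omega)
      let χ : Fin (k + 1 + 1) →o Fin (m + 1) :=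
        { toFun := fun i ↦ if i.1 ≤ k then ⟨min i.1 k, by omega⟩ else φ (Fin.last _)
          monotone' := fun i j hij ↦ by
            have hij' : i.1 ≤ j.1 := hij
            dsimp only
            split_ifs with h₁ h₂ h₂
            · exact Fin.mk_le_mk.2 (min_le_min_right _ hij)
            · exact Fin.mk_le_of_le_val (((min_le_right _ _).trans hlt.le))
            · omega
            · exact le_rfl }
      let e'' : y ⟶ (appendFunctor b').obj y' := CategoryOfElements.homMk _ _
        (Quiver.Hom.op (SimplexCategory.mkHom χ)) (funext fun i ↦ by
          change y.2 (if i.1 ≤ k then ⟨min i.1 k, _⟩ else φ (Fin.last _)) =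
            appendFun (n := k) y'.2 b' i
          split_ifs with h₁
          · rw [appendFun_of_le (n := k) y'.2 b' i h₁]
            exact congrArg y.2 (Fin.ext (min_eq_left h₁))
          · rw [appendFun_of_lt (n := k) y'.2 b' i (by omega), hφ₂])
      refine ⟨w.cons b', d.cons b', e'' ≫ (appendFunctor b').map f, ?_⟩
      rw [Category.assoc, degHom]
      refine Eq.trans ?_ (_ ≫= ((congrArg (appendFunctor b').map hf).trans
        ((appendFunctor b').map_comp f (degHom d))))
      apply elements_hom_ext
      ext i
      change (φ i).1 = (χ (appendMap ψ i)).1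
      obtain h₁ | h₁ := le_or_gt i.1 n
      · rw [appendMap_of_le _ _ h₁]
        have h₂ : (ψ ⟨i.1, Nat.lt_succ_of_le h₁⟩).1 ≤ k :=
          Nat.le_of_lt_succ (ψ ⟨i.1, Nat.lt_succ_of_le h₁⟩).2
        refine Eq.trans ?_ (congrArg Fin.val (if_pos h₂)).symm
        exact (min_eq_left h₂).symm
      · rw [appendMap_of_lt _ _ h₁]
        refine Eq.trans ?_ (congrArg Fin.val (if_neg (Nat.not_succ_le_self _))).symm
        exact congrArg (fun i ↦ (φ i).1) (Fin.ext (show i.1 = n + 1 by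
          have h₂ := i.2
          change i.1 < n + 1 + 1 at h₂
          omega))
    · have hb : b = b' := by
        rw [← lastObj_el x, ← hφ₂, ← Fin.ext heq]
        refine Eq.trans ?_ (hφ₁ (Fin.last n)).symm
        exact congrArg (el x).2 (Fin.ext (min_self _))
      subst hb
      let f : y ⟶ el x := CategoryOfElements.homMk _ _ (Quiver.Hom.op (SimplexCategory.mkHom
        (φ.comp (Fin.castSuccOrderEmb (n := n + 1)).toOrderHom))) (funext fun i ↦ hφ₁ i)
      refine ⟨x, .here x, f, ?_⟩
      apply elements_hom_ext
      ext i
      change (φ i).1 = (φ (Fin.castSucc ((degHom (.here x)).1.unop.toOrderHom i))).1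
      rw [degHom, repeatHom_toOrderHom]
      obtain h₁ | h₁ := le_or_gt i.1 n
      · exact congrArg (fun i ↦ (φ i).1) (Fin.ext (min_eq_left h₁).symm)
      · have h₃ : i = Fin.last _ := Fin.ext (show i.1 = n + 1 by
          have h₂ := i.2
          change i.1 < n + 1 + 1 at h₂
          omega)
        rw [h₃]
        refine heq.symm.trans (congrArg (fun i ↦ (φ i).1) (Fin.ext ?_))
        exact (min_eq_right (Nat.le_succ n)).symm

end Chain

end ChainElements

section BarLift

variable {V : Type u₁} [Category.{v} V] [MonoidalCategory V] [SymmetricCategory V]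
  [MonoidalClosed V] {C : Type v} [EnrichedCategory V C]
  {M : Type u₂} [Category.{v} M] [EnrichedOrdinaryCategory V M] [Tensored V M]
  (W : EnrichedFunctor V Cᵒᵖ V) (D : EnrichedFunctor V C M)

namespace Chain

lemma chainObj_el : {b : C} → (x : Chain C b) →
    chainObj D (seq (el x)) (el x).1.unop.len = ch D x
  | _, nil a => rfl
  | _, cons (b := b) x b' => by
    change (seq (el (x.cons b')) (el x).1.unop.len ⟶[V]
      seq (el (x.cons b')) ((el x).1.unop.len + 1)) ⊙ₗ
      chainObj D (seq (el (x.cons b'))) (el x).1.unop.len = (b ⟶[V] b') ⊙ₗ ch D x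
    rw [chainObj_congr D (seq_append_of_le b' (el x)), chainObj_el x, seq_append_last,
      seq_append_of_le b' (el x) _ le_rfl]
    exact congrArg (fun c ↦ (c ⟶[V] b') ⊙ₗ ch D x) (lastObj_el x)

lemma barObj_el {b : C} (x : Chain C b) :
    (barDiagram W D).obj (el x) = W.obj (op b) ⊙ₗ ch D x := by
  rw [← chainObj_el]
  exact congrArg (fun c ↦ W.obj (op c) ⊙ₗ _) (lastObj_el x)

/-- The value of the bar construction on a chain. -/
def elIso {b : C} (x : Chain C b) : (barDiagram W D).obj (el x) ≅ W.obj (op b) ⊙ₗ ch D x :=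
  eqToIso (barObj_el W D x)

lemma elIso_cons {b : C} (x : Chain C b) (b' : C) : (elIso W D (x.cons b')).hom =
    (appendIso W D b' (el x)).hom ≫ W.obj (op b') ⊴ₗ (elIso (representable b') D x).hom := by
  simp only [elIso, appendIso, eqToIso.hom, actionHomRight_eqToHom]
  exact (eqToHom_trans (barObj_append W D _ _ (seq_append_last b' (el x))
    (seq_append_of_le b' (el x))) _).symm

lemma map_repeatHom {b : C} (x : (families C).Elements) (h : lastObj x = b) {Y : M}
    (hY : chainObj D (seq x) x.1.unop.len = Y)
    (e : (barDiagram (representable b) D).obj x = (b ⟶[V] b) ⊙ₗ Y)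
    (e' : (barDiagram W D).obj x = W.obj (op b) ⊙ₗ Y) :
    (barDiagram W D).map (repeatHom x h) ≫ (appendIso W D b x).hom ≫ W.obj (op b) ⊴ₗ eqToHom e =
      eqToHom e' ≫ W.obj (op b) ⊴ₗ ((λₗ[V] Y).inv ≫ eId V b ⊵ₗ Y) := by
  subst h hY
  refine (_ ≫= (_ ≫= MonoidalLeftAction.actionHomRight_id _ _)).trans ?_
  refine (_ ≫= Category.comp_id _).trans ?_
  exact (barDiagram_map_appendRepeat W D x).trans (Category.id_comp _).symm

lemma elIso_naturality {b : C} {y x : Chain C b} (d : Deg y x) :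
    ∀ W : EnrichedFunctor V Cᵒᵖ V, (barDiagram W D).map (degHom d) ≫ (elIso W D x).hom =
      (elIso W D y).hom ≫ W.obj (op b) ⊴ₗ degMap D d := by
  induction d with
  | here x =>
    intro W
    rw [elIso_cons]
    exact map_repeatHom W D _ (lastObj_el x) (chainObj_el D x) (barObj_el (representable _) D x)
      (barObj_el W D x)
  | cons d b' ih =>
    intro W
    rw [elIso_cons, elIso_cons]
    refine (Category.assoc _ _ _).symm.trans ((appendIso_hom_naturality W D b' _ =≫ _).trans ?_)
    refine (Category.assoc _ _ _).trans (Eq.trans (_ ≫= ?_) (Category.assoc _ _ _).symm)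
    refine (MonoidalLeftAction.actionHomRight_comp _ _ _).symm.trans (Eq.trans ?_
      (MonoidalLeftAction.actionHomRight_comp _ _ _))
    exact congrArg (fun t ↦ W.obj (op b') ⊴ₗ t) (ih (representable b'))

end Chain

variable [HasLimits V] [HasColimits V] [ModelCategory V] [MonoidalModelCategory V]
  [HasLimits M] [HasColimits M] [ModelCategory M] [ModelEnrichedCategory V M]

open Chain in
lemma exists_lift_barDiagram (hC : LocallyPointedFlat C (tensorBifunctor V M))
    (hD : ∀ c, IsCofibrant (D.obj c)) (b : C) {E B : M} {p : E ⟶ B} {K L : V} {k : K ⟶ L}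
    (hk : CofibrationLift k p) (x : (families C).Elements) :
    letI T := barDiagram (representable (V := V) b) D
    ∀ (a : K ⊙ₗ T.obj x ⟶ E) (g : L ⊙ₗ T.obj x ⟶ B)
      (s : ∀ (y : (families C).Elements), (y ⟶ x) → y.1.unop.len < x.1.unop.len →
        (L ⊙ₗ T.obj y ⟶ E)),
      a ≫ p = k ⊵ₗ _ ≫ g → (∀ y e h, k ⊵ₗ _ ≫ s y e h = K ⊴ₗ T.map e ≫ a) →
      (∀ y e h, s y e h ≫ p = L ⊴ₗ T.map e ≫ g) →
      (∀ z y (f : z ⟶ y) e h h', L ⊴ₗ T.map f ≫ s y e h = s z (f ≫ e) h') →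
      ∃ t : L ⊙ₗ T.obj x ⟶ E, k ⊵ₗ _ ≫ t = a ∧ t ≫ p = g ∧
        ∀ y e h, L ⊴ₗ T.map e ≫ t = s y e h := by
  intro a g s h₁ h₂ h₃ h₄
  obtain ⟨c, x, rfl⟩ := Chain.exists_eq_el x
  let T := barDiagram (representable (V := V) b) D
  let N := (c ⟶[V] b)
  let i {y : Chain C c} : T.obj (el y) ≅ N ⊙ₗ ch D y := elIso (representable b) D y
  have hi {y x : Chain C c} (d : Deg y x) : T.map (degHom d) ≫ i.hom = i.hom ≫ N ⊴ₗ degMap D d :=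
    elIso_naturality D d (representable b)
  have hi' {y x : Chain C c} (d : Deg y x) : i.inv ≫ T.map (degHom d) = N ⊴ₗ degMap D d ≫ i.inv := by
    rw [Iso.inv_comp_eq, ← reassoc_of% hi, Iso.hom_inv_id, Category.comp_id]
  let j (Z : V) (y : Chain C c) : (Z ⊗ N) ⊙ₗ ch D y ⟶ Z ⊙ₗ T.obj (el y) :=
    (αₗ Z N (ch D y)).hom ≫ Z ⊴ₗ i.inv
  have hj (Z : V) {y x : Chain C c} (d : Deg y x) :
      j Z y ≫ Z ⊴ₗ T.map (degHom d) = (Z ⊗ N) ⊴ₗ degMap D d ≫ j Z x := by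
    dsimp only [j]
    rw [Category.assoc, ← MonoidalLeftAction.actionHomRight_comp, hi']
    simp
  have hj' (y : Chain C c) : j K y ≫ k ⊵ₗ T.obj (el y) = (k ▷ N) ⊵ₗ ch D y ≫ j L y := by
    dsimp only [j]
    rw [Category.assoc, MonoidalLeftAction.action_exchange]
    simp
  let j' (Z : V) (y : Chain C c) : Z ⊙ₗ T.obj (el y) ⟶ (Z ⊗ N) ⊙ₗ ch D y :=
    Z ⊴ₗ i.hom ≫ (αₗ Z N (ch D y)).inv
  have jj' (Z : V) (y : Chain C c) : j' Z y ≫ j Z y = 𝟙 _ := by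
    dsimp only [j, j']
    rw [Category.assoc, Iso.inv_hom_id_assoc, ← MonoidalLeftAction.actionHomRight_comp,
      Iso.hom_inv_id, MonoidalLeftAction.actionHomRight_id]
  have jj'' (Z : V) (y : Chain C c) : j Z y ≫ j' Z y = 𝟙 _ := by
    dsimp only [j, j']
    rw [Category.assoc, ← actionHomRight_comp_assoc,
      Iso.inv_hom_id, MonoidalLeftAction.actionHomRight_id, Category.id_comp, Iso.hom_inv_id]
  have hlen {w y : Chain C c} (d : Deg w y) : (el w).1.unop.len < (el y).1.unop.len := by
    rw [degHom_len d]
    exact Nat.lt_succ_self _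
  obtain ⟨t, ht₁, ht₂, ht₃⟩ := Chain.exists_lift hC D hD p x (k ▷ N) (hk.whiskerRight (hC.1 c b))
    (j K x ≫ a) (j L x ≫ g) (fun y d ↦ j L y ≫ s (el y) (degHom d) (hlen d))
    (by rw [Category.assoc, h₁, reassoc_of% hj'])
    (fun y d ↦ by rw [← reassoc_of% hj', h₂, ← reassoc_of% (hj K d)])
    (fun y d ↦ by rw [Category.assoc, h₃, ← reassoc_of% (hj L d)])
    (fun w y y' e d e' d' h ↦ by
      rw [← reassoc_of% (hj L e), ← reassoc_of% (hj L e'), h₄ _ _ _ _ _ ((hlen e).trans (hlen d)),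
        h₄ _ _ _ _ _ ((hlen e).trans (hlen d))]
      simp only [h.degHom_comp])
  refine ⟨j' L x ≫ t, ?_, ?_, fun y e h ↦ ?_⟩
  · have e₁ : k ⊵ₗ T.obj (el x) ≫ j' L x = j' K x ≫ (k ▷ N) ⊵ₗ ch D x := by
      rw [← cancel_epi (j K x), reassoc_of% hj', jj'', Category.comp_id, reassoc_of% jj'']
    rw [reassoc_of% e₁, ht₁, reassoc_of% jj']
  · rw [Category.assoc, ht₂, reassoc_of% jj']
  · obtain ⟨w, d, f, rfl⟩ := exists_eq_comp_degHom x y e h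
    have e₁ : L ⊴ₗ T.map (degHom d) ≫ j' L x = j' L w ≫ (L ⊗ N) ⊴ₗ degMap D d := by
      rw [← cancel_epi (j L w), reassoc_of% (hj L d), jj'', Category.comp_id, reassoc_of% jj'']
    rw [← h₄ _ _ f (degHom d) (hlen d)]
    rw [T.map_comp, MonoidalLeftAction.actionHomRight_comp, Category.assoc, reassoc_of% e₁, ht₃,
      reassoc_of% jj']

end BarLift

section RelativeLatching

open Simplicial SSet

variable {M : Type u₂} [Category.{v} M] [HasColimits M]
  {A A' : SimplexCategory ⥤ M} (j : A ⟶ A') (n : ℕ)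

/-- The relative latching object of a morphism of cosimplicial objects. -/
abbrev relativeLatchingSq := Functor.PushoutObjObj.ofHasPushout (copower M) j (boundary.{v} n).ι

/-- The relative latching object of a morphism of cosimplicial objects. -/
abbrev relativeLatching : M := (relativeLatchingSq j n).pt

/-- The relative latching morphism. -/
def relativeLatchingMap : relativeLatching j n ⟶ A'.obj ⦋n⦌ :=
  (relativeLatchingSq j n).ι ≫ (copowerStdSimplex A' ⦋n⦌).inv

variable {j n} {N N' : M}

/-- The part of a morphism from the relative latching object given by the target. -/
def latchingBoundary (d : relativeLatching j n ⟶ N) : (∂Δ[n] : SSet.{v}) ⟶ singObj A' N :=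
  (copowerAdjunction M).homEquiv ((relativeLatchingSq j n).inl ≫ d)

/-- The part of a morphism from the relative latching object given by the source. -/
def latchingSource (d : relativeLatching j n ⟶ N) : Δ[n] ⟶ singObj A N :=
  (copowerAdjunction M).homEquiv ((relativeLatchingSq j n).inr ≫ d)

lemma relativeLatching_hom_ext {d d' : relativeLatching j n ⟶ N}
    (h : latchingBoundary d = latchingBoundary d') (h' : latchingSource d = latchingSource d') :
    d = d' :=
  (relativeLatchingSq j n).hom_ext ((copowerAdjunction M).homEquiv.injective h)
    ((copowerAdjunction M).homEquiv.injective h')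

lemma exists_relativeLatching_desc (a : (∂Δ[n] : SSet.{v}) ⟶ singObj A' N)
    (b : Δ[n] ⟶ singObj A N) (h : a ≫ singPrecomp j N = (boundary n).ι ≫ b) :
    ∃ d : relativeLatching j n ⟶ N, latchingBoundary d = a ∧ latchingSource d = b := by
  refine ⟨(relativeLatchingSq j n).isPushout.desc ((copowerAdjunction M).homEquiv.symm a)
    ((copowerAdjunction M).homEquiv.symm b) ?_, ?_, ?_⟩
  · apply (copowerAdjunction M).homEquiv.injective
    rw [(copowerAdjunction M).homEquiv_naturality_one,
      (copowerAdjunction M).homEquiv_naturality_two, Equiv.apply_symm_apply, Equiv.apply_symm_apply]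
    exact h
  · rw [latchingBoundary, IsPushout.inl_desc, Equiv.apply_symm_apply]
  · rw [latchingSource, IsPushout.inr_desc, Equiv.apply_symm_apply]

lemma latchingBoundary_comp (d : relativeLatching j n ⟶ N) (f : N ⟶ N') :
    latchingBoundary (d ≫ f) = latchingBoundary d ≫ singPostcomp A' f := by
  rw [latchingBoundary, ← Category.assoc]
  exact (copowerAdjunction M).homEquiv_naturality_three _ _

lemma latchingSource_comp (d : relativeLatching j n ⟶ N) (f : N ⟶ N') :
    latchingSource (d ≫ f) = latchingSource d ≫ singPostcomp A f := by
  rw [latchingSource, ← Category.assoc]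
  exact (copowerAdjunction M).homEquiv_naturality_three _ _

lemma homEquiv_copowerStdSimplex_inv (A : SimplexCategory ⥤ M) (g : A.obj ⦋n⦌ ⟶ N) :
    (copowerAdjunction M).homEquiv ((copowerStdSimplex A ⦋n⦌).inv ≫ g) =
      SSet.yonedaEquiv.symm (show (singObj A N).obj (op ⦋n⦌) from g) := by
  apply SSet.yonedaEquiv.injective
  rw [(copowerAdjunction M).homEquiv_naturality_three, Equiv.apply_symm_apply]
  refine (SSet.yonedaEquiv_comp _ _).trans ?_
  have h : (copowerAdjunction M).homEquiv (copowerStdSimplex A ⦋n⦌).inv =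
    SSet.yonedaEquiv.symm (show (singObj A (A.obj ⦋n⦌)).obj (op ⦋n⦌) from 𝟙 (A.obj ⦋n⦌)) :=
    Equiv.apply_symm_apply _ _
  rw [h, Equiv.apply_symm_apply]
  exact Category.id_comp g

lemma latchingBoundary_map (g : A'.obj ⦋n⦌ ⟶ N) :
    latchingBoundary (relativeLatchingMap j n ≫ g) = (boundary n).ι ≫
      SSet.yonedaEquiv.symm (show (singObj A' N).obj (op ⦋n⦌) from g) := by
  rw [latchingBoundary, relativeLatchingMap, Category.assoc,
    (relativeLatchingSq j n).inl_ι_assoc, (copowerAdjunction M).homEquiv_naturality_two,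
    homEquiv_copowerStdSimplex_inv]

lemma latchingSource_map (g : A'.obj ⦋n⦌ ⟶ N) :
    latchingSource (relativeLatchingMap j n ≫ g) =
      SSet.yonedaEquiv.symm (show (singObj A N).obj (op ⦋n⦌) from j.app ⦋n⦌ ≫ g) := by
  rw [latchingSource, relativeLatchingMap, Category.assoc,
    (relativeLatchingSq j n).inr_ι_assoc, (copowerAdjunction M).homEquiv_naturality_one,
    homEquiv_copowerStdSimplex_inv]
  apply SSet.yonedaEquiv.injective
  rw [Equiv.apply_symm_apply]
  refine (SSet.yonedaEquiv_comp _ _).trans ?_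
  rw [Equiv.apply_symm_apply]
  rfl

lemma latchingBoundary_map_app (g : A'.obj ⦋n⦌ ⟶ N) {k : SimplexCategory} (θ : k ⟶ ⦋n⦌)
    (hk : k.len < n) : (latchingBoundary (relativeLatchingMap j n ≫ g)).app (op k)
      ⟨stdSimplex.objEquiv.symm θ, not_surjective_of_len_lt θ hk⟩ = A'.map θ ≫ g := by
  rw [latchingBoundary_map]
  refine (app_objEquiv_symm (SSet.yonedaEquiv.symm
    (show (singObj A' N).obj (op ⦋n⦌) from g)) θ).trans ?_
  rw [Equiv.apply_symm_apply]
  rfl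

variable [ModelCategory M]

lemma IsRelativeCofibration.cofibration_relativeLatchingMap (hj : IsRelativeCofibration j) :
    Cofibration (relativeLatchingMap j n) := by
  have : Cofibration (relativeLatchingSq j n).ι := cofibration_of_hasLiftingProperty _
    fun Z B p hp hp' ↦ ((copowerAdjunction M).hasLiftingProperty_iff _ (singLeibniz j p)).2
      (hj p hp hp' _ (modelCategoryQuillen.boundary_ι_mem_I n))
  rw [relativeLatchingMap]
  infer_instance

lemma IsRelativeTrivialCofibration.trivialCofibration_relativeLatchingMap
    (hj : IsRelativeTrivialCofibration j) :
    Cofibration (relativeLatchingMap j n) ∧ WeakEquivalence (relativeLatchingMap j n) := by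
  have := trivialCofibration_of_hasLiftingProperty (relativeLatchingSq j n).ι
    fun Z B p hp ↦ ((copowerAdjunction M).hasLiftingProperty_iff _ (singLeibniz j p)).2
      (hj p hp _ (modelCategoryQuillen.boundary_ι_mem_I n))
  have h₁ := this.1
  have h₂ := this.2
  rw [relativeLatchingMap]
  exact ⟨inferInstance, inferInstance⟩

/-- A relative Reedy cofibration and a fibration, one of which is trivial. -/
def RelativeAdmissible {B : Type*} [Category* B] [ModelCategory B] (j : A ⟶ A') {X Y : B}
    (p : X ⟶ Y) : Prop :=
  Fibration p ∧ (IsRelativeTrivialCofibration j ∨ (IsRelativeCofibration j ∧ WeakEquivalence p))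

end RelativeLatching

section BarSections

open Simplicial SSet

variable {V : Type u₁} [Category.{v} V] [MonoidalCategory V] [SymmetricCategory V]
  [MonoidalClosed V] [HasLimits V] [HasColimits V] [ModelCategory V] [MonoidalModelCategory V]
  {C : Type v} [EnrichedCategory V C]
  {M : Type u₂} [Category.{v} M] [EnrichedOrdinaryCategory V M] [Tensored V M]
  [HasLimits M] [HasColimits M] [ModelCategory M] [ModelEnrichedCategory V M]

lemma RelativeAdmissible.cofibrationLift {I I' : SimplexCategory ⥤ V} {j : I ⟶ I'} {E B : M}
    {p : E ⟶ B} (h : RelativeAdmissible j p) (n : ℕ) :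
    CofibrationLift (relativeLatchingMap j n) p := by
  intro X Y f hf
  apply actLift_of_lift₃
  apply PushoutProductAxiom.lift₃ (ModelEnrichedCategory.pushoutProduct (V := V) (M := M))
  obtain ⟨hp, h | ⟨h, hp'⟩⟩ := h
  · have h' := h.trivialCofibration_relativeLatchingMap (n := n)
    exact ⟨h'.1, hf, hp, Or.inl h'.2⟩
  · exact ⟨h.cofibration_relativeLatchingMap, hf, hp, Or.inr (Or.inr hp')⟩

/-- Functoriality of `tensorDiagram` in the cosimplicial object. -/
abbrev tensorDiagramMap {J : Type*} [Category* J] {I I' : SimplexCategory ⥤ V} (j : I ⟶ I')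
    (T : J ⥤ M) : tensorDiagram I T ⟶ tensorDiagram I' T where
  app x := Functor.whiskerRight j ((tensorBifunctor V M).flip.obj (T.obj x))
  naturality x y e := by
    ext n
    exact MonoidalLeftAction.action_exchange (j.app n) (T.map e)

lemma exists_lift_section {P : SSet.{v}} {I I' : SimplexCategory ⥤ V} (j : I ⟶ I')
    (T : P.Elements ⥤ M) {E B : M} {p : E ⟶ B} (x : P.Elements)
    (H : ∀ {K L : V} (k : K ⟶ L), CofibrationLift k p → ∀ (a : K ⊙ₗ T.obj x ⟶ E)
      (g : L ⊙ₗ T.obj x ⟶ B)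
      (s : ∀ y : P.Elements, (y ⟶ x) → (dimObj y).len < (dimObj x).len → (L ⊙ₗ T.obj y ⟶ E)),
      a ≫ p = k ⊵ₗ _ ≫ g → (∀ y e h, k ⊵ₗ _ ≫ s y e h = K ⊴ₗ T.map e ≫ a) →
      (∀ y e h, s y e h ≫ p = L ⊴ₗ T.map e ≫ g) →
      (∀ z y (f : z ⟶ y) e h h', L ⊴ₗ T.map f ≫ s y e h = s z (f ≫ e) h') →
      ∃ t : L ⊙ₗ T.obj x ⟶ E, k ⊵ₗ _ ≫ t = a ∧ t ≫ p = g ∧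
        ∀ y e h, L ⊴ₗ T.map e ≫ t = s y e h)
    (h : RelativeAdmissible j p)
    (φ : ∀ y : P.Elements, I.obj (dimObj y) ⊙ₗ T.obj y ⟶ E)
    (ψ : ∀ y : P.Elements, I'.obj (dimObj y) ⊙ₗ T.obj y ⟶ B)
    (s : ∀ y : P.Elements, (dimObj y).len < (dimObj x).len → (I'.obj (dimObj y) ⊙ₗ T.obj y ⟶ E))
    (nat_s : ∀ (y z : P.Elements) (hy) (hz) (e : y ⟶ z),
      I'.obj (dimObj z) ⊴ₗ T.map e ≫ s z hz = I'.map e.1.unop ⊵ₗ T.obj y ≫ s y hy)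
    (nat_φ : ∀ {y z : P.Elements} (e : y ⟶ z),
      I.obj (dimObj z) ⊴ₗ T.map e ≫ φ z = I.map e.1.unop ⊵ₗ T.obj y ≫ φ y)
    (nat_ψ : ∀ {y z : P.Elements} (e : y ⟶ z),
      I'.obj (dimObj z) ⊴ₗ T.map e ≫ ψ z = I'.map e.1.unop ⊵ₗ T.obj y ≫ ψ y)
    (s_φ : ∀ (y : P.Elements) (hy), j.app (dimObj y) ⊵ₗ T.obj y ≫ s y hy = φ y)
    (s_ψ : ∀ (y : P.Elements) (hy), s y hy ≫ p = ψ y)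
    (φ_ψ : ∀ (y : P.Elements), φ y ≫ p = j.app (dimObj y) ⊵ₗ T.obj y ≫ ψ y) :
    ∃ t : I'.obj (dimObj x) ⊙ₗ T.obj x ⟶ E, j.app (dimObj x) ⊵ₗ T.obj x ≫ t = φ x ∧
      t ≫ p = ψ x ∧
      (∀ y hy (e : x ⟶ y), I'.obj (dimObj y) ⊴ₗ T.map e ≫ s y hy = I'.map e.1.unop ⊵ₗ T.obj x ≫ t) ∧
      (∀ y hy (e : y ⟶ x), I'.obj (dimObj x) ⊴ₗ T.map e ≫ t =
        I'.map e.1.unop ⊵ₗ T.obj y ≫ s y hy) := by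
  let n := (dimObj x).len
  let k := relativeLatchingMap j n
  let xr {m : SimplexCategory} (θ : m ⟶ dimObj x) : P.Elements :=
    P.elementsMk (op m) (P.map θ.op x.2)
  let a₀ : (∂Δ[n] : SSet.{v}) ⟶ singObj I' (T.obj x ⟶[V] E) := boundaryDesc
    (fun m θ hm ↦ hatEquiv (I'.obj m) _ E (I'.obj m ⊴ₗ T.map (restrHom x θ) ≫ s (xr θ) hm))
    (fun m l θ θ' hm hl ↦ by
      let e : xr θ' ⟶ xr (θ ≫ θ') := CategoryOfElements.homMk _ _ θ.op (by
        change P.map _ (P.map _ x.2) = P.map _ x.2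
        rw [op_comp, P.map_comp]
        rfl)
      have he : restrHom x (θ ≫ θ') = restrHom x θ' ≫ e := rfl
      change I'.map θ ≫ hatEquiv _ _ _ _ = hatEquiv _ _ _ _
      rw [← hatEquiv_mapLeft, he, T.map_comp, MonoidalLeftAction.actionHomRight_comp,
        ← MonoidalLeftAction.action_exchange_assoc, Category.assoc]
      exact congrArg _ (_ ≫= (nat_s _ _ hm hl e).symm))
  have ha₀ {m : SimplexCategory} (θ : m ⟶ dimObj x) (hm : m.len < n) : a₀.app (op m)
      ⟨stdSimplex.objEquiv.symm θ, not_surjective_of_len_lt θ hm⟩ =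
      hatEquiv (I'.obj m) _ E (I'.obj m ⊴ₗ T.map (restrHom x θ) ≫ s (xr θ) hm) :=
    boundaryDesc_app _ _ θ hm
  let b₀ : Δ[n] ⟶ singObj I (T.obj x ⟶[V] E) := SSet.yonedaEquiv.symm
    (show (singObj I (T.obj x ⟶[V] E)).obj (op ⦋n⦌) from hatEquiv _ _ _ (φ x))
  obtain ⟨d, hd₁, hd₂⟩ := exists_relativeLatching_desc (j := j) a₀ b₀
    (boundary_hom_ext fun m θ hm ↦ by
      have h₁ : b₀.app (op m) (stdSimplex.objEquiv.symm θ) =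
          I.map θ ≫ hatEquiv _ _ _ (φ x) := by
        refine (app_objEquiv_symm _ θ).trans ?_
        rw [Equiv.apply_symm_apply]
        rfl
      refine (congrArg (j.app m ≫ ·) (ha₀ θ hm)).trans (Eq.trans ?_ h₁.symm)
      rw [← hatEquiv_mapLeft, ← hatEquiv_mapLeft, ← MonoidalLeftAction.action_exchange_assoc]
      refine congrArg _ ((_ ≫= s_φ (xr θ) hm).trans ?_)
      exact nat_φ (restrHom x θ))
  let a : relativeLatching j n ⊙ₗ T.obj x ⟶ E := (hatEquiv _ _ _).symm d
  have ha : hatEquiv _ _ _ a = d := Equiv.apply_symm_apply _ _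
  have hlow {y : P.Elements} (e : y ⟶ x) (hy : (dimObj y).len < (dimObj x).len)
      {m : SimplexCategory} (θ : m ⟶ dimObj x) (hm : m.len < n) :
      I'.obj m ⊴ₗ T.map e ≫ I'.obj m ⊴ₗ T.map (restrHom x θ) ≫ s (xr θ) hm =
        I'.map θ ⊵ₗ T.obj y ≫ I'.map e.1.unop ⊵ₗ T.obj y ≫ s y hy := by
    rw [← MonoidalLeftAction.actionHomRight_comp_assoc, ← T.map_comp,
      ← MonoidalLeftAction.comp_actionHomLeft_assoc, ← I'.map_comp]
    exact nat_s y (xr θ) hy hm (e ≫ restrHom x θ)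
  obtain ⟨t, ht₁, ht₂, ht₃⟩ := H k (h.cofibrationLift n) a (ψ x)
    (fun y e hy ↦ I'.map e.1.unop ⊵ₗ T.obj y ≫ s y hy)
    (by
      apply (hatEquiv _ _ _).injective
      rw [hatEquiv_comp, ha]
      refine Eq.trans ?_ (hatEquiv_mapLeft k (ψ x)).symm
      refine relativeLatching_hom_ext ?_ ?_
      · refine boundary_hom_ext fun m θ hm ↦ ?_
        rw [latchingBoundary_comp, hd₁]
        refine (congrArg (· ≫ _) (ha₀ θ hm)).trans (Eq.trans ?_
          (latchingBoundary_map_app _ θ hm).symm)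
        refine (hatEquiv_comp _ _).symm.trans ?_
        rw [Category.assoc, s_ψ, nat_ψ (restrHom x θ)]
        exact hatEquiv_mapLeft (I'.map θ) (ψ x)
      · rw [latchingSource_comp, hd₂]
        refine Eq.trans ?_ (latchingSource_map _).symm
        apply SSet.yonedaEquiv.injective
        refine (SSet.yonedaEquiv_comp _ _).trans ?_
        rw [Equiv.apply_symm_apply, Equiv.apply_symm_apply]
        refine (hatEquiv_comp _ _).symm.trans ((congrArg _ (φ_ψ x)).trans ?_)
        exact hatEquiv_mapLeft (j.app ⦋n⦌) (ψ x))
    (fun y e hy ↦ by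
      apply (hatEquiv _ _ _).injective
      rw [hatEquiv_mapRight, ha]
      refine (hatEquiv_mapLeft k _).trans (relativeLatching_hom_ext ?_ ?_)
      · refine boundary_hom_ext fun m θ hm ↦ ?_
        refine (latchingBoundary_map_app _ θ hm).trans ?_
        rw [latchingBoundary_comp, hd₁]
        refine Eq.trans ?_ (congrArg (· ≫ _) (ha₀ θ hm)).symm
        refine Eq.trans ?_ (hatEquiv_mapRight _ _ _)
        exact (hatEquiv_mapLeft (I'.map θ) _).symm.trans
          (congrArg (hatEquiv (I'.obj m) _ _) (hlow e hy θ hm).symm)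
      · refine (latchingSource_map _).trans ?_
        rw [latchingSource_comp, hd₂]
        apply SSet.yonedaEquiv.injective
        refine Eq.trans ?_ (SSet.yonedaEquiv_comp _ _).symm
        rw [Equiv.apply_symm_apply, Equiv.apply_symm_apply]
        refine Eq.trans ?_ (hatEquiv_mapRight _ (T.map e) (φ x))
        refine (hatEquiv_mapLeft (j.app ⦋n⦌) _).symm.trans (congrArg _ ?_)
        rw [nat_φ e, ← s_φ y hy, ← MonoidalLeftAction.comp_actionHomLeft_assoc,
          ← MonoidalLeftAction.comp_actionHomLeft_assoc]
        exact congrArg (fun t ↦ t ⊵ₗ T.obj y ≫ s y hy) (j.naturality e.1.unop).symm)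
    (fun y e hy ↦ by
      rw [Category.assoc, s_ψ]
      exact (nat_ψ e).symm)
    (fun z y f e hy hz ↦ by
      refine (MonoidalLeftAction.action_exchange_assoc (I'.map e.1.unop) (T.map f) _).trans ?_
      refine (_ ≫= nat_s z y hz hy f).trans ?_
      rw [← MonoidalLeftAction.comp_actionHomLeft_assoc, ← I'.map_comp]
      rfl)
  have hd : d = k ≫ hatEquiv _ _ _ t := by
    rw [← ha, ← ht₁]
    exact hatEquiv_mapLeft k t
  refine ⟨t, ?_, ht₂, fun y hy e ↦ ?_, fun y hy e ↦ ht₃ y e hy⟩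
  · apply (hatEquiv _ _ _).injective
    refine (hatEquiv_mapLeft (j.app ⦋n⦌) t).trans ?_
    have h₁ := (latchingSource_map (j := j) (hatEquiv _ _ _ t)).symm.trans
      ((congrArg latchingSource hd).symm.trans hd₂)
    exact SSet.yonedaEquiv.symm.injective h₁
  · obtain ⟨⟨m⟩, u⟩ := y
    obtain ⟨θ, hθ⟩ := e
    change x.1 ⟶ op m at θ
    change P.map θ x.2 = u at hθ
    subst hθ
    apply (hatEquiv _ _ _).injective
    refine Eq.trans ?_ (hatEquiv_mapLeft (I'.map θ.unop) t).symm
    have h₁ := latchingBoundary_map_app (j := j) (hatEquiv _ _ _ t) θ.unop hy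
    refine Eq.trans ?_ h₁
    refine (ha₀ θ.unop hy).symm.trans ?_
    rw [← hd₁, hd]

lemma secLift_bar (hC : LocallyPointedFlat C (tensorBifunctor V M)) (D : EnrichedFunctor V C M)
    (hD : ∀ c, IsCofibrant (D.obj c)) (b : C) {I I' : SimplexCategory ⥤ V} {j : I ⟶ I'}
    {E B : M} {p : E ⟶ B} (h : RelativeAdmissible j p) :
    SecLift (tensorDiagramMap j (barDiagram (representable b) D)) p :=
  secLift_of_step fun φ ψ hφψ x s hs hs' ↦
    exists_lift_section (P := families C) j (barDiagram (representable b) D) x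
      (fun k hk ↦ exists_lift_barDiagram D hC hD b hk x) h φ.app ψ.app s hs' φ.naturality
      ψ.naturality (fun y hy ↦ (hs y hy).1) (fun y hy ↦ (hs y hy).2)
      (fun y ↦ congrArg (fun ξ : Sec _ B ↦ ξ.app y) hφψ)

end BarSections

section TensorCosimplicial

open Simplicial SSet

variable {V : Type u₁} [Category.{v} V] [MonoidalCategory V] [SymmetricCategory V]
  [MonoidalClosed V] [HasLimits V] [HasColimits V] [ModelCategory V] [MonoidalModelCategory V]
  {M : Type u₂} [Category.{v} M] [EnrichedOrdinaryCategory V M] [Tensored V M]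
  [HasLimits M] [HasColimits M] [ModelCategory M] [ModelEnrichedCategory V M]

/-- The bijections `hatEquiv` as a morphism of simplicial sets. -/
def singHat (I : SimplexCategory ⥤ V) (X E : M) :
    singObj (I ⋙ (tensorBifunctor V M).flip.obj X) E ⟶ singObj I (X ⟶[V] E) where
  app k := ↾fun g ↦ hatEquiv (I.obj k.unop) X E g
  naturality k l f := by
    ext g
    exact hatEquiv_mapLeft (I.map f.unop) (Y := E) g

lemma rlp_tensorCosimplicial {I I' : SimplexCategory ⥤ V} {j : I ⟶ I'} {E B : M} {p : E ⟶ B}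
    (h : RelativeAdmissible j p) {X : M} (hX : IsCofibrant X) :
    modelCategoryQuillen.I.rlp
      (singLeibniz (Functor.whiskerRight j ((tensorBifunctor V M).flip.obj X)) p).π := by
  refine rlp_singLeibniz_π fun n a b c e₁ e₂ e₃ ↦ ?_
  have hb (N : M) : singHat I' X N ≫ singPrecomp j (X ⟶[V] N) =
      singPrecomp (Functor.whiskerRight j ((tensorBifunctor V M).flip.obj X)) N ≫ singHat I X N := by
    ext k g
    exact (hatEquiv_mapLeft (j.app k.unop) (Y := N) g).symm
  have hp (K : SimplexCategory ⥤ V) : singHat K X E ≫ singPostcomp K (eHomWhiskerLeft V X p) =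
      singPostcomp _ p ≫ singHat K X B := by
    ext k g
    exact (hatEquiv_comp (K := K.obj k.unop) (Y := E) g p).symm
  have hy {K : SimplexCategory ⥤ V} {N : M}
      (c : Δ[n] ⟶ singObj (K ⋙ (tensorBifunctor V M).flip.obj X) N) : c ≫ singHat K X N =
      SSet.yonedaEquiv.symm (show (singObj K (X ⟶[V] N)).obj (op ⦋n⦌) from
        hatEquiv (K.obj ⦋n⦌) X N (SSet.yonedaEquiv c)) := by
    apply SSet.yonedaEquiv.injective
    rw [Equiv.apply_symm_apply]
    exact SSet.yonedaEquiv_comp _ _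
  obtain ⟨d, hd₁, hd₂⟩ := exists_relativeLatching_desc (j := j) (a ≫ singHat I' X E)
    (b ≫ singHat I X E) (by rw [Category.assoc, hb, reassoc_of% e₁])
  obtain ⟨t, ht₁, ht₂⟩ := CofibrationLift.exists_lift (h.cofibrationLift n) hX ((hatEquiv _ _ _).symm d)
    (SSet.yonedaEquiv c) (by
      apply (hatEquiv _ _ _).injective
      rw [hatEquiv_comp, Equiv.apply_symm_apply]
      refine Eq.trans ?_ (hatEquiv_mapLeft (relativeLatchingMap j n) _).symm
      refine relativeLatching_hom_ext ?_ ?_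
      · rw [latchingBoundary_comp, hd₁, Category.assoc, hp, reassoc_of% e₃, hy]
        exact (latchingBoundary_map _).symm
      · rw [latchingSource_comp, hd₂, Category.assoc, hp, reassoc_of% e₂, ← hb, reassoc_of% hy c]
        refine Eq.trans ?_ (latchingSource_map _).symm
        apply SSet.yonedaEquiv.injective
        rw [Equiv.apply_symm_apply]
        refine (SSet.yonedaEquiv_comp _ _).trans ?_
        rw [Equiv.apply_symm_apply]
        rfl)
  have hd : d = relativeLatchingMap j n ≫ hatEquiv (I'.obj ⦋n⦌) X E t := by
    rw [Equiv.eq_symm_apply] at ht₁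
    exact ht₁.symm.trans (hatEquiv_mapLeft (relativeLatchingMap j n) t)
  refine ⟨SSet.yonedaEquiv.symm (show (singObj (I' ⋙ (tensorBifunctor V M).flip.obj X) E).obj
    (op ⦋n⦌) from t), boundary_hom_ext fun k θ hk ↦ ?_, ?_, ?_⟩
  · refine (app_objEquiv_symm (SSet.yonedaEquiv.symm (show (singObj (I' ⋙
      (tensorBifunctor V M).flip.obj X) E).obj (op ⦋n⦌) from t)) θ).trans ?_
    rw [Equiv.apply_symm_apply]
    apply (hatEquiv (I'.obj k) X E).injective
    refine (hatEquiv_mapLeft (I'.map θ) t).trans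
      ((latchingBoundary_map_app (j := j) (hatEquiv (I'.obj ⦋n⦌) X E t) θ hk).symm.trans ?_)
    rw [← hd, hd₁]
    rfl
  · apply SSet.yonedaEquiv.injective
    refine (SSet.yonedaEquiv_comp _ _).trans ?_
    rw [Equiv.apply_symm_apply]
    apply (hatEquiv (I.obj ⦋n⦌) X E).injective
    refine (hatEquiv_mapLeft (j.app ⦋n⦌) t).trans ?_
    have h₁ := latchingSource_map (j := j) (hatEquiv (I'.obj ⦋n⦌) X E t)
    rw [← hd, hd₂] at h₁
    exact SSet.yonedaEquiv.symm.injective (h₁.symm.trans (hy b))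
  · apply SSet.yonedaEquiv.injective
    refine (SSet.yonedaEquiv_comp _ _).trans ?_
    rw [Equiv.apply_symm_apply]
    exact ht₂

lemma secLift_firstVertex {J : Type v} [Category.{0} J] (T : J ⥤ M)
    (hT : ∀ x, IsCofibrant (T.obj x)) {I I' : SimplexCategory ⥤ V} {j : I ⟶ I'}
    {E B : M} {p : E ⟶ B} (h : RelativeAdmissible j p) :
    SecLift (tensorDiagramMap j (firstVertex J ⋙ T)) p := by
  have H (K : SimplexCategory ⥤ V) ⦃x y : Functor.Elements (nerve J : SSet.{v})⦄ (e : x ⟶ y)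
      (he : Epi e.1.unop) : IsIso ((tensorDiagram K (firstVertex J ⋙ T)).map e) := by
    have := isIso_firstVertex_map e he
    exact Functor.map_isIso ((tensorBifunctor V M).flip ⋙ (Functor.whiskeringLeft _ _ _).obj K)
      (T.map ((firstVertex J).map e))
  exact secLift_of_isIso_degeneracies (H I) (H I') (fun x ↦ rlp_tensorCosimplicial h (hT _))

end TensorCosimplicial

section Homotopies

open Simplicial SSet

variable {V : Type u₁} [Category.{v} V] [MonoidalCategory V] [SymmetricCategory V]
  [MonoidalClosed V] [HasLimits V] [HasColimits V] [ModelCategory V] [MonoidalModelCategory V]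
  {M : Type u₂} [Category.{v} M] [EnrichedOrdinaryCategory V M] [Tensored V M]
  [HasLimits M] [HasColimits M] [ModelCategory M] [ModelEnrichedCategory V M]
  {P : SimplexCategoryᵒᵖ ⥤ Type v} {I : SimplexCategory ⥤ V} {T : P.Elements ⥤ M} {E : M}

lemma exists_cylinder_section
    (h : ∀ (x : P.Elements) (m : SimplexCategory) (_ : m ⟶ ⦋1⦌) (_ : m ⟶ dimObj x),
      I.obj m ⊙ₗ T.obj x ⟶ E)
    (h₁ : ∀ x m l τ φ (ψ : l ⟶ m), I.map ψ ⊵ₗ T.obj x ≫ h x m τ φ = h x l (ψ ≫ τ) (ψ ≫ φ))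
    (h₂ : ∀ x y (e : x ⟶ y) m τ φ, I.obj m ⊴ₗ T.map e ≫ h y m τ φ = h x m τ (φ ≫ e.1.unop)) :
    ∃ H : Sec (tensorDiagram (cylinder I) T) E, ∀ (k : Fin 2) (x : P.Elements),
      (Sec.precomp (tensorDiagramMap (cylinderEnd I k) T) H).app x =
        h x (dimObj x) (SimplexCategory.const _ ⦋1⦌ k) (𝟙 _) := by
  let f (x : P.Elements) : Δ[1] ⊗ SSet.stdSimplex.{v}.obj (dimObj x) ⟶
      singObj I (T.obj x ⟶[V] E) :=
    { app m := ↾fun q ↦ hatEquiv (I.obj m.unop) (T.obj x) E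
        (h x m.unop (stdSimplex.objEquiv q.1) (stdSimplex.objEquiv q.2))
      naturality m l ψ := by
        ext q
        refine Eq.trans ?_ (hatEquiv_mapLeft (I.map ψ.unop) _)
        exact congrArg (hatEquiv (I.obj l.unop) (T.obj x) E) (h₁ x m.unop l.unop
          (stdSimplex.objEquiv q.1) (stdSimplex.objEquiv q.2) ψ.unop).symm }
  let g (x : P.Elements) : (cylinder I).obj (dimObj x) ⟶ (T.obj x ⟶[V] E) :=
    (cylinderEquiv I (dimObj x) _).symm (f x)
  have hg (x : P.Elements) : cylinderEquiv I (dimObj x) _ (g x) = f x := Equiv.apply_symm_apply _ _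
  let H : Sec (tensorDiagram (cylinder I) T) E :=
    { app x := (hatEquiv _ _ _).symm (g x)
      naturality {x y} e := by
        apply (hatEquiv ((cylinder I).obj (dimObj y)) (T.obj x) E).injective
        refine (hatEquiv_mapRight _ (T.map e) _).trans (Eq.trans ?_
          (hatEquiv_mapLeft ((cylinder I).map e.1.unop) _).symm)
        rw [Equiv.apply_symm_apply, Equiv.apply_symm_apply]
        apply (cylinderEquiv I _ _).injective
        rw [cylinderEquiv_comp, cylinderEquiv_map, hg, hg]
        ext m q
        exact (hatEquiv_mapRight _ (T.map e) _).symm.trans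
          (congrArg (hatEquiv (I.obj m.unop) (T.obj x) E) (h₂ x y e m.unop _ _)) }
  refine ⟨H, fun k x ↦ ?_⟩
  apply (hatEquiv (I.obj (dimObj x)) (T.obj x) E).injective
  refine (hatEquiv_mapLeft ((cylinderEnd I k).app (dimObj x)) _).trans ?_
  rw [Equiv.apply_symm_apply]
  refine (yonedaEquiv_cylInc_cylinderEquiv I (dimObj x) k (g x)).symm.trans ?_
  rw [hg]
  rfl

lemma weakEquivalence_iff_of_homotopy
    (hT : ∀ (k : Fin 2) ⦃E B : M⦄ (p : E ⟶ B), Fibration p →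
      SecLift (tensorDiagramMap (cylinderEnd I k) T) p)
    {f g : elementsCoend (tensorDiagram I T) ⟶ E} (H : Sec (tensorDiagram (cylinder I) T) E)
    (h₀ : Sec.precomp (tensorDiagramMap (cylinderEnd I 0) T) H = elementsCoendEquiv _ _ f)
    (h₁ : Sec.precomp (tensorDiagramMap (cylinderEnd I 1) T) H = elementsCoendEquiv _ _ g) :
    WeakEquivalence f ↔ WeakEquivalence g := by
  have w (k : Fin 2) := (trivialCofibration_of_hasLiftingProperty
    (elementsCoendMap (tensorDiagramMap (cylinderEnd I k) T))
    fun E B p hp ↦ hasLiftingProperty_elementsCoendMap (hT k p hp)).2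
  have w₀ := w 0
  have w₁ := w 1
  have e₀ : elementsCoendMap (tensorDiagramMap (cylinderEnd I 0) T) ≫
      (elementsCoendEquiv _ _).symm H = f := by
    apply (elementsCoendEquiv _ _).injective
    rw [elementsCoendEquiv_map_comp, Equiv.apply_symm_apply, h₀]
  have e₁ : elementsCoendMap (tensorDiagramMap (cylinderEnd I 1) T) ≫
      (elementsCoendEquiv _ _).symm H = g := by
    apply (elementsCoendEquiv _ _).injective
    rw [elementsCoendEquiv_map_comp, Equiv.apply_symm_apply, h₁]
  rw [← e₀, ← e₁, weakEquivalence_precomp_iff, weakEquivalence_precomp_iff]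

lemma weakEquivalence_of_section_comp {X Y : M} {s : Y ⟶ X} {b : X ⟶ Y} (h : s ≫ b = 𝟙 Y)
    (w : WeakEquivalence (b ≫ s)) : WeakEquivalence b := by
  rw [weakEquivalence_iff] at w ⊢
  let r : RetractArrow b (b ≫ s) :=
    { i := Arrow.homMk (𝟙 X) s (by simp)
      r := Arrow.homMk (𝟙 X) b (by simp [h])
      retract := by ext <;> simp [h] }
  exact (weakEquivalences M).of_retract r w

end Homotopies

section Augmentation

open Simplicial

variable {V : Type u₁} [Category.{v} V] [MonoidalCategory V] [SymmetricCategory V]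
  [MonoidalClosed V] {C : Type v} [EnrichedCategory V C]
  {M : Type u₂} [Category.{v} M] [EnrichedOrdinaryCategory V M] [Tensored V M]
  (D : EnrichedFunctor V C M) (c : C)

lemma unitInsert_diagramAct {X : M} (g : X ⟶ D.obj c) :
    unitInsert (eId V c) X ≫ (c ⟶[V] c) ⊴ₗ g ≫ diagramAct D c c = g := by
  rw [← Category.assoc, act_unit_natural, Category.assoc, Category.assoc, diagramAct_id,
    Category.comp_id]

/-- The insertion of a further object of a sequence, with an identity. -/
def appendUnit (x : (families C).Elements) :
    (barDiagram (representable (V := V) c) D).obj x ⟶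
      (barDiagram (representable (V := V) c) D).obj ((appendFunctor c).obj x) :=
  unitInsert (eId V c) _ ≫ (appendIso (representable c) D c x).inv

lemma appendUnit_hom (x : (families C).Elements) :
    appendUnit D c x ≫ (appendIso (representable (V := V) c) D c x).hom =
      unitInsert (eId V c) _ :=
  (Category.assoc _ _ _).trans ((_ ≫= Iso.inv_hom_id _).trans (Category.comp_id _))

lemma appendUnit_naturality {x y : (families C).Elements} (f : x ⟶ y) :
    (barDiagram (representable (V := V) c) D).map f ≫ appendUnit D c y =
      appendUnit D c x ≫ (barDiagram (representable c) D).map ((appendFunctor c).map f) := by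
  rw [← cancel_mono (appendIso (representable (V := V) c) D c y).hom]
  refine (Category.assoc _ _ _).trans ((_ ≫= appendUnit_hom D c y).trans (Eq.trans ?_
    (Category.assoc _ _ _).symm))
  refine Eq.trans ?_ (_ ≫= appendIso_hom_naturality (representable (V := V) c) D c f).symm
  refine Eq.trans ?_ (Category.assoc _ _ _)
  exact (act_unit_natural _ _).symm.trans (appendUnit_hom D c x =≫ _).symm

lemma appendUnit_appendProj (x : (families C).Elements) :
    appendUnit D c x ≫ (barDiagram (representable (V := V) c) D).map (appendProj c x) = 𝟙 _ := by
  refine (_ ≫= barDiagram_map_appendProj (representable (V := V) c) D c x).trans ?_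
  refine (Category.assoc _ _ _).symm.trans ((appendUnit_hom D c x =≫ _).trans ?_)
  let X := chainObj D (seq x) x.1.unop.len
  let N := (lastObj x ⟶[V] c)
  have h : unitInsert (eId V c) (N ⊙ₗ X) ≫ (αₗ _ _ _).inv ≫ eCompRev V (lastObj x) c c ⊵ₗ X =
      𝟙 _ := by
    have h' := act_left_unit _ _ _ (id_eCompRev V (lastObj x) c) (𝟙 (N ⊙ₗ X))
    rw [MonoidalLeftAction.actionHomRight_id, Category.id_comp, Category.id_comp,
      MonoidalLeftAction.id_actionHomLeft] at h'
    exact h'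
  exact (_ ≫= (_ ≫= congrArg (fun t ↦ t ⊵ₗ X) (weightAct_representable c (lastObj x) c))).trans h

lemma appendUnit_appendLast (x : (families C).Elements) :
    appendUnit D c x ≫ (barDiagram (representable (V := V) c) D).map (appendLast c x) =
      barAct D c x ≫ unitInsert (eId V c) (D.obj c) := by
  refine (_ ≫= barDiagram_map_appendLast (representable (V := V) c) D c x).trans ?_
  refine (Category.assoc _ _ _).symm.trans ((appendUnit_hom D c x =≫ _).trans ?_)
  exact act_unit_natural _ _

lemma barAct_single (c : C) : unitInsert (eId V c) (D.obj c) ≫ barAct D c (singleSeq c) = 𝟙 _ :=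
  unitInsert_diagramAct D c (𝟙 _)

end Augmentation

section Contraction

open Simplicial SSet

variable {V : Type u₁} [Category.{v} V] [MonoidalCategory V] [SymmetricCategory V]
  [MonoidalClosed V] [HasLimits V] [HasColimits V] [ModelCategory V] [MonoidalModelCategory V]
  {C : Type v} [EnrichedCategory V C]
  {M : Type u₂} [Category.{v} M] [EnrichedOrdinaryCategory V M] [Tensored V M]
  [HasLimits M] [HasColimits M] [ModelCategory M] [ModelEnrichedCategory V M]
  {P : SimplexCategoryᵒᵖ ⥤ Type v} (I : SimplexCategory ⥤ V)
  (G : P.Elements ⥤ (families C).Elements) (D : EnrichedFunctor V C M) (c : C)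

/-- The sections defined by a morphism from `I` to a constant cosimplicial object and the action on
`D`. -/
def augSec {I : SimplexCategory ⥤ V} {N : V} (q : I ⟶ (Functor.const SimplexCategory).obj N) :
    Sec (tensorDiagram I (G ⋙ barDiagram (representable c) D)) (N ⊙ₗ D.obj c) where
  app x := q.app (dimObj x) ⊵ₗ _ ≫ N ⊴ₗ barAct D c (G.obj x)
  naturality {x y} e := by
    have h₁ := barDiagram_map_barAct (V := V) D c (G.map e)
    have h₂ : I.map e.1.unop ≫ q.app (dimObj x) = q.app (dimObj y) :=
      (q.naturality e.1.unop).trans (Category.comp_id _)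
    let T := barDiagram (representable (V := V) c) D
    have h₃ : I.obj (dimObj y) ⊴ₗ T.map (G.map e) ≫ q.app (dimObj y) ⊵ₗ T.obj (G.obj y) =
      q.app (dimObj y) ⊵ₗ T.obj (G.obj x) ≫ N ⊴ₗ T.map (G.map e) :=
      MonoidalLeftAction.action_exchange _ _
    refine (Category.assoc _ _ _).symm.trans ((h₃ =≫ _).trans ((Category.assoc _ _ _).trans ?_))
    refine (_ ≫= ((MonoidalLeftAction.actionHomRight_comp _ _ _).symm.trans
      (congrArg (fun t ↦ N ⊴ₗ t) h₁))).trans ?_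
    refine Eq.trans ?_ (Category.assoc _ _ _)
    refine congrArg (· ≫ _) ?_
    rw [← h₂, MonoidalLeftAction.comp_actionHomLeft]
    rfl

/-- The morphism to the initial level. -/
def toInitialLevel : I ⟶ (Functor.const SimplexCategory).obj (I.obj ⦋0⦌) where
  app n := I.map (SimplexCategory.const n ⦋0⦌ 0)
  naturality m n φ := by
    refine (I.map_comp _ _).symm.trans (Eq.trans ?_ (Category.comp_id _).symm)
    congr 1

variable (u : P.obj (op ⦋0⦌))

/-- The universal sections. -/
abbrev univSec (A : P.Elements ⥤ SimplexCategory ⥤ M) : Sec A (elementsCoend A) :=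
  elementsCoendEquiv A _ (𝟙 _)

lemma univSec_postcomp {A : P.Elements ⥤ SimplexCategory ⥤ M} {E : M} (g : elementsCoend A ⟶ E) :
    (univSec A).postcomp g = elementsCoendEquiv A E g := by
  rw [← elementsCoendEquiv_comp, Category.id_comp]

/-- The components of the universal sections. -/
abbrev univApp (x : P.Elements) :
    I.obj (dimObj x) ⊙ₗ (barDiagram (representable (V := V) c) D).obj (G.obj x) ⟶
      elementsCoend (tensorDiagram I (G ⋙ barDiagram (representable c) D)) :=
  (univSec (tensorDiagram I (G ⋙ barDiagram (representable c) D))).app x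

lemma univApp_naturality {x y : P.Elements} (e : x ⟶ y) :
    I.obj (dimObj y) ⊴ₗ (barDiagram (representable (V := V) c) D).map (G.map e) ≫
      univApp I G D c y = I.map e.1.unop ⊵ₗ _ ≫ univApp I G D c x :=
  (univSec (tensorDiagram I (G ⋙ barDiagram (representable c) D))).naturality e

lemma univApp_comp {E : M}
    (φ : Sec (tensorDiagram I (G ⋙ barDiagram (representable (V := V) c) D)) E) (x : P.Elements) :
    univApp I G D c x ≫ (elementsCoendEquiv _ _).symm φ = φ.app x := by
  refine (congrArg (fun s : Sec _ E ↦ s.app x) (univSec_postcomp _)).trans ?_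
  rw [Equiv.apply_symm_apply]

variable (hu : G.obj (P.elementsMk (op ⦋0⦌) u) = singleSeq c)

/-- The inclusion of the values of the diagram. -/
def baseInclusion : I.obj ⦋0⦌ ⊙ₗ D.obj c ⟶
    elementsCoend (tensorDiagram I (G ⋙ barDiagram (representable (V := V) c) D)) :=
  I.obj ⦋0⦌ ⊴ₗ (unitInsert (eId V c) (D.obj c) ≫
    (barDiagram (representable (V := V) c) D).map (eqToHom hu.symm)) ≫
    univApp I G D c (P.elementsMk (op ⦋0⦌) u)

lemma baseInclusion_comp {N : V} (q : I ⟶ (Functor.const SimplexCategory).obj N) :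
    baseInclusion I G D c u hu ≫ (elementsCoendEquiv _ _).symm (augSec G D c q) =
      q.app ⦋0⦌ ⊵ₗ D.obj c := by
  let T := barDiagram (representable (V := V) c) D
  let x := P.elementsMk (op ⦋0⦌) u
  let r : singleSeq c ⟶ G.obj x := eqToHom hu.symm
  let i := unitInsert (eId V c) (D.obj c) ≫ T.map r
  have h₁ : i ≫ barAct D c (G.obj x) = 𝟙 _ :=
    (Category.assoc _ _ _).trans ((_ ≫= barDiagram_map_barAct D c r).trans (barAct_single D c))
  have h₂ : univApp I G D c x ≫ (elementsCoendEquiv _ _).symm (augSec G D c q) =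
      q.app ⦋0⦌ ⊵ₗ _ ≫ N ⊴ₗ barAct D c (G.obj x) := univApp_comp _ _ _ _ _ _
  refine (Category.assoc _ _ _).trans ((_ ≫= h₂).trans ?_)
  have h₃ : I.obj ⦋0⦌ ⊴ₗ i ≫ q.app ⦋0⦌ ⊵ₗ T.obj (G.obj x) = q.app ⦋0⦌ ⊵ₗ D.obj c ≫ N ⊴ₗ i :=
    MonoidalLeftAction.action_exchange _ _
  refine (Category.assoc _ _ _).symm.trans ((h₃ =≫ _).trans ((Category.assoc _ _ _).trans ?_))
  refine (_ ≫= ((MonoidalLeftAction.actionHomRight_comp _ _ _).symm.trans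
    (congrArg (fun t ↦ N ⊴ₗ t) h₁))).trans ?_
  simp

/-- The retraction onto the values of the diagram. -/
abbrev baseRetraction : elementsCoend (tensorDiagram I (G ⋙ barDiagram (representable (V := V) c) D)) ⟶
    I.obj ⦋0⦌ ⊙ₗ D.obj c :=
  (elementsCoendEquiv _ _).symm (augSec G D c (toInitialLevel I))

lemma baseInclusion_baseRetraction :
    baseInclusion I G D c u hu ≫ baseRetraction I G D c = 𝟙 _ := by
  rw [baseInclusion_comp]
  have : (toInitialLevel I).app ⦋0⦌ = 𝟙 _ := by
    refine Eq.trans ?_ (I.map_id _)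
    exact congrArg I.map (Subsingleton.elim _ _)
  rw [this]
  simp

lemma baseRetraction_baseInclusion_app (x : P.Elements) :
    (elementsCoendEquiv _ _ (baseRetraction I G D c ≫ baseInclusion I G D c u hu)).app x =
      I.map (SimplexCategory.const _ ⦋0⦌ 0) ⊵ₗ _ ≫ I.obj ⦋0⦌ ⊴ₗ (barAct D c (G.obj x) ≫
        unitInsert (eId V c) (D.obj c) ≫
          (barDiagram (representable (V := V) c) D).map (eqToHom hu.symm)) ≫
        univApp I G D c (P.elementsMk (op ⦋0⦌) u) := by
  rw [elementsCoendEquiv_comp, Equiv.apply_symm_apply]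
  refine (Category.assoc _ _ _).trans (_ ≫= ?_)
  refine (Category.assoc _ _ _).symm.trans (congrArg (· ≫ _) ?_)
  exact (MonoidalLeftAction.actionHomRight_comp _ _ _).symm

variable {I G D c u hu}

/-- The extension of `φ : [m] ⟶ [n]` with values in `[n + 1]`, given by `n + 1` where `τ` is
`1`. -/
def joinMap {m n : SimplexCategory} (τ : m ⟶ ⦋1⦌) (φ : m ⟶ n) : m ⟶ ⦋n.len + 1⦌ :=
  SimplexCategory.mkHom
    { toFun := fun i ↦ if τ.toOrderHom i = 0 then (φ.toOrderHom i).castSucc else Fin.last _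
      monotone' := fun i j hij ↦ by
        have hτ := τ.toOrderHom.monotone hij
        dsimp only
        split_ifs with h₁ h₂ h₂
        · exact Fin.castSucc_le_castSucc_iff.2 (φ.toOrderHom.monotone hij)
        · exact Fin.le_last _
        · rw [h₂] at hτ
          exact absurd (Fin.le_zero_iff.1 hτ) h₁
        · exact le_rfl }

lemma exists_cylinder_section_of_shift {T : P.Elements ⥤ M} {S : P.Elements ⥤ P.Elements} {E : M}
    (σ : ∀ x, I.obj (dimObj x) ⊙ₗ T.obj x ⟶ E)
    (hσ : ∀ {x y : P.Elements} (e : x ⟶ y),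
      I.obj (dimObj y) ⊴ₗ T.map e ≫ σ y = I.map e.1.unop ⊵ₗ _ ≫ σ x)
    (ε : ∀ x, T.obj x ⟶ T.obj (S.obj x))
    (hε : ∀ {x y : P.Elements} (f : x ⟶ y), T.map f ≫ ε y = ε x ≫ T.map (S.map f))
    (β : ∀ (x : P.Elements) (m : SimplexCategory) (_ : m ⟶ ⦋1⦌) (_ : m ⟶ dimObj x),
      m ⟶ dimObj (S.obj x))
    (hβ₁ : ∀ x m l τ φ (ψ : l ⟶ m), ψ ≫ β x m τ φ = β x l (ψ ≫ τ) (ψ ≫ φ))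
    (hβ₂ : ∀ x y (e : x ⟶ y) m τ φ,
      β y m τ φ ≫ (S.map e).1.unop = β x m τ (φ ≫ e.1.unop)) :
    ∃ H : Sec (tensorDiagram (cylinder I) T) E, ∀ (k : Fin 2) (x : P.Elements),
      (Sec.precomp (tensorDiagramMap (cylinderEnd I k) T) H).app x =
        I.obj (dimObj x) ⊴ₗ ε x ≫ I.map (β x (dimObj x) (SimplexCategory.const _ ⦋1⦌ k) (𝟙 _)) ⊵ₗ
          T.obj (S.obj x) ≫ σ (S.obj x) :=
  exists_cylinder_section
    (fun x m τ φ ↦ I.obj m ⊴ₗ ε x ≫ I.map (β x m τ φ) ⊵ₗ T.obj (S.obj x) ≫ σ (S.obj x))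
    (fun x m l τ φ ψ ↦ by
      rw [← MonoidalLeftAction.action_exchange_assoc, ← MonoidalLeftAction.comp_actionHomLeft_assoc,
        ← I.map_comp, hβ₁])
    (fun x y e m τ φ ↦ by
      rw [← MonoidalLeftAction.actionHomRight_comp_assoc, hε,
        MonoidalLeftAction.actionHomRight_comp, Category.assoc,
        MonoidalLeftAction.action_exchange_assoc, hσ,
        ← MonoidalLeftAction.comp_actionHomLeft_assoc, ← I.map_comp, hβ₂])

lemma shift_app_eq_self {T : P.Elements ⥤ M} {E : M} (σ : ∀ x, I.obj (dimObj x) ⊙ₗ T.obj x ⟶ E)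
    {x y : P.Elements} (e : y ⟶ x)
    (hσ : I.obj (dimObj x) ⊴ₗ T.map e ≫ σ x = I.map e.1.unop ⊵ₗ _ ≫ σ y)
    (ε : T.obj x ⟶ T.obj y) (h : ε ≫ T.map e = 𝟙 _) :
    I.obj (dimObj x) ⊴ₗ ε ≫ I.map e.1.unop ⊵ₗ T.obj y ≫ σ y = σ x := by
  rw [← hσ, ← MonoidalLeftAction.actionHomRight_comp_assoc, h,
    MonoidalLeftAction.actionHomRight_id, Category.id_comp]

lemma shift_app_eq {T : P.Elements ⥤ M} {E : M} (σ : ∀ x, I.obj (dimObj x) ⊙ₗ T.obj x ⟶ E)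
    {x y z : P.Elements} (e : y ⟶ z)
    (hσ : I.obj (dimObj z) ⊴ₗ T.map e ≫ σ z = I.map e.1.unop ⊵ₗ _ ≫ σ y)
    (θ : dimObj x ⟶ dimObj z) (ε : T.obj x ⟶ T.obj y) (ζ : T.obj x ⟶ T.obj z)
    (h : ε ≫ T.map e = ζ) :
    I.obj (dimObj x) ⊴ₗ ε ≫ I.map (θ ≫ e.1.unop) ⊵ₗ T.obj y ≫ σ y =
      I.map θ ⊵ₗ T.obj x ≫ I.obj (dimObj z) ⊴ₗ ζ ≫ σ z := by
  rw [I.map_comp, MonoidalLeftAction.comp_actionHomLeft, Category.assoc, ← hσ,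
    ← MonoidalLeftAction.action_exchange_assoc, ← MonoidalLeftAction.actionHomRight_comp_assoc,
    ← MonoidalLeftAction.action_exchange_assoc, MonoidalLeftAction.action_exchange_assoc, ← h,
    MonoidalLeftAction.action_exchange_assoc]

lemma joinMap_appendMap {m : SimplexCategory} (τ : m ⟶ ⦋1⦌) {x y : (families C).Elements}
    (e : x ⟶ y) (φ : m ⟶ dimObj y) :
    joinMap τ φ ≫ ((appendFunctor c).map e).1.unop = joinMap τ (φ ≫ e.1.unop) := by
  ext i
  change (appendMap e.1.unop.toOrderHom ((joinMap τ φ).toOrderHom i)).1 =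
    ((joinMap τ (φ ≫ e.1.unop)).toOrderHom i).1
  by_cases h : τ.toOrderHom i = 0
  · have h₁ : (joinMap τ φ).toOrderHom i = (φ.toOrderHom i).castSucc := if_pos h
    have h₂ : (joinMap τ (φ ≫ e.1.unop)).toOrderHom i =
      ((φ ≫ e.1.unop).toOrderHom i).castSucc := if_pos h
    rw [h₁, h₂, appendMap_of_le _ _ (Nat.le_of_lt_succ (φ.toOrderHom i).2)]
    rfl
  · have h₁ : (joinMap τ φ).toOrderHom i = Fin.last _ := if_neg h
    have h₂ : (joinMap τ (φ ≫ e.1.unop)).toOrderHom i = Fin.last _ := if_neg h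
    rw [h₁, h₂, appendMap_of_lt _ _ (Nat.lt_succ_self _)]

lemma weakEquivalence_families_contraction (hu : (families C).elementsMk (op ⦋0⦌) (fun _ ↦ c) =
      singleSeq c)
    (hT : ∀ (k : Fin 2) ⦃E B : M⦄ (p : E ⟶ B), Fibration p →
      SecLift (tensorDiagramMap (cylinderEnd I k)
        (𝟭 (families C).Elements ⋙ barDiagram (representable c) D)) p) :
    WeakEquivalence (baseRetraction I (𝟭 (families C).Elements) D c ≫
      baseInclusion I (𝟭 (families C).Elements) D c (fun _ ↦ c) hu) := by
  obtain ⟨H, hH⟩ := exists_cylinder_section_of_shift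
    (T := 𝟭 (families C).Elements ⋙ barDiagram (representable c) D) (S := appendFunctor c)
    (univApp I (𝟭 _) D c) (univApp_naturality I (𝟭 _) D c) (appendUnit D c)
    (appendUnit_naturality D c) (fun x m τ φ ↦ joinMap τ φ) (fun x m l τ φ ψ ↦ rfl)
    (fun x y e m τ φ ↦ joinMap_appendMap τ e φ)
  refine (weakEquivalence_iff_of_homotopy (T := 𝟭 _ ⋙ barDiagram (representable c) D) hT H
    (f := 𝟙 _) ?_ ?_).1 inferInstance
  · ext x
    exact (hH 0 x).trans (shift_app_eq_self (T := 𝟭 _ ⋙ barDiagram (representable c) D)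
      (univApp I (𝟭 _) D c) (appendProj c x)
      (univApp_naturality I (𝟭 _) D c (appendProj c x)) _ (appendUnit_appendProj D c x))
  · ext x
    refine (hH 1 x).trans (Eq.trans ?_
      (baseRetraction_baseInclusion_app I (𝟭 _) D c (fun _ ↦ c) hu x).symm)
    refine shift_app_eq (T := 𝟭 _ ⋙ barDiagram (representable c) D) (univApp I (𝟭 _) D c)
      (appendLast c x) (univApp_naturality I (𝟭 _) D c (appendLast c x))
      (SimplexCategory.const _ ⦋0⦌ 0) _ _ ((appendUnit_appendLast D c x).trans (_ ≫= ?_))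
    exact ((_ ≫= (barDiagram (representable c) D).map_id (singleSeq c)).trans
      (Category.comp_id _)).symm

lemma weakEquivalence_augmentation (hI : IsCofibrant (I.obj ⦋0⦌)) (hD : IsCofibrant (D.obj c))
    (q : I ⟶ (Functor.const SimplexCategory).obj (𝟙_ V)) (hq : WeakEquivalence (q.app ⦋0⦌))
    (w : WeakEquivalence (baseRetraction I G D c ≫ baseInclusion I G D c u hu)) :
    WeakEquivalence ((elementsCoendEquiv _ _).symm (augSec G D c q)) := by
  have h₁ := weakEquivalence_of_section_comp (baseInclusion_baseRetraction I G D c u hu) w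
  have h₂ := ModelEnrichedCategory.unit (V := V) (M := M) (q.app ⦋0⦌) (D.obj c) hI hq hD
  rw [← baseInclusion_comp I G D c u hu] at h₂
  have h₃ : WeakEquivalence (baseInclusion I G D c u hu) := by
    have := baseInclusion_baseRetraction I G D c u hu
    have h₄ : WeakEquivalence (baseInclusion I G D c u hu ≫ baseRetraction I G D c) := by
      rw [this]
      infer_instance
    exact (weakEquivalence_postcomp_iff _ _).1 h₄
  exact (weakEquivalence_precomp_iff _ _).1 h₂

end Contraction

section Prisms

open Simplicial SSet

variable {J : Type v} [Category.{0} J] (H : Fin 2 ⥤ J ⥤ J)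

/-- The chain obtained from a chain `c` by applying the functors `H 0` and `H 1` as prescribed by
`τ`. -/
def prismChain {m : SimplexCategory} (τ : m ⟶ ⦋1⦌) (c : ComposableArrows J m.len) :
    ComposableArrows J m.len :=
  Functor.prod' (SimplexCategory.toCat.map τ).toFunctor c ⋙ Functor.uncurry.obj H

lemma prismChain_const (k : Fin 2) {m : SimplexCategory} (c : ComposableArrows J m.len) :
    prismChain H (SimplexCategory.const m ⦋1⦌ k) c = c ⋙ H.obj k := by
  refine CategoryTheory.Functor.ext (fun _ ↦ rfl) fun i j f ↦ ?_
  refine Eq.trans ?_ ((Category.id_comp _).trans (Category.comp_id _)).symm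
  refine (congrArg (fun t ↦ NatTrans.app t (c.obj i) ≫ (H.obj k).map (c.map f)) (H.map_id k)).trans ?_
  exact Category.id_comp _

variable {V : Type u₁} [Category.{v} V] [MonoidalCategory V] [SymmetricCategory V]
  [MonoidalClosed V] [HasLimits V] [HasColimits V] [ModelCategory V] [MonoidalModelCategory V]
  {M : Type u₂} [Category.{v} M] [EnrichedOrdinaryCategory V M] [Tensored V M]
  [HasLimits M] [HasColimits M] [ModelCategory M] [ModelEnrichedCategory V M]
  {I : SimplexCategory ⥤ V} {B : J ⥤ M} {E : M}

/-- The components of a section on the nerve. -/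
abbrev Sec.chainApp (σ : Sec (tensorDiagram I (firstVertex J ⋙ B)) E) {m : SimplexCategory}
    (c : ComposableArrows J m.len) : I.obj m ⊙ₗ B.obj (c.obj 0) ⟶ E :=
  σ.app (Functor.elementsMk (nerve J : SSet.{v}) (op m) c)

lemma Sec.chainApp_congr (σ : Sec (tensorDiagram I (firstVertex J ⋙ B)) E) {m : SimplexCategory}
    {c c' : ComposableArrows J m.len} (h : c = c') {X : M} {f : X ⟶ B.obj (c.obj 0)}
    {f' : X ⟶ B.obj (c'.obj 0)} (hf : HEq f f') :
    I.obj m ⊴ₗ f ≫ σ.chainApp c = I.obj m ⊴ₗ f' ≫ σ.chainApp c' := by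
  subst h
  rw [eq_of_heq hf]

lemma Sec.chainApp_naturality (σ : Sec (tensorDiagram I (firstVertex J ⋙ B)) E)
    {l m : SimplexCategory} (c : ComposableArrows J m.len) (ψ : l ⟶ m) :
    I.obj l ⊴ₗ B.map (c.map (homOfLE (Fin.zero_le (ψ.toOrderHom 0)))) ≫
      σ.chainApp (c.whiskerLeft (SimplexCategory.toCat.map ψ).toFunctor) =
      I.map ψ ⊵ₗ _ ≫ σ.chainApp c := by
  let x := Functor.elementsMk (nerve J : SSet.{v}) (op m) c
  refine Eq.trans ?_ (σ.naturality (restrHom x ψ))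
  exact congrArg (fun t ↦ I.obj l ⊴ₗ B.map t ≫
    σ.chainApp (c.whiskerLeft (SimplexCategory.toCat.map ψ).toFunctor))
    (firstVertex_map_restrHom x ψ).symm

variable {H}

lemma act_exchange_of_eq {K L : V} {X Y Z : M} {u : K ⟶ L} (g : X ⟶ Y) {b : Y ⟶ Z}
    {s : K ⊙ₗ Z ⟶ E} {t : L ⊙ₗ Y ⟶ E} (h : K ⊴ₗ b ≫ s = u ⊵ₗ Y ≫ t) :
    u ⊵ₗ X ≫ L ⊴ₗ g ≫ t = K ⊴ₗ (g ≫ b) ≫ s := by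
  rw [MonoidalLeftAction.actionHomRight_comp, Category.assoc, h,
    MonoidalLeftAction.action_exchange_assoc]

lemma prism_component_comp {ε : ∀ k, B ⟶ H.obj k ⋙ B} {k l : Fin 2} (f : k ⟶ l)
    (hε : ε k ≫ Functor.whiskerRight (H.map f) B = ε l) {i j j' : J} (a : i ⟶ j) (b : j ⟶ j') :
    (B.map a ≫ (ε k).app j) ≫ B.map ((H.map f).app j ≫ (H.obj l).map b) =
      B.map (a ≫ b) ≫ (ε l).app j' := by
  have h := congrArg (fun t ↦ NatTrans.app t j) hε
  simp only [NatTrans.comp_app, Functor.whiskerRight_app] at h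
  have h' := (ε l).naturality b
  rw [Functor.comp_map] at h'
  rw [B.map_comp, Category.assoc, reassoc_of% h, B.map_comp, Category.assoc, h']

lemma exists_prism_section (σ : Sec (tensorDiagram I (firstVertex J ⋙ B)) E)
    (ε : ∀ k, B ⟶ H.obj k ⋙ B)
    (hε : ∀ {k l} (f : k ⟶ l), ε k ≫ Functor.whiskerRight (H.map f) B = ε l) :
    ∃ K : Sec (tensorDiagram (cylinder I) (firstVertex J ⋙ B)) E,
      ∀ (k : Fin 2) {m : SimplexCategory} (c : ComposableArrows J m.len),
      (Sec.precomp (tensorDiagramMap (cylinderEnd I k) (firstVertex J ⋙ B)) K).chainApp c =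
        I.obj m ⊴ₗ (ε k).app (c.obj 0) ≫ σ.chainApp (c ⋙ H.obj k) := by
  let g (x : Functor.Elements (nerve J : SSet.{v})) (m : SimplexCategory) (τ : m ⟶ ⦋1⦌)
      (φ : m ⟶ dimObj x) : B.obj ((nerveChain x).obj 0) ⟶ B.obj ((prismChain H τ
        ((nerveChain x).whiskerLeft (SimplexCategory.toCat.map φ).toFunctor)).obj 0) :=
    B.map ((nerveChain x).map (homOfLE (Fin.zero_le (φ.toOrderHom 0)))) ≫
      (ε (τ.toOrderHom 0)).app ((nerveChain x).obj (φ.toOrderHom 0))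
  obtain ⟨K, hK⟩ := exists_cylinder_section (P := (nerve J : SSet.{v})) (I := I)
    (T := firstVertex J ⋙ B) (E := E)
    (fun x m τ φ ↦ I.obj m ⊴ₗ g x m τ φ ≫ σ.chainApp (prismChain H τ
      ((nerveChain x).whiskerLeft (SimplexCategory.toCat.map φ).toFunctor)))
    (fun x m l τ φ ψ ↦ by
      let c := (nerveChain x).whiskerLeft (SimplexCategory.toCat.map φ).toFunctor
      let p := prismChain H τ c
      have h := σ.chainApp_naturality p ψ
      have e : g x m τ φ ≫ B.map (p.map (homOfLE (Fin.zero_le (ψ.toOrderHom 0)))) =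
          g x l (ψ ≫ τ) (ψ ≫ φ) := by
        refine (prism_component_comp (homOfLE (τ.toOrderHom.monotone (Fin.zero_le
          (ψ.toOrderHom 0)))) (hε _) _ ((nerveChain x).map (homOfLE (φ.toOrderHom.monotone
          (Fin.zero_le (ψ.toOrderHom 0)))))).trans ?_
        exact congrArg (fun t ↦ B.map t ≫ (ε _).app _) ((nerveChain x).map_comp _ _).symm
      exact (act_exchange_of_eq (g x m τ φ) h).trans (congrArg (fun t ↦ I.obj l ⊴ₗ t ≫ σ.chainApp
        (p.whiskerLeft (SimplexCategory.toCat.map ψ).toFunctor)) e))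
    (fun x y e m τ φ ↦ by
      obtain ⟨⟨k⟩, t⟩ := y
      obtain ⟨θ, hθ⟩ := e
      change x.1 ⟶ op k at θ
      change (nerve J : SSet.{v}).map θ x.2 = t at hθ
      subst hθ
      refine (Category.assoc _ _ _).symm.trans (congrArg (· ≫ _)
        ((MonoidalLeftAction.actionHomRight_comp _ _ _).symm.trans
          (congrArg (fun t ↦ I.obj m ⊴ₗ t) ?_)))
      refine (Category.assoc _ _ _).symm.trans (congrArg (· ≫ _) ?_)
      refine (B.map_comp _ _).symm.trans (congrArg B.map ?_)
      refine ((Category.comp_id _) =≫ _).trans ?_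
      exact ((nerveChain x).map_comp _ _).symm)
  refine ⟨K, fun k m c ↦ (hK k (Functor.elementsMk (nerve J : SSet.{v}) (op m) c)).trans
    (σ.chainApp_congr (prismChain_const H k c) (heq_of_eq ?_))⟩
  exact (congrArg (· ≫ _) ((congrArg B.map (c.map_id 0)).trans (B.map_id _))).trans
    (Category.id_comp _)

lemma exists_section_of_natTrans (σ : Sec (tensorDiagram I (firstVertex J ⋙ B)) E) {S : J ⥤ J}
    (ε : B ⟶ S ⋙ B) : ∃ s : Sec (tensorDiagram I (firstVertex J ⋙ B)) E,
      ∀ {m : SimplexCategory} (c : ComposableArrows J m.len),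
        s.chainApp c = I.obj m ⊴ₗ ε.app (c.obj 0) ≫ σ.chainApp (c ⋙ S) := by
  obtain ⟨K, hK⟩ := exists_prism_section (H := (Functor.const _).obj S) σ (fun _ ↦ ε) (fun _ ↦ by
    ext
    exact (_ ≫= B.map_id _).trans (Category.comp_id _))
  exact ⟨_, fun c ↦ hK 0 c⟩

lemma weakEquivalence_iff_of_natTrans
    (hT : ∀ (k : Fin 2) ⦃E A : M⦄ (p : E ⟶ A), Fibration p →
      SecLift (tensorDiagramMap (cylinderEnd I k) (firstVertex J ⋙ B)) p)
    {f g : elementsCoend (tensorDiagram I (firstVertex J ⋙ B)) ⟶ E}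
    (σ : Sec (tensorDiagram I (firstVertex J ⋙ B)) E) {S S' : J ⥤ J} (ν : S ⟶ S')
    (ε : B ⟶ S ⋙ B) (ε' : B ⟶ S' ⋙ B) (h : ε ≫ Functor.whiskerRight ν B = ε')
    (hf : ∀ {m : SimplexCategory} (c : ComposableArrows J m.len),
      (elementsCoendEquiv _ _ f).chainApp c = I.obj m ⊴ₗ ε.app (c.obj 0) ≫ σ.chainApp (c ⋙ S))
    (hg : ∀ {m : SimplexCategory} (c : ComposableArrows J m.len),
      (elementsCoendEquiv _ _ g).chainApp c = I.obj m ⊴ₗ ε'.app (c.obj 0) ≫ σ.chainApp (c ⋙ S')) :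
    WeakEquivalence f ↔ WeakEquivalence g := by
  obtain ⟨K, hK⟩ := exists_prism_section (H := ComposableArrows.mk₁ ν) σ
    (fun k ↦ match k with
      | 0 => ε
      | 1 => ε') (fun {k l} a ↦ by
      match k, l, a with
      | 0, 0, a =>
        refine (ε ≫= (congrArg (fun t ↦ Functor.whiskerRight t B)
          ((ComposableArrows.mk₁ ν).map_id 0))).trans ?_
        ext
        exact (_ ≫= B.map_id _).trans (Category.comp_id _)
      | 0, 1, a => exact h
      | 1, 0, a => exact absurd (leOfHom a) (by decide)
      | 1, 1, a =>
        refine (ε' ≫= (congrArg (fun t ↦ Functor.whiskerRight t B)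
          ((ComposableArrows.mk₁ ν).map_id 1))).trans ?_
        ext
        exact (_ ≫= B.map_id _).trans (Category.comp_id _))
  refine weakEquivalence_iff_of_homotopy hT K ?_ ?_
  · ext x
    exact (hK 0 x.2).trans (hf x.2).symm
  · ext x
    exact (hK 1 x.2).trans (hg x.2).symm

end Prisms

section NerveContraction

open Simplicial SSet

variable {V : Type u₁} [Category.{v} V] [MonoidalCategory V] [SymmetricCategory V]
  [MonoidalClosed V] [HasLimits V] [HasColimits V] [ModelCategory V] [MonoidalModelCategory V]
  {C : Type v} [EnrichedCategory V C]
  {M : Type u₂} [Category.{v} M] [EnrichedOrdinaryCategory V M] [Tensored V M]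
  [HasLimits M] [HasColimits M] [ModelCategory M] [ModelEnrichedCategory V M]
  {I : SimplexCategory ⥤ V} {D : EnrichedFunctor V C M} {c : C}

/-- `appendProj` as a natural transformation. -/
def appendProjNat (c : C) : appendFunctor (C := C) c ⟶ 𝟭 _ where
  app := appendProj c
  naturality _ _ f := appendProj_naturality c f

/-- `appendLast` as a natural transformation. -/
def appendLastNat (c : C) :
    appendFunctor (C := C) c ⟶ (Functor.const _).obj (singleSeq c) where
  app := appendLast c
  naturality _ _ f := (appendLast_naturality c f).trans (Category.comp_id _).symm

/-- `appendUnit` as a natural transformation. -/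
def appendUnitNat (D : EnrichedFunctor V C M) (c : C) :
    barDiagram (representable (V := V) c) D ⟶
      appendFunctor c ⋙ barDiagram (representable (V := V) c) D where
  app := appendUnit D c
  naturality _ _ f := appendUnit_naturality D c f

lemma weakEquivalence_nerve_contraction
    (hu : (firstVertex (families C).Elements).obj
      (Functor.elementsMk (nerve (families C).Elements : SSet.{v}) (op ⦋0⦌)
        ((Functor.const _).obj (singleSeq c))) = singleSeq c)
    (hT : ∀ (k : Fin 2) ⦃E B : M⦄ (p : E ⟶ B), Fibration p →
      SecLift (tensorDiagramMap (cylinderEnd I k)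
        (firstVertex (families C).Elements ⋙ barDiagram (representable c) D)) p) :
    WeakEquivalence (baseRetraction I (firstVertex (families C).Elements) D c ≫
      baseInclusion I (firstVertex (families C).Elements) D c
        ((Functor.const _).obj (singleSeq c)) hu) := by
  let σ := univSec (tensorDiagram I (firstVertex (families C).Elements ⋙
    barDiagram (representable (V := V) c) D))
  obtain ⟨s, hs⟩ := exists_section_of_natTrans σ (appendUnitNat D c)
  have hf {m : SimplexCategory} (x : ComposableArrows (families C).Elements m.len) :
      (elementsCoendEquiv _ _ ((elementsCoendEquiv _ _).symm s)).chainApp x =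
        I.obj m ⊴ₗ (appendUnitNat D c).app (x.obj 0) ≫ σ.chainApp (x ⋙ appendFunctor c) :=
    (congrArg (fun s : Sec _ _ ↦ s.chainApp x) (Equiv.apply_symm_apply _ _)).trans (hs x)
  refine (weakEquivalence_iff_of_natTrans hT (f := (elementsCoendEquiv _ _).symm s) σ
    (appendLastNat c) (appendUnitNat D c) _ rfl hf ?_).1 ((weakEquivalence_iff_of_natTrans hT
    (f := (elementsCoendEquiv _ _).symm s) (g := 𝟙 _) σ (appendProjNat c)
    (appendUnitNat D c) (𝟙 _) ?_ hf ?_).2 inferInstance)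
  · intro m x
    refine (baseRetraction_baseInclusion_app I (firstVertex (families C).Elements) D c _ hu
      (Functor.elementsMk (nerve _ : SSet.{v}) (op m) x)).trans ?_
    let c₀ : ComposableArrows (families C).Elements 0 := (Functor.const _).obj (singleSeq c)
    refine (act_exchange_of_eq _ (σ.chainApp_naturality c₀
      (SimplexCategory.const m ⦋0⦌ 0))).trans ?_
    refine congrArg (fun t ↦ I.obj m ⊴ₗ t ≫
      σ.chainApp (c₀.whiskerLeft (SimplexCategory.toCat.map (SimplexCategory.const m ⦋0⦌ 0)).toFunctor)) ?_
    refine Eq.trans ?_ (appendUnit_appendLast D c (x.obj 0)).symm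
    let B := barDiagram (representable (V := V) c) D
    refine (_ ≫= B.map_id (singleSeq c)).trans ((Category.comp_id _).trans (_ ≫= ?_))
    exact (_ ≫= B.map_id (singleSeq c)).trans (Category.comp_id _)
  · ext x
    exact appendUnit_appendProj D c x
  · intro m x
    exact ((MonoidalLeftAction.actionHomRight_id _ _ =≫ _).trans (Category.id_comp _)).symm

end NerveContraction

section Swap

variable {V : Type u₁} [Category.{v} V] [MonoidalCategory V] [SymmetricCategory V]
  {M : Type u₂} [Category.{v} M] [MonoidalLeftAction V M]

/-- The symmetry `K ⊗ (L ⊗ X) ⟶ L ⊗ (K ⊗ X)`. -/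
def actSwap (K L : V) (X : M) : K ⊙ₗ (L ⊙ₗ X) ⟶ L ⊙ₗ (K ⊙ₗ X) :=
  (αₗ K L X).inv ≫ (β_ K L).hom ⊵ₗ X ≫ (αₗ L K X).hom

lemma actSwap_actSwap (K L : V) (X : M) : actSwap K L X ≫ actSwap L K X = 𝟙 _ := by
  have h : (β_ K L).hom ⊵ₗ X ≫ (β_ L K).hom ⊵ₗ X = 𝟙 _ := by
    rw [← comp_actionHomLeft, SymmetricCategory.symmetry, id_actionHomLeft]
  simp only [actSwap, Category.assoc, Iso.hom_inv_id_assoc]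
  rw [reassoc_of% h, Iso.inv_hom_id]

/-- `actSwap` as an isomorphism. -/
@[simps]
def actSwapIso (K L : V) (X : M) : K ⊙ₗ (L ⊙ₗ X) ≅ L ⊙ₗ (K ⊙ₗ X) where
  hom := actSwap K L X
  inv := actSwap L K X
  hom_inv_id := actSwap_actSwap K L X
  inv_hom_id := actSwap_actSwap L K X

instance (K L : V) (X : M) : IsIso (actSwap K L X) := (actSwapIso K L X).isIso_hom

lemma actSwap_naturality (K L : V) {X Y : M} (f : X ⟶ Y) :
    K ⊴ₗ (L ⊴ₗ f) ≫ actSwap K L Y = actSwap K L X ≫ L ⊴ₗ (K ⊴ₗ f) := by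
  have h : K ⊴ₗ (L ⊴ₗ f) ≫ (αₗ K L Y).inv = (αₗ K L X).inv ≫ (K ⊗ L) ⊴ₗ f := by simp
  have h' : L ⊴ₗ (K ⊴ₗ f) = (αₗ L K X).inv ≫ (L ⊗ K) ⊴ₗ f ≫ (αₗ L K Y).hom := by simp
  rw [h', actSwap, reassoc_of% h]
  simp only [actSwap, Category.assoc, Iso.hom_inv_id_assoc]
  rw [← action_exchange_assoc]

lemma actSwap_naturality_left {K K' : V} (u : K ⟶ K') (L : V) (X : M) :
    u ⊵ₗ (L ⊙ₗ X) ≫ actSwap K' L X = actSwap K L X ≫ L ⊴ₗ (u ⊵ₗ X) := by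
  simp only [actSwap, Category.assoc, actionHomLeft_action,
    Iso.hom_inv_id_assoc]
  rw [← comp_actionHomLeft_assoc, BraidedCategory.braiding_naturality_left, comp_actionHomLeft,
    whiskerLeft_actionHomLeft]
  simp

lemma actSwap_naturality_right (K : V) {L L' : V} (u : L ⟶ L') (X : M) :
    K ⊴ₗ (u ⊵ₗ X) ≫ actSwap K L' X = actSwap K L X ≫ u ⊵ₗ (K ⊙ₗ X) := by
  rw [← cancel_mono (actSwap L' K X), Category.assoc, Category.assoc, actSwap_actSwap,
    actSwap_naturality_left, ← Category.assoc (actSwap K L X), actSwap_actSwap]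
  simp

lemma actSwap_tensor (K K' L : V) (X : M) :
    actSwap (K ⊗ K') L X ≫ L ⊴ₗ (αₗ K K' X).hom =
      (αₗ K K' (L ⊙ₗ X)).hom ≫ K ⊴ₗ actSwap K' L X ≫ actSwap K L (K' ⊙ₗ X) := by
  have h (A B N : V) : (α_ A B N).hom ⊵ₗ X = (αₗ (A ⊗ B) N X).hom ≫ (αₗ A B (N ⊙ₗ X)).hom ≫
      A ⊴ₗ (αₗ B N X).inv ≫ (αₗ A (B ⊗ N) X).inv := by
    rw [← associator_actionHom_assoc, actionHomRight_hom_inv_assoc, Iso.hom_inv_id,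
      Category.comp_id]
  have h' (A B N : V) : (α_ A B N).inv ⊵ₗ X = (αₗ A (B ⊗ N) X).hom ≫ A ⊴ₗ (αₗ B N X).hom ≫
      (αₗ A B (N ⊙ₗ X)).inv ≫ (αₗ (A ⊗ B) N X).inv := by
    rw [← cancel_epi ((α_ A B N).hom ⊵ₗ X), hom_inv_actionHomLeft, h]
    simp
  simp only [actSwap, BraidedCategory.braiding_tensor_left_hom, comp_actionHomLeft, h, h',
    whiskerRight_actionHomLeft, whiskerLeft_actionHomLeft, Category.assoc, actionHomRight_comp,
    Iso.inv_hom_id_assoc, actionHomRight_inv_hom, Category.comp_id]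

lemma unitInsert_actSwap {B : V} (u : 𝟙_ V ⟶ B) (L : V) (X : M) :
    ((λₗ[V] (L ⊙ₗ X)).inv ≫ u ⊵ₗ (L ⊙ₗ X)) ≫ actSwap B L X =
      L ⊴ₗ ((λₗ[V] X).inv ≫ u ⊵ₗ X) := by
  have h : (λₗ[V] (L ⊙ₗ X)).inv ≫ actSwap (𝟙_ V) L X = L ⊴ₗ (λₗ[V] X).inv := by
    rw [actSwap, ← Category.assoc, ← leftUnitor_inv_act, ← comp_actionHomLeft_assoc,
      ← cancel_mono (αₗ L (𝟙_ V) X).inv, ← rightUnitor_inv_act]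
    simp
  rw [Category.assoc, actSwap_naturality_left, reassoc_of% h, actionHomRight_comp]

end Swap

section TensorDiagrams

variable {V : Type u₁} [Category.{v} V] [MonoidalCategory V] [SymmetricCategory V]
  [MonoidalClosed V] {C : Type u} [EnrichedCategory V C]
  {M : Type u₂} [Category.{v} M] [EnrichedOrdinaryCategory V M] [Tensored V M]
  {W : EnrichedFunctor V Cᵒᵖ V}

/-- The diagram `c ↦ K ⊗ X c`. -/
abbrev tensorLeft (K : V) (X : EnrichedFunctor V C M) : EnrichedFunctor V C M :=
  diagramMk (fun c ↦ K ⊙ₗ X.obj c) (fun c c' ↦ actSwap _ K _ ≫ K ⊴ₗ diagramAct X c c')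
    (fun c ↦ by
      have := unitInsert_actSwap (eId V c) K (X.obj c)
      rw [Category.assoc] at this
      rw [reassoc_of% this, ← actionHomRight_comp, Category.assoc, diagramAct_id,
        actionHomRight_id])
    (fun c c' c'' ↦ by
      rw [← Category.assoc, actSwap_naturality_left, Category.assoc, ← actionHomRight_comp,
        diagramAct_comp, actionHomRight_comp, reassoc_of% actSwap_tensor, actionHomRight_comp,
        actionHomRight_comp, Category.assoc, reassoc_of% actSwap_naturality])

lemma diagramAct_tensorLeft (K : V) (X : EnrichedFunctor V C M) (c c' : C) :
    diagramAct (tensorLeft K X) c c' = actSwap _ K _ ≫ K ⊴ₗ diagramAct X c c' :=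
  diagramAct_diagramMk _ _ _ _ _ _

/-- Functoriality of `tensorLeft K X` in `X`. -/
def tensorLeftMapRight (K : V) {X Y : EnrichedFunctor V C M} (f : DiagramHom X Y) :
    DiagramHom (tensorLeft K X) (tensorLeft K Y) where
  app c := K ⊴ₗ f.app c
  naturality c c' := by
    rw [diagramAct_tensorLeft, diagramAct_tensorLeft, Category.assoc, ← actionHomRight_comp,
      f.naturality, actionHomRight_comp, reassoc_of% actSwap_naturality]

/-- Functoriality of `tensorLeft K X` in `K`. -/
def tensorLeftMapLeft {K L : V} (u : K ⟶ L) (X : EnrichedFunctor V C M) :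
    DiagramHom (tensorLeft K X) (tensorLeft L X) where
  app c := u ⊵ₗ X.obj c
  naturality c c' := by
    rw [diagramAct_tensorLeft, diagramAct_tensorLeft, Category.assoc, action_exchange,
      reassoc_of% actSwap_naturality_right]

namespace Balanced

variable {X : EnrichedFunctor V C M} {E p : M}

/-- The balanced family `W c ⊗ K ⊗ X c ⟶ K ⊗ E` induced by a balanced family `W c ⊗ X c ⟶ E`. -/
@[simps] def tensorLeft (K : V) (φ : Balanced W X E) : Balanced W (tensorLeft K X) (K ⊙ₗ E) where
  app c := actSwap _ K _ ≫ K ⊴ₗ φ.app c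
  balanced c c' := by
    rw [← Category.assoc, actSwap_naturality_left, Category.assoc, ← actionHomRight_comp,
      φ.balanced, actionHomRight_comp, reassoc_of% actSwap_tensor, diagramAct_tensorLeft,
      actionHomRight_comp, actionHomRight_comp, Category.assoc, reassoc_of% actSwap_naturality]

/-- A balanced family is universal if it exhibits its target as the weighted colimit. -/
def IsUniversal (φ : Balanced W X p) : Prop :=
  ∀ E : M, Function.Bijective (fun g : p ⟶ E ↦ φ.postcomp g)

lemma IsUniversal.hom_ext {φ : Balanced W X p} (h : φ.IsUniversal) {g g' : p ⟶ E}
    (e : ∀ c, φ.app c ≫ g = φ.app c ≫ g') : g = g' :=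
  (h E).1 (Balanced.ext e)

lemma IsUniversal.exists_desc {φ : Balanced W X p} (h : φ.IsUniversal) (ψ : Balanced W X E) :
    ∃ g : p ⟶ E, ∀ c, φ.app c ≫ g = ψ.app c := by
  obtain ⟨g, rfl⟩ := (h E).2 ψ
  exact ⟨g, fun _ ↦ rfl⟩

variable [ModelCategory V] [ModelCategory M] [ModelEnrichedCategory V M]

lemma IsUniversal.tensorLeft (K : V) {φ : Balanced W X p} (h : φ.IsUniversal) :
    (φ.tensorLeft K).IsUniversal := by
  refine fun E ↦ ⟨fun g g' e ↦ ?_, fun ψ ↦ ?_⟩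
  · apply (cotensorEquiv K p E).symm.injective
    refine h.hom_ext fun c ↦ ?_
    have e' := congrArg (fun t : Balanced _ _ _ ↦ t.app c) e
    simp only [postcomp_app, tensorLeft_app, Category.assoc, cancel_epi] at e'
    rw [← cotensorEquiv_symm_comp, ← cotensorEquiv_symm_comp, e']
  · let ψ' : Balanced W X (cotensor K E) :=
      { app c := (cotensorEquiv K _ E).symm (actSwap K _ _ ≫ ψ.app c)
        balanced c c' := by
          have e := ψ.balanced c c'
          have e' := actSwap_tensor (W.obj (op c')) (c ⟶[V] c') K (X.obj c)
          rw [diagramAct_tensorLeft] at e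
          rw [← cotensorEquiv_symm_comp, ← cotensorEquiv_symm_comp, ← cotensorEquiv_symm_comp]
          refine congrArg _ ?_
          rw [← Category.assoc, actSwap_naturality_right, Category.assoc, e,
            ← cancel_epi (actSwap _ K _), reassoc_of% actSwap_actSwap, reassoc_of% e',
            reassoc_of% actSwap_naturality, reassoc_of% actSwap_actSwap]
          simp }
    obtain ⟨g, hg⟩ := h.exists_desc ψ'
    refine ⟨cotensorEquiv K p E g, Balanced.ext fun c ↦ ?_⟩
    simp only [postcomp_app, tensorLeft_app, Category.assoc]
    rw [← cotensorEquiv_comp, hg, Equiv.apply_symm_apply, reassoc_of% actSwap_actSwap]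

end Balanced

end TensorDiagrams

section JointlyEpi

variable {V : Type u₁} [Category.{v} V] [MonoidalCategory V] [SymmetricCategory V]
  [MonoidalClosed V] {C : Type u} [EnrichedCategory V C]
  {M : Type u₂} [Category.{v} M] [EnrichedOrdinaryCategory V M] [Tensored V M]
  {J : Type*} {X : J → EnrichedFunctor V C M} {R : C → M} {ι : ∀ j c, (X j).obj c ⟶ R c}

/-- Diagrams with values jointly covered by the values of given diagrams. -/
abbrev diagramOfJointlyEpi
    (hι : ∀ (K : V) (c : C) {E : M} {f g : K ⊙ₗ R c ⟶ E},
      (∀ j, K ⊴ₗ ι j c ≫ f = K ⊴ₗ ι j c ≫ g) → f = g)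
    (act : ∀ c c' : C, (c ⟶[V] c') ⊙ₗ R c ⟶ R c')
    (hact : ∀ (c c' : C) j, _ ⊴ₗ ι j c ≫ act c c' = diagramAct (X j) c c' ≫ ι j c') :
    EnrichedFunctor V C M :=
  diagramMk R act
    (fun c ↦ by
      rw [Iso.inv_comp_eq, Category.comp_id]
      refine hι _ _ fun j ↦ ?_
      rw [action_exchange_assoc, hact, ← Category.assoc]
      have := diagramAct_id (X j) c
      rw [Iso.inv_comp_eq, Category.comp_id] at this
      rw [this, actionUnitIso_hom_naturality])
    (fun c c' c'' ↦ hι _ _ fun j ↦ by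
      rw [action_exchange_assoc, hact, reassoc_of% diagramAct_comp, tensor_actionHomRight]
      simp only [Category.assoc, Iso.inv_hom_id_assoc]
      rw [← actionHomRight_comp_assoc, hact, actionHomRight_comp, Category.assoc, hact])

/-- The morphisms to a jointly covered diagram. -/
@[simps] def diagramOfJointlyEpiι
    (hι : ∀ (K : V) (c : C) {E : M} {f g : K ⊙ₗ R c ⟶ E},
      (∀ j, K ⊴ₗ ι j c ≫ f = K ⊴ₗ ι j c ≫ g) → f = g)
    (act : ∀ c c' : C, (c ⟶[V] c') ⊙ₗ R c ⟶ R c')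
    (hact : ∀ (c c' : C) j, _ ⊴ₗ ι j c ≫ act c c' = diagramAct (X j) c c' ≫ ι j c') (j : J) :
    DiagramHom (X j) (diagramOfJointlyEpi hι act hact) where
  app c := ι j c
  naturality c c' := (hact c c' j).symm.trans (_ ≫= (diagramAct_diagramMk _ _ _ _ _ _).symm)

/-- Composition of morphisms of diagrams. -/
@[simps] def DiagramHom.comp {X Y Z : EnrichedFunctor V C M} (f : DiagramHom X Y)
    (g : DiagramHom Y Z) : DiagramHom X Z where
  app c := f.app c ≫ g.app c
  naturality c c' := by
    rw [reassoc_of% f.naturality, g.naturality, actionHomRight_comp, Category.assoc]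

/-- Morphisms from a jointly covered diagram. -/
@[simps] def DiagramHom.ofJointlyEpi {R Y : EnrichedFunctor V C M} (f : ∀ j, DiagramHom (X j) R)
    (hf : ∀ (K : V) (c : C) {E : M} {u v : K ⊙ₗ R.obj c ⟶ E},
      (∀ j, K ⊴ₗ (f j).app c ≫ u = K ⊴ₗ (f j).app c ≫ v) → u = v)
    (g : ∀ j, DiagramHom (X j) Y) (h : ∀ c, R.obj c ⟶ Y.obj c)
    (hh : ∀ j c, (f j).app c ≫ h c = (g j).app c) : DiagramHom R Y where
  app := h
  naturality c c' := hf _ _ fun j ↦ by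
    rw [← reassoc_of% (f j).naturality, hh, (g j).naturality, ← hh, actionHomRight_comp,
      Category.assoc]

end JointlyEpi

section CoendDiagrams

variable {V : Type u₁} [Category.{v} V] [MonoidalCategory V] [SymmetricCategory V]
  [MonoidalClosed V] {C : Type u} [EnrichedCategory V C]
  {M : Type u₂} [Category.{v} M] [EnrichedOrdinaryCategory V M] [Tensored V M]

variable (V C M) in
/-- A diagram in diagrams. -/
structure DiagramFamily (J : Type*) [Category* J] where
  /-- the values -/
  obj (c : C) : J ⥤ M
  /-- the action -/
  act (c c' : C) (x : J) : (c ⟶[V] c') ⊙ₗ (obj c).obj x ⟶ (obj c').obj x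
  act_naturality (c c' : C) {x y : J} (e : x ⟶ y) :
    act c c' x ≫ (obj c').map e = (c ⟶[V] c') ⊴ₗ (obj c).map e ≫ act c c' y
  act_id (c : C) (x : J) : (λₗ[V] ((obj c).obj x)).inv ≫ eId V c ⊵ₗ _ ≫ act c c x = 𝟙 _
  act_comp (c c' c'' : C) (x : J) : eCompRev V c c' c'' ⊵ₗ _ ≫ act c c'' x =
      (αₗ _ _ _).hom ≫ _ ⊴ₗ act c c' x ≫ act c' c'' x

namespace DiagramFamily

variable {J : Type*} [Category* J] (T : DiagramFamily V C M J)

/-- The diagrams in a diagram of diagrams. -/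
abbrev eval (x : J) : EnrichedFunctor V C M :=
  diagramMk (fun c ↦ (T.obj c).obj x) (fun c c' ↦ T.act c c' x) (fun c ↦ T.act_id c x)
    (fun c c' c'' ↦ T.act_comp c c' c'' x)

lemma diagramAct_eval (x : J) (c c' : C) : diagramAct (T.eval x) c c' = T.act c c' x :=
  diagramAct_diagramMk _ _ _ _ _ _

/-- The morphisms in a diagram of diagrams. -/
@[simps] def evalMap {x y : J} (e : x ⟶ y) : DiagramHom (T.eval x) (T.eval y) where
  app c := (T.obj c).map e
  naturality c c' := by
    rw [diagramAct_eval, diagramAct_eval]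
    exact T.act_naturality c c' e

end DiagramFamily

variable [HasColimits M]
  {P : SimplexCategoryᵒᵖ ⥤ Type v} {I : SimplexCategory ⥤ V} {Q : P.Elements ⥤ M}

variable (I Q) in
/-- The components of the universal sections of tensor diagrams. -/
def tensorι (x : P.Elements) :
    I.obj (dimObj x) ⊙ₗ Q.obj x ⟶ elementsCoend (tensorDiagram I Q) :=
  (elementsCoendEquiv (tensorDiagram I Q) _ (𝟙 _)).app x

lemma tensorι_naturality {x y : P.Elements} (e : x ⟶ y) :
    I.obj (dimObj y) ⊴ₗ Q.map e ≫ tensorι I Q y = I.map e.1.unop ⊵ₗ Q.obj x ≫ tensorι I Q x :=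
  (elementsCoendEquiv (tensorDiagram I Q) _ (𝟙 _)).naturality e

lemma tensorι_comp {E : M} (g : elementsCoend (tensorDiagram I Q) ⟶ E) (x : P.Elements) :
    tensorι I Q x ≫ g = (elementsCoendEquiv _ _ g).app x := by
  have h := elementsCoendEquiv_comp (tensorDiagram I Q) (𝟙 _) g
  rw [Category.id_comp] at h
  rw [h]
  rfl

lemma hom_ext_tensorι {E : M} {f g : elementsCoend (tensorDiagram I Q) ⟶ E}
    (h : ∀ x, tensorι I Q x ≫ f = tensorι I Q x ≫ g) : f = g := by
  apply (elementsCoendEquiv _ _).injective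
  ext x
  rw [← tensorι_comp, ← tensorι_comp, h]

lemma exists_desc_tensorι {E : M} (φ : ∀ x, I.obj (dimObj x) ⊙ₗ Q.obj x ⟶ E)
    (hφ : ∀ {x y : P.Elements} (e : x ⟶ y),
      I.obj (dimObj y) ⊴ₗ Q.map e ≫ φ y = I.map e.1.unop ⊵ₗ Q.obj x ≫ φ x) :
    ∃ f : elementsCoend (tensorDiagram I Q) ⟶ E, ∀ x, tensorι I Q x ≫ f = φ x := by
  refine ⟨(elementsCoendEquiv _ _).symm ⟨φ, hφ⟩, fun x ↦ ?_⟩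
  rw [tensorι_comp, Equiv.apply_symm_apply]

variable [HasLimits M] [ModelCategory V] [ModelCategory M] [ModelEnrichedCategory V M]

lemma hom_ext_act_tensorι {K : V} {E : M} {f g : K ⊙ₗ elementsCoend (tensorDiagram I Q) ⟶ E}
    (h : ∀ x, K ⊴ₗ tensorι I Q x ≫ f = K ⊴ₗ tensorι I Q x ≫ g) : f = g := by
  apply (cotensorEquiv K _ E).symm.injective
  refine hom_ext_tensorι fun x ↦ ?_
  rw [← cotensorEquiv_symm_comp, h, cotensorEquiv_symm_comp]

lemma exists_desc_act_tensorι {K : V} {E : M}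
    (φ : ∀ x, K ⊙ₗ (I.obj (dimObj x) ⊙ₗ Q.obj x) ⟶ E)
    (hφ : ∀ {x y : P.Elements} (e : x ⟶ y), K ⊴ₗ (I.obj (dimObj y) ⊴ₗ Q.map e) ≫ φ y =
      K ⊴ₗ (I.map e.1.unop ⊵ₗ Q.obj x) ≫ φ x) :
    ∃ f : K ⊙ₗ elementsCoend (tensorDiagram I Q) ⟶ E, ∀ x, K ⊴ₗ tensorι I Q x ≫ f = φ x := by
  obtain ⟨f, hf⟩ := exists_desc_tensorι (fun x ↦ (cotensorEquiv K _ E).symm (φ x))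
    (fun e ↦ by rw [← cotensorEquiv_symm_comp, ← cotensorEquiv_symm_comp, hφ])
  refine ⟨cotensorEquiv K _ E f, fun x ↦ ?_⟩
  rw [← cotensorEquiv_comp, hf, Equiv.apply_symm_apply]

namespace DiagramFamily

variable (I) (T : DiagramFamily V C M P.Elements)

lemma exists_coendAct (c c' : C) :
    ∃ f : (c ⟶[V] c') ⊙ₗ elementsCoend (tensorDiagram I (T.obj c)) ⟶
      elementsCoend (tensorDiagram I (T.obj c')), ∀ x, (c ⟶[V] c') ⊴ₗ tensorι I (T.obj c) x ≫ f =
        diagramAct (tensorLeft (I.obj (dimObj x)) (T.eval x)) c c' ≫ tensorι I (T.obj c') x := by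
  refine exists_desc_act_tensorι _ fun {x y} e ↦ ?_
  have h₁ := (tensorLeftMapRight (I.obj (dimObj y)) (T.evalMap e)).naturality c c'
  have h₂ := (tensorLeftMapLeft (I.map e.1.unop) (T.eval x)).naturality c c'
  simp only [tensorLeftMapRight, tensorLeftMapLeft, evalMap_app] at h₁ h₂
  rw [← reassoc_of% h₁, ← reassoc_of% h₂, tensorι_naturality]

/-- The diagram `c ↦ ∫^x I^x ⊗ T c x`. -/
abbrev coendDiagram : EnrichedFunctor V C M :=
  diagramOfJointlyEpi (X := fun x ↦ tensorLeft (I.obj (dimObj x)) (T.eval x))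
    (R := fun c ↦ elementsCoend (tensorDiagram I (T.obj c)))
    (ι := fun x c ↦ tensorι I (T.obj c) x)
    (fun _ _ _ _ _ h ↦ hom_ext_act_tensorι h)
    (fun c c' ↦ (T.exists_coendAct I c c').choose)
    (fun c c' ↦ (T.exists_coendAct I c c').choose_spec)

/-- The components of the universal sections as morphisms of diagrams. -/
def coendι (x : P.Elements) :
    DiagramHom (tensorLeft (I.obj (dimObj x)) (T.eval x)) (T.coendDiagram I) :=
  diagramOfJointlyEpiι (X := fun x ↦ tensorLeft (I.obj (dimObj x)) (T.eval x))
    (R := fun c ↦ elementsCoend (tensorDiagram I (T.obj c)))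
    (ι := fun x c ↦ tensorι I (T.obj c) x)
    (fun _ _ _ _ _ h ↦ hom_ext_act_tensorι h)
    (fun c c' ↦ (T.exists_coendAct I c c').choose)
    (fun c c' ↦ (T.exists_coendAct I c c').choose_spec) x

lemma coendι_app (x : P.Elements) (c : C) : (T.coendι I x).app c = tensorι I (T.obj c) x := rfl

variable {I T} {W : EnrichedFunctor V Cᵒᵖ V} {q : ∀ x, Balanced W (T.eval x) (Q.obj x)}

lemma exists_balanced_coend
    (hq : ∀ {x y : P.Elements} (e : x ⟶ y),
      (q y).precomp (T.evalMap e) = (q x).postcomp (Q.map e)) :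
    ∃ φ : Balanced W (T.coendDiagram I) (elementsCoend (tensorDiagram I Q)),
      ∀ x, φ.precomp (T.coendι I x) =
        ((q x).tensorLeft (I.obj (dimObj x))).postcomp (tensorι I Q x) := by
  have H (c : C) : ∃ f : W.obj (op c) ⊙ₗ elementsCoend (tensorDiagram I (T.obj c)) ⟶
      elementsCoend (tensorDiagram I Q), ∀ x, W.obj (op c) ⊴ₗ tensorι I (T.obj c) x ≫ f =
        actSwap _ _ _ ≫ I.obj (dimObj x) ⊴ₗ (q x).app c ≫ tensorι I Q x := by
    refine exists_desc_act_tensorι _ fun {x y} e ↦ ?_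
    have h₁ : W.obj (op c) ⊴ₗ (T.obj c).map e ≫ (q y).app c = (q x).app c ≫ Q.map e :=
      congrArg (fun t : Balanced _ _ _ ↦ t.app c) (hq e)
    rw [reassoc_of% actSwap_naturality, reassoc_of% actSwap_naturality_right,
      ← action_exchange_assoc, ← tensorι_naturality, ← actionHomRight_comp_assoc,
      ← actionHomRight_comp_assoc, h₁]
  choose f hf using H
  refine ⟨⟨f, fun c c' ↦ hom_ext_act_tensorι fun x ↦ ?_⟩, fun x ↦ Balanced.ext fun c ↦ ?_⟩
  · have h₁ : (W.obj (op c') ⊗ (c ⟶[V] c')) ⊴ₗ tensorι I (T.obj c) x ≫ (αₗ _ _ _).hom =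
      (αₗ _ _ _).hom ≫ W.obj (op c') ⊴ₗ ((c ⟶[V] c') ⊴ₗ tensorι I (T.obj c) x) := by simp
    have h₂ := ((q x).tensorLeft (I.obj (dimObj x))).balanced c c'
    have h₅ := ((T.coendι I x).naturality c c').symm
    simp only [Balanced.tensorLeft_app, coendι_app] at h₂ h₅
    rw [action_exchange_assoc, hf, reassoc_of% h₁, ← actionHomRight_comp_assoc, h₅,
      actionHomRight_comp, Category.assoc, hf, reassoc_of% h₂]
  · exact (hf c x).trans (Category.assoc _ _ _).symm

lemma exists_isUniversal_coend
    (hq : ∀ {x y : P.Elements} (e : x ⟶ y),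
      (q y).precomp (T.evalMap e) = (q x).postcomp (Q.map e))
    (hu : ∀ x, (q x).IsUniversal) :
    ∃ φ : Balanced W (T.coendDiagram I) (elementsCoend (tensorDiagram I Q)), φ.IsUniversal := by
  obtain ⟨φ, hφ⟩ := exists_balanced_coend (I := I) hq
  have hφ' {E : M} (x : P.Elements) (c : C) (g : elementsCoend (tensorDiagram I Q) ⟶ E) :
      ((q x).tensorLeft (I.obj (dimObj x))).app c ≫ tensorι I Q x ≫ g =
        W.obj (op c) ⊴ₗ tensorι I (T.obj c) x ≫ φ.app c ≫ g := by
    have := congrArg (fun t : Balanced _ _ _ ↦ t.app c ≫ g) (hφ x)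
    exact ((Category.assoc _ _ _).symm.trans this.symm).trans (Category.assoc _ _ _)
  refine ⟨φ, fun E ↦ ⟨fun g g' e ↦ hom_ext_tensorι fun x ↦ ?_, fun ψ ↦ ?_⟩⟩
  · refine ((hu x).tensorLeft (I.obj (dimObj x))).hom_ext fun c ↦ ?_
    have h : φ.app c ≫ g = φ.app c ≫ g' := congrArg (fun t : Balanced _ _ _ ↦ t.app c) e
    rw [hφ', hφ', h]
  · choose h hh using fun x ↦ ((hu x).tensorLeft (I.obj (dimObj x))).exists_desc
      (ψ.precomp (T.coendι I x))
    obtain ⟨g, hg⟩ := exists_desc_tensorι (I := I) (Q := Q) h (fun {x y} e ↦ by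
      refine ((hu x).tensorLeft (I.obj (dimObj y))).hom_ext fun c ↦ ?_
      have h₁ : W.obj (op c) ⊴ₗ (T.obj c).map e ≫ (q y).app c = (q x).app c ≫ Q.map e :=
        congrArg (fun t : Balanced _ _ _ ↦ t.app c) (hq e)
      have hx := hh x c
      have hy := hh y c
      have hn := tensorι_naturality (I := I) (Q := T.obj c) e
      simp only [Balanced.tensorLeft_app, Balanced.precomp_app, coendι_app, Category.assoc] at hx hy ⊢
      rw [← actionHomRight_comp_assoc, ← h₁, actionHomRight_comp, Category.assoc,
        ← reassoc_of% actSwap_naturality, hy, ← actionHomRight_comp_assoc, hn,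
        action_exchange_assoc, ← reassoc_of% actSwap_naturality_right, hx,
        actionHomRight_comp, Category.assoc])
    refine ⟨g, Balanced.ext fun c ↦ hom_ext_act_tensorι fun x ↦ ?_⟩
    have := hh x c
    rw [← hg] at this
    exact (hφ' x c g).symm.trans this

end DiagramFamily

end CoendDiagrams

section BarFamily

variable {V : Type u₁} [Category.{v} V] [MonoidalCategory V] [SymmetricCategory V]
  [MonoidalClosed V] {C : Type u} [EnrichedCategory V C]
  {M : Type u₂} [Category.{v} M] [EnrichedOrdinaryCategory V M] [Tensored V M]
  (W : EnrichedFunctor V Cᵒᵖ V) (D : EnrichedFunctor V C M)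

lemma Balanced.isUniversal_ofFree (a : C) (X : M) :
    (Balanced.ofFree a (𝟙 (W.obj (op a) ⊙ₗ X))).IsUniversal := by
  have key {E : M} (g : W.obj (op a) ⊙ₗ X ⟶ E) :
      W.obj (op a) ⊴ₗ ((λₗ[V] X).inv ≫ eId V a ⊵ₗ X) ≫
        (Balanced.ofFree a (𝟙 (W.obj (op a) ⊙ₗ X))).app a ≫ g = g := by
    have := act_right_unit (X := X) (eId V a) (weightAct W a a) (𝟙 _) (by simp [weightAct_id])
    rw [Balanced.ofFree_app, Category.comp_id, Category.assoc, reassoc_of% this, id_actionHomLeft,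
      Category.id_comp]
  refine fun E ↦ ⟨fun g g' e ↦ ?_, fun ψ ↦
    ⟨W.obj (op a) ⊴ₗ ((λₗ[V] X).inv ≫ eId V a ⊵ₗ X) ≫ ψ.app a, Balanced.ext fun c ↦ ?_⟩⟩
  · have h := congrArg (fun t : Balanced _ _ _ ↦ t.app a) e
    simp only [Balanced.postcomp_app] at h
    rw [← key g, h, key]
  · rw [Balanced.postcomp_app, Balanced.ofFree_app, Category.comp_id, Category.assoc,
      Balanced.app_eq_ofFree a ψ c]

/-- The action on the weight, as a morphism of bar constructions. -/
def barProj (c : C) (x : (families C).Elements) :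
    W.obj (op c) ⊙ₗ (barDiagram (representable (V := V) c) D).obj x ⟶ (barDiagram W D).obj x :=
  (αₗ _ _ _).inv ≫ weightAct W (lastObj x) c ⊵ₗ chainObj D (seq x) x.1.unop.len

lemma barProj_naturality (c : C) {x y : (families C).Elements} (e : x ⟶ y) :
    barProj W D c x ≫ (barDiagram W D).map e =
      W.obj (op c) ⊴ₗ (barDiagram (representable c) D).map e ≫ barProj W D c y := by
  have h (z : (families C).Elements) : (barDiagram W D).map (appendProj c z) =
    (appendIso W D c z).hom ≫ barProj W D c z := barDiagram_map_appendProj W D c z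
  rw [← cancel_epi (appendIso W D c x).hom, ← reassoc_of% appendIso_hom_naturality, ← h,
    ← Category.assoc, ← h, ← Functor.map_comp, ← Functor.map_comp, appendProj_naturality]

variable (V) in
/-- The bar constructions of the representable weights. -/
def barFamily {J : Type*} [Category* J] (G : J ⥤ (families C).Elements) :
    DiagramFamily V C M J where
  obj c := G ⋙ barDiagram (representable c) D
  act c c' x := (αₗ _ _ _).inv ≫ eCompRev V (lastObj (G.obj x)) c c' ⊵ₗ
    chainObj D (seq (G.obj x)) (G.obj x).1.unop.len
  act_naturality c c' x y e := by
    have h := barProj_naturality (representable (V := V) c') D c (G.map e)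
    rw [barProj, barProj, weightAct_representable, weightAct_representable] at h
    exact h
  act_id c x := by
    have h := diagramAct_id (freeDiagram (V := V) (lastObj (G.obj x))
      (chainObj D (seq (G.obj x)) (G.obj x).1.unop.len)) c
    rw [diagramAct_freeDiagram] at h
    exact h
  act_comp c c' c'' x := by
    have h := diagramAct_comp (freeDiagram (V := V) (lastObj (G.obj x))
      (chainObj D (seq (G.obj x)) (G.obj x).1.unop.len)) c c' c''
    rw [diagramAct_freeDiagram, diagramAct_freeDiagram, diagramAct_freeDiagram] at h
    exact h

/-- The universal balanced families of the bar constructions. -/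
def barBalanced {J : Type*} [Category* J] (G : J ⥤ (families C).Elements) (x : J) :
    Balanced W ((barFamily V D G).eval x) ((G ⋙ barDiagram W D).obj x) :=
  Balanced.ofFree (lastObj (G.obj x)) (𝟙 _)

lemma isUniversal_barBalanced {J : Type*} [Category* J] (G : J ⥤ (families C).Elements) (x : J) :
    (barBalanced W D G x).IsUniversal :=
  Balanced.isUniversal_ofFree W (lastObj (G.obj x)) _

lemma barBalanced_app {J : Type*} [Category* J] (G : J ⥤ (families C).Elements) (x : J) (c : C) :
    (barBalanced W D G x).app c = barProj W D c (G.obj x) :=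
  _ ≫= Category.comp_id _

lemma barBalanced_naturality {J : Type*} [Category* J] (G : J ⥤ (families C).Elements) {x y : J}
    (e : x ⟶ y) : (barBalanced W D G y).precomp ((barFamily V D G).evalMap e) =
      (barBalanced W D G x).postcomp ((G ⋙ barDiagram W D).map e) := by
  refine Balanced.ext fun c ↦ ?_
  refine (_ ≫= barBalanced_app W D G y c).trans (Eq.trans ?_ (barBalanced_app W D G x c =≫ _).symm)
  exact (barProj_naturality W D c (G.map e)).symm

/-- The action on the values of `D`, as a morphism of diagrams. -/
def barActHom {J : Type*} [Category* J] (G : J ⥤ (families C).Elements) (x : J) :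
    DiagramHom ((barFamily V D G).eval x) D where
  app c := barAct D c (G.obj x)
  naturality c c' := by
    rw [DiagramFamily.diagramAct_eval]
    let l := lastObj (G.obj x)
    let A := chainObj D (seq (G.obj x)) (G.obj x).1.unop.len
    let a := chainAct D (seq (G.obj x)) (G.obj x).1.unop.len
    have h : ((αₗ _ _ _).inv ≫ eCompRev V l c c' ⊵ₗ A) ≫ (l ⟶[V] c') ⊴ₗ a ≫ diagramAct D l c' =
        (c ⟶[V] c') ⊴ₗ ((l ⟶[V] c) ⊴ₗ a ≫ diagramAct D l c) ≫ diagramAct D c c' := by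
      rw [Category.assoc, ← action_exchange_assoc, diagramAct_comp, tensor_actionHomRight]
      simp
    exact h

variable [HasLimits M] [HasColimits M] [ModelCategory V] [ModelCategory M] [ModelEnrichedCategory V M]
  {P : SimplexCategoryᵒᵖ ⥤ Type v} (I : SimplexCategory ⥤ V)
  (G : P.Elements ⥤ (families C).Elements)

lemma exists_isUniversal_bar :
    ∃ φ : Balanced W ((barFamily V D G).coendDiagram I)
      (elementsCoend (tensorDiagram I (G ⋙ barDiagram W D))), φ.IsUniversal :=
  DiagramFamily.exists_isUniversal_coend (fun e ↦ barBalanced_naturality W D G e)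
    (fun x ↦ isUniversal_barBalanced W D G x)

end BarFamily

section Augmentation

variable {V : Type u₁} [Category.{v} V] [MonoidalCategory V] [SymmetricCategory V]
  [MonoidalClosed V] [HasLimits V] [HasColimits V] [ModelCategory V] [MonoidalModelCategory V]
  {C : Type v} [EnrichedCategory V C]
  {M : Type u₂} [Category.{v} M] [EnrichedOrdinaryCategory V M] [Tensored V M]
  [HasLimits M] [HasColimits M] [ModelCategory M] [ModelEnrichedCategory V M]
  {P : SimplexCategoryᵒᵖ ⥤ Type v} {I : SimplexCategory ⥤ V}
  (G : P.Elements ⥤ (families C).Elements) (D : EnrichedFunctor V C M)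

/-- The augmentation of the bar constructions as a morphism of diagrams. -/
def augHom (q : I ⟶ (Functor.const SimplexCategory).obj (𝟙_ V)) :
    DiagramHom ((barFamily V D G).coendDiagram I) (tensorLeft (𝟙_ V) D) :=
  DiagramHom.ofJointlyEpi ((barFamily V D G).coendι I) (fun _ _ _ _ _ h ↦ hom_ext_act_tensorι h)
    (fun x ↦ (tensorLeftMapLeft (q.app (dimObj x)) ((barFamily V D G).eval x)).comp
      (tensorLeftMapRight (𝟙_ V) (barActHom D G x)))
    (fun c ↦ (elementsCoendEquiv _ _).symm (augSec G D c q)) (fun x c ↦ by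
      exact (tensorι_comp _ x).trans
        (congrArg (fun s : Sec _ _ ↦ s.app x) (Equiv.apply_symm_apply _ (augSec G D c q))))

end Augmentation

section WeaklyEquivalent

variable {A : Type*} [Category* A] [ModelCategory A]

lemma WeaklyEquivalent.of_hom {X Y : A} (f : X ⟶ Y) (h : WeakEquivalence f) :
    WeaklyEquivalent X Y := .rel _ _ ⟨f, h⟩

lemma WeaklyEquivalent.of_iso {X Y : A} (e : X ≅ Y) : WeaklyEquivalent X Y :=
  .of_hom e.hom inferInstance

lemma WeaklyEquivalent.symm {X Y : A} (h : WeaklyEquivalent X Y) : WeaklyEquivalent Y X :=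
  Relation.EqvGen.symm _ _ h

lemma WeaklyEquivalent.trans {X Y Z : A} (h : WeaklyEquivalent X Y) (h' : WeaklyEquivalent Y Z) :
    WeaklyEquivalent X Z :=
  Relation.EqvGen.trans _ _ _ h h'

end WeaklyEquivalent

lemma isCofibrant_of_isInitial {A : Type*} [Category* A] [ModelCategory A] {O X : A}
    (h : IsInitial O) (i : O ⟶ X) [Cofibration i] : IsCofibrant X := by
  rw [isCofibrant_iff, show initial.to X = (initialIsInitial.uniqueUpToIso h).hom ≫ i from
    initialIsInitial.hom_ext _ _]
  infer_instance

section WeightedColimits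

variable {V : Type u₁} [Category.{v} V] [MonoidalCategory V] [SymmetricCategory V]
  [MonoidalClosed V] {C : Type v} [EnrichedCategory V C]
  {M : Type u₂} [Category.{v} M] [EnrichedOrdinaryCategory V M] [Tensored V M]

lemma WeightedColimit.exists_isUniversal {W : EnrichedFunctor V Cᵒᵖ V} {D : EnrichedFunctor V C M}
    (P : WeightedColimit W D) : ∃ φ : Balanced W D P.pt, φ.IsUniversal := by
  let φ : Balanced W D P.pt :=
    { app c := (hatEquiv _ _ _).symm (P.ι c)
      balanced c c' := by
        rw [Balanced.hat_balanced, Equiv.apply_symm_apply, Equiv.apply_symm_apply]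
        exact P.naturality c c' }
  have key {X : M} (g : P.pt ⟶ X) (c : C) : (eHomEquiv V g ⊗ₘ P.ι c) ≫ eCompRev V (D.obj c) P.pt X =
      (λ_ _).hom ≫ hatEquiv _ _ _ (φ.app c ≫ g) := by
    rw [hatEquiv_comp, Equiv.apply_symm_apply, MonoidalCategory.tensorHom_def', Category.assoc,
      eHomEquiv_whiskerRight_eCompRev]
    simp
  have bal {X : M} (ψ : Balanced W D X) (c c' : C) :
      𝟙_ V ◁ weightAct W c c' ≫ (λ_ _).hom ≫ hatEquiv _ _ _ (ψ.app c) = (α_ _ _ _).inv ≫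
        ((λ_ _).hom ≫ hatEquiv _ _ _ (ψ.app c') ⊗ₘ D.map c c') ≫
          eCompRev V (D.obj c) (D.obj c') X := by
    rw [leftUnitor_naturality_assoc, (Balanced.hat_balanced W D X c c' _ _).1 (ψ.balanced c c')]
    simp [MonoidalCategory.tensorHom_def]
  refine ⟨φ, fun X ↦ ⟨fun g g' e ↦ ?_, fun ψ ↦ ?_⟩⟩
  · apply (eHomEquiv V).injective
    obtain ⟨h, -, hu⟩ := P.existsUnique (X := X) (A := 𝟙_ V)
      (fun c ↦ (λ_ _).hom ≫ hatEquiv _ _ _ ((φ.postcomp g).app c)) (bal _)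
    refine (hu _ fun c ↦ (key g c).symm).trans (hu _ fun c ↦ ?_).symm
    have := congrArg (fun t : Balanced _ _ _ ↦ t.app c) e
    dsimp only at this
    rw [this]
    exact (key g' c).symm
  · obtain ⟨h, hh, -⟩ := P.existsUnique (X := X) (A := 𝟙_ V)
      (fun c ↦ (λ_ _).hom ≫ hatEquiv _ _ _ (ψ.app c)) (bal ψ)
    refine ⟨(eHomEquiv V).symm h, Balanced.ext fun c ↦ ?_⟩
    apply (hatEquiv _ _ _).injective
    rw [← cancel_epi (λ_ _).hom, hh, ← Equiv.apply_symm_apply (eHomEquiv V) h, key]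
    simp

lemma exists_isUniversal [HasColimits M] [HasLimits M] [ModelCategory V] [ModelCategory M]
    [ModelEnrichedCategory V M] (W : EnrichedFunctor V Cᵒᵖ V) (D : EnrichedFunctor V C M) :
    ∃ (p : M) (φ : Balanced W D p), φ.IsUniversal := by
  let F (x : C × C) : M := (W.obj (op x.2) ⊗ (x.1 ⟶[V] x.2)) ⊙ₗ D.obj x.1
  let G (c : C) : M := W.obj (op c) ⊙ₗ D.obj c
  let u : ∐ F ⟶ ∐ G := Sigma.desc fun x ↦ weightAct W x.1 x.2 ⊵ₗ D.obj x.1 ≫ Sigma.ι G x.1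
  let w : ∐ F ⟶ ∐ G := Sigma.desc fun x ↦
    (αₗ _ _ _).hom ≫ W.obj (op x.2) ⊴ₗ diagramAct D x.1 x.2 ≫ Sigma.ι G x.2
  have hu (x : C × C) : Sigma.ι F x ≫ u = _ := Sigma.ι_desc _ _
  have hw (x : C × C) : Sigma.ι F x ≫ w = _ := Sigma.ι_desc _ _
  let φ : Balanced W D (coequalizer u w) :=
    { app c := Sigma.ι G c ≫ coequalizer.π u w
      balanced c c' := by
        have h := Sigma.ι F (c, c') ≫= coequalizer.condition u w
        rw [reassoc_of% hu, reassoc_of% hw] at h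
        exact h }
  refine ⟨_, φ, fun E ↦ ⟨fun g g' e ↦ ?_, fun ψ ↦ ?_⟩⟩
  · refine coequalizer.hom_ext (Sigma.hom_ext _ _ fun c ↦ ?_)
    have := congrArg (fun t : Balanced _ _ _ ↦ t.app c) e
    exact (Category.assoc _ _ _).symm.trans (this.trans (Category.assoc _ _ _))
  · refine ⟨coequalizer.desc (Sigma.desc ψ.app) (Sigma.hom_ext _ _ fun x ↦ ?_),
      Balanced.ext fun c ↦ ?_⟩
    · rw [reassoc_of% hu, reassoc_of% hw, Sigma.ι_desc, Sigma.ι_desc]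
      exact ψ.balanced x.1 x.2
    · refine (Category.assoc _ _ _).trans ?_
      rw [coequalizer.π_desc, Sigma.ι_desc]

variable [HasLimits M] [HasColimits M] [ModelCategory V] [ModelCategory M]
  [ModelEnrichedCategory V M] {W : EnrichedFunctor V Cᵒᵖ V}

lemma weakEquivalence_of_isUniversal (hW : IsProjectivelyCofibrant W)
    {X Y : EnrichedFunctor V C M} (f : DiagramHom X Y)
    (hf : ∀ c, Cofibration (f.app c) ∧ WeakEquivalence (f.app c)) {p q : M} {φ : Balanced W X p}
    (hφ : φ.IsUniversal) {ψ : Balanced W Y q} (hψ : ψ.IsUniversal) {g : p ⟶ q}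
    (hg : ∀ c, φ.app c ≫ g = W.obj (op c) ⊴ₗ f.app c ≫ ψ.app c) : WeakEquivalence g := by
  refine (trivialCofibration_of_hasLiftingProperty g fun E B π hπ ↦ ⟨fun {t b} sq ↦ ?_⟩).2
  obtain ⟨χ, h₁, h₂⟩ := Balanced.exists_lift hW f (fun c ↦ (hf c).1) π hπ (.inl fun c ↦ (hf c).2)
    (φ.postcomp t) (ψ.postcomp b) (Balanced.ext fun c ↦ by
      simp [sq.w, reassoc_of% hg c])
  obtain ⟨l, hl⟩ := hψ.exists_desc χ
  refine ⟨⟨l, hφ.hom_ext fun c ↦ ?_, hψ.hom_ext fun c ↦ ?_⟩⟩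
  · rw [reassoc_of% hg c, hl]
    exact congrArg (fun t : Balanced _ _ _ ↦ t.app c) h₁
  · rw [← Category.assoc, hl]
    exact congrArg (fun t : Balanced _ _ _ ↦ t.app c) h₂

lemma isCofibrant_of_isUniversal (hW : IsProjectivelyCofibrant W) {X : EnrichedFunctor V C M}
    (hX : ∀ c, IsCofibrant (X.obj c)) {p : M} {φ : Balanced W X p} (hφ : φ.IsUniversal) :
    IsCofibrant p := by
  have hi (K : V) : IsInitial (K ⊙ₗ (⊥_ M)) :=
    IsInitial.isInitialObj ((curriedAction V M).obj K) _ initialIsInitial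
  let O : EnrichedFunctor V C M := diagramMk (fun _ ↦ ⊥_ M) (fun c c' ↦ (hi _).to _)
    (fun c ↦ initialIsInitial.hom_ext _ _) (fun c c' c'' ↦ (hi _).hom_ext _ _)
  let f : DiagramHom O X := { app c := initial.to _, naturality c c' := (hi _).hom_ext _ _ }
  rw [isCofibrant_iff]
  refine cofibration_of_hasLiftingProperty _ fun E B π hπ hπ' ↦ ⟨fun {t b} sq ↦ ?_⟩
  obtain ⟨χ, h₁, h₂⟩ := Balanced.exists_lift hW f (fun c ↦ (isCofibrant_iff _).1 (hX c)) π hπ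
    (.inr hπ') ⟨fun c ↦ (hi _).to _, fun c c' ↦ (hi _).hom_ext _ _⟩ (φ.postcomp b)
    (Balanced.ext fun c ↦ (hi _).hom_ext _ _)
  obtain ⟨l, hl⟩ := hφ.exists_desc χ
  refine ⟨⟨l, initialIsInitial.hom_ext _ _, hφ.hom_ext fun c ↦ ?_⟩⟩
  rw [← Category.assoc, hl]
  exact congrArg (fun t : Balanced _ _ _ ↦ t.app c) h₂

variable [HasLimits V] [HasColimits V] [MonoidalModelCategory V]

/-- The pushout of diagrams. -/
lemma exists_pushout_diagram {X Y Z : EnrichedFunctor V C M} (f : DiagramHom X Y)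
    (g : DiagramHom X Z) : ∃ (R : EnrichedFunctor V C M) (i : DiagramHom Y R) (j : DiagramHom Z R),
      ∀ c, IsPushout (f.app c) (g.app c) (i.app c) (j.app c) := by
  have H (c c' : C) := exists_desc_act_pushout (K := (c ⟶[V] c')) (f := f.app c) (g := g.app c)
    (diagramAct Y c c' ≫ pushout.inl (f.app c') (g.app c'))
    (diagramAct Z c c' ≫ pushout.inr (f.app c') (g.app c')) (by
      rw [← reassoc_of% f.naturality, ← reassoc_of% g.naturality, pushout.condition])
  choose a h₁ h₂ using H
  let S : Bool → EnrichedFunctor V C M := fun b ↦ b.rec Y Z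
  let ι (b : Bool) (c : C) : (S b).obj c ⟶ pushout (f.app c) (g.app c) :=
    match b with
    | false => pushout.inl (f.app c) (g.app c)
    | true => pushout.inr (f.app c) (g.app c)
  have hι (K : V) (c : C) {E : M} {u v : K ⊙ₗ pushout (f.app c) (g.app c) ⟶ E}
      (h : ∀ b, K ⊴ₗ ι b c ≫ u = K ⊴ₗ ι b c ≫ v) : u = v :=
    hom_ext_act_pushout (h false) (h true)
  have ha (c c' : C) (b : Bool) : (c ⟶[V] c') ⊴ₗ ι b c ≫ a c c' = diagramAct (S b) c c' ≫ ι b c' :=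
    match b with
    | false => h₁ c c'
    | true => h₂ c c'
  exact ⟨diagramOfJointlyEpi (X := S) (ι := ι) hι a ha,
    diagramOfJointlyEpiι (X := S) (ι := ι) hι a ha false,
    diagramOfJointlyEpiι (X := S) (ι := ι) hι a ha true, fun c ↦ IsPushout.of_hasPushout _ _⟩

end WeightedColimits

section Cylinders

variable {V : Type u₁} [Category.{v} V] [MonoidalCategory V] [SymmetricCategory V]
  [MonoidalClosed V] [HasLimits V] [HasColimits V] [ModelCategory V] [MonoidalModelCategory V]
  {M : Type u₂} [Category.{v} M] [EnrichedOrdinaryCategory V M] [Tensored V M]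
  [HasLimits M] [HasColimits M] [ModelCategory M] [ModelEnrichedCategory V M]

lemma exists_lift_of_cofibration {K L : V} (j : K ⟶ L) [Cofibration j] {X : M}
    (hX : IsCofibrant X) {E B : M} (p : E ⟶ B) [Fibration p]
    (h : WeakEquivalence j ∨ WeakEquivalence p) : HasLiftingProperty (j ⊵ₗ X) p := by
  refine ⟨fun {a b} sq ↦ ?_⟩
  have hi (K : V) : IsInitial (K ⊙ₗ (⊥_ M)) :=
    IsInitial.isInitialObj ((curriedAction V M).obj K) _ initialIsInitial
  have H : ActLift j (initial.to X) p := actLift_of_lift₃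
    (ModelEnrichedCategory.pushoutProduct.lift₃ ⟨inferInstance, (isCofibrant_iff _).1 hX,
      inferInstance, by tauto⟩)
  obtain ⟨l, h₁, -, h₂⟩ := H a ((hi _).to _) b ((hi _).hom_ext _ _) sq.w ((hi _).hom_ext _ _)
  exact ⟨⟨l, h₁, h₂⟩⟩

lemma exists_lift_coprod {A B L : V} (j : A ⨿ B ⟶ L) (X : M) {E Y : M} (p : E ⟶ Y)
    [HasLiftingProperty (j ⊵ₗ X) p] (a : A ⊙ₗ X ⟶ E) (a' : B ⊙ₗ X ⟶ E) (b : L ⊙ₗ X ⟶ Y)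
    (h : a ≫ p = (coprod.inl ≫ j) ⊵ₗ X ≫ b) (h' : a' ≫ p = (coprod.inr ≫ j) ⊵ₗ X ≫ b) :
    ∃ l : L ⊙ₗ X ⟶ E, (coprod.inl ≫ j) ⊵ₗ X ≫ l = a ∧ (coprod.inr ≫ j) ⊵ₗ X ≫ l = a' ∧
      l ≫ p = b := by
  let s : (A ⨿ B) ⊙ₗ X ⟶ E :=
    (hatEquiv _ X E).symm (coprod.desc (hatEquiv _ X E a) (hatEquiv _ X E a'))
  have hs : coprod.inl ⊵ₗ X ≫ s = a := by
    rw [← hatEquiv_symm_mapLeft, coprod.inl_desc, Equiv.symm_apply_apply]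
  have hs' : coprod.inr ⊵ₗ X ≫ s = a' := by
    rw [← hatEquiv_symm_mapLeft, coprod.inr_desc, Equiv.symm_apply_apply]
  have sq : CommSq s (j ⊵ₗ X) p b := ⟨by
    apply (hatEquiv _ _ _).injective
    apply coprod.hom_ext
    · rw [← hatEquiv_mapLeft, ← hatEquiv_mapLeft, reassoc_of% hs, h, comp_actionHomLeft_assoc]
    · rw [← hatEquiv_mapLeft, ← hatEquiv_mapLeft, reassoc_of% hs', h', comp_actionHomLeft_assoc]⟩
  refine ⟨sq.lift, ?_, ?_, sq.fac_right⟩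
  · rw [comp_actionHomLeft_assoc, sq.fac_left, hs]
  · rw [comp_actionHomLeft_assoc, sq.fac_left, hs']

lemma cofibration_actionHomLeft {K L : V} (j : K ⟶ L) [Cofibration j] {X : M}
    (hX : IsCofibrant X) : Cofibration (j ⊵ₗ X) :=
  cofibration_of_hasLiftingProperty _ fun _ _ p _ h ↦ exists_lift_of_cofibration j hX p (.inr h)

lemma weakEquivalence_actionHomLeft {K L : V} (j : K ⟶ L) [Cofibration j] (w : WeakEquivalence j)
    {X : M} (hX : IsCofibrant X) : WeakEquivalence (j ⊵ₗ X) :=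
  (trivialCofibration_of_hasLiftingProperty _ fun _ _ p _ ↦
    exists_lift_of_cofibration j hX p (.inl w)).2

lemma isCofibrant_tensor {K : V} (hK : IsCofibrant K) {X : M} (hX : IsCofibrant X) :
    IsCofibrant (K ⊙ₗ X) := by
  have : Cofibration (initial.to K) := (isCofibrant_iff _).1 hK
  have hc : Cofibration (initial.to K ⊵ₗ X) := cofibration_actionHomLeft (initial.to K) hX
  have hi : IsInitial ((⊥_ V) ⊙ₗ X) := IsInitial.isInitialObj ((curriedAction V M).flip.obj X) _
    initialIsInitial
  exact isCofibrant_of_isInitial hi (initial.to K ⊵ₗ X)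

lemma weakEquivalence_tensor_iff {Q : V} (hQ : IsCofibrant Q) (q : Q ⟶ 𝟙_ V)
    (hq : WeakEquivalence q) {X Y : M} (hX : IsCofibrant X) (hY : IsCofibrant Y) (f : X ⟶ Y) :
    WeakEquivalence (Q ⊴ₗ f) ↔ WeakEquivalence f := by
  have hx := ModelEnrichedCategory.unit q X hQ hq hX
  have hy := ModelEnrichedCategory.unit q Y hQ hq hY
  have e : Q ⊴ₗ f ≫ q ⊵ₗ Y ≫ (λₗ[V] Y).hom = q ⊵ₗ X ≫ (λₗ[V] X).hom ≫ f := by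
    rw [actionUnitIso_hom_naturality, action_exchange_assoc]
  rw [← weakEquivalence_postcomp_iff _ (q ⊵ₗ Y ≫ (λₗ[V] Y).hom), e,
    weakEquivalence_precomp_iff, weakEquivalence_precomp_iff]

variable {C : Type v} [EnrichedCategory V C] {W : EnrichedFunctor V Cᵒᵖ V}

lemma exists_diagram_cospan {X Y : EnrichedFunctor V C M} (hX : ∀ c, IsCofibrant (X.obj c))
    (hY : ∀ c, IsCofibrant (Y.obj c)) (f : DiagramHom X Y) (hf : ∀ c, WeakEquivalence (f.app c)) :
    ∃ (Q : V) (_ : IsCofibrant Q) (q : Q ⟶ 𝟙_ V) (_ : WeakEquivalence q)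
      (Z : EnrichedFunctor V C M) (i : DiagramHom (tensorLeft Q X) Z)
      (j : DiagramHom (tensorLeft Q Y) Z),
      (∀ c, Cofibration (i.app c) ∧ WeakEquivalence (i.app c)) ∧
        ∀ c, Cofibration (j.app c) ∧ WeakEquivalence (j.app c) := by
  let fac := MorphismProperty.factorizationData (cofibrations V) (trivialFibrations V)
    (initial.to (𝟙_ V))
  have hQ : IsCofibrant fac.Z := (isCofibrant_iff _).2 (by
    rw [show initial.to fac.Z = fac.i from initialIsInitial.hom_ext _ _]
    exact ⟨fac.hi⟩)
  have hq : WeakEquivalence fac.p := ((mem_trivialFibrations_iff _).1 fac.hp).2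
  obtain ⟨Cyl, hCyl⟩ := Cylinder.exists_very_good fac.Z
  obtain ⟨Z, i, j, hZ⟩ := exists_pushout_diagram (tensorLeftMapLeft Cyl.i₁ X)
    (tensorLeftMapRight fac.Z f)
  have hj (c : C) : Cofibration (j.app c) ∧ WeakEquivalence (j.app c) := by
    rw [← mem_trivialCofibrations_iff]
    have : Cofibration (Cyl.i₁ ⊵ₗ X.obj c) := cofibration_actionHomLeft _ (hX c)
    have : WeakEquivalence (Cyl.i₁ ⊵ₗ X.obj c) :=
      weakEquivalence_actionHomLeft Cyl.i₁ inferInstance (hX c)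
    exact MorphismProperty.of_isPushout (hZ c).flip (mem_trivialCofibrations (Cyl.i₁ ⊵ₗ X.obj c))
  refine ⟨fac.Z, hQ, fac.p, hq, Z, (tensorLeftMapLeft Cyl.i₀ X).comp i, j, fun c ↦ ⟨?_, ?_⟩, hj⟩
  · refine cofibration_of_hasLiftingProperty _ fun E B p hp hp' ↦ ⟨fun {a b} sq ↦ ?_⟩
    obtain ⟨l₁, hl₁⟩ : ∃ l : fac.Z ⊙ₗ Y.obj c ⟶ E, l ≫ p = j.app c ≫ b := by
      have : Cofibration (initial.to (fac.Z ⊙ₗ Y.obj c)) :=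
        (isCofibrant_iff _).1 (isCofibrant_tensor hQ (hY c))
      have sq' : CommSq (initial.to E) (initial.to (fac.Z ⊙ₗ Y.obj c)) p (j.app c ≫ b) :=
        ⟨initialIsInitial.hom_ext _ _⟩
      exact ⟨sq'.lift, sq'.fac_right⟩
    have := exists_lift_of_cofibration Cyl.i (hX c) p (.inr hp')
    have ha : a ≫ p = Cyl.i₀ ⊵ₗ X.obj c ≫ i.app c ≫ b := sq.w.trans (Category.assoc _ _ _)
    have hw : Cyl.i₁ ⊵ₗ X.obj c ≫ i.app c = fac.Z ⊴ₗ f.app c ≫ j.app c := (hZ c).w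
    obtain ⟨l₂, hl₂, hl₃, hl₄⟩ := exists_lift_coprod Cyl.i (X.obj c) p a
      (fac.Z ⊴ₗ f.app c ≫ l₁) (i.app c ≫ b) (by rw [ha, Precylinder.inl_i])
      (by rw [Category.assoc, hl₁, Precylinder.inr_i, reassoc_of% hw])
    rw [Precylinder.inl_i] at hl₂
    rw [Precylinder.inr_i] at hl₃
    refine ⟨⟨(hZ c).desc l₂ l₁ hl₃, ?_, (hZ c).hom_ext ?_ ?_⟩⟩
    · exact (Category.assoc _ _ _).trans ((_ ≫= (hZ c).inl_desc _ _ _).trans hl₂)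
    · exact ((hZ c).inl_desc_assoc _ _ _ _).trans hl₄
    · exact ((hZ c).inr_desc_assoc _ _ _ _).trans hl₁
  · obtain ⟨r, hr₁, hr₂⟩ : ∃ r : Z.obj c ⟶ fac.Z ⊙ₗ Y.obj c,
        i.app c ≫ r = Cyl.π ⊵ₗ X.obj c ≫ fac.Z ⊴ₗ f.app c ∧ j.app c ≫ r = 𝟙 _ := by
      refine ⟨(hZ c).desc _ _ ?_, (hZ c).inl_desc _ _ _, (hZ c).inr_desc _ _ _⟩
      have h : Cyl.i₁ ⊵ₗ X.obj c ≫ Cyl.π ⊵ₗ X.obj c = 𝟙 _ := by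
        rw [← comp_actionHomLeft, Precylinder.i₁_π, id_actionHomLeft]
      have h' := reassoc_of% h
      refine (h' _).trans ?_
      exact (Category.comp_id _).symm
    have h₁ : WeakEquivalence r := by
      have := (hj c).2
      rw [← weakEquivalence_precomp_iff (j.app c), hr₂]
      infer_instance
    have h₂ : ((tensorLeftMapLeft Cyl.i₀ X).comp i).app c ≫ r = fac.Z ⊴ₗ f.app c := by
      have h : Cyl.i₀ ⊵ₗ X.obj c ≫ Cyl.π ⊵ₗ X.obj c = 𝟙 _ := by
        rw [← comp_actionHomLeft, Precylinder.i₀_π, id_actionHomLeft]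
      refine (Category.assoc _ _ _).trans ((_ ≫= hr₁).trans ?_)
      have h' := reassoc_of% h
      exact h' _
    rw [← weakEquivalence_postcomp_iff _ r, h₂]
    exact (weakEquivalence_tensor_iff hQ fac.p hq (hX c) (hY c) (f.app c)).2 (hf c)

lemma weaklyEquivalent_of_diagramHom (hW : IsProjectivelyCofibrant W) {X Y : EnrichedFunctor V C M}
    (hX : ∀ c, IsCofibrant (X.obj c)) (hY : ∀ c, IsCofibrant (Y.obj c)) (f : DiagramHom X Y)
    (hf : ∀ c, WeakEquivalence (f.app c)) {p p' : M} {φ : Balanced W X p} (hφ : φ.IsUniversal)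
    {ψ : Balanced W Y p'} (hψ : ψ.IsUniversal) : WeaklyEquivalent p p' := by
  obtain ⟨Q, hQ, q, hq, Z, i, j, hi, hj⟩ := exists_diagram_cospan hX hY f hf
  obtain ⟨r, χ, hχ⟩ := exists_isUniversal W Z
  have H {A : EnrichedFunctor V C M} (hA : ∀ c, IsCofibrant (A.obj c)) {a : M} {α : Balanced W A a}
      (hα : α.IsUniversal) (k : DiagramHom (tensorLeft Q A) Z)
      (hk : ∀ c, Cofibration (k.app c) ∧ WeakEquivalence (k.app c)) : WeaklyEquivalent a r := by
    obtain ⟨g, hg⟩ := (hα.tensorLeft Q).exists_desc (χ.precomp k)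
    have h₁ := weakEquivalence_of_isUniversal hW k hk (hα.tensorLeft Q) hχ hg
    have h₂ := ModelEnrichedCategory.unit q a hQ hq (isCofibrant_of_isUniversal hW hA hα)
    have h₃ : WeakEquivalence (q ⊵ₗ a ≫ (λₗ[V] a).hom) := inferInstance
    exact (WeaklyEquivalent.of_hom _ h₃).symm.trans (.of_hom g h₁)
  exact (H hX hφ i hi).trans (H hY hψ j hj).symm

end Cylinders

section InitialCosimplicial

open Simplicial SSet

variable {M : Type u₂} [Category.{v} M] [HasColimits M] [ModelCategory M]

lemma IsCofibrantCosimplicial.isRelativeCofibration {A O : SimplexCategory ⥤ M}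
    (hA : IsCofibrantCosimplicial A) (hO : ∀ n, IsInitial (O.obj n)) (j : O ⟶ A) :
    IsRelativeCofibration j := by
  refine fun E B p hp hp' ↦ rlp_singLeibniz_π fun n a b c e₁ e₂ e₃ ↦ ?_
  have := hA p hp hp' _ (modelCategoryQuillen.boundary_ι_mem_I n)
  have sq : CommSq a (boundary n).ι (singPostcomp A p) c := ⟨e₃⟩
  refine ⟨sq.lift, sq.fac_left, ?_, sq.fac_right⟩
  ext k x
  exact (hO _).hom_ext _ _

lemma IsCofibrantCosimplicial.isCofibrant_zero {A : SimplexCategory ⥤ M}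
    (hA : IsCofibrantCosimplicial A) : IsCofibrant (A.obj ⦋0⦌) := by
  rw [isCofibrant_iff]
  refine cofibration_of_hasLiftingProperty _ fun E B p hp hp' ↦ ⟨fun {a b} sq ↦ ?_⟩
  have := hA p hp hp' _ (modelCategoryQuillen.boundary_ι_mem_I 0)
  have he (Y : SSet.{v}) (f g : (∂Δ[0] : SSet.{v}) ⟶ Y) : f = g :=
    boundary_hom_ext fun k _ hk ↦ absurd hk (Nat.not_lt_zero _)
  let c : Δ[0] ⟶ singObj A B := SSet.yonedaEquiv.symm (show (singObj A B).obj (op ⦋0⦌) from b)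
  let i : (∂Δ[0] : SSet.{v}) ⟶ singObj A E :=
    (Subcomplex.isInitialBot.ofIso (eqToIso (by rw [boundary_zero]))).to _
  have sq' : CommSq i (boundary 0).ι (singPostcomp A p) c := ⟨he _ _ _⟩
  refine ⟨⟨SSet.yonedaEquiv sq'.lift, initialIsInitial.hom_ext _ _, ?_⟩⟩
  have h := congrArg SSet.yonedaEquiv sq'.fac_right
  rw [SSet.yonedaEquiv_comp, Equiv.apply_symm_apply] at h
  exact h

lemma weakEquivalence_map_of_aug {A : SimplexCategory ⥤ M} {X : M}
    (q : A ⟶ (Functor.const SimplexCategory).obj X) (hq : ∀ n, WeakEquivalence (q.app n))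
    ⦃m n : SimplexCategory⦄ (φ : m ⟶ n) : WeakEquivalence (A.map φ) := by
  have h : A.map φ ≫ q.app n = q.app m := (q.naturality φ).trans (Category.comp_id _)
  have := hq n
  rw [← weakEquivalence_postcomp_iff _ (q.app n), h]
  exact hq m

end InitialCosimplicial

section Cofibrancy

variable {V : Type u₁} [Category.{v} V] [MonoidalCategory V] [SymmetricCategory V]
  [MonoidalClosed V] [HasLimits V] [HasColimits V] [ModelCategory V] [MonoidalModelCategory V]
  {C : Type v} [EnrichedCategory V C]
  {M : Type u₂} [Category.{v} M] [EnrichedOrdinaryCategory V M] [Tensored V M]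
  [HasLimits M] [HasColimits M] [ModelCategory M] [ModelEnrichedCategory V M]

lemma isCofibrant_of_cofibration_tensor {K : V} {X : M} (h : Cofibration (K ⊴ₗ initial.to X)) :
    IsCofibrant (K ⊙ₗ X) := by
  have hi : IsInitial (K ⊙ₗ (⊥_ M)) :=
    IsInitial.isInitialObj ((curriedAction V M).obj K) _ initialIsInitial
  exact isCofibrant_of_isInitial hi (K ⊴ₗ initial.to X)

lemma isCofibrant_of_isFlat {K : V} (hK : IsFlat (tensorBifunctor V M) K) {X : M}
    (hX : IsCofibrant X) : IsCofibrant (K ⊙ₗ X) :=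
  isCofibrant_of_cofibration_tensor (hK _ ((isCofibrant_iff _).1 hX)).1

variable (hC : LocallyFlat C (tensorBifunctor V M)) {D : EnrichedFunctor V C M}
  (hD : ∀ c, IsCofibrant (D.obj c))

include hC hD

lemma isCofibrant_chainObj (c : ℕ → C) (n : ℕ) : IsCofibrant (chainObj D c n) := by
  induction n with
  | zero => exact hD _
  | succ n ih => exact isCofibrant_of_isFlat (hC _ _) ih

lemma isCofibrant_barDiagram_representable (b : C) (x : (families C).Elements) :
    IsCofibrant ((barDiagram (representable (V := V) b) D).obj x) :=
  isCofibrant_of_isFlat (hC _ _) (isCofibrant_chainObj hC hD _ _)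

lemma isCofibrant_barDiagram {W : EnrichedFunctor V Cᵒᵖ V} (hW : IsProjectivelyCofibrant W)
    (x : (families C).Elements) : IsCofibrant ((barDiagram W D).obj x) := by
  have := (isCofibrant_iff _).1 (isCofibrant_chainObj hC hD
    (extend (n := x.1.unop.len) x.2) x.1.unop.len)
  exact isCofibrant_of_cofibration_tensor (cofibration_weight_tensor hW hC _ (initial.to _))

end Cofibrancy

section Comparison

variable {V : Type u₁} [Category.{v} V] [MonoidalCategory V] [SymmetricCategory V]
  [MonoidalClosed V] [HasLimits V] [HasColimits V] [ModelCategory V] [MonoidalModelCategory V]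
  {C : Type v} [EnrichedCategory V C]
  {M : Type u₂} [Category.{v} M] [EnrichedOrdinaryCategory V M] [Tensored V M]
  [HasLimits M] [HasColimits M] [ModelCategory M] [ModelEnrichedCategory V M]
  {P : SimplexCategoryᵒᵖ ⥤ Type v}

lemma isCofibrant_elementsCoend {I : SimplexCategory ⥤ V} (hI : IsCofibrantCosimplicial I)
    {T : P.Elements ⥤ M} (hT : ∀ {I I' : SimplexCategory ⥤ V} {j : I ⟶ I'} {E B : M} {p : E ⟶ B},
      RelativeAdmissible j p → SecLift (tensorDiagramMap j T) p) :
    IsCofibrant (elementsCoend (tensorDiagram I T)) := by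
  let O : SimplexCategory ⥤ V := (Functor.const _).obj (⊥_ V)
  let j : O ⟶ I := { app n := initial.to _, naturality _ _ _ := initialIsInitial.hom_ext _ _ }
  have hi (X : M) : IsInitial ((⊥_ V) ⊙ₗ X) :=
    IsInitial.isInitialObj ((curriedAction V M).flip.obj X) _ initialIsInitial
  rw [isCofibrant_iff]
  refine cofibration_of_hasLiftingProperty _ fun E B p hp hp' ↦ ⟨fun {a b} sq ↦ ?_⟩
  obtain ⟨χ, -, hχ⟩ := hT (j := j) ⟨hp, .inr ⟨hI.isRelativeCofibration (fun _ ↦ initialIsInitial) j,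
    hp'⟩⟩ ⟨fun x ↦ (hi _).to E, fun _ ↦ (hi _).hom_ext _ _⟩ (elementsCoendEquiv _ _ b)
    (Sec.ext (funext fun x ↦ (hi _).hom_ext _ _))
  refine ⟨⟨(elementsCoendEquiv _ _).symm χ, initialIsInitial.hom_ext _ _,
    (elementsCoendEquiv _ _).injective ?_⟩⟩
  rw [elementsCoendEquiv_comp, Equiv.apply_symm_apply, hχ]

lemma isCofibrant_tensorUnit {X : M} (hX : IsCofibrant X) : IsCofibrant (𝟙_ V ⊙ₗ X) := by
  have := (isCofibrant_iff _).1 hX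
  exact isCofibrant_of_isInitial initialIsInitial (initial.to X ≫ (λₗ[V] X).inv)

lemma weaklyEquivalent_elementsCoend {I : SimplexCategory ⥤ V} (hI : IsCofibrantCosimplicial I)
    (q : I ⟶ (Functor.const SimplexCategory).obj (𝟙_ V)) {W : EnrichedFunctor V Cᵒᵖ V}
    (hW : IsProjectivelyCofibrant W) {D : EnrichedFunctor V C M} (hD : ∀ c, IsCofibrant (D.obj c))
    (G : P.Elements ⥤ (families C).Elements)
    (hT : ∀ (c : C) {I I' : SimplexCategory ⥤ V} {j : I ⟶ I'} {E B : M} {p : E ⟶ B},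
      RelativeAdmissible j p →
        SecLift (tensorDiagramMap j (G ⋙ barDiagram (representable (V := V) c) D)) p)
    (hw : ∀ c, WeakEquivalence ((elementsCoendEquiv _ _).symm (augSec G D c q)))
    (U : WeightedColimit W D) :
    WeaklyEquivalent U.pt (elementsCoend (tensorDiagram I (G ⋙ barDiagram W D))) := by
  obtain ⟨φ, hφ⟩ := exists_isUniversal_bar W D I G
  obtain ⟨ψ, hψ⟩ := U.exists_isUniversal
  have h := weaklyEquivalent_of_diagramHom hW (X := (barFamily V D G).coendDiagram I)
    (fun c ↦ isCofibrant_elementsCoend hI (hT c)) (fun c ↦ isCofibrant_tensorUnit (V := V) (hD c))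
    (augHom G D q) hw hφ (hψ.tensorLeft (𝟙_ V))
  exact ((h.trans (.of_iso (λₗ[V] U.pt)))).symm

lemma weaklyEquivalent_elementsCoend_families (hC : LocallyPointedFlat C (tensorBifunctor V M))
    {I : SimplexCategory ⥤ V} (hI : IsCofibrantCosimplicial I)
    (q : I ⟶ (Functor.const SimplexCategory).obj (𝟙_ V)) (hq : ∀ n, WeakEquivalence (q.app n))
    {W : EnrichedFunctor V Cᵒᵖ V} (hW : IsProjectivelyCofibrant W) {D : EnrichedFunctor V C M}
    (hD : ∀ c, IsCofibrant (D.obj c)) (U : WeightedColimit W D) :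
    WeaklyEquivalent U.pt (elementsCoend (tensorDiagram I (𝟭 _ ⋙ barDiagram W D))) := by
  have hT (c : C) {I I' : SimplexCategory ⥤ V} {j : I ⟶ I'} {E B : M} {p : E ⟶ B}
      (h : RelativeAdmissible j p) :
      SecLift (tensorDiagramMap j (𝟭 _ ⋙ barDiagram (representable (V := V) c) D)) p :=
    secLift_bar hC D hD c h
  refine weaklyEquivalent_elementsCoend hI q hW hD (𝟭 _) hT (fun c ↦ ?_) U
  exact weakEquivalence_augmentation hI.isCofibrant_zero (hD c) q (hq _)
    (weakEquivalence_families_contraction rfl fun k E B p hp ↦ hT c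
      ⟨hp, .inl (hI.isRelativeTrivialCofibration_cylinderEnd (weakEquivalence_map_of_aug q hq) k)⟩)

lemma weaklyEquivalent_elementsCoend_nerve (hC : LocallyFlat C (tensorBifunctor V M))
    {I : SimplexCategory ⥤ V} (hI : IsCofibrantCosimplicial I)
    (q : I ⟶ (Functor.const SimplexCategory).obj (𝟙_ V)) (hq : ∀ n, WeakEquivalence (q.app n))
    {W : EnrichedFunctor V Cᵒᵖ V} (hW : IsProjectivelyCofibrant W) {D : EnrichedFunctor V C M}
    (hD : ∀ c, IsCofibrant (D.obj c)) (U : WeightedColimit W D) :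
    WeaklyEquivalent U.pt (elementsCoend
      (tensorDiagram I (firstVertex (families C).Elements ⋙ barDiagram W D))) := by
  have hT (c : C) {I I' : SimplexCategory ⥤ V} {j : I ⟶ I'} {E B : M} {p : E ⟶ B}
      (h : RelativeAdmissible j p) : SecLift (tensorDiagramMap j
        (firstVertex (families C).Elements ⋙ barDiagram (representable (V := V) c) D)) p :=
    secLift_firstVertex _ (isCofibrant_barDiagram_representable hC hD c) h
  refine weaklyEquivalent_elementsCoend hI q hW hD (firstVertex _) hT (fun c ↦ ?_) U
  exact weakEquivalence_augmentation hI.isCofibrant_zero (hD c) q (hq _)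
    (weakEquivalence_nerve_contraction rfl fun k E B p hp ↦ hT c
      ⟨hp, .inl (hI.isRelativeTrivialCofibration_cylinderEnd (weakEquivalence_map_of_aug q hq) k)⟩)

end Comparison

section CellAttachment

universe t w

variable {J : Type t} [Category.{w} J] {A : Type u₂} [Category.{v} A]

/-- The result of attaching morphisms `i l : X l ⟶ K l` freely to a diagram `X`. -/
structure CellAttachment (X : J ⥤ A) {K : J → A} (i : ∀ l, X.obj l ⟶ K l) where
  /-- the new diagram -/
  obj : J ⥤ A
  /-- the inclusion of the old diagram -/
  incl : X ⟶ obj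
  /-- the attached cells -/
  cell (l : J) : K l ⟶ obj.obj l
  comp_cell (l : J) : i l ≫ cell l = incl.app l
  exists_desc {k : J} {Z : A} (f : X.obj k ⟶ Z) (s : ∀ l, (l ⟶ k) → (K l ⟶ Z))
    (h : ∀ l g, i l ≫ s l g = X.map g ≫ f) :
    ∃ t : obj.obj k ⟶ Z, incl.app k ≫ t = f ∧ ∀ l g, cell l ≫ obj.map g ≫ t = s l g
  hom_ext {k : J} {Z : A} {t t' : obj.obj k ⟶ Z} (h : incl.app k ≫ t = incl.app k ≫ t')
    (h' : ∀ l (g : l ⟶ k), cell l ≫ obj.map g ≫ t = cell l ≫ obj.map g ≫ t') : t = t'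

lemma exists_cellAttachment [HasCoproducts.{max t w} A] [HasPushouts A] (X : J ⥤ A) {K : J → A}
    (i : ∀ l, X.obj l ⟶ K l) : Nonempty (CellAttachment X i) := by
  let S (k : J) := Σ l : J, (l ⟶ k)
  let a (k : J) : (∐ fun x : S k ↦ X.obj x.1) ⟶ X.obj k := Sigma.desc fun x ↦ X.map x.2
  let b (k : J) : (∐ fun x : S k ↦ X.obj x.1) ⟶ ∐ fun x : S k ↦ K x.1 :=
    Limits.Sigma.map fun x ↦ i x.1
  let R (k : J) : A := pushout (a k) (b k)
  let c {k l : J} (g : l ⟶ k) : K l ⟶ R k :=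
    Sigma.ι (fun x : S k ↦ K x.1) ⟨l, g⟩ ≫ pushout.inr (a k) (b k)
  have hc {k l : J} (g : l ⟶ k) : i l ≫ c g = X.map g ≫ pushout.inl (a k) (b k) := by
    have h := Sigma.ι (fun x : S k ↦ X.obj x.1) ⟨l, g⟩ ≫= pushout.condition (f := a k) (g := b k)
    rw [Sigma.ι_desc_assoc, Sigma.ι_map_assoc] at h
    exact h.symm
  have hext {k : J} {Z : A} {t t' : R k ⟶ Z}
      (h : pushout.inl (a k) (b k) ≫ t = pushout.inl (a k) (b k) ≫ t')
      (h' : ∀ l (g : l ⟶ k), c g ≫ t = c g ≫ t') : t = t' := by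
    refine pushout.hom_ext h (Sigma.hom_ext _ _ fun x ↦ ?_)
    exact (Category.assoc _ _ _).symm.trans ((h' x.1 x.2).trans (Category.assoc _ _ _))
  have hdesc {k : J} {Z : A} (f : X.obj k ⟶ Z) (s : ∀ l, (l ⟶ k) → (K l ⟶ Z))
      (h : ∀ l g, i l ≫ s l g = X.map g ≫ f) :
      ∃ t : R k ⟶ Z, pushout.inl (a k) (b k) ≫ t = f ∧ ∀ l g, c g ≫ t = s l g := by
    refine ⟨pushout.desc f (Sigma.desc fun x ↦ s x.1 x.2) (Sigma.hom_ext _ _ fun x ↦ ?_),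
      pushout.inl_desc _ _ _, fun l g ↦ ?_⟩
    · rw [Sigma.ι_desc_assoc, Sigma.ι_map_assoc, Sigma.ι_desc, h]
    · refine (Category.assoc _ _ _).trans ?_
      rw [pushout.inr_desc, Sigma.ι_desc]
  have hm {k k' : J} (h : k ⟶ k') := hdesc (X.map h ≫ pushout.inl (a k') (b k'))
    (fun l g ↦ c (g ≫ h)) (fun l g ↦ by rw [hc, X.map_comp, Category.assoc])
  choose m hm₁ hm₂ using @hm
  let O : J ⥤ A :=
    { obj := R
      map := m
      map_id k := hext (by
        rw [hm₁, X.map_id, Category.id_comp]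
        exact (Category.comp_id _).symm) fun l g ↦ by
        rw [hm₂, Category.comp_id, Category.comp_id]
      map_comp {k k' k''} h h' := hext
        (by rw [hm₁, reassoc_of% hm₁, hm₁, X.map_comp, Category.assoc]) fun l g ↦ by
          rw [hm₂, reassoc_of% hm₂, hm₂, Category.assoc] }
  have hO {k l : J} (g : l ⟶ k) : c (𝟙 l) ≫ O.map g = c g := by
    refine (hm₂ g l (𝟙 l)).trans ?_
    rw [Category.id_comp]
  exact ⟨{
    obj := O
    incl := { app k := pushout.inl (a k) (b k), naturality k k' h := (hm₁ h).symm }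
    cell l := c (𝟙 l)
    comp_cell l := (hc _).trans (by rw [X.map_id, Category.id_comp])
    exists_desc f s h := by
      obtain ⟨t, h₁, h₂⟩ := hdesc f s h
      exact ⟨t, h₁, fun l g ↦ (Category.assoc _ _ _).symm.trans ((hO g =≫ t).trans (h₂ l g))⟩
    hom_ext h h' := hext h fun l g ↦ (hO g =≫ _).symm.trans ((Category.assoc _ _ _).trans
      ((h' l g).trans ((Category.assoc _ _ _).symm.trans (hO g =≫ _)))) }⟩

namespace CellAttachment

variable {X : J ⥤ A} {K : J → A} {i : ∀ l, X.obj l ⟶ K l} (Y : CellAttachment X i)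

lemma exists_natTrans {Z : J ⥤ A} (f : X ⟶ Z) (s : ∀ l, K l ⟶ Z.obj l)
    (h : ∀ l, i l ≫ s l = f.app l) :
    ∃ t : Y.obj ⟶ Z, Y.incl ≫ t = f ∧ ∀ l, Y.cell l ≫ t.app l = s l := by
  have H (k : J) := Y.exists_desc (f.app k) (fun l g ↦ s l ≫ Z.map g)
    (fun l g ↦ by rw [reassoc_of% h, f.naturality])
  choose t h₁ h₂ using H
  refine ⟨{ app := t, naturality := fun k k' g ↦ Y.hom_ext ?_ fun l g' ↦ ?_ }, ?_, fun l ↦ ?_⟩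
  · rw [← Y.incl.naturality_assoc, h₁, reassoc_of% h₁, f.naturality]
  · have h' := h₂ k' l (g' ≫ g)
    have h'' := h₂ k l g' =≫ Z.map g
    simp only [Functor.map_comp, Category.assoc] at h' h''
    rw [h', h'']
  · ext k
    exact h₁ k
  · have h' := h₂ l l (𝟙 l)
    rwa [Y.obj.map_id, Z.map_id, Category.id_comp, Category.comp_id] at h'

variable [ModelCategory A] (hi : ∀ l, Cofibration (i l))

include hi

lemma hasLiftingProperty_incl {G H : J ⥤ A} (p : G ⟶ H)
    (hp : ∀ l, Fibration (p.app l) ∧ WeakEquivalence (p.app l)) : HasLiftingProperty Y.incl p := by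
  refine ⟨fun {f b} sq ↦ ?_⟩
  have hs (l : J) : ∃ s : K l ⟶ G.obj l, i l ≫ s = f.app l ∧ s ≫ p.app l = Y.cell l ≫ b.app l := by
    have := hi l
    have := (hp l).1
    have := (hp l).2
    have sq' : CommSq (f.app l) (i l) (p.app l) (Y.cell l ≫ b.app l) := ⟨by
      rw [reassoc_of% Y.comp_cell, ← NatTrans.comp_app, ← NatTrans.comp_app, sq.w]⟩
    exact ⟨sq'.lift, sq'.fac_left, sq'.fac_right⟩
  choose s hs₁ hs₂ using hs
  obtain ⟨t, ht, ht'⟩ := Y.exists_natTrans f s hs₁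
  refine ⟨⟨t, ht, ?_⟩⟩
  ext k
  refine Y.hom_ext ?_ fun l g ↦ ?_
  · rw [← NatTrans.comp_app, ← NatTrans.comp_app, reassoc_of% ht, sq.w]
  · have h : Y.cell l ≫ (t ≫ p).app l = Y.cell l ≫ b.app l := by
      rw [NatTrans.comp_app, reassoc_of% ht', hs₂]
    rw [(t ≫ p).naturality, b.naturality, reassoc_of% h]

lemma cofibration_cell (l : J) : Cofibration (Y.cell l) := by
  classical
  refine cofibration_of_hasLiftingProperty _ fun E B p hp hp' ↦ ⟨fun {a b} sq ↦ ?_⟩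
  have hs (x : Σ k, (k ⟶ l)) : ∃ s : K x.1 ⟶ E, i x.1 ≫ s = X.map x.2 ≫ i l ≫ a ∧
      s ≫ p = Y.cell x.1 ≫ Y.obj.map x.2 ≫ b ∧
        ∀ h : x = ⟨l, 𝟙 l⟩, s = eqToHom (by rw [h]) ≫ a := by
    by_cases h : x = ⟨l, 𝟙 l⟩
    · subst h
      exact ⟨a, by simp, by simp [sq.w], fun _ ↦ by simp⟩
    · have := hi x.1
      have sq' : CommSq (X.map x.2 ≫ i l ≫ a) (i x.1) p (Y.cell x.1 ≫ Y.obj.map x.2 ≫ b) := ⟨by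
        rw [Category.assoc, Category.assoc, sq.w, reassoc_of% Y.comp_cell, reassoc_of% Y.comp_cell,
          Y.incl.naturality_assoc]⟩
      exact ⟨sq'.lift, sq'.fac_left, sq'.fac_right, fun h' ↦ (h h').elim⟩
  choose s hs₁ hs₂ hs₃ using hs
  obtain ⟨t, ht, ht'⟩ := Y.exists_desc (i l ≫ a) (fun k g ↦ s ⟨k, g⟩) fun k g ↦ hs₁ ⟨k, g⟩
  refine ⟨⟨t, ?_, Y.hom_ext ?_ fun k g ↦ ?_⟩⟩
  · have h := ht' l (𝟙 l)
    rw [hs₃ ⟨l, 𝟙 l⟩ rfl] at h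
    simpa using h
  · rw [reassoc_of% ht, sq.w, reassoc_of% Y.comp_cell]
  · rw [reassoc_of% ht', hs₂]

end CellAttachment

end CellAttachment

section Sequences

universe t w

variable {J : Type t} [Category.{w} J] {A : Type u₂} [Category.{v} A] [HasColimitsOfShape ℕ A]

lemma exists_sequential_colimit (X : ℕ → J ⥤ A) (f : ∀ n, X n ⟶ X (n + 1)) :
    ∃ (Y : J ⥤ A) (c : ∀ n, X n ⟶ Y), (∀ n, f n ≫ c (n + 1) = c n) ∧
      ∀ (l : J) {Z : A} (s : ∀ n, (X n).obj l ⟶ Z), (∀ n, (f n).app l ≫ s (n + 1) = s n) →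
        ∃ t : Y.obj l ⟶ Z, (∀ n, (c n).app l ≫ t = s n) ∧
          ∀ t', (∀ n, (c n).app l ≫ t' = s n) → t' = t := by
  let F := Functor.ofSequence f
  refine ⟨colimit F, fun n ↦ colimit.ι F n, fun n ↦ ?_, fun l Z s hs ↦ ?_⟩
  · exact (congrArg (· ≫ colimit.ι F (n + 1)) (Functor.ofSequence_map_homOfLE_succ f n)).symm.trans
      (colimit.w F (homOfLE (Nat.le_add_right n 1)))
  · have h := isColimitOfPreserves ((evaluation J A).obj l) (colimit.isColimit F)
    let c : Cocone (F ⋙ (evaluation J A).obj l) :=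
      { pt := Z
        ι := NatTrans.ofSequence s fun n ↦ by
          refine Eq.trans ?_ ((hs n).trans (Category.comp_id _).symm)
          exact congrArg (fun t ↦ NatTrans.app t l ≫ s (n + 1))
            (Functor.ofSequence_map_homOfLE_succ f n) }
    exact ⟨h.desc c, fun n ↦ h.fac c n, fun t' ht' ↦ h.hom_ext fun n ↦
      (ht' n).trans (h.fac c n).symm⟩

lemma exists_seq_of_step {α : ℕ → Type*} (r : ∀ n, α n → α (n + 1) → Prop) (x : α 0)
    (h : ∀ n y, ∃ z, r n y z) : ∃ s : ∀ n, α n, s 0 = x ∧ ∀ n, r n (s n) (s (n + 1)) := by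
  choose g hg using h
  exact ⟨fun n ↦ Nat.rec x g n, rfl, fun n ↦ hg _ _⟩

variable [HasCoproducts.{max t w} A] [ModelCategory A]

lemma exists_cofibrant_factorization {X T : J ⥤ A} (f : X ⟶ T) :
    ∃ (Y : J ⥤ A) (j : X ⟶ Y) (r : Y ⟶ T), j ≫ r = f ∧ (∀ l, WeakEquivalence (r.app l)) ∧
      ∀ {G H : J ⥤ A} (p : G ⟶ H), (∀ l, Fibration (p.app l) ∧ WeakEquivalence (p.app l)) →
        HasLiftingProperty j p := by
  have step (x : Σ X : J ⥤ A, (X ⟶ T)) : ∃ (y : Σ X : J ⥤ A, (X ⟶ T)) (u : x.1 ⟶ y.1)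
      (K : J → A) (i : ∀ l, x.1.obj l ⟶ K l) (α : ∀ l, K l ⟶ y.1.obj l), u ≫ y.2 = x.2 ∧
        (∀ l, i l ≫ α l = u.app l) ∧ (∀ l, Cofibration (i l)) ∧ (∀ l, Cofibration (α l)) ∧
        (∀ l, WeakEquivalence (α l ≫ y.2.app l)) ∧
        ∀ {G H : J ⥤ A} (p : G ⟶ H), (∀ l, Fibration (p.app l) ∧ WeakEquivalence (p.app l)) →
          HasLiftingProperty u p := by
    let fac (l : J) := MorphismProperty.factorizationData (cofibrations A) (trivialFibrations A)
      (x.2.app l)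
    obtain ⟨Y⟩ := exists_cellAttachment x.1 fun l ↦ (fac l).i
    obtain ⟨r, hr, hr'⟩ := Y.exists_natTrans x.2 (fun l ↦ (fac l).p) (fun l ↦ (fac l).fac)
    have hi (l : J) : Cofibration (fac l).i := ⟨(fac l).hi⟩
    refine ⟨⟨Y.obj, r⟩, Y.incl, _, fun l ↦ (fac l).i, Y.cell, hr, Y.comp_cell, hi,
      Y.cofibration_cell hi, fun l ↦ ?_, fun p hp ↦ Y.hasLiftingProperty_incl hi p hp⟩
    rw [hr']
    exact ((mem_trivialFibrations_iff _).1 (fac l).hp).2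
  choose y u K i α hu hα hi hα' hw hL using step
  let S (n : ℕ) : Σ X : J ⥤ A, (X ⟶ T) := Nat.rec ⟨X, f⟩ (fun _ x ↦ y x) n
  obtain ⟨Y, c, hc, hY⟩ := exists_sequential_colimit (fun n ↦ (S n).1) (fun n ↦ u (S n))
  have ext {l : J} {Z : A} {g g' : Y.obj l ⟶ Z} (h : ∀ n, (c n).app l ≫ g = (c n).app l ≫ g') :
      g = g' := by
    obtain ⟨t, -, ht⟩ := hY l (fun n ↦ (c n).app l ≫ g') fun n ↦ by
      rw [← Category.assoc, ← NatTrans.comp_app, hc]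
    exact (ht _ h).trans (ht _ fun _ ↦ rfl).symm
  have desc {Z : J ⥤ A} (s : ∀ n, (S n).1 ⟶ Z) (hs : ∀ n, u (S n) ≫ s (n + 1) = s n) :
      ∃ t : Y ⟶ Z, ∀ n, c n ≫ t = s n := by
    have H (l : J) := hY l (fun n ↦ (s n).app l) fun n ↦ by rw [← NatTrans.comp_app, hs]
    choose t ht ht' using H
    refine ⟨{ app := t, naturality := fun k l g ↦ ext fun n ↦ ?_ }, fun n ↦ ?_⟩
    · rw [← NatTrans.naturality_assoc, ht, reassoc_of% ht, NatTrans.naturality]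
    · ext l
      exact ht l n
  obtain ⟨r, hr⟩ := desc (fun n ↦ (S n).2) (fun n ↦ hu (S n))
  refine ⟨Y, c 0, r, hr 0, fun l ↦ ?_, fun {G H} p hp ↦ ⟨fun {a b} sq ↦ ?_⟩⟩
  · have h : Cofibration (α (S 0) l ≫ (c 1).app l) ∧ WeakEquivalence (α (S 0) l ≫ (c 1).app l) := by
      refine trivialCofibration_of_hasLiftingProperty _ fun E B p hp ↦ ⟨fun {a b} sq ↦ ?_⟩
      obtain ⟨s, hs, hs'⟩ := exists_seq_of_step
        (α := fun n ↦ {s : K (S n) l ⟶ E // s ≫ p = α (S n) l ≫ (c (n + 1)).app l ≫ b})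
        (fun n s t ↦ (α (S n) l ≫ i (S (n + 1)) l) ≫ t.1 = s.1)
        ⟨a, sq.w.trans (Category.assoc _ _ _)⟩ (fun n s ↦ by
          have := hi (S (n + 1)) l
          have := hα' (S n) l
          have h₀ : (α (S n) l ≫ i (S (n + 1)) l) ≫ α (S (n + 1)) l ≫ (S (n + 2)).2.app l =
              α (S n) l ≫ (S (n + 1)).2.app l := by
            rw [Category.assoc, reassoc_of% hα, ← NatTrans.comp_app, hu]
          have h₁ : WeakEquivalence (α (S (n + 1)) l ≫ (S (n + 2)).2.app l) := hw (S (n + 1)) l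
          have h₂ : WeakEquivalence (α (S n) l ≫ i (S (n + 1)) l) := by
            rw [← weakEquivalence_postcomp_iff _ (α (S (n + 1)) l ≫ (S (n + 2)).2.app l), h₀]
            exact hw (S n) l
          have h₃ : Cofibration (α (S n) l ≫ i (S (n + 1)) l) := inferInstance
          have sq' : CommSq s.1 (α (S n) l ≫ i (S (n + 1)) l) p
              (α (S (n + 1)) l ≫ (c (n + 1 + 1)).app l ≫ b) := ⟨by
            rw [s.2, Category.assoc, reassoc_of% hα, ← NatTrans.comp_app_assoc]
            exact (_ ≫= (congrArg (fun t ↦ NatTrans.app t l) (hc (n + 1)) =≫ b)).symm⟩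
          exact ⟨⟨sq'.lift, sq'.fac_right⟩, sq'.fac_left⟩)
      obtain ⟨t, ht, -⟩ := hY l (fun n ↦ i (S n) l ≫ (s n).1) fun n ↦ by
        rw [← hα, Category.assoc, ← hs' n, Category.assoc]
      refine ⟨⟨t, ?_, ext fun n ↦ ?_⟩⟩
      · have h₀ := hs' 0
        rw [hs, Category.assoc] at h₀
        rw [Category.assoc, ht]
        exact h₀
      · rw [reassoc_of% ht, (s n).2, reassoc_of% hα, ← NatTrans.comp_app_assoc, hc]
    have h₁ := h.2
    rw [← weakEquivalence_precomp_iff (α (S 0) l ≫ (c 1).app l), Category.assoc,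
      ← NatTrans.comp_app, hr]
    exact hw (S 0) l
  · obtain ⟨s, hs, hs'⟩ := exists_seq_of_step
      (α := fun n ↦ {s : (S n).1 ⟶ G // s ≫ p = c n ≫ b})
      (fun n s t ↦ u (S n) ≫ t.1 = s.1) ⟨a, sq.w⟩ (fun n s ↦ by
        have := hL (S n) p hp
        have sq' : CommSq s.1 (u (S n)) p (c (n + 1) ≫ b) := ⟨by
          rw [s.2, reassoc_of% hc]⟩
        exact ⟨⟨sq'.lift, sq'.fac_right⟩, sq'.fac_left⟩)
    obtain ⟨t, ht⟩ := desc (fun n ↦ (s n).1) hs'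
    refine ⟨⟨t, by rw [ht, hs], ?_⟩⟩
    ext l
    refine ext fun n ↦ ?_
    rw [← NatTrans.comp_app, ← NatTrans.comp_app, reassoc_of% ht, (s n).2]

end Sequences

section Powers

universe t w

variable {J : Type t} [Category.{w} J] {M : Type u₂} [Category.{v} M]

/-- The morphism `f` has the left lifting property with respect to pointwise trivial fibrations. -/
def IsPointwiseProjective [ModelCategory M] {X Y : J ⥤ M} (f : X ⟶ Y) : Prop :=
  ∀ ⦃G H : J ⥤ M⦄ (p : G ⟶ H), (∀ l, Fibration (p.app l) ∧ WeakEquivalence (p.app l)) →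
    HasLiftingProperty f p

variable [HasProducts.{v} M]

/-- The diagram of powers `j ↦ E ^ (S j)`. -/
abbrev powObj (S : Jᵒᵖ ⥤ Type v) (E : M) : J ⥤ M := S.rightOp ⋙ piConst.obj E

/-- The projections of `powObj S E`. -/
abbrev powπ (S : Jᵒᵖ ⥤ Type v) (E : M) (j : J) (s : S.obj (op j)) : (powObj S E).obj j ⟶ E :=
  Pi.π (fun _ : S.obj (op j) ↦ E) s

lemma powObj_map_π (S : Jᵒᵖ ⥤ Type v) (E : M) {j k : J} (φ : j ⟶ k) (s : S.obj (op k)) :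
    (powObj S E).map φ ≫ powπ S E k s = powπ S E j (S.map φ.op s) :=
  (Pi.map'_comp_π _ _ _).trans (Category.comp_id _)

/-- The morphism to `powObj S E` corresponding to a morphism to `singObj A E`. -/
def toPow {A : J ⥤ M} {S : Jᵒᵖ ⥤ Type v} {E : M} (a : S ⟶ singObj A E) : A ⟶ powObj S E where
  app j := Pi.lift fun s : S.obj (op j) ↦ a.app (op j) s
  naturality j k φ := by
    refine Pi.hom_ext _ _ fun s ↦ ?_
    have h := ConcreteCategory.congr_hom (a.naturality φ.op) s
    refine (Category.assoc _ _ _).trans ((_ ≫= Pi.lift_π _ _).trans ?_)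
    refine Eq.trans ?_ ((_ ≫= powObj_map_π S E φ s).symm.trans (Category.assoc _ _ _).symm)
    exact h.symm.trans (Pi.lift_π (fun s : S.obj (op j) ↦ a.app (op j) s) _).symm

lemma toPow_app_π {A : J ⥤ M} {S : Jᵒᵖ ⥤ Type v} {E : M} (a : S ⟶ singObj A E) (j : J)
    (s : S.obj (op j)) : (toPow a).app j ≫ powπ S E j s = a.app (op j) s :=
  Pi.lift_π _ _

/-- The morphism to `singObj A E` corresponding to a morphism to `powObj S E`. -/
def ofPow {A : J ⥤ M} {S : Jᵒᵖ ⥤ Type v} {E : M} (f : A ⟶ powObj S E) : S ⟶ singObj A E where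
  app j := ↾fun s ↦ f.app j.unop ≫ powπ S E j.unop s
  naturality j k φ := by
    ext s
    refine Eq.trans ?_ ((f.naturality_assoc φ.unop _).symm)
    exact _ ≫= (powObj_map_π S E φ.unop s).symm

variable [HasPullbacks M] [ModelCategory M]

lemma IsPointwiseProjective.exists_lift {X Y : J ⥤ M} {f : X ⟶ Y} (hf : IsPointwiseProjective f)
    {E B : M} (p : E ⟶ B) [Fibration p] [WeakEquivalence p] {S T : Jᵒᵖ ⥤ Type v} (i : S ⟶ T)
    (hi : ∀ j, Function.Injective (i.app j)) (a : S ⟶ singObj Y E) (b : T ⟶ singObj X E)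
    (c : T ⟶ singObj Y B) (e₁ : a ≫ singPrecomp f E = i ≫ b)
    (e₂ : b ≫ singPostcomp X p = c ≫ singPrecomp f B) (e₃ : a ≫ singPostcomp Y p = i ≫ c) :
    ∃ h : T ⟶ singObj Y E, i ≫ h = a ∧ h ≫ singPrecomp f E = b ∧ h ≫ singPostcomp Y p = c := by
  have pext {K : M} {S : Jᵒᵖ ⥤ Type v} {E : M} {j : J} {g g' : K ⟶ (powObj S E).obj j}
      (h : ∀ s, g ≫ powπ S E j s = g' ≫ powπ S E j s) : g = g' := Pi.hom_ext _ _ h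
  let pc (S : Jᵒᵖ ⥤ Type v) : powObj S E ⟶ powObj S B := Functor.whiskerLeft _ (piConst.map p)
  have hpc (S : Jᵒᵖ ⥤ Type v) (j s) : (pc S).app j ≫ powπ S B j s = powπ S E j s ≫ p :=
    Pi.map_π (fun _ ↦ p) s
  let pr (E : M) : powObj T E ⟶ powObj S E :=
    Functor.whiskerRight (NatTrans.rightOp i) (piConst.obj E)
  have hpr (E : M) (j s) : (pr E).app j ≫ powπ S E j s = powπ T E j (i.app (op j) s) :=
    (Pi.map'_comp_π _ _ _).trans (Category.comp_id _)
  have hsq : pr E ≫ pc S = pc T ≫ pr B := by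
    ext j : 2
    refine pext fun s ↦ ?_
    simp only [NatTrans.comp_app, Category.assoc, hpc, hpr, reassoc_of% hpr]
  let P := pullback (pc S) (pr B)
  let g : powObj T E ⟶ P := pullback.lift (pr E) (pc T) hsq
  have hP (j : J) : IsPullback ((pullback.fst (pc S) (pr B)).app j)
      ((pullback.snd (pc S) (pr B)).app j) ((pc S).app j) ((pr B).app j) :=
    (IsPullback.of_hasPullback (pc S) (pr B)).map ((evaluation _ _).obj j)
  have hg₁ (j : J) : g.app j ≫ (pullback.fst (pc S) (pr B)).app j = (pr E).app j := by
    rw [← NatTrans.comp_app, pullback.lift_fst]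
  have hg₂ (j : J) : g.app j ≫ (pullback.snd (pc S) (pr B)).app j = (pc T).app j := by
    rw [← NatTrans.comp_app, pullback.lift_snd]
  have hg (j : J) : Fibration (g.app j) ∧ WeakEquivalence (g.app j) := by
    refine trivialFibration_of_hasLiftingProperty _ fun K L k hk ↦ ⟨fun {u w} sq ↦ ?_⟩
    have h₁ : u ≫ (pr E).app j = k ≫ w ≫ (pullback.fst (pc S) (pr B)).app j := by
      rw [← hg₁, ← Category.assoc, sq.w, Category.assoc]
    have h₂ : u ≫ (pc T).app j = k ≫ w ≫ (pullback.snd (pc S) (pr B)).app j := by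
      rw [← hg₂, ← Category.assoc, sq.w, Category.assoc]
    have h₃ : (w ≫ (pullback.fst (pc S) (pr B)).app j) ≫ (pc S).app j =
        (w ≫ (pullback.snd (pc S) (pr B)).app j) ≫ (pr B).app j := by
      rw [Category.assoc, (hP j).w, Category.assoc]
    have H (s : T.obj (op j)) : ∃ d : L ⟶ E, k ≫ d = u ≫ powπ T E j s ∧
        d ≫ p = (w ≫ (pullback.snd (pc S) (pr B)).app j) ≫ powπ T B j s ∧
        ∀ r, i.app (op j) r = s → d = (w ≫ (pullback.fst (pc S) (pr B)).app j) ≫ powπ S E j r := by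
      by_cases h : ∃ r, i.app (op j) r = s
      · obtain ⟨r, rfl⟩ := h
        refine ⟨(w ≫ (pullback.fst (pc S) (pr B)).app j) ≫ powπ S E j r, ?_, ?_, fun r' hr' ↦ ?_⟩
        · rw [← hpr, reassoc_of% h₁, Category.assoc]
        · rw [Category.assoc, ← hpc, ← Category.assoc, h₃, Category.assoc, hpr]
        · rw [hi _ hr']
      · have sq' : CommSq (u ≫ powπ T E j s) k p
            ((w ≫ (pullback.snd (pc S) (pr B)).app j) ≫ powπ T B j s) := ⟨by
          rw [Category.assoc, ← hpc, reassoc_of% h₂, Category.assoc]⟩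
        exact ⟨sq'.lift, sq'.fac_left, sq'.fac_right, fun r hr ↦ (h ⟨r, hr⟩).elim⟩
    choose d hd₁ hd₂ hd₃ using H
    let D : L ⟶ (powObj T E).obj j := Pi.lift d
    have hD (s) : D ≫ powπ T E j s = d s := Pi.lift_π _ _
    refine ⟨⟨D, pext fun s ↦ ?_, (hP j).hom_ext (pext fun s ↦ ?_) (pext fun s ↦ ?_)⟩⟩
    · rw [Category.assoc, hD, hd₁]
    · rw [Category.assoc D, hg₁, Category.assoc, hpr, hD, hd₃ _ s rfl]
    · rw [Category.assoc D, hg₂, Category.assoc, hpc, reassoc_of% hD, hd₂]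
  have q₁ : toPow a ≫ pc S = toPow c ≫ pr B := by
    ext j : 2
    refine pext fun s ↦ ?_
    simp only [NatTrans.comp_app, Category.assoc, hpc, hpr, toPow_app_π, reassoc_of% toPow_app_π]
    exact ConcreteCategory.congr_hom (NatTrans.congr_app e₃ (op j)) s
  have sq : CommSq (toPow b) f g (pullback.lift (toPow a) (toPow c) q₁) := ⟨by
    refine pullback.hom_ext ?_ ?_
    · rw [Category.assoc, pullback.lift_fst, Category.assoc, pullback.lift_fst]
      ext j : 2
      refine pext fun s ↦ ?_
      simp only [NatTrans.comp_app, Category.assoc, hpr, toPow_app_π]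
      exact (ConcreteCategory.congr_hom (NatTrans.congr_app e₁ (op j)) s).symm
    · rw [Category.assoc, pullback.lift_snd, Category.assoc, pullback.lift_snd]
      ext j : 2
      refine pext fun s ↦ ?_
      simp only [NatTrans.comp_app, Category.assoc, hpc, toPow_app_π, reassoc_of% toPow_app_π]
      exact ConcreteCategory.congr_hom (NatTrans.congr_app e₂ (op j)) s⟩
  have := hf g hg
  have l₁ : sq.lift ≫ pr E = toPow a := by
    have := sq.fac_right =≫ pullback.fst _ _
    rwa [pullback.lift_fst, Category.assoc, pullback.lift_fst] at this
  have l₂ : sq.lift ≫ pc T = toPow c := by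
    have := sq.fac_right =≫ pullback.snd _ _
    rwa [pullback.lift_snd, Category.assoc, pullback.lift_snd] at this
  refine ⟨ofPow sq.lift, ?_, ?_, ?_⟩
  · ext j s
    have h := NatTrans.congr_app l₁ j.unop =≫ powπ S E j.unop s
    rw [NatTrans.comp_app, Category.assoc, hpr, toPow_app_π] at h
    exact h
  · ext j s
    have h := NatTrans.congr_app sq.fac_left j.unop =≫ powπ T E j.unop s
    rw [NatTrans.comp_app, Category.assoc, toPow_app_π] at h
    exact h
  · ext j s
    have h := NatTrans.congr_app l₂ j.unop =≫ powπ T B j.unop s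
    rw [NatTrans.comp_app, Category.assoc, hpc, toPow_app_π] at h
    exact (Category.assoc _ _ _).trans h

end Powers

section Slices

open Simplicial SSet

variable {M : Type u₂} [Category.{v} M]

lemma IsPointwiseProjective.isRelativeCofibration [HasLimits M] [HasColimits M] [ModelCategory M]
    {A A' : SimplexCategory ⥤ M} {f : A ⟶ A'} (hf : IsPointwiseProjective f) :
    IsRelativeCofibration f := by
  refine fun E B p hp hp' ↦ rlp_singLeibniz_π fun n a b c e₁ e₂ e₃ ↦ ?_
  exact hf.exists_lift p (boundary n).ι (fun _ _ _ ↦ Subtype.ext) a b c e₁ e₂ e₃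

variable {F : Type v} [Category.{0} F]

/-- The presheaf `(y, m) ↦ (y ⟶ x) × S m`. -/
@[simps]
def slicePresheaf (x : F) (S : SSet.{v}) : (F × SimplexCategory)ᵒᵖ ⥤ Type v where
  obj z := (z.unop.1 ⟶ x) × S.obj (op z.unop.2)
  map f := ↾fun p ↦ (f.unop.1 ≫ p.1, S.map f.unop.2.op p.2)

/-- The elements of `slicePresheaf x S`. -/
abbrev sliceMk {x : F} {S : SSet.{v}} {z : (F × SimplexCategory)ᵒᵖ} (g : z.unop.1 ⟶ x)
    (s : S.obj (op z.unop.2)) : (slicePresheaf x S).obj z :=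
  (g, s)

variable (Z : F × SimplexCategory ⥤ M) {x : F} {S : SSet.{v}} {E : M}

/-- Extension of a morphism along `F`. -/
def sliceExtend (a : S ⟶ singObj ((Functor.curry.obj Z).obj x) E) :
    slicePresheaf x S ⟶ singObj Z E where
  app z := ↾fun p ↦ (Z.map ((p.1, 𝟙 _) : z.unop ⟶ (x, z.unop.2)) ≫
    a.app (op z.unop.2) p.2 : Z.obj z.unop ⟶ E)
  naturality z z' f := by
    ext p
    have h := ConcreteCategory.congr_hom (a.naturality f.unop.2.op) p.2
    refine (_ ≫= h).trans ?_
    refine (Category.assoc _ _ _).symm.trans (Eq.trans ?_ (Category.assoc _ _ _))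
    refine congrArg (· ≫ _) ((Z.map_comp _ _).symm.trans (Eq.trans ?_ (Z.map_comp _ _)))
    refine congrArg Z.map (Prod.ext ?_ ?_)
    · exact Category.comp_id _
    · exact (Category.id_comp _).trans (Category.comp_id _).symm

/-- Restriction to the identity of `x`. -/
def sliceRestrict (h : slicePresheaf x S ⟶ singObj Z E) :
    S ⟶ singObj ((Functor.curry.obj Z).obj x) E where
  app m := ↾fun s ↦ (h.app (op (x, m.unop)) (sliceMk (𝟙 x) s) : Z.obj (x, m.unop) ⟶ E)
  naturality m m' φ := by
    ext s
    let ψ : (x, m'.unop) ⟶ (x, m.unop) := (𝟙 x, φ.unop)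
    have e := ConcreteCategory.congr_hom (h.naturality ψ.op) (sliceMk (𝟙 x) s)
    refine Eq.trans ?_ e
    exact congrArg (fun t ↦ h.app (op (x, m'.unop)) (sliceMk t (S.map φ s)))
      (Category.comp_id _).symm

variable {Z} [HasLimits M] [HasColimits M] [ModelCategory M]

lemma IsPointwiseProjective.exists_lift_curry {Z' : F × SimplexCategory ⥤ M} {f : Z ⟶ Z'}
    (hf : IsPointwiseProjective f) (x : F) {E B : M} (p : E ⟶ B) [Fibration p] [WeakEquivalence p]
    {n : ℕ} (a : (∂Δ[n] : SSet.{v}) ⟶ singObj ((Functor.curry.obj Z').obj x) E)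
    (b : Δ[n] ⟶ singObj ((Functor.curry.obj Z).obj x) E)
    (c : Δ[n] ⟶ singObj ((Functor.curry.obj Z').obj x) B)
    (e₁ : a ≫ singPrecomp ((Functor.curry.map f).app x) E = (boundary n).ι ≫ b)
    (e₂ : b ≫ singPostcomp _ p = c ≫ singPrecomp ((Functor.curry.map f).app x) B)
    (e₃ : a ≫ singPostcomp _ p = (boundary n).ι ≫ c) :
    ∃ h : Δ[n] ⟶ singObj ((Functor.curry.obj Z').obj x) E, (boundary n).ι ≫ h = a ∧
      h ≫ singPrecomp ((Functor.curry.map f).app x) E = b ∧ h ≫ singPostcomp _ p = c := by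
  let i : slicePresheaf x (∂Δ[n] : SSet.{v}) ⟶ slicePresheaf x Δ[n] :=
    { app z := ↾fun p ↦ (p.1, (boundary n).ι.app _ p.2) }
  obtain ⟨h, h₁, h₂, h₃⟩ := hf.exists_lift p i
    (fun z s t e ↦ Prod.ext (Prod.ext_iff.1 e).1 (Subtype.ext (Prod.ext_iff.1 e).2))
    (sliceExtend Z' a) (sliceExtend Z b) (sliceExtend Z' c) (by
      ext z s
      have e := ConcreteCategory.congr_hom (NatTrans.congr_app e₁ (op z.unop.2)) s.2
      exact (f.naturality_assoc _ _).symm.trans (_ ≫= e)) (by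
      ext z s
      have e := ConcreteCategory.congr_hom (NatTrans.congr_app e₂ (op z.unop.2)) s.2
      exact (Category.assoc _ _ _).trans ((_ ≫= e).trans (f.naturality_assoc _ _))) (by
      ext z s
      have e := ConcreteCategory.congr_hom (NatTrans.congr_app e₃ (op z.unop.2)) s.2
      exact (Category.assoc _ _ _).trans (_ ≫= e))
  have key (Z : F × SimplexCategory ⥤ M) {m : SimplexCategoryᵒᵖ} {Y : M} (t : Z.obj (x, m.unop) ⟶ Y) :
      Z.map ((𝟙 x, 𝟙 _) : (x, m.unop) ⟶ (x, m.unop)) ≫ t = t := by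
    exact (congrArg (· ≫ t) (Z.map_id (x, m.unop))).trans (Category.id_comp t)
  refine ⟨sliceRestrict Z' h, ?_, ?_, ?_⟩
  · ext m s
    exact (ConcreteCategory.congr_hom (NatTrans.congr_app h₁ (op (x, m.unop))) (sliceMk (𝟙 x) s)).trans
      (key Z' _)
  · ext m s
    exact (ConcreteCategory.congr_hom (NatTrans.congr_app h₂ (op (x, m.unop))) (sliceMk (𝟙 x) s)).trans
      (key Z _)
  · ext m s
    exact (ConcreteCategory.congr_hom (NatTrans.congr_app h₃ (op (x, m.unop))) (sliceMk (𝟙 x) s)).trans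
      (key Z' _)

/-- The cofibration of a summand, followed by a pointwise projective morphism. -/
lemma isRelativeCofibration_summand {X X₁ X₂ Y : F × SimplexCategory ⥤ M} {i₁ : X₁ ⟶ X}
    {i₂ : X₂ ⟶ X} (hX : IsColimit (BinaryCofan.mk i₁ i₂)) {j : X ⟶ Y} (hj : IsPointwiseProjective j)
    (x : F) (h₂ : IsCofibrantCosimplicial ((Functor.curry.obj X₂).obj x)) :
    IsRelativeCofibration ((Functor.curry.map (i₁ ≫ j)).app x) := by
  have hc (z : F × SimplexCategory) : IsColimit (BinaryCofan.mk (i₁.app z) (i₂.app z)) :=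
    mapIsColimitOfPreservesOfIsColimit ((evaluation _ _).obj z) _ _ hX
  have hext {z : F × SimplexCategory} {Z : M} {g g' : X.obj z ⟶ Z}
      (h : i₁.app z ≫ g = i₁.app z ≫ g') (h' : i₂.app z ≫ g = i₂.app z ≫ g') : g = g' :=
    BinaryCofan.IsColimit.hom_ext (hc z) h h'
  have hd {z : F × SimplexCategory} {Z : M} (g₁ : X₁.obj z ⟶ Z) (g₂ : X₂.obj z ⟶ Z) :
      ∃ g : X.obj z ⟶ Z, i₁.app z ≫ g = g₁ ∧ i₂.app z ≫ g = g₂ :=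
    ⟨(BinaryCofan.IsColimit.desc' (hc z) g₁ g₂).1, (BinaryCofan.IsColimit.desc' (hc z) g₁ g₂).2⟩
  refine fun E B p hp hp' ↦ rlp_singLeibniz_π fun n a b c e₁ e₂ e₃ ↦ ?_
  let k₂ := (Functor.curry.map (i₂ ≫ j)).app x
  have := h₂ p hp hp' _ (modelCategoryQuillen.boundary_ι_mem_I n)
  have sq : CommSq (a ≫ singPrecomp k₂ E) (boundary n).ι (singPostcomp _ p)
      (c ≫ singPrecomp k₂ B) := ⟨by
    rw [Category.assoc, singPrecomp_singPostcomp, ← Category.assoc, e₃, Category.assoc]⟩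
  choose g hg₁ hg₂ using fun (m : SimplexCategoryᵒᵖ) (s : (Δ[n] : SSet.{v}).obj m) ↦
    hd (z := (x, m.unop)) (b.app m s) (sq.lift.app m s)
  let b' : Δ[n] ⟶ singObj ((Functor.curry.obj X).obj x) E :=
    { app m := ↾fun s ↦ g m s
      naturality m m' φ := by
        ext s
        refine hext ((hg₁ _ _).trans ?_) ((hg₂ _ _).trans ?_)
        · refine Eq.trans ?_ (i₁.naturality_assoc _ _)
          refine Eq.trans ?_ (_ ≫= hg₁ m s).symm
          exact ConcreteCategory.congr_hom (b.naturality φ) s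
        · refine Eq.trans ?_ (i₂.naturality_assoc _ _)
          refine Eq.trans ?_ (_ ≫= hg₂ m s).symm
          exact ConcreteCategory.congr_hom (sq.lift.naturality φ) s }
  obtain ⟨h, r₁, r₂, r₃⟩ := hj.exists_lift_curry x p a b' c (by
    ext m s
    refine hext ?_ ?_
    · exact (Category.assoc _ _ _).symm.trans
        ((ConcreteCategory.congr_hom (NatTrans.congr_app e₁ m) s).trans (hg₁ _ _).symm)
    · exact (Category.assoc _ _ _).symm.trans
        ((ConcreteCategory.congr_hom (NatTrans.congr_app sq.fac_left m) s).symm.trans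
          (hg₂ _ _).symm)) (by
    ext m s
    refine hext ?_ ?_
    · refine (Category.assoc _ _ _).symm.trans ((hg₁ _ _ =≫ p).trans ?_)
      exact (ConcreteCategory.congr_hom (NatTrans.congr_app e₂ m) s).trans (Category.assoc _ _ _)
    · refine (Category.assoc _ _ _).symm.trans ((hg₂ _ _ =≫ p).trans ?_)
      exact (ConcreteCategory.congr_hom (NatTrans.congr_app sq.fac_right m) s).trans
        (Category.assoc _ _ _)) e₃
  refine ⟨h, r₁, ?_, r₃⟩
  ext m s
  refine (Category.assoc _ _ _).trans ?_
  exact (_ ≫= ConcreteCategory.congr_hom (NatTrans.congr_app r₂ m) s).trans (hg₁ m s)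

lemma weaklyEquivalent_elementsCoend_firstVertex {X₁ X₂ : F ⥤ SimplexCategory ⥤ M} {B : F ⥤ M}
    (f₁ : X₁ ⟶ B ⋙ Functor.const SimplexCategory) (f₂ : X₂ ⟶ B ⋙ Functor.const SimplexCategory)
    (h₁ : ∀ x, IsCofibrantCosimplicial (X₁.obj x)) (h₂ : ∀ x, IsCofibrantCosimplicial (X₂.obj x))
    (w₁ : ∀ x n, WeakEquivalence ((f₁.app x).app n))
    (w₂ : ∀ x n, WeakEquivalence ((f₂.app x).app n)) :
    WeaklyEquivalent (elementsCoend (firstVertex F ⋙ X₁)) (elementsCoend (firstVertex F ⋙ X₂)) := by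
  have : HasColimitsOfSize.{0, 0} M := hasColimitsOfSizeShrink.{0, 0, v, v} M
  obtain ⟨X₁, rfl⟩ : ∃ X, Functor.curry.obj X = X₁ := ⟨_, Functor.curry_obj_uncurry_obj X₁⟩
  obtain ⟨X₂, rfl⟩ : ∃ X, Functor.curry.obj X = X₂ := ⟨_, Functor.curry_obj_uncurry_obj X₂⟩
  obtain ⟨T, hT⟩ : ∃ X, Functor.curry.obj X = B ⋙ Functor.const SimplexCategory :=
    ⟨_, Functor.curry_obj_uncurry_obj _⟩
  generalize B ⋙ Functor.const SimplexCategory = T' at f₁ f₂ hT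
  subst hT
  obtain ⟨f₁, rfl⟩ := Functor.curry.map_surjective f₁
  obtain ⟨f₂, rfl⟩ := Functor.curry.map_surjective f₂
  obtain ⟨Y, j, r, hr, hw, hj⟩ := exists_cofibrant_factorization (coprod.desc f₁ f₂)
  have hj' : IsPointwiseProjective j := fun _ _ p hp ↦ hj p hp
  have key {X : F × SimplexCategory ⥤ M} (i : X ⟶ X₁ ⨿ X₂)
      (hi : ∀ x, IsRelativeCofibration ((Functor.curry.map (i ≫ j)).app x))
      (hi' : ∀ z, WeakEquivalence ((i ≫ coprod.desc f₁ f₂).app z)) :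
      WeaklyEquivalent (elementsCoend (firstVertex F ⋙ Functor.curry.obj X))
        (elementsCoend (firstVertex F ⋙ Functor.curry.obj Y)) := by
    have hh (x : F) : IsRelativeTrivialCofibration ((Functor.curry.map (i ≫ j)).app x) := by
      refine (hi x).isRelativeTrivialCofibration fun n ↦ ?_
      change WeakEquivalence ((i ≫ j).app (x, n))
      have := hw (x, n)
      rw [← weakEquivalence_postcomp_iff _ (r.app (x, n)), ← NatTrans.comp_app, Category.assoc, hr]
      exact hi' _
    have H (X : F × SimplexCategory ⥤ M) ⦃x y : Functor.Elements (nerve F : SSet.{v})⦄ (e : x ⟶ y)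
        (he : Epi e.1.unop) : IsIso ((firstVertex F ⋙ Functor.curry.obj X).map e) := by
      have := isIso_firstVertex_map e he
      exact Functor.map_isIso (Functor.curry.obj X) ((firstVertex F).map e)
    let g := Functor.whiskerLeft (firstVertex F) (Functor.curry.map (i ≫ j))
    have hg {E B : M} (p : E ⟶ B) (hp : Fibration p) : SecLift g p :=
      secLift_of_isIso_degeneracies (H X) (H Y) fun x ↦ hh ((firstVertex F).obj x) p hp
    exact .of_hom (elementsCoendMap g) (trivialCofibration_of_hasLiftingProperty _ fun _ _ p hp ↦
      hasLiftingProperty_elementsCoendMap (hg p hp)).2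
  have hc := coprodIsCoprod X₁ X₂
  refine (key coprod.inl (fun x ↦ isRelativeCofibration_summand hc hj' x (h₂ x)) fun z ↦ ?_).trans
    (key coprod.inr (fun x ↦ isRelativeCofibration_summand (BinaryCofan.isColimitFlip hc) hj' x
      (h₁ x)) fun z ↦ ?_).symm
  · rw [coprod.inl_desc]
    exact w₁ z.1 z.2
  · rw [coprod.inr_desc]
    exact w₂ z.1 z.2

end Slices

section CosimplicialResolutions

open Simplicial SSet

variable {M : Type u₂} [Category.{v} M] [HasColimits M] [ModelCategory M]

lemma IsRelativeCofibration.isCofibrantCosimplicial {O A : SimplexCategory ⥤ M} {j : O ⟶ A}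
    (hj : IsRelativeCofibration j) (hO : ∀ n, IsInitial (O.obj n)) :
    IsCofibrantCosimplicial A := by
  rintro E B p hp hp' _ _ _ ⟨n⟩
  refine ⟨fun {a c} sq ↦ ?_⟩
  let b : Δ[n] ⟶ singObj O E :=
    { app m := ↾fun _ ↦ (hO m.unop).to E
      naturality _ _ _ := by
        ext
        exact (hO _).hom_ext _ _ }
  obtain ⟨h, h₁, -, h₃⟩ := exists_lift_of_singLeibniz (hj p hp hp') (boundary n).ι a b c
    (by ext; exact (hO _).hom_ext _ _) (by ext; exact (hO _).hom_ext _ _) sq.w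
  exact ⟨⟨h, h₁, h₃⟩⟩

lemma exists_cosimplicial_resolution [HasLimits M] (X : M) :
    ∃ (A : SimplexCategory ⥤ M) (q : A ⟶ (Functor.const SimplexCategory).obj X),
      IsCofibrantCosimplicial A ∧ ∀ n, WeakEquivalence (q.app n) := by
  have : HasColimitsOfSize.{0, 0} M := hasColimitsOfSizeShrink.{0, 0, v, v} M
  let O : SimplexCategory ⥤ M := (Functor.const _).obj (⊥_ M)
  obtain ⟨A, j, q, -, hq, hj⟩ := exists_cofibrant_factorization
    ((Functor.const SimplexCategory).map (initial.to X))
  have hj' : IsPointwiseProjective j := fun _ _ p hp ↦ hj p hp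
  exact ⟨A, q, hj'.isRelativeCofibration.isCofibrantCosimplicial fun _ ↦ initialIsInitial, hq⟩

lemma IsCofibrantCosimplicial.isCofibrant_obj {A : SimplexCategory ⥤ M}
    (hA : IsCofibrantCosimplicial A) (n : SimplexCategory) : IsCofibrant (A.obj n) := by
  rw [isCofibrant_iff]
  refine cofibration_of_hasLiftingProperty _ fun E B p hp hp' ↦ ⟨fun {a b} sq ↦ ?_⟩
  let i := Subcomplex.ι (⊥ : (stdSimplex.{v}.obj n).Subcomplex)
  have := hasLiftingProperty_of_boundary (hA p hp hp') i
  let c : stdSimplex.{v}.obj n ⟶ singObj A B :=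
    SSet.yonedaEquiv.symm (show (singObj A B).obj (op n) from b)
  have sq' : CommSq (Subcomplex.isInitialBot.to _) i (singPostcomp A p) c :=
    ⟨Subcomplex.isInitialBot.hom_ext _ _⟩
  refine ⟨⟨SSet.yonedaEquiv sq'.lift, initialIsInitial.hom_ext _ _, ?_⟩⟩
  have h := congrArg SSet.yonedaEquiv sq'.fac_right
  rw [SSet.yonedaEquiv_comp, Equiv.apply_symm_apply] at h
  exact h

end CosimplicialResolutions

section Comparison

variable {V : Type u₁} [Category.{v} V] [MonoidalCategory V] [SymmetricCategory V]
  [MonoidalClosed V] [HasLimits V] [HasColimits V] [ModelCategory V] [MonoidalModelCategory V]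
  {M : Type u₂} [Category.{v} M] [EnrichedOrdinaryCategory V M] [Tensored V M]
  [HasLimits M] [HasColimits M] [ModelCategory M] [ModelEnrichedCategory V M]

lemma IsCofibrantCosimplicial.tensor {I : SimplexCategory ⥤ V} (hI : IsCofibrantCosimplicial I)
    {X : M} (hX : IsCofibrant X) :
    IsCofibrantCosimplicial (I ⋙ (tensorBifunctor V M).flip.obj X) := by
  let O : SimplexCategory ⥤ V := (Functor.const _).obj (⊥_ V)
  let j : O ⟶ I := { app n := initial.to _, naturality _ _ _ := initialIsInitial.hom_ext _ _ }
  have hj := hI.isRelativeCofibration (fun _ ↦ initialIsInitial) j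
  have h : IsRelativeCofibration (Functor.whiskerRight j ((tensorBifunctor V M).flip.obj X)) :=
    fun E B p hp hp' ↦ rlp_tensorCosimplicial ⟨hp, .inr ⟨hj, hp'⟩⟩ hX
  exact h.isCofibrantCosimplicial fun _ ↦
    IsInitial.isInitialObj ((curriedAction V M).flip.obj X) _ initialIsInitial

/-- The augmentation of the diagram of cosimplicial objects `I ⊗ T x`. -/
def tensorAug {J : Type*} [Category* J] {I : SimplexCategory ⥤ V}
    (q : I ⟶ (Functor.const SimplexCategory).obj (𝟙_ V)) (T : J ⥤ M) :
    tensorDiagram I T ⟶ T ⋙ Functor.const SimplexCategory where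
  app x :=
    { app n := q.app n ⊵ₗ T.obj x ≫ (λₗ[V] (T.obj x)).hom
      naturality m n φ := by
        have h : I.map φ ≫ q.app n = q.app m := (q.naturality φ).trans (Category.comp_id _)
        have h' : I.map φ ⊵ₗ T.obj x ≫ q.app n ⊵ₗ T.obj x = q.app m ⊵ₗ T.obj x := by
          rw [← comp_actionHomLeft, h]
        exact (Category.assoc _ _ _).symm.trans ((h' =≫ _).trans (Category.comp_id _).symm) }
  naturality x y e := by
    ext n
    have h : I.obj n ⊴ₗ T.map e ≫ q.app n ⊵ₗ T.obj y ≫ (λₗ[V] (T.obj y)).hom =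
        (q.app n ⊵ₗ T.obj x ≫ (λₗ[V] (T.obj x)).hom) ≫ T.map e := by
      rw [action_exchange_assoc, Category.assoc, actionUnitIso_hom_naturality]
      rfl
    exact h

lemma weaklyEquivalent_hocolim {J : Type v} [Category.{0} J] {T : J ⥤ M}
    (hT : ∀ x, IsCofibrant (T.obj x)) (T' : DiagramResolution T) {I : SimplexCategory ⥤ V}
    (hI : IsCofibrantCosimplicial I) (q : I ⟶ (Functor.const SimplexCategory).obj (𝟙_ V))
    (hq : ∀ n, WeakEquivalence (q.app n)) :
    WeaklyEquivalent (elementsCoend (tensorDiagram I (firstVertex J ⋙ T))) (hocolim T') := by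
  obtain ⟨e⟩ := exists_iso_hocolim T'
  refine WeaklyEquivalent.trans ?_ (.of_iso e)
  refine weaklyEquivalent_elementsCoend_firstVertex (X₁ := tensorDiagram I T) (tensorAug q T) T'.aug
    (fun x ↦ hI.tensor (hT x)) (fun x ↦ (T'.isReedyCofibrant x).isCofibrantCosimplicial)
    (fun x n ↦ ?_) T'.weakEquivalence
  have := ModelEnrichedCategory.unit (q.app n) (T.obj x) (hI.isCofibrant_obj n) (hq n) (hT x)
  change WeakEquivalence (q.app n ⊵ₗ T.obj x ≫ (λₗ[V] (T.obj x)).hom)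
  infer_instance

end Comparison

end HWC

end

theorem mainTheorem1
    {V : Type u₁} [Category.{v} V] [MonoidalCategory V] [SymmetricCategory V] [MonoidalClosed V]
    [HasLimits V] [HasColimits V] [ModelCategory V] [HWC.MonoidalModelCategory V]
    {M : Type u₂} [Category.{v} M] [EnrichedOrdinaryCategory V M] [HWC.Tensored V M]
    [HasLimits M] [HasColimits M] [ModelCategory M] [HWC.ModelEnrichedCategory V M]
    {C : Type v} [EnrichedCategory V C]
    (hC : HWC.LocallyPointedFlat C (HWC.tensorBifunctor V M))
    (W : EnrichedFunctor V Cᵒᵖ V) (hW : HWC.IsProjectivelyCofibrant W)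
    (D : EnrichedFunctor V C M) (hD : ∀ c, IsCofibrant (D.obj c)) :
    (∀ (P : HWC.WeightedColimit W D) (I : HWC.CosimplicialResolution (𝟙_ V)),
      HWC.WeaklyEquivalent P.pt (HWC.realization I.obj (HWC.barSimplicial W D))) ∧
    (∀ (P : HWC.WeightedColimit W D) (T : HWC.DiagramResolution (HWC.barDiagram W D)),
      HWC.WeaklyEquivalent P.pt (HWC.hocolim T)) ∧
    (∀ x : (HWC.families C).Elements, IsCofibrant ((HWC.barDiagram W D).obj x)) ∧
    (∀ (c : ℕ → C) (n : ℕ), IsCofibrant (HWC.chainObj (V := V) D c n)) ∧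
    (HWC.LocallyFlat C (curriedTensor V) → ∀ c : C, IsCofibrant (W.obj (op c))) := by
  refine ⟨fun P I ↦ ?_, fun P T ↦ ?_, HWC.isCofibrant_barDiagram hC.1 hD hW,
    HWC.isCofibrant_chainObj hC.1 hD, fun hV ↦ HWC.isCofibrant_of_isProjectivelyCofibrant hV hW⟩
  · obtain ⟨e⟩ := HWC.exists_iso_realization I.obj (HWC.barDiagram W D)
    exact (HWC.weaklyEquivalent_elementsCoend_families hC I.isReedyCofibrant.isCofibrantCosimplicial
      I.aug I.weakEquivalence hW hD P).trans (.of_iso e)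
  · obtain ⟨I, q, hI, hq⟩ := HWC.exists_cosimplicial_resolution (𝟙_ V)
    exact (HWC.weaklyEquivalent_elementsCoend_nerve hC.1 hI q hq hW hD P).trans
      (HWC.weaklyEquivalent_hocolim (HWC.isCofibrant_barDiagram hC.1 hD hW) T hI q hq)
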